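/- **Setting.** All objects are families indexed by a security parameter $\lambda\in\mathbb N$. A function $\mu:\mathbb N\to\mathbb R_{\ge 0}$ is negligible if $\mu(\lambda)p(\lambda)\to 0$ for every polynomial $p$. "Efficient" means: implemented by quantum circuits over a fixed universal gate set whose descriptions are output by a polynomial-time Turing machine on input $1^\lambda$; a measurement $\{E^{(i)}\}_i$ is efficient if the isometry $|\varphi\rangle\mapsto\sum_i|i\rangle\otimes E^{(i)}|\varphi\rangle$ is. **Function families.** Let $(\mathcal F,\mathcal G)$ be an extended noisy trapdoor claw-free function (ENTCF) family: finite domain $\mathcal X\subseteq\{0,1\}^w$, images $\mathcal Y$, efficient algorithms generating keys with trapdoors for $\mathcal F$ and for $\mathcal G$, and for each key $k$ and $b\in\{0,1\}$ a map $f_{k,b}$ from $\mathcal X$ to probability distributions on $\mathcal Y$, efficiently invertible with the trapdoor, and with efficient check and range-superposition procedures common to both families. For keys of $\mathcal G$ the supports of all $f_{k,b}(x)$ are pairwise disjoint. For keys of $\mathcal F$ and fixed $b$ the supports of $f_{k,b}(x)$, $x\in\mathcal X$, are disjoint, and $f_{k,0}(x_0)=f_{k,1}(x_1)$ defines a perfect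 matching of $\mathcal X$ with itself; its pairs $(x_0,x_1)$ are called claws. There are sets $G_{k,b,x}\subseteq\{0,1\}^w$ of good strings, containing all but a negligible fraction of $\{0,1\}^w$ and decidable efficiently with the trapdoor, with the *adaptive hardcore bit* property: for every efficient quantum procedure $A$, $|\Pr[A(k)\in H_k]-\Pr[A(k)\in\bar H_k]|$ is negligible for a random key $k$ of $\mathcal F$, where $H_k$ is the set of $(b,x_b,d,d\cdot(x_0\oplus x_1))$ with $(x_0,x_1)$ a claw and $d\in G_{k,0,x_0}\cap G_{k,1,x_1}$, and $\bar H_k$ is $H_k$ with the last bit flipped. *Injective invariance*: no efficient quantum procedure distinguishes random keys of $\mathcal F$ and of $\mathcal G$ with non-negligible advantage. (Finally, as is usual in the definition, for each efficient $A$ there is a string $d$ such that $A(k)$ predicts $d\cdot(x_0\oplus x_1)$ with probability negligibly close to $\frac12$.) *Decoding maps.* $\hat x_b(k,y)$ is the $x\in\mathcal X$ with $y\in\mathrm{Supp} f_{k,b}(x)$, undefined if there is none. For $k$ from $\mathcal G$, $\hat b(k,y)$ is the bit $b$ with $y\in\bigcup_x\mathrm{Supp} f_{k,b}(x)$, undefined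 if there is none, and $\hat x(k,y)=\hat x_{\hat b(k,y)}(k,y)$. For $k$ from $\mathcal F$, $\hat u(k,y,d)=d\cdot(x_0\oplus x_1)$ where $x_b=\hat x_b(k,y)$, and $\hat u(k,y,d)$ is undefined if some $x_b$ is undefined or if $d\notin G_{k,0,x_0}\cap G_{k,1,x_1}$. Conditions on undefined values count as violated; terms indexed by undefined values are $0$. **Devices.** A basis choice is $(\theta_1,\theta_2)\in\{0,1\}^2$; the key $k_i$ is generated from $\mathcal G$ if $\theta_i=0$ and from $\mathcal F$ if $\theta_i=1$, independently for $i=1,2$. A device $D=(S,\Pi,M,P)$ consists of * for each pair of keys, a density operator $\psi=\sum_{y_1,y_2}\psi_{y_1,y_2}\otimes|y_1,y_2\rangle\langle y_1,y_2|$ on $\mathcal H_D\otimes\mathcal H_Y$, where $\mathcal H_D$ is a register of qubits; * projective measurements $\Pi=\{\Pi^{(b_1,x_1;b_2,x_2)}\}$ and $M=\{M^{(d_1,d_2)}\}_{d_1,d_2\in\{0,1\}^w}$ on $\mathcal H_D\otimes\mathcal H_Y$, block diagonal in $y_1,y_2$; * for $q_1,q_2\in\{0,1\}$, a projective measurement $P_{q_1,q_2}=\{P^{(v_1,v_2)}_{q_1,q_2}\}_{v_1,v_2\in\{0,1\}}$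 on $\mathcal H_D\otimes\mathcal H_Y\otimes\mathcal H_R$, block diagonal in $y_1,y_2,d_1,d_2$. The measurements do not depend on the keys (which may be stored in $\mathcal H_D$). The device is efficient if $\psi$ can be prepared efficiently from the two keys and all its measurements are efficient. The post-measurement state is $$\sigma=\sum_{y_1,y_2,d_1,d_2}\sigma_{y_1,y_2;d_1,d_2}\otimes|y_1,y_2;d_1,d_2\rangle\langle y_1,y_2;d_1,d_2|,\qquad \sigma_{y_1,y_2;d_1,d_2}=M^{(d_1,d_2)}_{y_1,y_2}\,\psi_{y_1,y_2}\,M^{(d_1,d_2)}_{y_1,y_2}.$$ Write $\psi^{(\theta_1,\theta_2)},\sigma^{(\theta_1,\theta_2)}$ when the keys are generated for $(\theta_1,\theta_2)$; all traces and squared norms below are averaged over the keys. Let $\sigma^{(0,v_1;1,v_2)}$ be the part of $\sigma^{(0,1)}$ with $\hat b(k_1,y_1)=v_1$ and $\hat u(k_2,y_2,d_2)=v_2\oplus\hat b(k_1,y_1)$, and $\sigma^{(1,v_1;0,v_2)}$ the part of $\sigma^{(1,0)}$ with $\hat u(k_1,y_1,d_1)=v_1\oplus\hat b(k_2,y_2)$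 and $\hat b(k_2,y_2)=v_2$. The marginal observables are $Z_1=\sum_{i,j}(-1)^iP^{(i,j)}_{0,0}$, $Z_2=\sum_{i,j}(-1)^jP^{(i,j)}_{0,0}$, $X_1=\sum_{i,j}(-1)^iP^{(i,j)}_{1,1}$, $X_2=\sum_{i,j}(-1)^jP^{(i,j)}_{1,1}$, $\tilde Z_1=\sum_{i,j}(-1)^iP^{(i,j)}_{0,1}$, $\tilde Z_2=\sum_{i,j}(-1)^jP^{(i,j)}_{1,0}$, $\tilde X_1=\sum_{i,j}(-1)^iP^{(i,j)}_{1,0}$, $\tilde X_2=\sum_{i,j}(-1)^jP^{(i,j)}_{0,1}$. For a binary observable $O$, $O^{(b)}=\frac12(\mathbb 1+(-1)^bO)$. Let $1-\gamma_P(D)$ be the minimum over $\theta\in\{0,1\}$ of $$\sum\mathrm{Tr}\big[\Pi^{(\hat b(k_1,y_1),\hat x(k_1,y_1);b_2,x_2)}_{y_1,y_2}\psi^{(0,\theta)}_{y_1,y_2}\big],\quad \sum\mathrm{Tr}\big[\Pi^{(b_1,x_1;\hat b(k_2,y_2),\hat x(k_2,y_2))}_{y_1,y_2}\psi^{(\theta,0)}_{y_1,y_2}\big],$$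 $$\sum\mathrm{Tr}\big[\Pi^{(b_1,x_1;b,\hat x_b(k_2,y_2))}_{y_1,y_2}\psi^{(\theta,1)}_{y_1,y_2}\big],\quad \sum\mathrm{Tr}\big[\Pi^{(b,\hat x_b(k_1,y_1);b_2,x_2)}_{y_1,y_2}\psi^{(1,\theta)}_{y_1,y_2}\big]$$ (sums over all free indices). Let $1-\gamma_T(D)$ be the minimum of the eight numbers $\sum_{v_1,v_2}\mathrm{Tr}[O^{(v_i)}\sigma^{(0,v_1;1,v_2)}]$ for $(O,i)\in\{(Z_1,1),(\tilde Z_1,1),(X_2,2),(\tilde X_2,2)\}$ and $\sum_{v_1,v_2}\mathrm{Tr}[O^{(v_i)}\sigma^{(1,v_1;0,v_2)}]$ for $(O,i)\in\{(X_1,1),(\tilde X_1,1),(Z_2,2),(\tilde Z_2,2)\}$. The device is perfect if $\gamma_P(D)$ is negligible. **Proposition 4.1.** For every ENTCF family, every efficient perfect device $D$, all $\theta_1,\theta_2\in\{0,1\}$ and $i\in\{1,2\}$, $$\{Z_i,X_i\}\approx_{\gamma_T(D)^{1/2},\,\sigma^{(\theta_1,\theta_2)}}0 ,$$ that is, with a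 universal constant $C$ and a negligible function $\mu$ (which may depend on the family and the device), for all $\lambda$, $$\mathrm{Tr}\big[\{Z_i,X_i\}^\dagger\{Z_i,X_i\}\,\sigma^{(\theta_1,\theta_2)}\big]\le C\,\gamma_T(D)^{1/2}+\mu(\lambda),\qquad \{A,B\}=AB+BA .$$ -/

import Mathlib

open scoped Matrix BigOperators ComplexOrder

noncomputable section

/-! ### Bit strings and binary encodings of finite sets -/

/-- Bit strings of length `n`; also the computational basis of `n` qubits. -/
abbrev Bits (n : ℕ) : Type := Fin n → Bool

/-- The `i`-th bit of `x`; positions outside the string read as `0`. -/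
def bitAt {n : ℕ} (x : Bits n) (i : ℕ) : Bool := if h : i < n then x ⟨i, h⟩ else false

/-- The all-zero string. -/
def zeros (n : ℕ) : Bits n := fun _ => false

/-- Bitwise exclusive or. -/
def xorBits {n : ℕ} (x y : Bits n) : Bits n := fun i => xor (x i) (y i)

/-- The inner product `d · s` modulo 2. -/
def dotBits {n : ℕ} (d s : Bits n) : Bool :=
  (Finset.univ.filter fun i => d i = true ∧ s i = true).card.bodd

/-- The sign `(-1)^b`. -/
def sgn (b : Bool) : ℂ := if b then -1 else 1

/-- A bit as a string of length one. -/
def encBit : Bool ≃ Bits 1 := (Equiv.funUnique (Fin 1) Bool).symm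

/-- Pairs are encoded by concatenation. -/
def encPair {α β : Type} {m n : ℕ} (e : α ≃ Bits m) (f : β ≃ Bits n) : α × β ≃ Bits (m + n) :=
  (Equiv.prodCongr e f).trans (Fin.appendEquiv m n)

/-- A bit string is its own encoding. -/
def encSelf (n : ℕ) : Bits n ≃ Bits n := Equiv.refl _

/-- A function of the security parameter is negligible: it is nonnegative and decays faster than
the inverse of every polynomial. -/
def Negligible (μ : ℕ → ℝ) : Prop :=
  (∀ l, 0 ≤ μ l) ∧ ∀ p : Polynomial ℝ,
    Filter.Tendsto (fun l : ℕ => μ l * p.eval (l : ℝ)) Filter.atTop (nhds 0)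

/-! ### Quantum circuits over a fixed universal gate set -/

/-- Gates, acting on wires with the given numbers: Hadamard, `T = diag(1, e^{iπ/4})`, NOT,
CNOT (control, target), and Toffoli (two controls, target). -/
inductive Gate where
  | had (t : ℕ)
  | phase (t : ℕ)
  | flip (t : ℕ)
  | cnot (c t : ℕ)
  | toffoli (c c' t : ℕ)

/-- A circuit: a number of ancilla wires (added after the input wires and initialised to `0`) and
a list of gates, applied from left to right. -/
structure Circuit where
  anc : ℕ
  gates : List Gate

/-- The single-qubit operator `u` on wire `t` of `N` wires (identity if there is no wire `t`). -/
def oneQubit (N t : ℕ) (u : Matrix Bool Bool ℂ) : Matrix (Bits N) (Bits N) ℂ := fun a b =>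
  if ∀ j : Fin N, (j : ℕ) ≠ t → a j = b j then
    (if t < N then u (bitAt a t) (bitAt b t) else 1) else 0

/-- The NOT of wire `t` controlled by the wires in `cs` (identity if `t` is missing or is one of
the controls, or if some control is missing). -/
def ctrlNot (N : ℕ) (cs : List ℕ) (t : ℕ) : Matrix (Bits N) (Bits N) ℂ := fun a b =>
  if a = fun j : Fin N =>
      xor (b j) (decide ((j : ℕ) = t ∧ t ∉ cs ∧ ∀ c ∈ cs, bitAt b c = true)) then 1 else 0

/-- The unitary of a gate on `N` wires. -/
def Gate.mat (N : ℕ) : Gate → Matrix (Bits N) (Bits N) ℂ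
  | .had t => oneQubit N t fun a b => ((Real.sqrt 2 : ℝ) : ℂ)⁻¹ * sgn (a && b)
  | .phase t => oneQubit N t fun a b =>
      if a = b then (if a then Complex.exp (Complex.I * (Real.pi / 4)) else 1) else 0
  | .flip t => ctrlNot N [] t
  | .cnot c t => ctrlNot N [c] t
  | .toffoli c c' t => ctrlNot N [c, c'] t

/-- The unitary of a list of gates on `N` wires, the head of the list being applied first. -/
def gatesMat (N : ℕ) : List Gate → Matrix (Bits N) (Bits N) ℂ
  | [] => 1
  | g :: gs => gatesMat N gs * g.mat N

/-- The description of a circuit as a bit string: all numbers are written in unary and terminated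
by a `0`; each gate is a tag followed by its wires. -/
def encNat (n : ℕ) : List Bool := List.replicate n true ++ [false]

def Gate.encode : Gate → List Bool
  | .had t => encNat 0 ++ encNat t
  | .phase t => encNat 1 ++ encNat t
  | .flip t => encNat 2 ++ encNat t
  | .cnot c t => encNat 3 ++ encNat c ++ encNat t
  | .toffoli c c' t => encNat 4 ++ encNat c ++ encNat c' ++ encNat t

def Circuit.encode (C : Circuit) : List Bool :=
  encNat C.anc ++ C.gates.flatMap Gate.encode

/-- A family of circuits is efficient (uniform, polynomial): some polynomial-time Turing machine
outputs the description of the `l`-th circuit on input `1^l`. -/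
def EfficientCircuits (C : ℕ → Circuit) : Prop :=
  Nonempty (Turing.TM2ComputableInPolyTime Computability.unaryEncodeNat Circuit.encode C)

/-- A length (number of qubits) is efficient: some polynomial-time Turing machine outputs it in
unary on input `1^l`. -/
def EfficientLength (n : ℕ → ℕ) : Prop :=
  Nonempty (Turing.TM2ComputableInPolyTime Computability.unaryEncodeNat
    Computability.unaryEncodeNat n)

/-! ### Efficient procedures, functions, state preparations and measurements -/

/-- The amplitudes of the output of the circuit on the basis state `x` and zero ancillas. -/
def Circuit.amp (C : Circuit) {n : ℕ} (x : Bits n) : Bits (n + C.anc) → ℂ := fun a =>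
  gatesMat (n + C.anc) C.gates a (Fin.append x (zeros C.anc))

/-- The state of the first `m` wires after running the circuit on the basis state `x`, the other
wires being traced out. -/
def Circuit.state (C : Circuit) {n : ℕ} (x : Bits n) (m : ℕ) : Matrix (Bits m) (Bits m) ℂ :=
  fun z z' => ∑ a : Bits (n + C.anc), ∑ a' : Bits (n + C.anc),
    if (∀ i : Fin m, bitAt a i = z i) ∧ (∀ i : Fin m, bitAt a' i = z' i) ∧
        (∀ j : Fin (n + C.anc), m ≤ (j : ℕ) → a j = a' j)
    then C.amp x a * star (C.amp x a') else 0

/-- The probability that the circuit, run on `x` and measured in the computational basis, shows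
`z` on its first `m` wires. -/
def Circuit.out (C : Circuit) {n m : ℕ} (x : Bits n) (z : Bits m) : ℝ :=
  ∑ a : Bits (n + C.anc), if ∀ i : Fin m, bitAt a i = z i then ‖C.amp x a‖ ^ 2 else 0

open Classical in
/-- The probability that the output of the circuit on `x`, decoded by `e`, lies in `S`. -/
def Circuit.prob (C : Circuit) {n m : ℕ} {β : Type} (x : Bits n) (e : β ≃ Bits m) (S : Set β) : ℝ :=
  ∑ z : Bits m, if e.symm z ∈ S then C.out x z else 0

/-- The deterministic function `g` is efficiently computable. -/
def EfficientFun {α β : ℕ → Type} {n m : ℕ → ℕ} (eα : ∀ l, α l ≃ Bits (n l))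
    (eβ : ∀ l, β l ≃ Bits (m l)) (g : ∀ l, α l → β l) : Prop :=
  ∃ C : ℕ → Circuit, EfficientCircuits C ∧
    ∀ l (a : α l), (C l).prob (eα l a) (eβ l) {g l a} = 1

/-- The states `ρ l a` on the space with basis `H l` can be prepared efficiently from the classical
input `a`. -/
def EfficientStates {α H : ℕ → Type} {n m : ℕ → ℕ} (eα : ∀ l, α l ≃ Bits (n l))
    (eH : ∀ l, H l ≃ Bits (m l)) (ρ : ∀ l, α l → Matrix (H l) (H l) ℂ) : Prop :=
  ∃ C : ℕ → Circuit, EfficientCircuits C ∧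
    ∀ l (a : α l), (C l).state (eα l a) (m l) = Matrix.reindex (eH l) (eH l) (ρ l a)

/-- The measurements `{E l i}ᵢ` are efficient: the isometry `|φ⟩ ↦ ∑ᵢ E i |φ⟩ ⊗ |i⟩` is implemented
by an efficient family of circuits. Wires: the measured system, then the register for the outcome
(initially zero), then workspace that starts and ends in the state zero. -/
def EfficientMeasurement {I H : ℕ → Type} {n a : ℕ → ℕ} (eI : ∀ l, I l ≃ Bits (a l))
    (eH : ∀ l, H l ≃ Bits (n l)) (E : ∀ l, I l → Matrix (H l) (H l) ℂ) : Prop :=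
  ∃ C : ℕ → Circuit, EfficientCircuits C ∧
    ∀ l (x x' : H l) (i : I l) (c : Bits (C l).anc),
      gatesMat (n l + a l + (C l).anc) (C l).gates
          (Fin.append (Fin.append (eH l x') (eI l i)) c)
          (Fin.append (Fin.append (eH l x) (zeros (a l))) (zeros (C l).anc)) =
        if c = zeros (C l).anc then E l i x' x else 0

/-! ### Extended noisy trapdoor claw-free function families -/

/-- The data of a family: `κ`, `τ`, `w`, `m` are the lengths of keys, trapdoors, preimages and
images; preimages form a set `X l` of bit strings, and images are arbitrary strings of length `m l`.
The first argument of `gen` and `f` tells the two families apart: `true` is the claw-free family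
(the Hadamard basis), `false` the injective family (the computational basis). -/
structure FunctionFamilies where
  κ : ℕ → ℕ
  τ : ℕ → ℕ
  w : ℕ → ℕ
  m : ℕ → ℕ
  /-- the key generation algorithms, which output a key and a trapdoor -/
  gen : Bool → ℕ → Circuit
  /-- the domain -/
  X : ∀ l, Finset (Bits (w l))
  /-- `f θ l k b x` is the output distribution of the function `f_{k,b}` at `x` -/
  f : Bool → ∀ l, Bits (κ l) → Bool → Bits (w l) → PMF (Bits (m l))
  /-- for a claw-free key, the distributions that can be prepared in superposition -/
  f' : ∀ l, Bits (κ l) → Bool → Bits (w l) → PMF (Bits (m l))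
  /-- inversion for the claw-free family, from the trapdoor, the bit and the image -/
  invF : ∀ l, Bits (τ l) × (Bool × Bits (m l)) → Bits (w l)
  /-- inversion for the injective family, from the trapdoor and the image -/
  invG : ∀ l, Bits (τ l) × Bits (m l) → Bool × Bits (w l)
  /-- the check procedure, which does not need the trapdoor, common to both families -/
  chk : ∀ l, (Bits (κ l) × Bool) × (Bits (w l) × Bits (m l)) → Bool
  /-- the preparation of range superpositions, common to both families -/
  samp : ℕ → Circuit
  /-- the strings `d` for which the bit `d · (x₀ ⊕ x₁)` is hard to find -/
  good : ∀ l, Bits (κ l) → Bool → Bits (w l) → Set (Bits (w l))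

namespace FunctionFamilies

variable (F : FunctionFamilies)

/-- The probability that key generation outputs `(k, t)`. -/
def genProb (θ : Bool) (l : ℕ) (k : Bits (F.κ l)) (t : Bits (F.τ l)) : ℝ :=
  (F.gen θ l).out (zeros 0) (Fin.append k t)

/-- The distribution of the key. -/
def keyProb (θ : Bool) (l : ℕ) (k : Bits (F.κ l)) : ℝ := ∑ t, F.genProb θ l k t

/-- `k` is a key of type `θ`. -/
def IsKey (θ : Bool) (l : ℕ) (k : Bits (F.κ l)) : Prop := F.keyProb θ l k ≠ 0

/-- `t` is a trapdoor for the key `k` of type `θ`. -/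
def IsKeyPair (θ : Bool) (l : ℕ) (k : Bits (F.κ l)) (t : Bits (F.τ l)) : Prop :=
  F.genProb θ l k t ≠ 0

/-- `(x₀, x₁)` is a claw of the claw-free key `k`. -/
def IsClaw (l : ℕ) (k : Bits (F.κ l)) (x₀ x₁ : Bits (F.w l)) : Prop :=
  x₀ ∈ F.X l ∧ x₁ ∈ F.X l ∧ F.f true l k false x₀ = F.f true l k true x₁

/-- The distributions prepared by the procedure `samp`. -/
def rangeDist (θ : Bool) (l : ℕ) : Bits (F.κ l) → Bool → Bits (F.w l) → PMF (Bits (F.m l)) :=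
  if θ then F.f' l else F.f false l

/-- The amplitudes of `|X|^{-1/2} ∑_{x ∈ X, y} √(p_{k,b}(x)(y)) |x⟩|y⟩`. -/
def rangeAmp (θ : Bool) (l : ℕ) (k : Bits (F.κ l)) (b : Bool) (z : Bits (F.w l) × Bits (F.m l)) :
    ℂ :=
  if z.1 ∈ F.X l then
    ((Real.sqrt ((F.rangeDist θ l k b z.1 z.2).toReal / (F.X l).card) : ℝ) : ℂ) else 0

/-- The squared Hellinger distance. -/
def hellingerSq {α : Type} [Fintype α] (p q : PMF α) : ℝ :=
  1 - ∑ y, Real.sqrt ((p y).toReal * (q y).toReal)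

/-- The tuples `(b, x_b, d, d · (x₀ ⊕ x₁))` for claws `(x₀, x₁)` and good `d`. -/
def hardcoreSet (l : ℕ) (k : Bits (F.κ l)) :
    Set ((Bool × Bits (F.w l)) × (Bits (F.w l) × Bool)) :=
  {r | ∃ x₀ x₁, F.IsClaw l k x₀ x₁ ∧ r.1.2 = (if r.1.1 then x₁ else x₀) ∧
    r.2.1 ∈ F.good l k false x₀ ∧ r.2.1 ∈ F.good l k true x₁ ∧
    r.2.2 = dotBits r.2.1 (xorBits x₀ x₁)}

/-- The same tuples with the last bit flipped. -/
def hardcoreSetFlipped (l : ℕ) (k : Bits (F.κ l)) :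
    Set ((Bool × Bits (F.w l)) × (Bits (F.w l) × Bool)) :=
  {r | (r.1, (r.2.1, !r.2.2)) ∈ F.hardcoreSet l k}

end FunctionFamilies

open Classical in
/-- Extended noisy trapdoor claw-free function families. -/
structure ENTCF extends FunctionFamilies where
  κ_eff : EfficientLength κ
  τ_eff : EfficientLength τ
  w_eff : EfficientLength w
  m_eff : EfficientLength m
  X_nonempty : ∀ l, (X l).Nonempty
  /-- efficient function generation, for both families -/
  gen_eff : ∀ θ, EfficientCircuits (gen θ)
  /-- claw-free family: efficient inversion with the trapdoor -/
  invF_eff : EfficientFun (fun l => encPair (encSelf (τ l)) (encPair encBit (encSelf (m l))))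
    (fun l => encSelf (w l)) invF
  invF_spec : ∀ l k t, toFunctionFamilies.IsKeyPair true l k t → ∀ b, ∀ x ∈ X l,
    ∀ y ∈ (f true l k b x).support, invF l (t, (b, y)) = x
  /-- claw-free family: the claws form a perfect matching of the domain -/
  matching : ∀ l k, toFunctionFamilies.IsKey true l k →
    (∀ x₀ ∈ X l, ∃! x₁, toFunctionFamilies.IsClaw l k x₀ x₁) ∧
    (∀ x₁ ∈ X l, ∃! x₀, toFunctionFamilies.IsClaw l k x₀ x₁)
  /-- claw-free family: images under `f'` have the same preimages -/
  f'_inv : ∀ l k t, toFunctionFamilies.IsKeyPair true l k t → ∀ x₀ x₁,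
    toFunctionFamilies.IsClaw l k x₀ x₁ → ∀ b, ∀ y ∈ (f' l k b (if b then x₁ else x₀)).support,
      invF l (t, (false, y)) = x₀ ∧ invF l (t, (true, y)) = x₁
  /-- claw-free family: `f'` is close to `f` on average -/
  f'_close : ∃ μ, Negligible μ ∧ ∀ l k, toFunctionFamilies.IsKey true l k → ∀ b,
    (∑ x ∈ X l, FunctionFamilies.hellingerSq (f true l k b x) (f' l k b x)) / (X l).card ≤ μ l
  /-- injective family: the outputs at distinct pairs `(b, x)` have disjoint supports -/
  disjoint : ∀ l k, toFunctionFamilies.IsKey false l k → ∀ b b', ∀ x ∈ X l, ∀ x' ∈ X l,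
    (b, x) ≠ (b', x') → Disjoint (f false l k b x).support (f false l k b' x').support
  /-- injective family: efficient inversion with the trapdoor -/
  invG_eff : EfficientFun (fun l => encPair (encSelf (τ l)) (encSelf (m l)))
    (fun l => encPair encBit (encSelf (w l))) invG
  invG_spec : ∀ l k t, toFunctionFamilies.IsKeyPair false l k t → ∀ b, ∀ x ∈ X l,
    ∀ y ∈ (f false l k b x).support, invG l (t, y) = (b, x)
  /-- efficient check procedure, the same for both families -/
  chk_eff : EfficientFun (fun l => encPair (encPair (encSelf (κ l)) encBit)
    (encPair (encSelf (w l)) (encSelf (m l)))) (fun _ => encBit) chk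
  chk_spec : ∀ θ l k, toFunctionFamilies.IsKey θ l k → ∀ b, ∀ x ∈ X l, ∀ y,
    chk l ((k, b), (x, y)) = true ↔ y ∈ (toFunctionFamilies.rangeDist θ l k b x).support
  /-- efficient preparation of range superpositions up to negligible infidelity, the same procedure
  for both families -/
  samp_eff : EfficientCircuits samp
  samp_spec : ∀ θ, ∃ μ, Negligible μ ∧ ∀ l k, toFunctionFamilies.IsKey θ l k → ∀ b,
    1 - μ l ≤ (∑ z, ∑ z', star (toFunctionFamilies.rangeAmp θ l k b z) *
      (samp l).state (encPair (encSelf (κ l)) encBit (k, b)) (w l + m l)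
        (encPair (encSelf (w l)) (encSelf (m l)) z) (encPair (encSelf (w l)) (encSelf (m l)) z') *
      toFunctionFamilies.rangeAmp θ l k b z').re
  /-- all but a negligible fraction of the strings are good -/
  good_dense : ∃ μ, Negligible μ ∧ ∀ l k, toFunctionFamilies.IsKey true l k → ∀ b, ∀ x ∈ X l,
    ((Finset.univ.filter fun d => d ∉ good l k b x).card : ℝ) / 2 ^ (w l) ≤ μ l
  /-- goodness can be checked efficiently with the trapdoor -/
  good_eff : ∃ g : ∀ l, (Bits (κ l) × Bits (τ l)) × (Bool × (Bits (w l) × Bits (w l))) → Bool,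
    EfficientFun (fun l => encPair (encPair (encSelf (κ l)) (encSelf (τ l)))
      (encPair encBit (encPair (encSelf (w l)) (encSelf (w l))))) (fun _ => encBit) g ∧
    ∀ l k t, toFunctionFamilies.IsKeyPair true l k t → ∀ b, ∀ x ∈ X l, ∀ d,
      g l ((k, t), (b, (x, d))) = true ↔ d ∈ good l k b x
  /-- adaptive hardcore bit -/
  hardcore : ∀ A : ℕ → Circuit, EfficientCircuits A → ∃ μ, Negligible μ ∧ ∀ l,
    |∑ k, toFunctionFamilies.keyProb true l k *
      ((A l).prob k (encPair (encPair encBit (encSelf (w l))) (encPair (encSelf (w l)) encBit))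
          (toFunctionFamilies.hardcoreSet l k) -
        (A l).prob k (encPair (encPair encBit (encSelf (w l))) (encPair (encSelf (w l)) encBit))
          (toFunctionFamilies.hardcoreSetFlipped l k))| ≤ μ l
  /-- injective invariance -/
  invariance : ∀ A : ℕ → Circuit, EfficientCircuits A → ∃ μ, Negligible μ ∧ ∀ l,
    |∑ k, toFunctionFamilies.keyProb true l k * (A l).prob k encBit {false} -
      ∑ k, toFunctionFamilies.keyProb false l k * (A l).prob k encBit {false}| ≤ μ l
  /-- for some fixed string `d`, the bit `d · (x₀ ⊕ x₁)` cannot be predicted from the key -/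
  fixed_hardcore : ∀ A : ℕ → Circuit, EfficientCircuits A → ∃ μ, Negligible μ ∧
    ∃ d : ∀ l, Bits (w l), ∀ l,
    |∑ k, toFunctionFamilies.keyProb true l k * (A l).prob k encBit
        {c | ∃ x₀ x₁, toFunctionFamilies.IsClaw l k x₀ x₁ ∧ c = dotBits (d l) (xorBits x₀ x₁)} -
      1 / 2| ≤ μ l

namespace ENTCF

variable (F : ENTCF)

/-- Preimages. -/
abbrev W (l : ℕ) : Type := Bits (F.w l)

/-- Images. -/
abbrev Y (l : ℕ) : Type := Bits (F.m l)

/-! ### Decoding maps -/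

open Classical in
/-- `x̂_b(k, y)`, the preimage of `y` under `f_{k,b}`; `none` if there is none. -/
def xHat (θ : Bool) (l : ℕ) (k : Bits (F.κ l)) (y : F.Y l) (b : Bool) : Option (F.W l) :=
  if h : ∃ x ∈ F.X l, y ∈ (F.f θ l k b x).support then some h.choose else none

open Classical in
/-- `b̂(k, y)` for an injective key `k`; `none` if `y` is not an image. -/
def bHat (l : ℕ) (k : Bits (F.κ l)) (y : F.Y l) : Option Bool :=
  if h : ∃ b, ∃ x ∈ F.X l, y ∈ (F.f false l k b x).support then some h.choose else none

open Classical in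
/-- `û(k, y, d) = d · (x̂₀(k, y) ⊕ x̂₁(k, y))` for a claw-free key `k`; `none` if `y` has no claw or
`d` is not good for that claw. -/
def uHat (l : ℕ) (k : Bits (F.κ l)) (y : F.Y l) (d : F.W l) : Option Bool :=
  match F.xHat true l k y false, F.xHat true l k y true with
  | some x₀, some x₁ =>
      if d ∈ F.good l k false x₀ ∧ d ∈ F.good l k true x₁ then some (dotBits d (xorBits x₀ x₁))
      else none
  | _, _ => none

open Classical in
/-- The correct answers in the preimage round for a key of type `θ`: `(b̂, x̂_b̂)` for an injective
key, and `(b, x̂_b)` for both values of `b` for a claw-free key. -/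
def correct (θ : Bool) (l : ℕ) (k : Bits (F.κ l)) (y : F.Y l) : Finset (Bool × F.W l) :=
  Finset.univ.filter fun r =>
    (θ = false → F.bHat l k y = some r.1) ∧ F.xHat θ l k y r.1 = some r.2

/-- The average of `g` over keys of types `θ₁` and `θ₂`, generated independently. -/
def avg (θ₁ θ₂ : Bool) (l : ℕ) (g : Bits (F.κ l) → Bits (F.κ l) → ℝ) : ℝ :=
  ∑ k₁, ∑ k₂, F.keyProb θ₁ l k₁ * F.keyProb θ₂ l k₂ * g k₁ k₂

end ENTCF

/-! ### Devices -/

/-- A projective measurement. -/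
def IsProjectiveMeasurement {I H : Type} [Fintype I] [DecidableEq I] [Fintype H] [DecidableEq H]
    (E : I → Matrix H H ℂ) : Prop :=
  (∀ i, (E i).IsHermitian) ∧ (∀ i j, E i * E j = if i = j then E i else 0) ∧ ∑ i, E i = 1

/-- The squared state-dependent norm `‖A‖²_ρ = Tr(A† A ρ)`. -/
def stateNormSq {H : Type} [Fintype H] (A ρ : Matrix H H ℂ) : ℝ := (Aᴴ * A * ρ).trace.re

/-- The anti-commutator. -/
def anticomm {H : Type} [Fintype H] (A B : Matrix H H ℂ) : Matrix H H ℂ := A * B + B * A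

/-- The projector `O^{(b)}` onto the `(-1)^b`-eigenspace of a binary observable `O`. -/
def eigenproj {H : Type} [DecidableEq H] (O : Matrix H H ℂ) (b : Bool) : Matrix H H ℂ :=
  (1 / 2 : ℂ) • (1 + sgn b • O)

/-- A device (for every security parameter `l`). Its private space `H_D` consists of `nD l` qubits.
Operators that are classical on the registers `Y` (the two images) and `R` (the two strings
`d₁, d₂`) are given by their blocks. The states depend on the two keys sent by the verifier. -/
structure Device (F : ENTCF) where
  nD : ℕ → ℕ
  /-- blocks of the state after the images have been returned -/
  ψ : ∀ l, Bits (F.κ l) → Bits (F.κ l) → F.Y l × F.Y l → Matrix (Bits (nD l)) (Bits (nD l)) ℂ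
  /-- blocks of the measurement in the preimage round -/
  Pi : ∀ l, (Bool × F.W l) × (Bool × F.W l) → F.Y l × F.Y l →
    Matrix (Bits (nD l)) (Bits (nD l)) ℂ
  /-- blocks of the measurement of the strings in the Hadamard round -/
  M : ∀ l, F.W l × F.W l → F.Y l × F.Y l → Matrix (Bits (nD l)) (Bits (nD l)) ℂ
  /-- blocks of the measurement answering the questions `q₁, q₂` -/
  P : ∀ l, Bool × Bool → Bool × Bool → (F.Y l × F.Y l) × (F.W l × F.W l) →
    Matrix (Bits (nD l)) (Bits (nD l)) ℂ
  ψ_pos : ∀ l k₁ k₂, (Matrix.blockDiagonal (ψ l k₁ k₂)).PosSemidef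
  ψ_trace : ∀ l k₁ k₂, (Matrix.blockDiagonal (ψ l k₁ k₂)).trace = 1
  Pi_proj : ∀ l, IsProjectiveMeasurement fun r => Matrix.blockDiagonal (Pi l r)
  M_proj : ∀ l, IsProjectiveMeasurement fun d => Matrix.blockDiagonal (M l d)
  P_proj : ∀ l q, IsProjectiveMeasurement fun v => Matrix.blockDiagonal (P l q v)

namespace Device

variable {F : ENTCF} (D : Device F)

/-- Basis of `H_D ⊗ H_Y`. -/
abbrev HY (l : ℕ) : Type := Bits (D.nD l) × (F.Y l × F.Y l)

/-- Basis of `H_D ⊗ H_Y ⊗ H_R`. -/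
abbrev HYR (l : ℕ) : Type := Bits (D.nD l) × ((F.Y l × F.Y l) × (F.W l × F.W l))

/-- The registers `D, Y` as qubits. -/
def encHY (l : ℕ) : D.HY l ≃ Bits (D.nD l + (F.m l + F.m l)) :=
  encPair (encSelf _) (encPair (encSelf _) (encSelf _))

/-- The registers `D, Y, R` as qubits. -/
def encHYR (l : ℕ) : D.HYR l ≃ Bits (D.nD l + ((F.m l + F.m l) + (F.w l + F.w l))) :=
  encPair (encSelf _) (encPair (encPair (encSelf _) (encSelf _)) (encPair (encSelf _) (encSelf _)))

/-- Efficient devices: the states can be prepared efficiently from the two keys, and all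
measurements are efficient. -/
structure Efficient : Prop where
  nD_eff : EfficientLength D.nD
  ψ_eff : EfficientStates (α := fun l => Bits (F.κ l) × Bits (F.κ l)) (H := D.HY)
    (fun _ => encPair (encSelf _) (encSelf _)) D.encHY
    fun l k => Matrix.blockDiagonal (D.ψ l k.1 k.2)
  Pi_eff : EfficientMeasurement (I := fun l => (Bool × F.W l) × (Bool × F.W l)) (H := D.HY)
    (fun _ => encPair (encPair encBit (encSelf _)) (encPair encBit (encSelf _))) D.encHY
    fun l r => Matrix.blockDiagonal (D.Pi l r)
  M_eff : EfficientMeasurement (I := fun l => F.W l × F.W l) (H := D.HY)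
    (fun _ => encPair (encSelf _) (encSelf _)) D.encHY
    fun l d => Matrix.blockDiagonal (D.M l d)
  P_eff : ∀ q, EfficientMeasurement (I := fun _ => Bool × Bool) (H := D.HYR)
    (fun _ => encPair encBit encBit) D.encHYR
    fun l v => Matrix.blockDiagonal (D.P l q v)

/-! #### Marginal observables -/

/-- The projector of the outcome `v` of the measurement for the questions `q`. -/
def PFull (l : ℕ) (q v : Bool × Bool) : Matrix (D.HYR l) (D.HYR l) ℂ :=
  Matrix.blockDiagonal (D.P l q v)

def Z₁ (l : ℕ) : Matrix (D.HYR l) (D.HYR l) ℂ :=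
  ∑ v : Bool × Bool, sgn v.1 • D.PFull l (false, false) v
def Z₂ (l : ℕ) : Matrix (D.HYR l) (D.HYR l) ℂ :=
  ∑ v : Bool × Bool, sgn v.2 • D.PFull l (false, false) v
def X₁ (l : ℕ) : Matrix (D.HYR l) (D.HYR l) ℂ :=
  ∑ v : Bool × Bool, sgn v.1 • D.PFull l (true, true) v
def X₂ (l : ℕ) : Matrix (D.HYR l) (D.HYR l) ℂ :=
  ∑ v : Bool × Bool, sgn v.2 • D.PFull l (true, true) v
def Z₁tilde (l : ℕ) : Matrix (D.HYR l) (D.HYR l) ℂ :=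
  ∑ v : Bool × Bool, sgn v.1 • D.PFull l (false, true) v
def Z₂tilde (l : ℕ) : Matrix (D.HYR l) (D.HYR l) ℂ :=
  ∑ v : Bool × Bool, sgn v.2 • D.PFull l (true, false) v
def X₁tilde (l : ℕ) : Matrix (D.HYR l) (D.HYR l) ℂ :=
  ∑ v : Bool × Bool, sgn v.1 • D.PFull l (true, false) v
def X₂tilde (l : ℕ) : Matrix (D.HYR l) (D.HYR l) ℂ :=
  ∑ v : Bool × Bool, sgn v.2 • D.PFull l (false, true) v

/-! #### Post-measurement states -/

/-- The block of the post-measurement state at `y₁, y₂; d₁, d₂`. -/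
def σBlock (l : ℕ) (k₁ k₂ : Bits (F.κ l)) (o : (F.Y l × F.Y l) × (F.W l × F.W l)) :
    Matrix (Bits (D.nD l)) (Bits (D.nD l)) ℂ :=
  D.M l o.2 o.1 * D.ψ l k₁ k₂ o.1 * D.M l o.2 o.1

/-- The post-measurement state `σ` (for given keys). -/
def σ (l : ℕ) (k₁ k₂ : Bits (F.κ l)) : Matrix (D.HYR l) (D.HYR l) ℂ :=
  Matrix.blockDiagonal (D.σBlock l k₁ k₂)

/-- `σ^{(0,v₁; 1,v₂)}`, the part with `b̂(k₁,y₁) = v₁` and `û(k₂,y₂,d₂) = v₂ ⊕ b̂(k₁,y₁)`, for an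
injective `k₁` and a claw-free `k₂`. -/
def σ01 (l : ℕ) (k₁ k₂ : Bits (F.κ l)) (v₁ v₂ : Bool) : Matrix (D.HYR l) (D.HYR l) ℂ :=
  Matrix.blockDiagonal fun o =>
    if F.bHat l k₁ o.1.1 = some v₁ ∧ F.uHat l k₂ o.1.2 o.2.2 = some (xor v₂ v₁)
    then D.σBlock l k₁ k₂ o else 0

/-- `σ^{(1,v₁; 0,v₂)}`, the part with `û(k₁,y₁,d₁) = v₁ ⊕ b̂(k₂,y₂)` and `b̂(k₂,y₂) = v₂`, for a
claw-free `k₁` and an injective `k₂`. -/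
def σ10 (l : ℕ) (k₁ k₂ : Bits (F.κ l)) (v₁ v₂ : Bool) : Matrix (D.HYR l) (D.HYR l) ℂ :=
  Matrix.blockDiagonal fun o =>
    if F.uHat l k₁ o.1.1 o.2.1 = some (xor v₁ v₂) ∧ F.bHat l k₂ o.1.2 = some v₂
    then D.σBlock l k₁ k₂ o else 0

/-! #### Success probabilities -/

/-- The probability that the first preimage answer is correct, for keys of types `θ₁, θ₂`. -/
def pre₁ (l : ℕ) (θ₁ θ₂ : Bool) : ℝ :=
  F.avg θ₁ θ₂ l fun k₁ k₂ => ∑ y : F.Y l × F.Y l, ∑ r ∈ F.correct θ₁ l k₁ y.1,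
    ∑ r' : Bool × F.W l, (D.Pi l (r, r') y * D.ψ l k₁ k₂ y).trace.re

/-- The probability that the second preimage answer is correct, for keys of types `θ₁, θ₂`. -/
def pre₂ (l : ℕ) (θ₁ θ₂ : Bool) : ℝ :=
  F.avg θ₁ θ₂ l fun k₁ k₂ => ∑ y : F.Y l × F.Y l, ∑ r ∈ F.correct θ₂ l k₂ y.2,
    ∑ r' : Bool × F.W l, (D.Pi l (r', r) y * D.ψ l k₁ k₂ y).trace.re

/-- `γ_P`: one minus the smallest success probability in the preimage round. -/
def γP (l : ℕ) : ℝ :=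
  1 - ⨅ θ : Bool, ⨅ j : Fin 4,
    (![D.pre₁ l false θ, D.pre₂ l θ false, D.pre₂ l θ true, D.pre₁ l true θ] : Fin 4 → ℝ) j

/-- The probability, for keys of types `(0, 1)`, that measuring the observable `O` gives the correct
answer number `i`. -/
def test01 (l : ℕ) (O : Matrix (D.HYR l) (D.HYR l) ℂ) (i : Bool × Bool → Bool) : ℝ :=
  F.avg false true l fun k₁ k₂ =>
    (∑ v : Bool × Bool, eigenproj O (i v) * D.σ01 l k₁ k₂ v.1 v.2).trace.re

/-- The same for keys of types `(1, 0)`. -/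
def test10 (l : ℕ) (O : Matrix (D.HYR l) (D.HYR l) ℂ) (i : Bool × Bool → Bool) : ℝ :=
  F.avg true false l fun k₁ k₂ =>
    (∑ v : Bool × Bool, eigenproj O (i v) * D.σ10 l k₁ k₂ v.1 v.2).trace.re

/-- `γ_T`: one minus the smallest success probability in the test case. -/
def γT (l : ℕ) : ℝ :=
  1 - ⨅ j : Fin 8,
    (![D.test01 l (D.Z₁ l) Prod.fst, D.test01 l (D.Z₁tilde l) Prod.fst,
      D.test10 l (D.X₁ l) Prod.fst, D.test10 l (D.X₁tilde l) Prod.fst,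
      D.test10 l (D.Z₂ l) Prod.snd, D.test10 l (D.Z₂tilde l) Prod.snd,
      D.test01 l (D.X₂ l) Prod.snd, D.test01 l (D.X₂tilde l) Prod.snd] : Fin 8 → ℝ) j

/-- Perfect devices. -/
def Perfect : Prop := Negligible D.γP

/-- `A ≈_{ε, σ^{(θ₁,θ₂)}} 0` with `C` as the constant in `O(ε)`: the squared norm of `A` on the
post-measurement state, averaged over the keys, is at most `C ε` plus a negligible function. -/
def ApproxZero (C : ℝ) (ε : ℕ → ℝ) (θ₁ θ₂ : Bool)
    (A : ∀ l, Matrix (D.HYR l) (D.HYR l) ℂ) : Prop :=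
  ∃ μ, Negligible μ ∧ ∀ l,
    F.avg θ₁ θ₂ l (fun k₁ k₂ => stateNormSq (A l) (D.σ l k₁ k₂)) ≤ C * ε l + μ l

end Device

end

/-! Fix a place `i` and write Z, X for the two observables there. Consider first the types of keys
for which X is tested: claw-free at `i`, injective at the other place. Let ξ be a purification of
the post-measurement state. Let η₀ and η₁ be the vectors obtained by inserting, before the strings
`d` are measured, the preimage measurement with both answers correct and with bit 0 or 1 at the
place `i`. Let S be multiplication by the classical sign (-1)^(û ⊕ b̂), or 0 where it is undefined.
Three facts are used.

(1) ξ is close to η₀ + η₁, since the device is perfect (`incorrect_le`), and Z is close to (-1)^b on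
η_b, up to γ_T and a negligible error (`preimageProb_ge`). (2) X agrees with S on ξ up to γ_T, by
the test case (`le_sum_testSign`). (3) The correlations of X with S on η₀ and η₁ add up to something
negligible (`sum_testSign_corr_le`, `abs_hardcoreAdv_le`): in these branches a preimage and a string
`d` are known, and b̂ can be decoded with the trapdoor of the other key, so a correlated X would
predict an adaptive hardcore bit.

By (1) the η_b approximate the components of ξ in the eigenspaces of Z. The number ⟨ξ, SXξ⟩ + ⟨Zξ,
SXZξ⟩ is twice the sum of ⟨v, SXv⟩ over these two components v, so by (3) its real part is bounded
above by a small error. Since the first term is near 1 by (2), SX is near 1 on ξ and near -1 on Zξ.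
As S is classical it commutes with Z, and ZXξ ≈ ZSξ = SZξ ≈ -XZξ. This is
`anticommute_of_uncorrelated`. The approximation in (1) costs √γ_T in norm and enters the inner
products linearly, whence the exponent 1/2 for the squared norm.

The second half of (1) cannot be read off from the test case directly, since Z is tested only for an
injective key at `i`. There the answer agrees with the decoded image (`le_imageProb`). Injective
invariance makes the other key injective as well; then correct preimages are unique and measuring
them hardly disturbs the state (`imageProb_le_preimageProb`). Now the answer can be compared with
the measured preimage instead of the decoded image, which needs no trapdoor at `i`, so injective
invariance can change the key at `i` into a claw-free one.

To pass to all types of keys, the squared anticommutator is written as an expectation of signs in an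
efficient experiment that measures Z, X and Z in turn (`four_mul_trace_eq`, `sum_expect_triple`);
injective invariance then gives `anticommProb_invariance`.

The cryptographic assumptions speak only of circuits whose descriptions are printed by
polynomial-time Turing machines. Hence the experiments have to be compiled. `PolyStr.of_program`
composes polynomial-time machines, `Layout` and `Proc` describe circuits that act on part of the
wires and keep classical records, and `Device.Experiment.exists_circuits` gives the output
distribution of every experiment that is needed. -/

noncomputable section

/-! ### Fragments of stack machines -/

/-- `n` steps of the machine `M` lead from `c` to `c'`. -/
def StepsIn {K : Type} [DecidableEq K] {Γ : K → Type} {Λ σ : Type}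
    (M : Λ → Turing.TM2.Stmt Γ Λ σ) (n : ℕ) (c c' : Turing.TM2.Cfg Γ Λ σ) : Prop :=
  (flip bind (Turing.TM2.step M))^[n] (some c) = some c'

section StepsIn

variable {K : Type} [DecidableEq K] {Γ : K → Type} {Λ σ : Type}
  {M : Λ → Turing.TM2.Stmt Γ Λ σ}

theorem StepsIn.refl (c : Turing.TM2.Cfg Γ Λ σ) : StepsIn M 0 c c := rfl

theorem StepsIn.trans {m n : ℕ} {a b c : Turing.TM2.Cfg Γ Λ σ} (h₁ : StepsIn M m a b)
    (h₂ : StepsIn M n b c) : StepsIn M (m + n) a c := by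
  unfold StepsIn at *
  rw [add_comm, Function.iterate_add_apply, h₁, h₂]

theorem StepsIn.label (x : Λ) (v : σ) (S : ∀ k, List (Γ k)) :
    StepsIn M 1 ⟨some x, v, S⟩ (Turing.TM2.stepAux (M x) v S) := rfl

end StepsIn

/-- A fragment of a program with its own labels `L`, to be continued by another statement. -/
structure Frag {K : Type} (Γ : K → Type) (σ : Type) where
  L : Type
  fin : Fintype L
  -- Continuation-passing form: the next statement is an argument, and the labels are known only
  -- through a map to those of the surrounding program. Fragments then compose without changing
  -- their own code.
  entry : ∀ {Λ : Type}, (L → Λ) → Turing.TM2.Stmt Γ Λ σ → Turing.TM2.Stmt Γ Λ σ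
  body : ∀ {Λ : Type}, (L → Λ) → Turing.TM2.Stmt Γ Λ σ → L → Turing.TM2.Stmt Γ Λ σ

namespace Frag

variable {K : Type} {Γ : K → Type} {τ : Type}

/-- In all fragments the `Option Bool` component of the control state is scratch space for the
symbol just read. No fragment relies on what another one has left there. -/
def skip : Frag Γ (Option Bool × τ) where
  L := Empty
  fin := inferInstance
  entry _ q := q
  body _ _ x := x.elim

def seq (f g : Frag Γ (Option Bool × τ)) : Frag Γ (Option Bool × τ) where
  L := f.L ⊕ g.L
  fin := by have := f.fin; have := g.fin; infer_instance
  entry e q := f.entry (e ∘ Sum.inl) (g.entry (e ∘ Sum.inr) q)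
  body e q
    | .inl x => f.body (e ∘ Sum.inl) (g.entry (e ∘ Sum.inr) q) x
    | .inr x => g.body (e ∘ Sum.inr) q x

def push (k : K) (a : Γ k) : Frag Γ (Option Bool × τ) where
  L := Empty
  fin := inferInstance
  entry _ q := .push k (fun _ => a) q
  body _ _ x := x.elim

/-- Remove the top of a stack. -/
def pop (k : K) : Frag Γ (Option Bool × τ) where
  L := Empty
  fin := inferInstance
  entry _ q := .pop k (fun v _ => v) q
  body _ _ x := x.elim

def load (g : τ → τ) : Frag Γ (Option Bool × τ) where
  L := Empty
  fin := inferInstance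
  entry _ q := .load (fun v => (v.1, g v.2)) q
  body _ _ x := x.elim

def ite (c : τ → Bool) (f g : Frag Γ (Option Bool × τ)) : Frag Γ (Option Bool × τ) where
  L := f.L ⊕ g.L
  fin := by have := f.fin; have := g.fin; infer_instance
  entry e q := .branch (fun v => c v.2) (f.entry (e ∘ Sum.inl) q) (g.entry (e ∘ Sum.inr) q)
  body e q
    | .inl x => f.body (e ∘ Sum.inl) q x
    | .inr x => g.body (e ∘ Sum.inr) q x

/-- Run `f` if the stack `k` is empty and `g` otherwise. -/
def ifEmpty (k : K) (f g : Frag Γ (Option Bool × τ)) : Frag Γ (Option Bool × τ) where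
  L := f.L ⊕ g.L
  fin := by have := f.fin; have := g.fin; infer_instance
  entry e q := .peek k (fun v a => (a.map fun _ => true, v.2)) <|
    .branch (fun v => v.1.isNone) (f.entry (e ∘ Sum.inl) q) (g.entry (e ∘ Sum.inr) q)
  body e q
    | .inl x => f.body (e ∘ Sum.inl) q x
    | .inr x => g.body (e ∘ Sum.inr) q x

/-- Pop the stack `k` until it is empty, running `B c` for every symbol `c`. -/
def forPop (k : K) (conv : Γ k → Bool) (B : Bool → Frag Γ (Option Bool × τ)) :
    Frag Γ (Option Bool × τ) where
  L := Unit ⊕ ((B true).L ⊕ (B false).L)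
  fin := by have := (B true).fin; have := (B false).fin; infer_instance
  -- The continuation is reached only from the head of the loop, once the stack is empty; so it
  -- occurs in `body` and not here.
  entry e _ := .goto fun _ => e (.inl ())
  body e q
    | .inl _ => .pop k (fun v a => (a.map conv, v.2)) <|
        .branch (fun v => v.1.isSome)
          (.branch (fun v => v.1 == some true)
            ((B true).entry (fun x => e (.inr (.inl x))) (.goto fun _ => e (.inl ())))
            ((B false).entry (fun x => e (.inr (.inr x))) (.goto fun _ => e (.inl ()))))
          q
    | .inr (.inl x) => (B true).body (fun x => e (.inr (.inl x))) (.goto fun _ => e (.inl ())) x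
    | .inr (.inr x) => (B false).body (fun x => e (.inr (.inr x))) (.goto fun _ => e (.inl ())) x

variable [DecidableEq K]

/-- In every machine that contains it, the fragment leads in at most `t` steps from the state `w`
and the stacks `S` to `w'` and `S'`. -/
def Runs (f : Frag Γ (Option Bool × τ)) (t : ℕ) (w : τ) (S : ∀ k, List (Γ k)) (w' : τ)
    (S' : ∀ k, List (Γ k)) : Prop :=
  ∀ (Λ : Type) (M : Λ → Turing.TM2.Stmt Γ Λ (Option Bool × τ)) (e : f.L → Λ)
    (q : Turing.TM2.Stmt Γ Λ (Option Bool × τ)), (∀ x, M (e x) = f.body e q x) →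
    ∀ b, ∃ b' n, n ≤ t ∧ StepsIn M n (Turing.TM2.stepAux (f.entry e q) (b, w) S)
      (Turing.TM2.stepAux q (b', w') S')

theorem Runs.mono {f : Frag Γ (Option Bool × τ)} {t t' : ℕ} {w S w' S'} (h : f.Runs t w S w' S')
    (ht : t ≤ t') : f.Runs t' w S w' S' := by
  intro Λ M e q hM b
  obtain ⟨b', n, hn, h⟩ := h _ M e q hM b
  exact ⟨b', n, hn.trans ht, h⟩

theorem Runs.out_eq {f : Frag Γ (Option Bool × τ)} {t : ℕ} {w S w' S' S''}
    (h : f.Runs t w S w' S') (hS : S' = S'') : f.Runs t w S w' S'' := hS ▸ h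

theorem runs_skip (w : τ) (S : ∀ k, List (Γ k)) : skip.Runs 0 w S w S :=
  fun _ _ _ _ _ b => ⟨b, 0, le_rfl, .refl _⟩

theorem Runs.seq {f g : Frag Γ (Option Bool × τ)} {t₁ t₂ : ℕ} {w₀ w₁ w₂ S₀ S₁ S₂}
    (hf : f.Runs t₁ w₀ S₀ w₁ S₁) (hg : g.Runs t₂ w₁ S₁ w₂ S₂) :
    (f.seq g).Runs (t₁ + t₂) w₀ S₀ w₂ S₂ := by
  intro Λ M e q hM b
  obtain ⟨b₁, n₁, h₁, s₁⟩ := hf _ M (e ∘ Sum.inl) (g.entry (e ∘ Sum.inr) q) (fun x => hM (.inl x)) b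
  obtain ⟨b₂, n₂, h₂, s₂⟩ := hg _ M (e ∘ Sum.inr) q (fun x => hM (.inr x)) b₁
  exact ⟨b₂, n₁ + n₂, add_le_add h₁ h₂, s₁.trans s₂⟩

theorem runs_push (k : K) (a : Γ k) (w : τ) (S : ∀ k, List (Γ k)) :
    (push k a).Runs 0 w S w (Function.update S k (a :: S k)) :=
  fun _ _ _ _ _ b => ⟨b, 0, le_rfl, .refl _⟩

theorem runs_pop (k : K) (w : τ) (S : ∀ k, List (Γ k)) :
    (pop k).Runs 0 w S w (Function.update S k (S k).tail) :=
  fun _ _ _ _ _ b => ⟨b, 0, le_rfl, .refl _⟩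

theorem runs_load (g : τ → τ) (w : τ) (S : ∀ k, List (Γ k)) : (load g).Runs 0 w S (g w) S :=
  fun _ _ _ _ _ b => ⟨b, 0, le_rfl, .refl _⟩

theorem runs_ite_true {c : τ → Bool} {f g : Frag Γ (Option Bool × τ)} {t : ℕ} {w S w' S'}
    (hc : c w = true) (h : f.Runs t w S w' S') : (ite c f g).Runs t w S w' S' := by
  intro Λ M e q hM b
  simpa [ite, hc] using h _ M (e ∘ Sum.inl) q (fun x => hM (.inl x)) b

theorem runs_ite_false {c : τ → Bool} {f g : Frag Γ (Option Bool × τ)} {t : ℕ} {w S w' S'}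
    (hc : c w = false) (h : g.Runs t w S w' S') : (ite c f g).Runs t w S w' S' := by
  intro Λ M e q hM b
  simpa [ite, hc] using h _ M (e ∘ Sum.inr) q (fun x => hM (.inr x)) b

theorem runs_ifEmpty_nil {k : K} {f g : Frag Γ (Option Bool × τ)} {t : ℕ} {w S w' S'}
    (hk : S k = []) (h : f.Runs t w S w' S') : (ifEmpty k f g).Runs t w S w' S' := by
  intro Λ M e q hM b
  simpa [ifEmpty, hk] using h _ M (e ∘ Sum.inl) q (fun x => hM (.inl x)) none

theorem runs_ifEmpty_cons {k : K} {f g : Frag Γ (Option Bool × τ)} {t : ℕ} {w S w' S'}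
    (hk : S k ≠ []) (h : g.Runs t w S w' S') : (ifEmpty k f g).Runs t w S w' S' := by
  intro Λ M e q hM b
  obtain ⟨a, l, hl⟩ := List.exists_cons_of_ne_nil hk
  simpa [ifEmpty, hl] using h _ M (e ∘ Sum.inr) q (fun x => hM (.inr x)) (some true)

theorem runs_forPop_nil {k : K} {conv : Γ k → Bool} {B : Bool → Frag Γ (Option Bool × τ)}
    {w : τ} {S : ∀ k, List (Γ k)} (hk : S k = []) : (forPop k conv B).Runs 1 w S w S := by
  intro Λ M e q hM b
  refine ⟨none, 1, le_rfl, ?_⟩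
  have h := StepsIn.label (M := M) (e (.inl ())) (b, w) S
  rw [hM (.inl ())] at h
  have hS : Function.update S k [] = S := by rw [← hk]; exact Function.update_eq_self k S
  simpa [forPop, hk, hS] using h

theorem runs_forPop_cons {k : K} {conv : Γ k → Bool} {B : Bool → Frag Γ (Option Bool × τ)}
    {w w₁ w' : τ} {S S₁ S' : ∀ k, List (Γ k)} {c : Γ k} {cs : List (Γ k)} {t₁ t₂ : ℕ}
    (hk : S k = c :: cs) (hB : (B (conv c)).Runs t₁ w (Function.update S k cs) w₁ S₁)
    (h : (forPop k conv B).Runs t₂ w₁ S₁ w' S') :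
    (forPop k conv B).Runs (t₁ + t₂ + 1) w S w' S' := by
  intro Λ M e q hM b
  have h₀ := StepsIn.label (M := M) (e (.inl ())) (b, w) S
  rw [hM (.inl ())] at h₀
  cases hc : conv c with
  | true =>
    rw [hc] at hB
    obtain ⟨b₁, n₁, hn₁, s₁⟩ := hB _ M (fun x => e (.inr (.inl x))) (.goto fun _ => e (.inl ()))
      (fun x => hM (.inr (.inl x))) (some true)
    obtain ⟨b₂, n₂, hn₂, s₂⟩ := h _ M e q hM b₁
    refine ⟨b₂, 1 + n₁ + n₂, by omega, (StepsIn.trans ?_ s₁).trans s₂⟩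
    simpa [forPop, hk, hc] using h₀
  | false =>
    rw [hc] at hB
    obtain ⟨b₁, n₁, hn₁, s₁⟩ := hB _ M (fun x => e (.inr (.inr x))) (.goto fun _ => e (.inl ()))
      (fun x => hM (.inr (.inr x))) (some false)
    obtain ⟨b₂, n₂, hn₂, s₂⟩ := h _ M e q hM b₁
    refine ⟨b₂, 1 + n₁ + n₂, by omega, (StepsIn.trans ?_ s₁).trans s₂⟩
    simpa [forPop, hk, hc] using h₀

end Frag

/-! ### Machines with subroutines -/

/-- The stacks of a program with three subroutines: the input, the results of the subroutines,
working stacks, and the output. -/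
inductive Stk where
  | inp
  | arg (i : Fin 3)
  | tmp
  | acc
  | cnt
  | out
  deriving DecidableEq, Fintype

section Host

variable (tm : Fin 3 → Turing.FinTM2)

/-- The stacks of the whole machine. -/
abbrev HostK : Type := Stk ⊕ (Σ i, (tm i).K)

/-- Their alphabets. -/
abbrev HostΓ : HostK tm → Type
  | .inl _ => Bool
  | .inr p => (tm p.1).Γ p.2

/-- The control states: those of the program (`Q`) and of the subroutines. -/
abbrev Hostτ (Q : Type) : Type := Q × (∀ i, (tm i).σ)

instance : DecidableEq (HostK tm) := inferInstance

variable {tm}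

/-- The stacks of the whole machine, from those of the program and of the subroutines. -/
def hostStk (S : Stk → List Bool) (O : ∀ i, ∀ k, List ((tm i).Γ k)) :
    ∀ k, List (HostΓ tm k)
  | .inl k => S k
  | .inr p => O p.1 p.2

theorem update_hostStk_inl (S : Stk → List Bool) (O : ∀ i, ∀ k, List ((tm i).Γ k)) (k : Stk)
    (x : List Bool) : Function.update (hostStk S O) (.inl k) x =
      hostStk (Function.update S k x) O := by
  funext k'
  rcases k' with k' | p
  · by_cases h : k' = k
    · subst h; simp [hostStk]
    · simp [hostStk, h]
  · simp [hostStk]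

theorem update_hostStk_inr (S : Stk → List Bool) (O : ∀ i, ∀ k, List ((tm i).Γ k)) (i : Fin 3)
    (k : (tm i).K) (x : List ((tm i).Γ k)) :
    Function.update (hostStk S O) (.inr ⟨i, k⟩) x =
      hostStk S (Function.update O i (Function.update (O i) k x)) := by
  funext k'
  rcases k' with k' | ⟨j, k'⟩
  · simp [hostStk]
  · by_cases h : j = i
    · subst h
      by_cases h' : k' = k
      · subst h'; simp [hostStk]
      · rw [Function.update_of_ne (by simpa using h')]
        simp [hostStk, h']
    · rw [Function.update_of_ne (by intro h'; exact h (congrArg Sigma.fst (Sum.inr.inj h')))]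
      simp [hostStk, h]

variable {Q : Type}

/-- The statement `q` of the subroutine `i` as a statement of the whole machine; halting is replaced
by `next`. -/
def callStmt (i : Fin 3) {Λ : Type} (e : (tm i).Λ → Λ)
    (next : Turing.TM2.Stmt (HostΓ tm) Λ (Option Bool × Hostτ tm Q)) :
    Turing.TM2.Stmt (tm i).Γ (tm i).Λ (tm i).σ →
      Turing.TM2.Stmt (HostΓ tm) Λ (Option Bool × Hostτ tm Q)
  | .push k f q => .push (.inr ⟨i, k⟩) (fun v => f (v.2.2 i)) (callStmt i e next q)
  | .peek k f q => .peek (.inr ⟨i, k⟩)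
      (fun v a => (v.1, v.2.1, Function.update v.2.2 i (f (v.2.2 i) a))) (callStmt i e next q)
  | .pop k f q => .pop (.inr ⟨i, k⟩)
      (fun v a => (v.1, v.2.1, Function.update v.2.2 i (f (v.2.2 i) a))) (callStmt i e next q)
  | .load a q => .load (fun v => (v.1, v.2.1, Function.update v.2.2 i (a (v.2.2 i))))
      (callStmt i e next q)
  | .branch c q q' => .branch (fun v => c (v.2.2 i)) (callStmt i e next q) (callStmt i e next q')
  | .goto f => .goto fun v => e (f (v.2.2 i))
  | .halt => next

/-- Run the subroutine `i`. -/
def Frag.call (i : Fin 3) : Frag (HostΓ tm) (Option Bool × Hostτ tm Q) where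
  L := (tm i).Λ
  fin := (tm i).ΛFin
  entry e _ := .goto fun _ => e (tm i).main
  body e q x := callStmt i e q ((tm i).m x)

/-- By induction on the statement: every instruction of the subroutine acts on its own stacks and
its own component of the control state as in the original machine. The two cases of the result are a
jump, which stays inside the subroutine, and a halt, which passes to `next`. -/
theorem stepAux_callStmt (i : Fin 3) {Λ : Type} (e : (tm i).Λ → Λ)
    (next : Turing.TM2.Stmt (HostΓ tm) Λ (Option Bool × Hostτ tm Q)) (b : Option Bool) (c : Q)
    (w : ∀ i, (tm i).σ) (S : Stk → List Bool) (O : ∀ i, ∀ k, List ((tm i).Γ k))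
    (q : Turing.TM2.Stmt (tm i).Γ (tm i).Λ (tm i).σ) (v : (tm i).σ)
    (s : ∀ k, List ((tm i).Γ k)) :
    Turing.TM2.stepAux (callStmt i e next q) (b, c, Function.update w i v)
        (hostStk S (Function.update O i s)) =
      match Turing.TM2.stepAux q v s with
      | ⟨some x, v', s'⟩ =>
        ⟨some (e x), (b, c, Function.update w i v'), hostStk S (Function.update O i s')⟩
      | ⟨none, v', s'⟩ =>
        Turing.TM2.stepAux next (b, c, Function.update w i v')
          (hostStk S (Function.update O i s')) := by
  have hget : ∀ (s : ∀ k, List ((tm i).Γ k)) (k : (tm i).K),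
      hostStk S (Function.update O i s) (.inr ⟨i, k⟩) = s k := by
    intro s k; simp [hostStk]
  induction q generalizing v s with
  | push k f q ih =>
    simp only [callStmt, Turing.TM2.stepAux, update_hostStk_inr, Function.update_self,
      Function.update_idem, hget]
    exact ih _ _
  | peek k f q ih =>
    simp only [callStmt, Turing.TM2.stepAux, Function.update_self, Function.update_idem, hget]
    exact ih _ _
  | pop k f q ih =>
    simp only [callStmt, Turing.TM2.stepAux, update_hostStk_inr, Function.update_self,
      Function.update_idem, hget]
    exact ih _ _
  | load a q ih =>
    simp only [callStmt, Turing.TM2.stepAux, Function.update_self, Function.update_idem]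
    exact ih _ _
  | branch f q q' ih ih' =>
    simp only [callStmt, Turing.TM2.stepAux, Function.update_self]
    cases f v
    · exact ih' _ _
    · exact ih _ _
  | goto f => simp [callStmt]
  | halt => simp [callStmt]

/-- The effect of a subroutine that halts. -/
theorem Frag.runs_call (i : Fin 3) (c : Q) (w : ∀ i, (tm i).σ) (S : Stk → List Bool)
    (O : ∀ i, ∀ k, List ((tm i).Γ k)) {n : ℕ} {c' : Turing.TM2.Cfg (tm i).Γ (tm i).Λ (tm i).σ}
    (hc' : c'.l = none) (h : StepsIn (tm i).m n ⟨some (tm i).main, w i, O i⟩ c') :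
    (Frag.call (Q := Q) i).Runs n (c, w) (hostStk S O) (c, Function.update w i c'.var)
      (hostStk S (Function.update O i c'.stk)) := by
  intro Λ M (e : (tm i).Λ → Λ) q hM b
  replace hM : ∀ x : (tm i).Λ, M (e x) = callStmt i e q ((tm i).m x) := hM
  refine ⟨b, n, le_rfl, ?_⟩
  change StepsIn M n ⟨some (e (tm i).main), (b, c, w), hostStk S O⟩ _
  -- The induction on the number of steps has to start from an arbitrary configuration of the
  -- subroutine, not only from its initial one.
  suffices H : ∀ (n : ℕ) (x : (tm i).Λ) (v : (tm i).σ) (s : ∀ k, List ((tm i).Γ k)),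
      StepsIn (tm i).m n ⟨some x, v, s⟩ c' →
      StepsIn M n ⟨some (e x), (b, c, Function.update w i v), hostStk S (Function.update O i s)⟩
        (Turing.TM2.stepAux q (b, c, Function.update w i c'.var)
          (hostStk S (Function.update O i c'.stk))) by
    have := H n _ _ _ h
    simpa using this
  intro n
  induction n with
  | zero =>
    intro x v s h
    have : (⟨some x, v, s⟩ : Turing.TM2.Cfg (tm i).Γ (tm i).Λ (tm i).σ) = c' := by
      simpa [StepsIn] using h
    rw [← this] at hc'
    simp at hc'
  | succ n ih =>
    intro x v s h
    have h1 := StepsIn.label (M := M) (e x) (b, c, Function.update w i v)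
      (hostStk S (Function.update O i s))
    rw [hM x, stepAux_callStmt] at h1
    unfold StepsIn at h
    rw [Function.iterate_succ_apply] at h
    change (flip bind (Turing.TM2.step (tm i).m))^[n]
      (some (Turing.TM2.stepAux ((tm i).m x) v s)) = some c' at h
    rw [add_comm]
    refine h1.trans ?_
    rcases hst : Turing.TM2.stepAux ((tm i).m x) v s with ⟨_ | y, v', s'⟩
    · rw [hst] at h
      -- A halted machine has no next configuration: with steps left to make, the iteration would
      -- end in `none` and not in `c'`.
      have hn : n = 0 := by
        by_contra hn
        obtain ⟨m, rfl⟩ := Nat.exists_eq_succ_of_ne_zero hn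
        rw [Function.iterate_succ_apply] at h
        change (flip bind (Turing.TM2.step (tm i).m))^[m] none = some c' at h
        have hnone : ∀ m, (flip bind (Turing.TM2.step (tm i).m))^[m] none = none := by
          intro m; induction m with
          | zero => rfl
          | succ m ih => rw [Function.iterate_succ_apply]; exact ih
        rw [hnone] at h; simp at h
      subst hn
      have : (⟨none, v', s'⟩ : Turing.TM2.Cfg (tm i).Γ (tm i).Λ (tm i).σ) = c' := by
        simpa using h
      subst this
      exact .refl _
    · rw [hst] at h
      exact ih y v' s' h

end Host

end

noncomputable section

/-! ### Polynomially bounded functions -/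

def PolyBdd (g : ℕ → ℕ) : Prop := ∃ p : Polynomial ℕ, ∀ l, g l ≤ p.eval l

theorem PolyBdd.const (c : ℕ) : PolyBdd fun _ => c := ⟨Polynomial.C c, fun l => by simp⟩

theorem PolyBdd.id : PolyBdd fun l => l := ⟨Polynomial.X, fun l => by simp⟩

theorem PolyBdd.add {f g : ℕ → ℕ} (hf : PolyBdd f) (hg : PolyBdd g) :
    PolyBdd fun l => f l + g l := by
  obtain ⟨p, hp⟩ := hf
  obtain ⟨q, hq⟩ := hg
  exact ⟨p + q, fun l => by simpa using add_le_add (hp l) (hq l)⟩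

theorem PolyBdd.mul {f g : ℕ → ℕ} (hf : PolyBdd f) (hg : PolyBdd g) :
    PolyBdd fun l => f l * g l := by
  obtain ⟨p, hp⟩ := hf
  obtain ⟨q, hq⟩ := hg
  exact ⟨p * q, fun l => by simpa using Nat.mul_le_mul (hp l) (hq l)⟩

theorem PolyBdd.mono {f g : ℕ → ℕ} (hf : PolyBdd f) (h : ∀ l, g l ≤ f l) : PolyBdd g := by
  obtain ⟨p, hp⟩ := hf
  exact ⟨p, fun l => (h l).trans (hp l)⟩

/-! ### The growth of stacks -/

/-- The number of pushes in a statement. -/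
def stmtPushes {K : Type} {Γ : K → Type} {Λ σ : Type} : Turing.TM2.Stmt Γ Λ σ → ℕ
  | .push _ _ q => stmtPushes q + 1
  | .peek _ _ q => stmtPushes q
  | .pop _ _ q => stmtPushes q
  | .load _ q => stmtPushes q
  | .branch _ q q' => stmtPushes q + stmtPushes q'
  | .goto _ => 0
  | .halt => 0

theorem length_stepAux_le {K : Type} [DecidableEq K] {Γ : K → Type} {Λ σ : Type}
    (q : Turing.TM2.Stmt Γ Λ σ) (v : σ) (S : ∀ k, List (Γ k)) (k : K) :
    ((Turing.TM2.stepAux q v S).stk k).length ≤ (S k).length + stmtPushes q := by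
  induction q generalizing v S with
  | push k' f q ih =>
    refine (ih _ _).trans ?_
    by_cases h : k = k'
    · subst h; simp [stmtPushes]; try omega
    · simp [h, stmtPushes]; try omega
  | peek k' f q ih => exact ih _ _
  | pop k' f q ih =>
    refine (ih _ _).trans ?_
    by_cases h : k = k'
    · subst h; simp [stmtPushes]; try omega
    · simp [h, stmtPushes]
  | load a q ih => exact ih _ _
  | branch c q q' ih ih' =>
    simp only [Turing.TM2.stepAux, stmtPushes]
    cases c v
    · exact (ih' _ _).trans (by omega)
    · exact (ih _ _).trans (by omega)
  | goto f => simp [stmtPushes]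
  | halt => simp [stmtPushes]

/-- One step runs through one statement, so it lengthens a stack by at most the number of pushes in
that statement. The sum over all labels is a constant that serves for every step of the machine. -/
theorem length_le_of_stepsIn (tm : Turing.FinTM2) (k : tm.K) :
    ∃ c, ∀ n (a b : Turing.TM2.Cfg tm.Γ tm.Λ tm.σ), StepsIn tm.m n a b →
      (b.stk k).length ≤ (a.stk k).length + c * n := by
  have := tm.ΛFin
  refine ⟨∑ x, stmtPushes (tm.m x), fun n => ?_⟩
  induction n with
  | zero =>
    intro a b h
    have : a = b := by simpa [StepsIn] using h
    simp [this]
  | succ n ih =>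
    intro a b h
    unfold StepsIn at h
    rw [Function.iterate_succ_apply'] at h
    obtain ⟨d, hd⟩ : ∃ d, (flip bind (Turing.TM2.step tm.m))^[n] (some a) = some d := by
      cases h' : (flip bind (Turing.TM2.step tm.m))^[n] (some a) with
      | none => rw [h'] at h; simp [flip] at h
      | some d => exact ⟨d, rfl⟩
    rw [hd] at h
    change Turing.TM2.step tm.m d = some b at h
    have h1 := ih a d hd
    rcases d with ⟨_ | x, v, S⟩
    · simp at h
    · simp only [Turing.TM2.step, Option.some.injEq] at h
      subst h
      have h2 := length_stepAux_le (tm.m x) v S k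
      have h3 : stmtPushes (tm.m x) ≤ ∑ x, stmtPushes (tm.m x) :=
        Finset.single_le_sum (f := fun x => stmtPushes (tm.m x)) (fun _ _ => Nat.zero_le _)
          (Finset.mem_univ x)
      simp only at h1
      rw [mul_add]
      omega

/-! ### Strings computable in polynomial time from the security parameter -/

/-- The string `f l` is computable in polynomial time from `1^l`. -/
def PolyStr (f : ℕ → List Bool) : Prop :=
  Nonempty (Turing.TM2ComputableInPolyTime Computability.unaryEncodeNat (id : List Bool → List Bool)
    f)

/-- Polynomial-time computability refers to the output only through its encoding. Hence families of
circuits can be treated as families of bit strings from here on. -/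
theorem efficientCircuits_iff (C : ℕ → Circuit) :
    EfficientCircuits C ↔ PolyStr fun l => (C l).encode :=
  ⟨fun ⟨h⟩ => ⟨⟨h.toTM2ComputableAux, h.time, h.outputsFun⟩⟩,
    fun ⟨h⟩ => ⟨⟨h.toTM2ComputableAux, h.time, h.outputsFun⟩⟩⟩

theorem unaryEncodeNat_eq (n : ℕ) :
    Computability.unaryEncodeNat n = List.replicate n true := by
  induction n with
  | zero => rfl
  | succ n ih => rw [Computability.unaryEncodeNat, ih, List.replicate_succ]

theorem efficientLength_iff (n : ℕ → ℕ) :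
    EfficientLength n ↔ PolyStr fun l => List.replicate (n l) true := by
  simp only [← unaryEncodeNat_eq]
  exact ⟨fun ⟨h⟩ => ⟨⟨h.toTM2ComputableAux, h.time, h.outputsFun⟩⟩,
    fun ⟨h⟩ => ⟨⟨h.toTM2ComputableAux, h.time, h.outputsFun⟩⟩⟩

theorem efficientLength_id : EfficientLength fun l => l :=
  ⟨Turing.idComputableInPolyTime _⟩

theorem initList_stk (tm : Turing.FinTM2) (s : List (tm.Γ tm.k₀)) :
    (Turing.initList tm s).stk = Function.update (fun _ => []) tm.k₀ s := by
  funext k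
  by_cases h : k = tm.k₀
  · subst h; simp [Turing.initList]
  · simp [Turing.initList, h]

theorem haltList_stk (tm : Turing.FinTM2) (s : List (tm.Γ tm.k₁)) :
    (Turing.haltList tm s).stk = Function.update (fun _ => []) tm.k₁ s := by
  funext k
  by_cases h : k = tm.k₁
  · subst h; simp [Turing.haltList]
  · simp [Turing.haltList, h]

/-- A polynomial running time bounds the number of pushes. The bound is needed because a program
that reads this string runs for a time that depends on its length. -/
theorem PolyStr.length_bdd {f : ℕ → List Bool} (hf : PolyStr f) :
    PolyBdd fun l => (f l).length := by
  obtain ⟨h⟩ := hf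
  obtain ⟨c, hc⟩ := length_le_of_stepsIn h.tm h.tm.k₁
  refine PolyBdd.mono (f := fun l => l + c * h.time.eval l)
    (PolyBdd.id.add ((PolyBdd.const c).mul ⟨h.time, fun l => le_rfl⟩)) fun l => ?_
  have H := h.outputsFun l
  have h1 := hc H.steps _ _ H.evals_in_steps
  rw [initList_stk] at h1
  have h3 : ((Turing.haltList h.tm (List.map h.outputAlphabet.invFun (f l))).stk
      h.tm.k₁).length = (f l).length := by
    rw [haltList_stk]; simp
  -- The output stack may be the input stack, which starts with `l` symbols; every other stack
  -- starts empty.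
  have h4 : (Function.update (fun k => ([] : List (h.tm.Γ k))) h.tm.k₀
      (List.map h.inputAlphabet.invFun (Computability.unaryEncodeNat l)) h.tm.k₁).length ≤ l := by
    by_cases hk : h.tm.k₁ = h.tm.k₀
    · rw [hk, Function.update_self, List.length_map, unaryEncodeNat_eq, List.length_replicate]
    · rw [Function.update_of_ne hk]; simp
  have h5 : (Computability.unaryEncodeNat l).length = l := by
    rw [unaryEncodeNat_eq, List.length_replicate]
  have h2 : H.steps ≤ h.time.eval l :=
    H.steps_le_m.trans_eq (congrArg (fun n => h.time.eval n) h5)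
  simp only [id] at h1
  rw [h3] at h1
  calc (f l).length ≤ _ := h1
    _ ≤ l + c * H.steps := by gcongr
    _ ≤ _ := by gcongr

/-! ### Programs -/

section Program

variable {tm : Fin 3 → Turing.FinTM2} {Q : Type}

/-- A fragment whose effect is confined to the control state and the stacks of the program. -/
def Frag.Local (P : Frag (HostΓ tm) (Option Bool × Hostτ tm Q)) (t : ℕ) (c : Q)
    (S : Stk → List Bool) (c' : Q) (S' : Stk → List Bool) : Prop :=
  ∀ w O, P.Runs t (c, w) (hostStk S O) (c', w) (hostStk S' O)

namespace Frag

theorem Local.mono {P : Frag (HostΓ tm) (Option Bool × Hostτ tm Q)} {t t' : ℕ} {c S c' S'}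
    (h : P.Local t c S c' S') (ht : t ≤ t') : P.Local t' c S c' S' :=
  fun w O => (h w O).mono ht

theorem Local.out_eq {P : Frag (HostΓ tm) (Option Bool × Hostτ tm Q)} {t : ℕ} {c S c' S' S''}
    (h : P.Local t c S c' S') (hS : S' = S'') : P.Local t c S c' S'' := hS ▸ h

theorem local_skip (c : Q) (S : Stk → List Bool) :
    (skip : Frag (HostΓ tm) (Option Bool × Hostτ tm Q)).Local 0 c S c S :=
  fun _ _ => runs_skip _ _

theorem Local.seq {f g : Frag (HostΓ tm) (Option Bool × Hostτ tm Q)} {t₁ t₂ : ℕ}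
    {c₀ c₁ c₂ S₀ S₁ S₂} (hf : f.Local t₁ c₀ S₀ c₁ S₁) (hg : g.Local t₂ c₁ S₁ c₂ S₂) :
    (f.seq g).Local (t₁ + t₂) c₀ S₀ c₂ S₂ :=
  fun w O => (hf w O).seq (hg w O)

/-- Push a bit on a stack of the program. -/
def put (k : Stk) (b : Bool) : Frag (HostΓ tm) (Option Bool × Hostτ tm Q) :=
  push (Γ := HostΓ tm) (.inl k) b

theorem local_put (k : Stk) (b : Bool) (c : Q) (S : Stk → List Bool) :
    (put k b : Frag (HostΓ tm) (Option Bool × Hostτ tm Q)).Local 0 c S c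
      (Function.update S k (b :: S k)) := by
  intro w O
  rw [← update_hostStk_inl]
  exact runs_push _ _ _ _

def drop (k : Stk) : Frag (HostΓ tm) (Option Bool × Hostτ tm Q) :=
  pop (Γ := HostΓ tm) (.inl k)

theorem local_drop (k : Stk) (c : Q) (S : Stk → List Bool) :
    (drop k : Frag (HostΓ tm) (Option Bool × Hostτ tm Q)).Local 0 c S c
      (Function.update S k (S k).tail) := by
  intro w O
  rw [← update_hostStk_inl]
  exact runs_pop _ _ _

/-- Change the control state. -/
def ctl (g : Q → Q) : Frag (HostΓ tm) (Option Bool × Hostτ tm Q) := load fun v => (g v.1, v.2)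

theorem local_ctl (g : Q → Q) (c : Q) (S : Stk → List Bool) :
    (ctl g : Frag (HostΓ tm) (Option Bool × Hostτ tm Q)).Local 0 c S (g c) S :=
  fun _ _ => runs_load _ _ _

/-- Run a fragment that depends on a condition on the control state. -/
def cases (d : Q → Bool) (f g : Frag (HostΓ tm) (Option Bool × Hostτ tm Q)) :
    Frag (HostΓ tm) (Option Bool × Hostτ tm Q) := ite (fun v => d v.1) f g

theorem local_cases_true {d : Q → Bool} {f g : Frag (HostΓ tm) (Option Bool × Hostτ tm Q)} {t : ℕ}
    {c S c' S'} (hd : d c = true) (h : f.Local t c S c' S') : (cases d f g).Local t c S c' S' :=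
  fun w O => runs_ite_true hd (h w O)

theorem local_cases_false {d : Q → Bool} {f g : Frag (HostΓ tm) (Option Bool × Hostτ tm Q)} {t : ℕ}
    {c S c' S'} (hd : d c = false) (h : g.Local t c S c' S') : (cases d f g).Local t c S c' S' :=
  fun w O => runs_ite_false hd (h w O)

def isEmpty (k : Stk) (f g : Frag (HostΓ tm) (Option Bool × Hostτ tm Q)) :
    Frag (HostΓ tm) (Option Bool × Hostτ tm Q) := ifEmpty (.inl k) f g

theorem local_isEmpty_nil {k : Stk} {f g : Frag (HostΓ tm) (Option Bool × Hostτ tm Q)} {t : ℕ}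
    {c S c' S'} (hk : S k = []) (h : f.Local t c S c' S') : (isEmpty k f g).Local t c S c' S' :=
  fun w O => runs_ifEmpty_nil hk (h w O)

theorem local_isEmpty_cons {k : Stk} {f g : Frag (HostΓ tm) (Option Bool × Hostτ tm Q)} {t : ℕ}
    {c S c' S'} (hk : S k ≠ []) (h : g.Local t c S c' S') : (isEmpty k f g).Local t c S c' S' :=
  fun w O => runs_ifEmpty_cons hk (h w O)

def each (k : Stk) (B : Bool → Frag (HostΓ tm) (Option Bool × Hostτ tm Q)) :
    Frag (HostΓ tm) (Option Bool × Hostτ tm Q) := forPop (.inl k) id B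

theorem local_each_nil {k : Stk} {B : Bool → Frag (HostΓ tm) (Option Bool × Hostτ tm Q)}
    {c : Q} {S : Stk → List Bool} (hk : S k = []) : (each k B).Local 1 c S c S :=
  fun _ _ => runs_forPop_nil hk

theorem local_each_cons {k : Stk} {B : Bool → Frag (HostΓ tm) (Option Bool × Hostτ tm Q)}
    {c c₁ c' : Q} {S S₁ S' : Stk → List Bool} {b : Bool} {bs : List Bool} {t₁ t₂ : ℕ}
    (hk : S k = b :: bs) (hB : (B b).Local t₁ c (Function.update S k bs) c₁ S₁)
    (h : (each k B).Local t₂ c₁ S₁ c' S') : (each k B).Local (t₁ + t₂ + 1) c S c' S' := by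
  intro w O
  have hB' := hB w O
  rw [← update_hostStk_inl] at hB'
  exact runs_forPop_cons (Γ := HostΓ tm) (k := .inl k) (S := hostStk S O) hk hB' (h w O)

/-- Move the stack `a` on top of the stack `b`, reversing it. -/
def move (a b : Stk) : Frag (HostΓ tm) (Option Bool × Hostτ tm Q) := each a (put b)

theorem local_move {a b : Stk} (hab : a ≠ b) (c : Q) (S : Stk → List Bool) :
    (move a b : Frag (HostΓ tm) (Option Bool × Hostτ tm Q)).Local ((S a).length + 1) c S c
      (Function.update (Function.update S a []) b ((S a).reverse ++ S b)) := by
  generalize hl : S a = l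
  induction l generalizing S with
  | nil =>
    refine ((local_each_nil hl).mono (by simp)).out_eq ?_
    funext k
    simp only [Function.update_apply]
    split_ifs <;> simp_all
  | cons x l ih =>
    have h := ih (Function.update (Function.update S a l) b (x :: S b)) (by simp [hab])
    have hput := local_put (tm := tm) b x c (Function.update S a l)
    rw [Function.update_of_ne hab.symm] at hput
    refine ((local_each_cons hl hput h).mono (by simp)).out_eq ?_
    funext k
    simp only [Function.update_apply]
    split_ifs <;> simp_all

/-- Put a copy of the stack `a` on top of the stack `b`. -/
def copy (a b : Stk) : Frag (HostΓ tm) (Option Bool × Hostτ tm Q) :=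
  (move a .tmp).seq (each .tmp fun x => (put a x).seq (put b x))

theorem local_each_two {a b : Stk} (hab : a ≠ b) (ha : a ≠ .tmp) (hb : b ≠ .tmp) (c : Q)
    (S : Stk → List Bool) :
    (each .tmp fun x => (put a x).seq (put b x) :
      Frag (HostΓ tm) (Option Bool × Hostτ tm Q)).Local ((S .tmp).length + 1) c S c
      (Function.update (Function.update (Function.update S .tmp []) a ((S .tmp).reverse ++ S a)) b
        ((S .tmp).reverse ++ S b)) := by
  generalize hl : S .tmp = l
  induction l generalizing S with
  | nil =>
    refine ((local_each_nil hl).mono (by simp)).out_eq ?_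
    funext k
    simp only [Function.update_apply]
    split_ifs <;> simp_all
  | cons x l ih =>
    have h := ih (Function.update (Function.update (Function.update S .tmp l) a (x :: S a)) b
      (x :: S b)) (by simp [ha.symm, hb.symm])
    have hput := (local_put (tm := tm) a x c (Function.update S .tmp l)).seq (local_put b x c _)
    rw [Function.update_of_ne ha, Function.update_of_ne hab.symm, Function.update_of_ne hb] at hput
    refine ((local_each_cons hl hput h).mono (by simp)).out_eq ?_
    funext k
    simp only [Function.update_apply]
    split_ifs <;> simp_all

theorem local_copy {a b : Stk} (hab : a ≠ b) (ha : a ≠ .tmp) (hb : b ≠ .tmp) (c : Q)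
    (S : Stk → List Bool) (ht : S .tmp = []) :
    (copy a b : Frag (HostΓ tm) (Option Bool × Hostτ tm Q)).Local (2 * (S a).length + 2) c S c
      (Function.update S b (S a ++ S b)) := by
  have h1 := local_move (tm := tm) ha c S
  have h2 := local_each_two (tm := tm) hab ha hb c
    (Function.update (Function.update S a []) .tmp ((S a).reverse ++ S .tmp))
  refine ((h1.seq h2).mono (by simp [ht]; omega)).out_eq ?_
  funext k
  simp only [Function.update_apply]
  split_ifs <;> simp_all

end Frag
end Program
end

/-! ### Feeding and reading subroutines, and the complete machine. -/

noncomputable section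

section Program

variable {tm : Fin 3 → Turing.FinTM2} {Q : Type}

namespace Frag

/-- Copy the input to a stack of the subroutine `i`, given an encoding of bits in its alphabet. -/
def feed (i : Fin 3) (k : (tm i).K) (enc : Bool → (tm i).Γ k) :
    Frag (HostΓ tm) (Option Bool × Hostτ tm Q) :=
  -- The detour through `.tmp` keeps a copy of the input, which all three subroutines have to read.
  (move .inp .tmp).seq (each .tmp fun x =>
    (put .inp x).seq (push (Γ := HostΓ tm) (.inr ⟨i, k⟩) (enc x)))

theorem runs_feed_loop (i : Fin 3) (k : (tm i).K) (enc : Bool → (tm i).Γ k) (w : Hostτ tm Q)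
    (S : Stk → List Bool) (O : ∀ i, ∀ k, List ((tm i).Γ k)) :
    (each .tmp fun x => (put .inp x).seq (push (Γ := HostΓ tm) (.inr ⟨i, k⟩) (enc x)) :
      Frag (HostΓ tm) (Option Bool × Hostτ tm Q)).Runs ((S .tmp).length + 1) w (hostStk S O) w
      (hostStk (Function.update (Function.update S .tmp []) .inp ((S .tmp).reverse ++ S .inp))
        (Function.update O i (Function.update (O i) k
          (((S .tmp).reverse).map enc ++ O i k)))) := by
  generalize hl : S .tmp = l
  induction l generalizing S O with
  | nil =>
    have h1 : Function.update (Function.update S .tmp []) .inp ([].reverse ++ S .inp) = S := by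
      funext k
      simp only [Function.update_apply]
      split_ifs <;> simp_all
    have h2 : Function.update O i (Function.update (O i) k ((([] : List Bool).reverse).map enc ++ O i k)) = O := by
      simp
    rw [h1, h2]
    exact (runs_forPop_nil (Γ := HostΓ tm) (k := .inl .tmp) (S := hostStk S O) hl).mono (by simp)
  | cons x l ih =>
    have h := ih (Function.update (Function.update S .tmp l) .inp (x :: S .inp))
      (Function.update O i (Function.update (O i) k (enc x :: O i k))) (by simp)
    have h1 : (put .inp x).Runs 0 w (Function.update (hostStk S O) (.inl .tmp) l) w
        (hostStk (Function.update (Function.update S .tmp l) .inp (x :: S .inp)) O) := by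
      have h1 := local_put (tm := tm) (Q := Q) .inp x w.1 (Function.update S .tmp l) w.2 O
      rw [Function.update_of_ne (by simp)] at h1
      rwa [update_hostStk_inl]
    have h2 := runs_push (Γ := HostΓ tm) (.inr ⟨i, k⟩) (enc x) w
      (hostStk (Function.update (Function.update S .tmp l) .inp (x :: S .inp)) O)
    rw [update_hostStk_inr] at h2
    have h3 := h1.seq h2
    have h4 := runs_forPop_cons (Γ := HostΓ tm) (k := .inl .tmp) (S := hostStk S O) (conv := id)
      (c := x) (cs := l) hl h3 h
    refine (h4.mono (by simp)).out_eq ?_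
    congr 1
    · funext k
      simp only [Function.update_apply]
      split_ifs <;> simp_all
    · simp

theorem runs_feed (i : Fin 3) (k : (tm i).K) (enc : Bool → (tm i).Γ k) (w : Hostτ tm Q)
    (S : Stk → List Bool) (O : ∀ i, ∀ k, List ((tm i).Γ k)) (ht : S .tmp = []) :
    (feed i k enc : Frag (HostΓ tm) (Option Bool × Hostτ tm Q)).Runs (2 * (S .inp).length + 2) w
      (hostStk S O) w
      (hostStk S (Function.update O i (Function.update (O i) k ((S .inp).map enc ++ O i k)))) := by
  have h1 := local_move (tm := tm) (Q := Q) (a := .inp) (b := .tmp) (by simp) w.1 S w.2 O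
  have h2 := runs_feed_loop i k enc w
    (Function.update (Function.update S .inp []) .tmp ((S .inp).reverse ++ S .tmp)) O
  refine ((h1.seq h2).mono (by simp [ht]; omega)).out_eq ?_
  congr 1
  · funext k
    simp only [Function.update_apply]
    split_ifs <;> simp_all
  · simp [ht]

/-- Move a stack of a subroutine to a stack of the program, reversing it. -/
def fetch (i : Fin 3) (k : (tm i).K) (dec : (tm i).Γ k → Bool) (b : Stk) :
    Frag (HostΓ tm) (Option Bool × Hostτ tm Q) :=
  forPop (Γ := HostΓ tm) (.inr ⟨i, k⟩) dec (put b)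

theorem runs_fetch (i : Fin 3) (k : (tm i).K) (dec : (tm i).Γ k → Bool) (b : Stk) (w : Hostτ tm Q)
    (S : Stk → List Bool) (O : ∀ i, ∀ k, List ((tm i).Γ k)) :
    (fetch i k dec b : Frag (HostΓ tm) (Option Bool × Hostτ tm Q)).Runs ((O i k).length + 1) w
      (hostStk S O) w
      (hostStk (Function.update S b (((O i k).map dec).reverse ++ S b))
        (Function.update O i (Function.update (O i) k []))) := by
  generalize hl : O i k = l
  induction l generalizing S O with
  | nil =>
    have h2 : Function.update O i (Function.update (O i) k []) = O := by
      rw [← hl]; simp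
    rw [h2]
    simp only [List.map_nil, List.reverse_nil, List.nil_append, Function.update_eq_self]
    exact (runs_forPop_nil (Γ := HostΓ tm) (k := .inr ⟨i, k⟩) (S := hostStk S O) hl).mono (by simp)
  | cons x l ih =>
    have h := ih (Function.update S b (dec x :: S b))
      (Function.update O i (Function.update (O i) k l)) (by simp)
    have h1 := local_put (tm := tm) (Q := Q) b (dec x) w.1 S w.2
      (Function.update O i (Function.update (O i) k l))
    rw [← update_hostStk_inr] at h1
    have h4 := runs_forPop_cons (Γ := HostΓ tm) (k := .inr ⟨i, k⟩) (S := hostStk S O) (conv := dec)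
      (c := x) (cs := l) hl h1 h
    refine (h4.mono (by simp)).out_eq ?_
    congr 1
    · simp
    · simp

end Frag

/-- The stacks of a program that contain the input and the strings `a`. -/
def argStk (n : ℕ) (a : Fin 3 → List Bool) : Stk → List Bool
  | .inp => List.replicate n true
  | .arg i => a i
  | _ => []

/-- The stacks of a program that contain the output only. -/
def outStk (x : List Bool) : Stk → List Bool
  | .out => x
  | _ => []

end Program

/-- Run the subroutine `i` on the input and move its result to the stack `arg i`. -/
def Frag.loadArg {Q : Type} (h : ∀ _ : Fin 3, Turing.TM2ComputableAux Bool Bool) (i : Fin 3) :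
    Frag (HostΓ fun i => (h i).tm) (Option Bool × Hostτ (fun i => (h i).tm) Q) :=
  ((Frag.feed (tm := fun i => (h i).tm) i (h i).tm.k₀ (h i).inputAlphabet.symm).seq
    (Frag.call i)).seq
    -- Both transfers reverse the string, so the second one restores the order.
    ((Frag.fetch (tm := fun i => (h i).tm) i (h i).tm.k₁ (h i).outputAlphabet .tmp).seq
      (Frag.move .tmp (.arg i)))

theorem Frag.runs_loadArg {Q : Type} (h : ∀ _ : Fin 3, Turing.TM2ComputableAux Bool Bool)
    (i : Fin 3) (n t : ℕ) (y : List Bool) (a : Fin 3 → List Bool) (ha : a i = []) (c : Q)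
    (H : Turing.TM2OutputsInTime (h i).tm
      ((Computability.unaryEncodeNat n).map (h i).inputAlphabet.invFun)
      (some (y.map (h i).outputAlphabet.invFun)) t) :
    (Frag.loadArg (Q := Q) h i).Runs (2 * n + t + 2 * y.length + 4)
      (c, fun i => (h i).tm.initialState) (hostStk (argStk n a) fun _ _ => [])
      (c, fun i => (h i).tm.initialState)
      (hostStk (argStk n (Function.update a i y)) fun _ _ => []) := by
  set w : ∀ i, (h i).tm.σ := fun i => (h i).tm.initialState with hw
  set O : ∀ i, ∀ k, List ((h i).tm.Γ k) := fun _ _ => [] with hO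
  have h1 := Frag.runs_feed (tm := fun i => (h i).tm) (Q := Q) i (h i).tm.k₀
    (h i).inputAlphabet.symm (c, w) (argStk n a) O rfl
  set O₁ : ∀ i, ∀ k, List ((h i).tm.Γ k) := Function.update O i (Function.update (O i)
    (h i).tm.k₀ ((argStk n a .inp).map (h i).inputAlphabet.symm ++ O i (h i).tm.k₀)) with hO₁
  have hinit : Turing.initList (h i).tm
      ((Computability.unaryEncodeNat n).map (h i).inputAlphabet.invFun) =
      ⟨some (h i).tm.main, w i, O₁ i⟩ := by
    have := initList_stk (h i).tm
      ((Computability.unaryEncodeNat n).map (h i).inputAlphabet.invFun)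
    have h' : O₁ i = (Turing.initList (h i).tm
        ((Computability.unaryEncodeNat n).map (h i).inputAlphabet.invFun)).stk := by
      rw [this, hO₁, Function.update_self, unaryEncodeNat_eq]
      simp [hO, argStk]
    rw [h']
    rfl
  have h2 := Frag.runs_call (tm := fun i => (h i).tm) (Q := Q) i c w (argStk n a) O₁
    (c' := Turing.haltList (h i).tm (y.map (h i).outputAlphabet.invFun)) rfl
    (by rw [← hinit]; exact H.evals_in_steps)
  -- A computation in the sense of `TM2OutputsInTime` ends in the initial state with all stacks but
  -- the output stack empty. So the control state is unchanged, and fetching the output leaves the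
  -- subroutine as it was.
  have hv : Function.update w i (Turing.haltList (h i).tm
      (y.map (h i).outputAlphabet.invFun)).var = w := Function.update_eq_self i w
  rw [hv, haltList_stk, hO₁, Function.update_idem] at h2
  set O₂ : ∀ i, ∀ k, List ((h i).tm.Γ k) := Function.update O i (Function.update (fun _ => [])
    (h i).tm.k₁ (y.map (h i).outputAlphabet.invFun)) with hO₂
  have h3 := Frag.runs_fetch (tm := fun i => (h i).tm) (Q := Q) i (h i).tm.k₁
    (h i).outputAlphabet .tmp (c, w) (argStk n a) O₂
  have hy : O₂ i (h i).tm.k₁ = y.map (h i).outputAlphabet.invFun := by simp [hO₂]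
  have hO₃ : Function.update O₂ i (Function.update (O₂ i) (h i).tm.k₁ []) = O := by
    rw [hO₂]; simp [hO]
  rw [hO₃, hy] at h3
  have hyy : (y.map (h i).outputAlphabet.invFun).map (h i).outputAlphabet = y := by
    rw [List.map_map]
    conv_rhs => rw [← List.map_id y]
    congr 1
    funext x
    exact (h i).outputAlphabet.apply_symm_apply x
  rw [hyy] at h3
  have h4 := Frag.local_move (tm := fun i => (h i).tm) (Q := Q) (a := .tmp) (b := .arg i)
    (by simp) c (Function.update (argStk n a) .tmp (y.reverse ++ argStk n a .tmp)) w O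
  have hn : (argStk n a .inp).length = n := by simp [argStk]
  refine (((h1.seq h2).seq (h3.seq h4)).mono ?_).out_eq ?_
  · have := H.steps_le_m
    simp only [hn, Function.update_self, List.length_map, List.length_append, List.length_reverse]
    simp only [argStk, List.length_nil]
    omega
  · congr 1
    funext k
    cases k with
    | arg j =>
      by_cases hj : j = i
      · subst hj; simp [argStk, ha]
      · have : Stk.arg j ≠ Stk.arg i := by simpa using hj
        simp [argStk, hj]
    | _ => simp [argStk]

/-- The whole machine. -/
def hostMachine {Q : Type} [Fintype Q] (tm : Fin 3 → Turing.FinTM2)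
    (R : Frag (HostΓ tm) (Option Bool × Hostτ tm Q)) (c : Q) : Turing.FinTM2 :=
  have := R.fin
  have : ∀ i, Fintype (tm i).K := fun i => (tm i).kFin
  have : ∀ i, Fintype (tm i).σ := fun i => (tm i).σFin
  { K := HostK tm
    k₀ := .inl .inp
    k₁ := .inl .out
    Γ := HostΓ tm
    Λ := Unit ⊕ R.L
    main := .inl ()
    σ := Option Bool × Hostτ tm Q
    initialState := (none, c, fun i => (tm i).initialState)
    Γk₀Fin := inferInstanceAs (Fintype Bool)
    m := fun
      -- The scratch component is reset before halting, because `haltList` demands the initial state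
      -- of the machine. For the same reason programs have to end in the control state `c` in which
      -- they start.
      | .inl _ => R.entry Sum.inr (.load (fun v => (none, v.2)) .halt)
      | .inr x => R.body Sum.inr (.load (fun v => (none, v.2)) .halt) x }

theorem outputs_hostMachine {Q : Type} [Fintype Q] (tm : Fin 3 → Turing.FinTM2)
    (R : Frag (HostΓ tm) (Option Bool × Hostτ tm Q)) (c : Q) (l t : ℕ) (y : List Bool)
    (h : R.Runs t (c, fun i => (tm i).initialState)
      (hostStk (argStk l fun _ => []) fun _ _ => []) (c, fun i => (tm i).initialState)
      (hostStk (outStk y) fun _ _ => [])) :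
    Nonempty (Turing.TM2OutputsInTime (hostMachine tm R c)
      ((Computability.unaryEncodeNat l).map (Equiv.refl Bool).invFun)
      (some (y.map (Equiv.refl Bool).invFun)) (1 + t)) := by
  obtain ⟨b', n, hn, hs⟩ := h (Unit ⊕ R.L) (hostMachine tm R c).m Sum.inr
    (.load (fun v => (none, v.2)) .halt) (fun x => rfl) none
  have h1 := (StepsIn.label (M := (hostMachine tm R c).m) (Sum.inl ())
    (none, c, fun i => (tm i).initialState)
    (hostStk (argStk l fun _ => []) fun _ _ => [])).trans hs
  refine ⟨⟨⟨1 + n, ?_⟩, Nat.add_le_add_left hn 1⟩⟩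
  have e1 : Turing.initList (hostMachine tm R c)
      ((Computability.unaryEncodeNat l).map (Equiv.refl Bool).invFun) =
      ⟨some (Sum.inl ()), (none, c, fun i => (tm i).initialState),
        hostStk (argStk l fun _ => []) fun _ _ => []⟩ := by
    have h' : hostStk (argStk l fun _ => []) (fun _ _ => []) =
        (Turing.initList (hostMachine tm R c)
          ((Computability.unaryEncodeNat l).map (Equiv.refl Bool).invFun)).stk := by
      rw [initList_stk]
      funext k
      rcases k with k | p
      · cases k <;> simp [hostStk, argStk, hostMachine, unaryEncodeNat_eq]
      · simp [hostStk, hostMachine]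
    rw [h']; rfl
  have e2 : Turing.haltList (hostMachine tm R c) (y.map (Equiv.refl Bool).invFun) =
      ⟨none, (none, c, fun i => (tm i).initialState), hostStk (outStk y) fun _ _ => []⟩ := by
    have h' : hostStk (outStk y) (fun _ _ => []) = (Turing.haltList (hostMachine tm R c)
        (y.map (Equiv.refl Bool).invFun)).stk := by
      rw [haltList_stk]
      funext k
      rcases k with k | p
      · cases k <;> simp [hostStk, outStk, hostMachine]
      · simp [hostStk, hostMachine]
    rw [h']; rfl
  change (flip bind (Turing.TM2.step (hostMachine tm R c).m))^[1 + n] (some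
    (Turing.initList (hostMachine tm R c)
      ((Computability.unaryEncodeNat l).map (Equiv.refl Bool).invFun))) =
    some (Turing.haltList (hostMachine tm R c) (y.map (Equiv.refl Bool).invFun))
  rw [e1, e2]
  exact h1

/-- Programs with polynomial running time compute polynomial-time functions. -/
theorem PolyStr.of_program {Q : Type} [Fintype Q] (c : Q) {f : Fin 3 → ℕ → List Bool}
    (hf : ∀ i, PolyStr (f i)) (F : ℕ → List Bool)
    (P : ∀ tm : Fin 3 → Turing.FinTM2, Frag (HostΓ tm) (Option Bool × Hostτ tm Q)) (t : ℕ → ℕ)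
    (ht : PolyBdd t)
    (hP : ∀ tm l, (P tm).Local (t l) c (argStk l fun i => f i l) c (outStk (F l))) :
    PolyStr F := by
  let h := fun i => (hf i).some
  let ha : ∀ _ : Fin 3, Turing.TM2ComputableAux Bool Bool := fun i => (h i).toTM2ComputableAux
  let tm : Fin 3 → Turing.FinTM2 := fun i => (ha i).tm
  let R : Frag (HostΓ tm) (Option Bool × Hostτ tm Q) :=
    ((Frag.loadArg ha 0).seq ((Frag.loadArg ha 1).seq (Frag.loadArg ha 2))).seq (P tm)
  let b : Fin 3 → ℕ → ℕ := fun i l => 2 * l + (h i).time.eval l + 2 * (f i l).length + 4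
  have hb : ∀ i, PolyBdd (b i) := fun i =>
    ((((PolyBdd.const 2).mul PolyBdd.id).add ⟨(h i).time, fun _ => le_rfl⟩).add
      ((PolyBdd.const 2).mul (hf i).length_bdd)).add (PolyBdd.const 4)
  let w : ∀ i, (tm i).σ := fun i => (tm i).initialState
  have hR : ∀ l, R.Runs (b 0 l + (b 1 l + b 2 l) + t l) (c, w)
      (hostStk (argStk l fun _ => []) fun _ _ => []) (c, w)
      (hostStk (outStk (F l)) fun _ _ => []) := by
    intro l
    have hl : (Computability.unaryEncodeNat l).length = l := by simp [unaryEncodeNat_eq]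
    have H : ∀ i, Turing.TM2OutputsInTime (ha i).tm
        ((Computability.unaryEncodeNat l).map (ha i).inputAlphabet.invFun)
        (some ((f i l).map (ha i).outputAlphabet.invFun)) ((h i).time.eval l) := fun i =>
      ⟨((h i).outputsFun l).toEvalsTo, ((h i).outputsFun l).steps_le_m.trans_eq
        (congrArg (fun n => (h i).time.eval n) hl)⟩
    have h0 := Frag.runs_loadArg (Q := Q) ha 0 l _ _ (fun _ => []) rfl c (H 0)
    have h1 := Frag.runs_loadArg (Q := Q) ha 1 l _ _ (Function.update (fun _ => []) 0 (f 0 l))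
      (by simp) c (H 1)
    have h2 := Frag.runs_loadArg (Q := Q) ha 2 l _ _
      (Function.update (Function.update (fun _ => []) 0 (f 0 l)) 1 (f 1 l)) (by simp) c (H 2)
    have h3 := hP tm l w fun _ _ => []
    have hargs : Function.update (Function.update (Function.update (fun _ => []) 0 (f 0 l)) 1
        (f 1 l)) 2 (f 2 l) = fun i => f i l := by
      funext i
      fin_cases i <;> simp
    rw [hargs] at h2
    exact (h0.seq (h1.seq h2)).seq h3
  obtain ⟨p, hp⟩ := (((hb 0).add ((hb 1).add (hb 2))).add ht).add (PolyBdd.const 1)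
  refine ⟨⟨⟨hostMachine tm R c, Equiv.refl Bool, Equiv.refl Bool⟩, p, fun l => ?_⟩⟩
  have hlen : (Computability.unaryEncodeNat l).length = l := by simp [unaryEncodeNat_eq]
  have H := (outputs_hostMachine tm R c l _ _ (hR l)).some
  refine ⟨H.toEvalsTo, H.steps_le_m.trans ?_⟩
  have := hp l
  simp only at this
  rw [hlen]
  omega

end

noncomputable section

/-! ### Programs for strings -/

section Program

variable {tm : Fin 3 → Turing.FinTM2} {Q : Type}

namespace Frag

/-- A loop over a stack, described by a function `next` on abstract states. -/
theorem local_each_fold {σ : Type} {k : Stk}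
    {B : Bool → Frag (HostΓ tm) (Option Bool × Hostτ tm Q)} {t : ℕ} (ctl : σ → Q)
    (St : σ → List Bool → Stk → List Bool) (next : σ → Bool → σ) (inv : σ → List Bool → Prop)
    (hnext : ∀ s b x, inv s (b :: x) → inv (next s b) x)
    (hk : ∀ s x, St s x k = x) (hpop : ∀ s b x, Function.update (St s (b :: x)) k x = St s x)
    (hB : ∀ s b x, inv s (b :: x) →
      (B b).Local t (ctl s) (St s x) (ctl (next s b)) (St (next s b) x))
    (x : List Bool) (s : σ) (hs : inv s x) :
    (each k B).Local (x.length * (t + 1) + 1) (ctl s) (St s x) (ctl (x.foldl next s))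
      (St (x.foldl next s) []) := by
  induction x generalizing s with
  | nil => exact (local_each_nil (hk s [])).mono (by simp)
  | cons b x ih =>
    have h := hB s b x hs
    rw [← hpop s b x] at h
    refine (local_each_cons (hk s (b :: x)) h (ih (next s b) (hnext s b x hs))).mono ?_
    simp only [List.length_cons]
    ring_nf
    omega

/-- Empty a stack. -/
def drain (k : Stk) : Frag (HostΓ tm) (Option Bool × Hostτ tm Q) := each k fun _ => skip

theorem local_drain (k : Stk) (c : Q) (S : Stk → List Bool) :
    (drain k : Frag (HostΓ tm) (Option Bool × Hostτ tm Q)).Local ((S k).length + 1) c S c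
      (Function.update S k []) := by
  have h := local_each_fold (tm := tm) (k := k) (B := fun _ => skip) (t := 0) (σ := Unit)
    (fun _ => c) (fun _ x => Function.update S k x) (fun s _ => s) (fun _ _ => True)
    (fun _ _ _ _ => trivial) (by simp) (by simp) (fun s b x _ => local_skip _ _) (S k) () trivial
  unfold drain
  simpa using h

end Frag
end Program

open Frag

theorem polyStr_unary_id : PolyStr fun l => List.replicate l true :=
  (efficientLength_iff _).1 efficientLength_id

/-- The two idle subroutines compute the input in unary. Their results and the input itself are
drained, since at the end all stacks but the output have to be empty. -/
theorem PolyStr.of_program_one {Q : Type} [Fintype Q] (c : Q) {f : ℕ → List Bool}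
    (hf : PolyStr f) (F : ℕ → List Bool)
    (P : ∀ tm : Fin 3 → Turing.FinTM2, Frag (HostΓ tm) (Option Bool × Hostτ tm Q)) (t : ℕ → ℕ)
    (ht : PolyBdd t)
    (hP : ∀ tm l, (P tm).Local (t l) c
      (Function.update (fun _ => []) (.arg 0) (f l)) c (outStk (F l))) :
    PolyStr F := by
  refine PolyStr.of_program (f := ![f, fun l => List.replicate l true,
    fun l => List.replicate l true]) c ?_ F
    (fun tm => (drain .inp).seq ((drain (.arg 1)).seq ((drain (.arg 2)).seq (P tm))))
    (fun l => (l + 1) + ((l + 1) + ((l + 1) + t l))) ?_ fun tm l => ?_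
  · intro i
    fin_cases i
    exacts [hf, polyStr_unary_id, polyStr_unary_id]
  · have h1 := PolyBdd.id.add (PolyBdd.const 1)
    exact h1.add (h1.add (h1.add ht))
  · set S := argStk l fun i => (![f, fun l => List.replicate l true,
      fun l => List.replicate l true] : Fin 3 → ℕ → List Bool) i l with hS
    have h1 := local_drain (tm := tm) .inp c S
    have h2 := local_drain (tm := tm) (.arg 1) c (Function.update S .inp [])
    have h3 := local_drain (tm := tm) (.arg 2) c
      (Function.update (Function.update S .inp []) (.arg 1) [])
    have e : Function.update (Function.update (Function.update S .inp []) (.arg 1) []) (.arg 2) [] =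
        Function.update (fun _ => []) (.arg 0) (f l) := by
      funext k
      rcases k with _ | i | _ | _ | _ | _
      on_goal 2 => fin_cases i
      all_goals simp [hS, argStk]
    rw [e] at h3
    refine (h1.seq (h2.seq (h3.seq (hP tm l)))).mono ?_
    simp [hS, argStk]

theorem PolyStr.append {f g : ℕ → List Bool} (hf : PolyStr f) (hg : PolyStr g) :
    PolyStr fun l => f l ++ g l := by
  refine PolyStr.of_program (Q := Unit) (f := ![f, g, fun l => List.replicate l true]) () ?_ _
    -- Each argument is moved twice because a single move reverses it; the second argument goes
    -- first because the output is a stack.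
    (fun tm => (drain .inp).seq ((drain (.arg 2)).seq ((move (.arg 1) .tmp).seq
      ((move .tmp .out).seq ((move (.arg 0) .tmp).seq (move .tmp .out))))))
    (fun l => (l + 1) + ((l + 1) + (((g l).length + 1) + (((g l).length + 1) +
      (((f l).length + 1) + ((f l).length + 1)))))) ?_ fun tm l => ?_
  · intro i
    fin_cases i
    exacts [hf, hg, polyStr_unary_id]
  · have h1 := PolyBdd.id.add (PolyBdd.const 1)
    have h2 := hf.length_bdd.add (PolyBdd.const 1)
    have h3 := hg.length_bdd.add (PolyBdd.const 1)
    exact h1.add (h1.add (h3.add (h3.add (h2.add h2))))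
  · set S := argStk l fun i => (![f, g, fun l => List.replicate l true] :
      Fin 3 → ℕ → List Bool) i l with hS
    have h := (local_drain (tm := tm) .inp () S).seq ((local_drain (.arg 2) () _).seq
      ((local_move (a := .arg 1) (b := .tmp) (by simp) () _).seq
      ((local_move (a := .tmp) (b := .out) (by simp) () _).seq
      ((local_move (a := .arg 0) (b := .tmp) (by simp) () _).seq
      (local_move (a := .tmp) (b := .out) (by simp) () _)))))
    refine (h.mono ?_).out_eq ?_
    · simp [hS, argStk]
    · funext k
      rcases k with _ | i | _ | _ | _ | _
      on_goal 2 => fin_cases i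
      all_goals simp [hS, argStk, outStk]

/-- Push a word. -/
def Frag.word {tm : Fin 3 → Turing.FinTM2} {Q : Type} (k : Stk) :
    List Bool → Frag (HostΓ tm) (Option Bool × Hostτ tm Q)
  | [] => skip
  | b :: x => (Frag.word k x).seq (put k b)

theorem Frag.local_word {tm : Fin 3 → Turing.FinTM2} {Q : Type} (k : Stk) (x : List Bool) (c : Q)
    (S : Stk → List Bool) :
    (word k x : Frag (HostΓ tm) (Option Bool × Hostτ tm Q)).Local 0 c S c
      (Function.update S k (x ++ S k)) := by
  induction x with
  | nil => simpa using! local_skip c S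
  | cons b x ih =>
    refine (ih.seq (local_put _ _ _ _)).out_eq ?_
    simp

theorem polyStr_const (x : List Bool) : PolyStr fun _ => x := by
  refine PolyStr.of_program_one (Q := Unit) () polyStr_unary_id _
    (fun tm => (drain (.arg 0)).seq (word .out x)) (fun l => l + 1)
    (PolyBdd.id.add (PolyBdd.const 1)) fun tm l => ?_
  refine (((local_drain (.arg 0) () _).seq (local_word _ _ _ _)).mono ?_).out_eq ?_
  · simp
  · funext k
    rcases k with _ | i | _ | _ | _ | _ <;> simp [outStk]

/-- The part of a string after its first `0`. -/
def afterZero : List Bool → List Bool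
  | [] => []
  | true :: x => afterZero x
  | false :: x => x

/-- The description of a circuit starts with the number of ancillas in unary, terminated by a zero;
this reads off that number, and `PolyStr.afterZero` reads off the gates. The control bit tells
whether the zero has been seen and is reset at the end. -/
theorem PolyStr.takeOnes {f : ℕ → List Bool} (hf : PolyStr f) :
    PolyStr fun l => (f l).takeWhile id := by
  refine PolyStr.of_program_one (Q := Bool) false hf _
    (fun tm => (each (.arg 0) fun b => cases id skip
      (match b with | true => put .tmp true | false => ctl fun _ => true)).seq
      ((move .tmp .out).seq (ctl fun _ => false)))
    (fun l => ((f l).length * 1 + 1) + (((f l).length + 1) + 0)) ?_ fun tm l => ?_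
  · exact ((hf.length_bdd.mul (PolyBdd.const 1)).add (PolyBdd.const 1)).add
      ((hf.length_bdd.add (PolyBdd.const 1)).add (PolyBdd.const 0))
  · let St : Bool × List Bool → List Bool → Stk → List Bool := fun s x =>
      Function.update (Function.update (fun _ => []) (.arg 0) x) .tmp s.2
    let next : Bool × List Bool → Bool → Bool × List Bool := fun s b =>
      if s.1 then s else if b then (s.1, true :: s.2) else (true, s.2)
    have h := local_each_fold (tm := tm) (k := .arg 0) (t := 0) (Q := Bool) (σ := Bool × List Bool)
      (B := fun b => cases id skip
        (match b with | true => put .tmp true | false => ctl fun _ => true))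
      Prod.fst St next (fun _ _ => True) (fun _ _ _ _ => trivial) (by simp [St])
      (by
        intro s b x; funext k
        simp only [St, Function.update_apply]
        split_ifs <;> simp_all)
      (by
        rintro ⟨q, y⟩ b x -
        cases q with
        | true => exact local_cases_true rfl (local_skip _ _)
        | false =>
          refine local_cases_false rfl ?_
          cases b with
          | true =>
            refine (local_put _ _ _ _).out_eq ?_
            simp [St, next]
          | false => exact local_ctl _ _ _)
      (f l) (false, []) trivial
    have hfold : ∀ (x : List Bool) (y : List Bool),
        (x.foldl next (false, y)).2 = (x.takeWhile id).reverse ++ y := by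
      have htrue : ∀ (x : List Bool) (y : List Bool), x.foldl next (true, y) = (true, y) := by
        intro x y
        induction x with
        | nil => rfl
        | cons b x ih => exact ih
      intro x
      induction x with
      | nil => intro y; rfl
      | cons b x ih =>
        intro y
        cases b with
        | true =>
          have := ih (true :: y)
          simpa [next] using this
        | false => simp [next, htrue]
    have e0 : St (false, []) (f l) = Function.update (fun _ => []) (.arg 0) (f l) := by
      funext k
      simp only [St, Function.update_apply]
      split_ifs <;> simp_all
    rw [e0] at h
    refine ((h.seq ((local_move (a := .tmp) (b := .out) (by simp) _ _).seq
      (local_ctl (fun _ => false) _ _))).mono ?_).out_eq ?_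
    · simp only [St, Function.update_self, hfold]
      have := (List.takeWhile_prefix (p := id) (l := f l)).length_le
      simp
      omega
    · funext k
      rcases k with _ | i | _ | _ | _ | _ <;> simp [outStk, St, hfold]

theorem PolyStr.afterZero {f : ℕ → List Bool} (hf : PolyStr f) :
    PolyStr fun l => afterZero (f l) := by
  refine PolyStr.of_program_one (Q := Bool) false hf _
    (fun tm => (each (.arg 0) fun b => cases id (put .tmp b)
      (match b with | true => skip | false => ctl fun _ => true)).seq
      ((move .tmp .out).seq (ctl fun _ => false)))
    (fun l => ((f l).length * 1 + 1) + (((f l).length + 1) + 0)) ?_ fun tm l => ?_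
  · exact ((hf.length_bdd.mul (PolyBdd.const 1)).add (PolyBdd.const 1)).add
      ((hf.length_bdd.add (PolyBdd.const 1)).add (PolyBdd.const 0))
  · let St : Bool × List Bool → List Bool → Stk → List Bool := fun s x =>
      Function.update (Function.update (fun _ => []) (.arg 0) x) .tmp s.2
    let next : Bool × List Bool → Bool → Bool × List Bool := fun s b =>
      if s.1 then (true, b :: s.2) else if b then s else (true, s.2)
    have h := local_each_fold (tm := tm) (k := .arg 0) (t := 0) (Q := Bool) (σ := Bool × List Bool)
      (B := fun b => cases id (put .tmp b)
        (match b with | true => skip | false => ctl fun _ => true))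
      Prod.fst St next (fun _ _ => True) (fun _ _ _ _ => trivial) (by simp [St])
      (by
        intro s b x; funext k
        simp only [St, Function.update_apply]
        split_ifs <;> simp_all)
      (by
        rintro ⟨q, y⟩ b x -
        cases q with
        | true =>
          refine (local_cases_true rfl (local_put _ _ _ _)).out_eq ?_
          simp [St, next]
        | false =>
          refine local_cases_false rfl ?_
          cases b with
          | true => exact local_skip _ _
          | false => exact local_ctl _ _ _)
      (f l) (false, []) trivial
    have htrue : ∀ (x : List Bool) (y : List Bool),
        x.foldl next (true, y) = (true, x.reverse ++ y) := by
      intro x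
      induction x with
      | nil => intro y; rfl
      | cons b x ih =>
        intro y
        have := ih (b :: y)
        simpa [next] using this
    have hfold : ∀ x : List Bool,
        (x.foldl next (false, [])).2 = (_root_.afterZero x).reverse := by
      intro x
      induction x with
      | nil => rfl
      | cons b x ih =>
        cases b with
        | true => simpa [next, _root_.afterZero] using ih
        | false => simp [next, htrue, _root_.afterZero]
    have hlen : ∀ x : List Bool, (_root_.afterZero x).length ≤ x.length := by
      intro x
      induction x with
      | nil => exact le_rfl
      | cons b x ih => cases b <;> simp [_root_.afterZero]; omega
    have e0 : St (false, []) (f l) = Function.update (fun _ => []) (.arg 0) (f l) := by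
      funext k
      simp only [St, Function.update_apply]
      split_ifs <;> simp_all
    rw [e0] at h
    refine ((h.seq ((local_move (a := .tmp) (b := .out) (by simp) _ _).seq
      (local_ctl (fun _ => false) _ _))).mono ?_).out_eq ?_
    · simp only [St, Function.update_self, hfold]
      have := hlen (f l)
      simp
      omega
    · funext k
      rcases k with _ | i | _ | _ | _ | _ <;> simp [outStk, St, hfold]

end

noncomputable section

open Frag

/-! ### Renaming the wires of a circuit -/

/-- Rename wires. -/
def Gate.rename (ρ : ℕ → ℕ) : Gate → Gate
  | .had t => .had (ρ t)
  | .phase t => .phase (ρ t)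
  | .flip t => .flip (ρ t)
  | .cnot c t => .cnot (ρ c) (ρ t)
  | .toffoli c c' t => .toffoli (ρ c) (ρ c') (ρ t)

/-- Leave a gap of `s` wires before wire `a`. -/
def gap (a s w : ℕ) : ℕ := if w < a then w else w + s

theorem gap_strictMono (a s : ℕ) : StrictMono (gap a s) := by
  intro x y h
  unfold gap
  split_ifs <;> omega

/-- The text of a list of gates. -/
def encGates (gs : List Gate) : List Bool := gs.flatMap Gate.encode

/-- A step of the transformation of texts that leaves gaps. The control state tells whether the tag
of a gate or the number of a wire is read, how many more wires follow, and whether the gap has been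
skipped; the other components are the output and a counter. -/
def gapNext (a s : ℕ) : ((Fin 5 ⊕ Fin 3 × Bool) × List Bool × ℕ) → Bool →
    ((Fin 5 ⊕ Fin 3 × Bool) × List Bool × ℕ)
  | (.inl n, y, c), true => (.inl (n + 1), true :: y, c)
  | (.inl n, y, _), false => (.inr (if n = 4 then 2 else if n = 3 then 1 else 0, false),
      false :: y, a)
  | (.inr (j, m), y, c), true =>
      (.inr (j, m || c == 0), true :: ((if !m && c == 0 then List.replicate s true else []) ++ y),
        c - 1)
  | (.inr (j, m), y, c), false =>
      (if j = 0 then .inl 0 else .inr (j - 1, false),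
        false :: ((if !m && c == 0 then List.replicate s true else []) ++ y), a)

theorem foldl_gapNext_jumped (a s : ℕ) (j : Fin 3) (w : ℕ) (x y : List Bool) (c : ℕ) :
    (List.replicate w true ++ false :: x).foldl (gapNext a s) (.inr (j, true), y, c) =
      x.foldl (gapNext a s) (if j = 0 then .inl 0 else .inr (j - 1, false),
        false :: (List.replicate w true ++ y), a) := by
  induction w generalizing y c with
  | zero => simp [gapNext]
  | succ w ih =>
    have := ih (true :: y) (c - 1)
    rw [List.replicate_succ, List.cons_append, List.foldl_cons]
    simp only [gapNext, Bool.true_or, Bool.not_true, Bool.false_and]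
    simp only [Bool.false_eq_true, if_false, List.nil_append]
    rw [this]
    congr 4
    rw [← List.replicate_succ, List.replicate_succ', List.append_assoc]
    rfl

/-- The counter starts at `a` and drops with every `1`. If it is zero when a symbol is read, the
wire is at least `a`, and `s` further ones are written, once only because of the flag. This also
happens at the terminating `0`, which covers the wire `a` itself. A general counter `c` in place of
`a` makes the induction work. -/
theorem foldl_gapNext_wire (a s : ℕ) (j : Fin 3) (w : ℕ) (x y : List Bool) (c : ℕ) :
    (encNat w ++ x).foldl (gapNext a s) (.inr (j, false), y, c) =
      x.foldl (gapNext a s) (if j = 0 then .inl 0 else .inr (j - 1, false),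
        (encNat (gap c s w)).reverse ++ y, a) := by
  have hrev : ∀ n, (encNat n).reverse ++ y = false :: (List.replicate n true ++ y) := by
    intro n; simp [encNat]
  rw [hrev]
  unfold encNat
  rw [List.append_assoc]
  have hassoc : ∀ (m n : ℕ) (z : List Bool), List.replicate m true ++ (List.replicate n true ++ z) =
      List.replicate (m + n) true ++ z := by
    intro m n z; rw [← List.append_assoc, List.replicate_append_replicate]
  have hcons : ∀ (m : ℕ) (z : List Bool), List.replicate m true ++ true :: z =
      List.replicate (m + 1) true ++ z := fun m z => hassoc m 1 z
  induction w generalizing y c with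
  | zero =>
    rcases Nat.eq_zero_or_pos c with hc | hc
    · subst hc; simp [gapNext, gap]
    · have : (c == 0) = false := by simp; omega
      simp [gapNext, gap, this, hc]
  | succ w ih =>
    rw [List.replicate_succ, List.cons_append, List.foldl_cons]
    rcases Nat.eq_zero_or_pos c with hc | hc
    · subst hc
      have := foldl_gapNext_jumped a s j w x (true :: (List.replicate s true ++ y)) 0
      simp only [gapNext, List.cons_append, List.nil_append] at this ⊢
      simp only [BEq.rfl, Bool.or_true, Bool.not_false, Bool.true_and, if_true, Nat.zero_sub]
      rw [this]
      simp only [gap, Nat.not_lt_zero, if_false]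
      rw [hcons, hassoc]
    · have hc0 : (c == 0) = false := by simp; omega
      have := ih (true :: y) (c - 1) (by intro n; simp [encNat])
      simp only [gapNext, hc0, Bool.or_false, Bool.not_false, Bool.true_and]
      simp only [Bool.false_eq_true, if_false, List.nil_append]
      have hgap : gap (c - 1) s w + 1 = gap c s (w + 1) := by
        unfold gap; split_ifs <;> omega
      rw [this, hcons, hgap]

/-- The tag of a gate determines how many wires follow: three for tag 4, two for tag 3, one for the
others. `Fin 3` counts the wires still to come after the current one. -/
theorem foldl_gapNext_gates (a s : ℕ) (gs : List Gate) (y : List Bool) (c : ℕ) :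
    ((encGates gs).foldl (gapNext a s) (.inl 0, y, c)).1 = .inl 0 ∧
    ((encGates gs).foldl (gapNext a s) (.inl 0, y, c)).2.1 =
      (encGates (gs.map (Gate.rename (gap a s)))).reverse ++ y := by
  induction gs generalizing y c with
  | nil => simp [encGates]
  | cons g gs ih =>
    have hg : (encGates (g :: gs)).foldl (gapNext a s) (.inl 0, y, c) =
        (encGates gs).foldl (gapNext a s)
          (.inl 0, (g.rename (gap a s)).encode.reverse ++ y, a) := by
      have he : encGates (g :: gs) = g.encode ++ encGates gs := rfl
      rw [he]
      have tag : ∀ (n : Fin 5) (m : ℕ), m = n → ∀ (z u : List Bool) (c : ℕ),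
          (encNat m ++ z).foldl (gapNext a s) (.inl 0, u, c) = z.foldl (gapNext a s)
            (.inr (if n = 4 then 2 else if n = 3 then 1 else 0, false),
              (encNat m).reverse ++ u, a) := by
        rintro n _ rfl z u c
        fin_cases n <;> rfl
      cases g with
      | had t =>
        simp only [Gate.encode, Gate.rename, List.append_assoc]
        rw [tag 0 0 rfl, if_neg (by decide), if_neg (by decide), foldl_gapNext_wire]
        simp
      | phase t =>
        simp only [Gate.encode, Gate.rename, List.append_assoc]
        rw [tag 1 1 rfl, if_neg (by decide), if_neg (by decide), foldl_gapNext_wire]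
        simp
      | flip t =>
        simp only [Gate.encode, Gate.rename, List.append_assoc]
        rw [tag 2 2 rfl, if_neg (by decide), if_neg (by decide), foldl_gapNext_wire]
        simp
      | cnot d t =>
        simp only [Gate.encode, Gate.rename, List.append_assoc]
        rw [tag 3 3 rfl, if_neg (by decide), if_pos rfl, foldl_gapNext_wire, if_neg (by decide),
          foldl_gapNext_wire]
        simp
      | toffoli d d' t =>
        simp only [Gate.encode, Gate.rename, List.append_assoc]
        rw [tag 4 4 rfl, if_pos rfl, foldl_gapNext_wire, if_neg (by decide), foldl_gapNext_wire,
          if_neg (by decide), foldl_gapNext_wire]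
        simp
    rw [hg]
    obtain ⟨h1, h2⟩ := ih ((g.rename (gap a s)).encode.reverse ++ y) a
    refine ⟨h1, h2.trans ?_⟩
    simp [encGates]


section Program

variable {tm : Fin 3 → Turing.FinTM2}

/-- The stacks of the program that leaves gaps: the text, `a` and `s` in unary, the output and the
counter. -/
def gapStk (a s : ℕ) (σ : (Fin 5 ⊕ Fin 3 × Bool) × List Bool × ℕ) (x : List Bool) :
    Stk → List Bool
  | .arg i => if i = 0 then x else if i = 1 then List.replicate a true else List.replicate s true
  | .acc => σ.2.1
  | .cnt => List.replicate σ.2.2 true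
  | _ => []

abbrev GapCtl : Type := Fin 5 ⊕ Fin 3 × Bool

/-- Restore the counter. -/
def gapReset : Frag (HostΓ tm) (Option Bool × Hostτ tm GapCtl) :=
  (drain .cnt).seq (copy (.arg 1) .cnt)

theorem local_gapReset (a s : ℕ) (q : GapCtl) (y : List Bool) (c : ℕ) (hc : c ≤ a)
    (x : List Bool) (q' : GapCtl) :
    (gapReset : Frag (HostΓ tm) (Option Bool × Hostτ tm GapCtl)).Local (3 * a + 3) q'
      (gapStk a s (q, y, c) x) q' (gapStk a s (q, y, a) x) := by
  refine (((local_drain .cnt q' _).seq (local_copy (a := .arg 1) (b := .cnt) (by simp) (by simp)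
    (by simp) q' _ (by simp [gapStk]))).mono ?_).out_eq ?_
  · simp [gapStk]; omega
  · funext k
    rcases k with _ | i | _ | _ | _ | _ <;> simp [gapStk]

def gapTag (b : Bool) : Frag (HostΓ tm) (Option Bool × Hostτ tm GapCtl) :=
  if b then (put .acc true).seq (ctl fun q => q.elim (fun n => .inl (n + 1)) .inr)
  else (put .acc false).seq (gapReset.seq (ctl fun q =>
    q.elim (fun n => .inr (if n = 4 then 2 else if n = 3 then 1 else 0, false)) .inr))

def gapJump : Frag (HostΓ tm) (Option Bool × Hostτ tm GapCtl) :=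
  isEmpty .cnt (cases (fun q => q.elim (fun _ => true) fun p => p.2) skip
    ((copy (.arg 2) .acc).seq (ctl fun q => q.elim .inl fun p => .inr (p.1, true)))) skip

def gapWire (b : Bool) : Frag (HostΓ tm) (Option Bool × Hostτ tm GapCtl) :=
  gapJump.seq (if b then (put .acc true).seq (drop .cnt)
    else (put .acc false).seq (gapReset.seq (ctl fun q =>
      q.elim .inl fun p => if p.1 = 0 then .inl 0 else .inr (p.1 - 1, false))))

def gapBody (b : Bool) : Frag (HostΓ tm) (Option Bool × Hostτ tm GapCtl) :=
  cases (fun q => q.elim (fun _ => true) fun _ => false) (gapTag b) (gapWire b)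

theorem local_gapJump (a s : ℕ) (j : Fin 3) (m : Bool) (y : List Bool) (c : ℕ) (x : List Bool) :
    (gapJump : Frag (HostΓ tm) (Option Bool × Hostτ tm GapCtl)).Local (2 * s + 2) (.inr (j, m))
      (gapStk a s (.inr (j, m), y, c) x) (.inr (j, m || c == 0))
      (gapStk a s (.inr (j, m || c == 0),
        (if !m && c == 0 then List.replicate s true else []) ++ y, c) x) := by
  rcases Nat.eq_zero_or_pos c with hc | hc
  · subst hc
    refine local_isEmpty_nil (by simp [gapStk]) ?_
    cases m with
    | true => exact (local_cases_true rfl (local_skip _ _)).mono (by omega)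
    | false =>
      refine local_cases_false rfl ?_
      refine (((local_copy (a := .arg 2) (b := .acc) (by simp) (by simp)
        (by simp) _ _ (by simp [gapStk])).seq (local_ctl _ _ _)).mono ?_).out_eq ?_
      · simp [gapStk]
      · funext k
        rcases k with _ | i | _ | _ | _ | _ <;> simp [gapStk]
  · have h0 : (c == 0) = false := by simp; omega
    refine local_isEmpty_cons ?_ ?_
    · simp [gapStk]; omega
    · simp only [h0, Bool.or_false, Bool.and_false]
      exact ((local_skip _ _).mono (by omega))

theorem local_gapBody (a s : ℕ) (σ : GapCtl × List Bool × ℕ) (b : Bool) (x : List Bool)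
    (hσ : σ.2.2 ≤ a) :
    (gapBody b : Frag (HostΓ tm) (Option Bool × Hostτ tm GapCtl)).Local (3 * a + 2 * s + 5) σ.1
      (gapStk a s σ x) (gapNext a s σ b).1 (gapStk a s (gapNext a s σ b) x) := by
  obtain ⟨q, y, c⟩ := σ
  rcases q with n | ⟨j, m⟩
  · refine local_cases_true rfl ?_
    cases b with
    | true =>
      refine (((local_put .acc true _ _).seq (local_ctl _ _ _)).mono (by omega)).out_eq ?_
      funext k
      rcases k with _ | i | _ | _ | _ | _ <;> simp [gapStk, gapNext]
    | false =>
      have h1 := local_put (tm := tm) .acc false (Sum.inl n : GapCtl)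
        (gapStk a s (.inl n, y, c) x)
      have e1 : Function.update (gapStk a s (.inl n, y, c) x) .acc
          (false :: gapStk a s (.inl n, y, c) x .acc) = gapStk a s (.inl n, false :: y, c) x := by
        funext k
        rcases k with _ | i | _ | _ | _ | _ <;> simp [gapStk]
      rw [e1] at h1
      exact (h1.seq ((local_gapReset a s _ _ _ hσ _ _).seq (local_ctl _ _ _))).mono (by omega)
  · refine local_cases_false rfl ?_
    have h0 := local_gapJump (tm := tm) a s j m y c x
    set y' := (if !m && c == 0 then List.replicate s true else []) ++ y with hy'
    cases b with
    | true =>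
      refine ((h0.seq ((local_put .acc true _ _).seq (local_drop .cnt _ _))).mono
        (by omega)).out_eq ?_
      funext k
      rcases k with _ | i | _ | _ | _ | _ <;> simp [gapStk, gapNext, hy']
    | false =>
      have h1 := local_put (tm := tm) .acc false (Sum.inr (j, m || c == 0) : GapCtl)
        (gapStk a s (.inr (j, m || c == 0), y', c) x)
      have e1 : Function.update (gapStk a s (.inr (j, m || c == 0), y', c) x) .acc
          (false :: gapStk a s (.inr (j, m || c == 0), y', c) x .acc) =
          gapStk a s (.inr (j, m || c == 0), false :: y', c) x := by
        funext k
        rcases k with _ | i | _ | _ | _ | _ <;> simp [gapStk]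
      rw [e1] at h1
      exact (h0.seq (h1.seq ((local_gapReset a s _ _ _ hσ _ _).seq (local_ctl _ _ _)))).mono
        (by omega)

end Program

/-- Leaving a gap in the wires of efficient lists of gates. -/
theorem PolyStr.gap {G : ℕ → List Gate} (hG : PolyStr fun l => encGates (G l)) {a s : ℕ → ℕ}
    (ha : EfficientLength a) (hs : EfficientLength s) :
    PolyStr fun l => encGates ((G l).map (Gate.rename (gap (a l) (s l)))) := by
  have ha' := (efficientLength_iff _).1 ha
  have hs' := (efficientLength_iff _).1 hs
  have hab := ha'.length_bdd
  have hsb := hs'.length_bdd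
  simp only [List.length_replicate] at hab hsb
  have hGb := hG.length_bdd
  -- Every wire number grows by at most `s`, and every wire is written with at least one symbol. The
  -- length of the output enters the running time through the last move.
  have hout : PolyBdd fun l =>
      (encGates ((G l).map (Gate.rename (_root_.gap (a l) (s l))))).length := by
    refine (hGb.mul ((PolyBdd.const 1).add hsb)).mono fun l => ?_
    have hgate : ∀ g : Gate, (g.rename (_root_.gap (a l) (s l))).encode.length ≤
        g.encode.length * (1 + s l) := by
      have hw : ∀ w, _root_.gap (a l) (s l) w ≤ w + s l := by
        intro w; unfold _root_.gap; split_ifs <;> omega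
      intro g
      cases g with
      | had t => have := hw t; simp [Gate.encode, Gate.rename, encNat]; nlinarith
      | phase t => have := hw t; simp [Gate.encode, Gate.rename, encNat]; nlinarith
      | flip t => have := hw t; simp [Gate.encode, Gate.rename, encNat]; nlinarith
      | cnot c t =>
        have := hw t; have := hw c; simp [Gate.encode, Gate.rename, encNat]; nlinarith
      | toffoli c c' t =>
        have := hw t; have := hw c; have := hw c'
        simp [Gate.encode, Gate.rename, encNat]; nlinarith
    have : ∀ gs : List Gate, (encGates (gs.map (Gate.rename (_root_.gap (a l) (s l))))).length ≤
        (encGates gs).length * (1 + s l) := by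
      intro gs
      induction gs with
      | nil => simp [encGates]
      | cons g gs ih =>
        have := hgate g
        simp only [encGates, List.map_cons, List.flatMap_cons, List.length_append] at ih ⊢
        nlinarith
    exact this (G l)
  refine PolyStr.of_program (Q := GapCtl) (f := ![fun l => encGates (G l),
    fun l => List.replicate (a l) true, fun l => List.replicate (s l) true]) (.inl 0) ?_ _
    (fun tm => (drain .inp).seq ((each (.arg 0) gapBody).seq ((drain .cnt).seq
      ((drain (.arg 1)).seq ((drain (.arg 2)).seq (move .acc .out))))))
    (fun l => (l + 1) + (((encGates (G l)).length * (3 * a l + 2 * s l + 5 + 1) + 1) +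
      ((a l + 1) + ((a l + 1) + ((s l + 1) +
        ((encGates ((G l).map (Gate.rename (_root_.gap (a l) (s l))))).length + 1)))))) ?_
    fun tm l => ?_
  · intro i
    fin_cases i
    exacts [hG, ha', hs']
  · have h1 := PolyBdd.const 1
    refine (PolyBdd.id.add h1).add (((hGb.mul (((((PolyBdd.const 3).mul hab).add
      ((PolyBdd.const 2).mul hsb)).add (PolyBdd.const 5)).add h1)).add h1).add
      ((hab.add h1).add ((hab.add h1).add ((hsb.add h1).add (hout.add h1)))))
  · set S := argStk l fun i => (![fun l => encGates (G l), fun l => List.replicate (a l) true,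
      fun l => List.replicate (s l) true] : Fin 3 → ℕ → List Bool) i l with hS
    have h0 := local_drain (tm := tm) .inp (.inl 0 : GapCtl) S
    have e0 : Function.update S .inp [] =
        gapStk (a l) (s l) (.inl 0, [], 0) (encGates (G l)) := by
      funext k
      rcases k with _ | i | _ | _ | _ | _
      on_goal 2 => fin_cases i
      all_goals simp [hS, argStk, gapStk]
    rw [e0] at h0
    have hinv : ∀ (σ : GapCtl × List Bool × ℕ) (b : Bool), σ.2.2 ≤ a l →
        (gapNext (a l) (s l) σ b).2.2 ≤ a l := by
      rintro ⟨n | ⟨j, m⟩, y, c⟩ b h <;> cases b <;> simp [gapNext] at h ⊢ <;> omega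
    have hfinal : ∀ (x : List Bool) (σ : GapCtl × List Bool × ℕ), σ.2.2 ≤ a l →
        (x.foldl (gapNext (a l) (s l)) σ).2.2 ≤ a l := by
      intro x
      induction x with
      | nil => exact fun _ h => h
      | cons b x ih => exact fun σ h => ih _ (hinv σ b h)
    have h1 := local_each_fold (tm := tm) (k := .arg 0) (B := gapBody)
      (t := 3 * a l + 2 * s l + 5) (fun σ => σ.1) (gapStk (a l) (s l)) (gapNext (a l) (s l))
      (fun σ _ => σ.2.2 ≤ a l) (fun σ b _ h => hinv σ b h) (by simp [gapStk])
      (by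
        intro σ b x; funext k
        rcases k with _ | i | _ | _ | _ | _
        on_goal 2 => fin_cases i
        all_goals simp [gapStk])
      (fun σ b x h => local_gapBody _ _ σ b x h) (encGates (G l)) (.inl 0, [], 0) (Nat.zero_le _)
    obtain ⟨f1, f2⟩ := foldl_gapNext_gates (a l) (s l) (G l) [] 0
    have f3 := hfinal (encGates (G l)) (.inl 0, [], 0) (Nat.zero_le _)
    rw [f1] at h1
    have h := h0.seq (h1.seq ((local_drain .cnt _ _).seq ((local_drain (.arg 1) _ _).seq
      ((local_drain (.arg 2) _ _).seq (local_move (a := .acc) (b := .out) (by simp) _ _)))))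
    refine (h.mono ?_).out_eq ?_
    · simp [hS, argStk, gapStk, f2]
      omega
    · funext k
      rcases k with _ | i | _ | _ | _ | _
      on_goal 2 => fin_cases i
      all_goals simp [gapStk, outStk, f2]

end

noncomputable section

open Frag

/-! ### Efficient lists of gates -/

/-- Add the bits on `n` wires from `a` on to those on the wires from `b` on. -/
def cnotRange (a b n : ℕ) : List Gate := (List.range n).map fun i => .cnot (a + i) (b + i)

theorem cnotRange_succ (a b n : ℕ) :
    cnotRange a b (n + 1) = cnotRange a b n ++ [.cnot (a + n) (b + n)] := by
  simp [cnotRange, List.range_succ]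

theorem encGates_append (gs hs : List Gate) :
    encGates (gs ++ hs) = encGates gs ++ encGates hs := by
  simp [encGates]

section Program

variable {tm : Fin 3 → Turing.FinTM2}

/-- The stacks of the program for `cnotRange` after `s.1` gates. -/
def cnotStk (a b : ℕ) (s : ℕ × List Bool) (x : List Bool) : Stk → List Bool
  | .arg i => if i = 0 then List.replicate (a + s.1) true
      else if i = 1 then List.replicate (b + s.1) true else x
  | .acc => s.2
  | _ => []

def cnotNext (a b : ℕ) (s : ℕ × List Bool) (_ : Bool) : ℕ × List Bool :=
  (s.1 + 1, (Gate.cnot (a + s.1) (b + s.1)).encode.reverse ++ s.2)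

/-- The accumulator holds the output in reverse, so the word pushed first is the tag 3. The two wire
numbers are kept in unary on stacks that grow by one, ready for the next gate. -/
def cnotBody : Frag (HostΓ tm) (Option Bool × Hostτ tm Unit) :=
  (word .acc [false, true, true, true]).seq ((copy (.arg 0) .acc).seq ((put .acc false).seq
    ((copy (.arg 1) .acc).seq ((put .acc false).seq ((put (.arg 0) true).seq
      (put (.arg 1) true))))))

theorem local_cnotBody (a b n : ℕ) (s : ℕ × List Bool) (x : List Bool) (hs : s.1 ≤ n) :
    (cnotBody : Frag (HostΓ tm) (Option Bool × Hostτ tm Unit)).Local (2 * a + 2 * b + 4 * n + 4) ()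
      (cnotStk a b s x) () (cnotStk a b (cnotNext a b s true) x) := by
  have h := (local_word (tm := tm) .acc [false, true, true, true] () (cnotStk a b s x)).seq
    ((local_copy (a := .arg 0) (b := .acc) (by simp) (by simp) (by simp) () _
      (by simp [cnotStk])).seq
    ((local_put .acc false () _).seq
    ((local_copy (a := .arg 1) (b := .acc) (by simp) (by simp) (by simp) () _
      (by simp [cnotStk])).seq
    ((local_put .acc false () _).seq
    ((local_put (.arg 0) true () _).seq (local_put (.arg 1) true () _))))))
  refine (h.mono ?_).out_eq ?_
  · simp [cnotStk]; omega
  · funext k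
    rcases k with _ | i | _ | _ | _ | _
    on_goal 2 => fin_cases i
    all_goals simp [cnotStk, cnotNext, Gate.encode, encNat, ← List.replicate_succ]
    all_goals rfl

end Program

theorem foldl_cnotNext (a b n : ℕ) : (List.replicate n true).foldl (cnotNext a b) (0, []) =
    (n, (encGates (cnotRange a b n)).reverse) := by
  induction n with
  | zero => rfl
  | succ n ih =>
    rw [List.replicate_succ', List.foldl_append, ih, cnotRange_succ, encGates_append]
    simp [cnotNext, encGates]

theorem PolyStr.cnotRange {a b n : ℕ → ℕ} (ha : EfficientLength a) (hb : EfficientLength b)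
    (hn : EfficientLength n) : PolyStr fun l => encGates (cnotRange (a l) (b l) (n l)) := by
  have ha' := (efficientLength_iff _).1 ha
  have hb' := (efficientLength_iff _).1 hb
  have hn' := (efficientLength_iff _).1 hn
  have hab := ha'.length_bdd
  have hbb := hb'.length_bdd
  have hnb := hn'.length_bdd
  simp only [List.length_replicate] at hab hbb hnb
  have hout : ∀ l, (encGates (_root_.cnotRange (a l) (b l) (n l))).length ≤
      n l * (6 + a l + b l + 2 * n l) := by
    intro l
    have : ∀ m, m ≤ n l → (encGates (_root_.cnotRange (a l) (b l) m)).length ≤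
        m * (6 + a l + b l + 2 * n l) := by
      intro m
      induction m with
      | zero => intro; simp [_root_.cnotRange, encGates]
      | succ m ih =>
        intro hm
        have := ih (by omega)
        rw [cnotRange_succ, encGates_append, List.length_append]
        have e : (encGates [Gate.cnot (a l + m) (b l + m)]).length = 6 + a l + b l + 2 * m := by
          simp [encGates, Gate.encode, encNat]; omega
        rw [e, Nat.add_mul, Nat.one_mul]
        omega
    exact this _ le_rfl
  refine PolyStr.of_program (Q := Unit) (f := ![fun l => List.replicate (a l) true,
    fun l => List.replicate (b l) true, fun l => List.replicate (n l) true]) () ?_ _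
    (fun tm => (drain .inp).seq ((each (.arg 2) fun _ => cnotBody).seq
      ((drain (.arg 0)).seq ((drain (.arg 1)).seq (move .acc .out)))))
    (fun l => (l + 1) + ((n l * (2 * a l + 2 * b l + 4 * n l + 4 + 1) + 1) +
      ((a l + n l + 1) + ((b l + n l + 1) + (n l * (6 + a l + b l + 2 * n l) + 1))))) ?_
    fun tm l => ?_
  · intro i
    fin_cases i
    exacts [ha', hb', hn']
  · have h1 := PolyBdd.const 1
    have h2 := PolyBdd.const 2
    refine (PolyBdd.id.add h1).add (((hnb.mul (((((h2.mul hab).add (h2.mul hbb)).add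
      ((PolyBdd.const 4).mul hnb)).add (PolyBdd.const 4)).add h1)).add h1).add
      (((hab.add hnb).add h1).add (((hbb.add hnb).add h1).add
        ((hnb.mul ((((PolyBdd.const 6).add hab).add hbb).add (h2.mul hnb))).add h1))))
  · set S := argStk l fun i => (![fun l => List.replicate (a l) true,
      fun l => List.replicate (b l) true, fun l => List.replicate (n l) true] :
        Fin 3 → ℕ → List Bool) i l with hS
    have h0 := local_drain (tm := tm) .inp () S
    have e0 : Function.update S .inp [] = cnotStk (a l) (b l) (0, []) (List.replicate (n l) true) := by
      funext k
      rcases k with _ | i | _ | _ | _ | _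
      on_goal 2 => fin_cases i
      all_goals simp [hS, argStk, cnotStk]
    rw [e0] at h0
    have h1 := local_each_fold (tm := tm) (k := .arg 2) (B := fun _ => cnotBody)
      (t := 2 * a l + 2 * b l + 4 * n l + 4) (fun _ => ()) (cnotStk (a l) (b l))
      (cnotNext (a l) (b l)) (fun s x => s.1 + x.length = n l)
      (fun s c x h => by simp [cnotNext] at h ⊢; omega) (by simp [cnotStk])
      (by
        intro σ b x; funext k
        rcases k with _ | i | _ | _ | _ | _
        on_goal 2 => fin_cases i
        all_goals simp [cnotStk])
      (fun s c x h => local_cnotBody _ _ (n l) s x (by omega)) (List.replicate (n l) true) (0, [])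
      (by simp)
    rw [foldl_cnotNext] at h1
    have h := h0.seq (h1.seq ((local_drain (.arg 0) _ _).seq
      ((local_drain (.arg 1) _ _).seq (local_move (a := .acc) (b := .out) (by simp) _ _))))
    have := hout l
    refine (h.mono ?_).out_eq ?_
    · simp [hS, argStk, cnotStk]
      omega
    · funext k
      rcases k with _ | i | _ | _ | _ | _
      on_goal 2 => fin_cases i
      all_goals simp [cnotStk, outStk]

theorem EfficientLength.add {a b : ℕ → ℕ} (ha : EfficientLength a) (hb : EfficientLength b) :
    EfficientLength fun l => a l + b l := by
  rw [efficientLength_iff] at *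
  simpa only [List.replicate_append_replicate] using ha.append hb

theorem efficientLength_const (c : ℕ) : EfficientLength fun _ => c :=
  (efficientLength_iff _).2 (polyStr_const _)

theorem EfficientLength.polyStr_encNat {a : ℕ → ℕ} (ha : EfficientLength a) :
    PolyStr fun l => encNat (a l) :=
  ((efficientLength_iff _).1 ha).append (polyStr_const [false])

theorem encode_eq (C : Circuit) : C.encode = encNat C.anc ++ encGates C.gates := rfl

/-- A family of circuits is efficient if the numbers of ancillas and the lists of gates are. -/
theorem efficientCircuits_iff_anc_gates (C : ℕ → Circuit) :
    EfficientCircuits C ↔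
      EfficientLength (fun l => (C l).anc) ∧ PolyStr fun l => encGates (C l).gates := by
  have h1 : ∀ (n : ℕ) (x : List Bool), (encNat n ++ x).takeWhile id = List.replicate n true := by
    intro n x
    induction n with
    | zero => simp [encNat]
    | succ n ih =>
      have : encNat (n + 1) ++ x = true :: (encNat n ++ x) := by simp [encNat, List.replicate_succ]
      rw [this, List.takeWhile_cons, id, if_pos rfl, ih, List.replicate_succ]
  have h2 : ∀ (n : ℕ) (x : List Bool), afterZero (encNat n ++ x) = x := by
    intro n x
    induction n with
    | zero => simp [encNat, afterZero]
    | succ n ih =>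
      have : encNat (n + 1) ++ x = true :: (encNat n ++ x) := by simp [encNat, List.replicate_succ]
      rw [this, afterZero, ih]
  rw [efficientCircuits_iff, efficientLength_iff]
  constructor
  · intro h
    have a := h.takeOnes
    have b := h.afterZero
    simp only [encode_eq, h1, h2] at a b
    exact ⟨a, b⟩
  · rintro ⟨a, b⟩
    exact ((efficientLength_iff _).2 a).polyStr_encNat.append b

/-- An efficient family of lists of gates. -/
def EffGates (G : ℕ → List Gate) : Prop := PolyStr fun l => encGates (G l)

theorem EffGates.append {G H : ℕ → List Gate} (hG : EffGates G) (hH : EffGates H) :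
    EffGates fun l => G l ++ H l := by
  have := PolyStr.append hG hH
  simpa only [EffGates, encGates_append] using this

theorem effGates_nil : EffGates fun _ => [] := polyStr_const []

theorem effGates_had {a : ℕ → ℕ} (ha : EfficientLength a) : EffGates fun l => [.had (a l)] := by
  have := (polyStr_const (encNat 0)).append ha.polyStr_encNat
  simpa [EffGates, encGates, Gate.encode] using this

/-- Renamings of wires that preserve efficiency. -/
def EffMap (ρ : ℕ → ℕ → ℕ) : Prop :=
  ∀ G : ℕ → List Gate, EffGates G → EffGates fun l => (G l).map (Gate.rename (ρ l))

theorem Gate.rename_rename (ρ ρ' : ℕ → ℕ) (g : Gate) :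
    (g.rename ρ).rename ρ' = g.rename (ρ' ∘ ρ) := by cases g <;> rfl

theorem EffMap.comp {ρ ρ' : ℕ → ℕ → ℕ} (h' : EffMap ρ') (h : EffMap ρ) :
    EffMap fun l => ρ' l ∘ ρ l := by
  intro G hG
  have := h' _ (h G hG)
  simpa only [List.map_map, Function.comp_def, Gate.rename_rename] using this

theorem effMap_gap {a s : ℕ → ℕ} (ha : EfficientLength a) (hs : EfficientLength s) :
    EffMap fun l => gap (a l) (s l) := fun _ hG => PolyStr.gap hG ha hs

end

noncomputable section

/-! ### Bits and wires -/

theorem bitAt_of_lt {n : ℕ} (x : Bits n) {i : ℕ} (h : i < n) : bitAt x i = x ⟨i, h⟩ := dif_pos h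

theorem bitAt_of_le {n : ℕ} (x : Bits n) {i : ℕ} (h : n ≤ i) : bitAt x i = false :=
  dif_neg (by omega)

@[simp] theorem bitAt_fin {n : ℕ} (x : Bits n) (i : Fin n) : bitAt x i = x i := bitAt_of_lt x i.2

theorem bits_ext {n : ℕ} {x y : Bits n} (h : ∀ i < n, bitAt x i = bitAt y i) : x = y := by
  funext i
  simpa using h i i.2

theorem bitAt_append {m n : ℕ} (x : Bits m) (y : Bits n) (i : ℕ) :
    bitAt (Fin.append x y) i = if i < m then bitAt x i else bitAt y (i - m) := by
  split_ifs with h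
  · rw [bitAt_of_lt _ h, bitAt_of_lt _ (by omega : i < m + n)]
    exact Fin.append_left x y ⟨i, h⟩
  · by_cases h' : i < m + n
    · obtain ⟨j, rfl⟩ := Nat.exists_eq_add_of_le (not_lt.1 h)
      rw [bitAt_of_lt _ h', bitAt_of_lt _ (by omega : m + j - m < n)]
      have := Fin.append_right x y ⟨j, by omega⟩
      simpa [Fin.natAdd] using this
    · rw [bitAt_of_le _ (by omega), bitAt_of_le _ (by omega)]

@[simp] theorem bitAt_append_add {m n : ℕ} (x : Bits m) (y : Bits n) (i : ℕ) :
    bitAt (Fin.append x y) (m + i) = bitAt y i := by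
  simp [bitAt_append]

theorem bitAt_append_lt {m n : ℕ} (x : Bits m) (y : Bits n) {i : ℕ} (h : i < m) :
    bitAt (Fin.append x y) i = bitAt x i := by
  simp [bitAt_append, h]

@[simp] theorem bitAt_zeros (n i : ℕ) : bitAt (zeros n) i = false := by
  simp [bitAt, zeros]

@[simp] theorem bitAt_xorBits {n : ℕ} (x y : Bits n) (i : ℕ) :
    bitAt (xorBits x y) i = xor (bitAt x i) (bitAt y i) := by
  unfold bitAt; split_ifs <;> simp [xorBits]

/-- Extend or truncate a string to length `N`. -/
def zext (N : ℕ) {n : ℕ} (x : Bits n) : Bits N := fun j => bitAt x j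

theorem bitAt_zext {N n : ℕ} (x : Bits n) {i : ℕ} (h : i < N) : bitAt (zext N x) i = bitAt x i := by
  rw [bitAt_of_lt _ h]; rfl

theorem append_zeros_eq_zext {n : ℕ} (x : Bits n) (e : ℕ) :
    Fin.append x (zeros e) = zext (n + e) x := by
  refine bits_ext fun i hi => ?_
  rw [bitAt_zext _ hi, bitAt_append]
  split_ifs with h
  · rfl
  · rw [bitAt_zeros, bitAt_of_le _ (by omega)]

theorem zext_add {n N : ℕ} (h : n ≤ N) (x : Bits n) (e : ℕ) :
    zext (N + e) x = Fin.append (zext N x) (zeros e) := by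
  refine bits_ext fun i hi => ?_
  rw [bitAt_zext _ hi, bitAt_append]
  split_ifs with h'
  · rw [bitAt_zext _ h']
  · rw [bitAt_zeros, bitAt_of_le _ (by omega)]

/-! ### Layouts: a subsystem of the wires of a circuit -/

/-- A description of basis states of `N` wires by the state in `S` of a subsystem of `s` wires, the
`i`-th of which is the wire `ρ i`, and the state in `Q` of the other wires. -/
structure Layout (N : ℕ) {S : Type} {s : ℕ} (eS : S ≃ Bits s) (ρ : ℕ → ℕ) (Q : Type) where
  J : S × Q ≃ Bits N
  mono : StrictMono ρ
  -- A gate on a missing wire of the subsystem acts trivially; its renaming must be missing among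
  -- the `N` wires as well.
  top : ∀ i, ρ (s + i) = N + i
  sys : ∀ z q i, i < s → bitAt (J (z, q)) (ρ i) = bitAt (eS z) i
  rest : ∀ z z' q w, (∀ i < s, ρ i ≠ w) → bitAt (J (z, q)) w = bitAt (J (z', q)) w

namespace Layout

variable {N s : ℕ} {S Q : Type} {eS : S ≃ Bits s} {ρ : ℕ → ℕ}

theorem lt (L : Layout N eS ρ Q) {i : ℕ} (h : i < s) : ρ i < N := by
  have := L.mono h
  have := L.top 0
  simp only [add_zero] at this
  omega

theorem le (L : Layout N eS ρ Q) {i : ℕ} (h : s ≤ i) : N ≤ ρ i := by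
  obtain ⟨j, rfl⟩ := Nat.exists_eq_add_of_le h
  rw [L.top]; omega

theorem sys_all (L : Layout N eS ρ Q) (p : S × Q) (i : ℕ) :
    bitAt (L.J p) (ρ i) = bitAt (eS p.1) i := by
  by_cases h : i < s
  · exact L.sys _ _ _ h
  · rw [bitAt_of_le _ (L.le (not_lt.1 h)), bitAt_of_le _ (not_lt.1 h)]

/-- Replacing the state of the subsystem in `p` by that of `p'` does not affect the other wires. The
result then agrees with `p'` on all wires, and `J` is injective. -/
theorem snd_eq (L : Layout N eS ρ Q) {p p' : S × Q}
    (h : ∀ w < N, (∀ i < s, ρ i ≠ w) → bitAt (L.J p) w = bitAt (L.J p') w) : p.2 = p'.2 := by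
  have : L.J (p'.1, p.2) = L.J p' := by
    refine bits_ext fun w hw => ?_
    by_cases hs : ∃ i < s, ρ i = w
    · obtain ⟨i, hi, rfl⟩ := hs
      rw [L.sys_all, L.sys_all]
    · push Not at hs
      rw [L.rest _ p.1 _ _ hs]
      exact h w hw hs
  have h2 := L.J.injective this
  exact (Prod.ext_iff.1 h2).2

/-- Agreement off the wire `ρ t` splits into equality of the states of the other wires and agreement
of the subsystem off its wire `t`. If `t` is missing in the subsystem, then `ρ t` is missing by
`top`, and both operators are the identity. -/
theorem oneQubit_rename [DecidableEq Q] (L : Layout N eS ρ Q) (t : ℕ) (u : Matrix Bool Bool ℂ)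
    (p p' : S × Q) :
    oneQubit N (ρ t) u (L.J p) (L.J p') =
      if p.2 = p'.2 then oneQubit s t u (eS p.1) (eS p'.1) else 0 := by
  have key : (∀ j : Fin N, (j : ℕ) ≠ ρ t → L.J p j = L.J p' j) ↔
      p.2 = p'.2 ∧ ∀ j : Fin s, (j : ℕ) ≠ t → eS p.1 j = eS p'.1 j := by
    constructor
    · intro h
      have h' : ∀ w < N, w ≠ ρ t → bitAt (L.J p) w = bitAt (L.J p') w := by
        intro w hw hne
        have := h ⟨w, hw⟩ hne
        rwa [bitAt_of_lt _ hw, bitAt_of_lt _ hw]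
      refine ⟨L.snd_eq fun w hw hs => h' w hw ?_, fun j hj => ?_⟩
      · rintro rfl
        by_cases ht : t < s
        · exact hs t ht rfl
        · have := L.le (not_lt.1 ht); omega
      · have := h' (ρ j) (L.lt j.2) fun e => hj (L.mono.injective e)
        rwa [L.sys_all, L.sys_all, bitAt_fin, bitAt_fin] at this
    · rintro ⟨hq, h⟩ j hj
      rw [← bitAt_fin (L.J p), ← bitAt_fin (L.J p')]
      by_cases hs : ∃ i < s, ρ i = j
      · obtain ⟨i, hi, hij⟩ := hs
        rw [← hij, L.sys_all, L.sys_all, bitAt_of_lt _ hi, bitAt_of_lt _ hi]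
        refine h ⟨i, hi⟩ ?_
        rintro rfl
        exact hj hij.symm
      · push Not at hs
        have := L.rest p.1 p'.1 p.2 j hs
        rwa [← Prod.mk.eta (p := p'), ← hq]
  unfold oneQubit
  simp only [key, L.sys_all]
  by_cases hq : p.2 = p'.2
  · simp only [hq, true_and, if_true]
    by_cases ht : t < s
    · simp [ht, L.lt ht]
    · have := L.le (not_lt.1 ht)
      simp [ht, not_lt.2 this]
  · simp [hq]

theorem ctrlNot_rename [DecidableEq Q] (L : Layout N eS ρ Q) (cs : List ℕ) (t : ℕ)
    (p p' : S × Q) :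
    ctrlNot N (cs.map ρ) (ρ t) (L.J p) (L.J p') =
      if p.2 = p'.2 then ctrlNot s cs t (eS p.1) (eS p'.1) else 0 := by
  set f : Bits s := fun j => xor (eS p'.1 j)
    (decide ((j : ℕ) = t ∧ t ∉ cs ∧ ∀ c ∈ cs, bitAt (eS p'.1) c = true)) with hf
  have hmem : ρ t ∈ cs.map ρ ↔ t ∈ cs := List.mem_map_of_injective L.mono.injective
  have key : (fun j : Fin N => xor (L.J p' j) (decide ((j : ℕ) = ρ t ∧ ρ t ∉ cs.map ρ ∧
      ∀ c ∈ cs.map ρ, bitAt (L.J p') c = true))) = L.J (eS.symm f, p'.2) := by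
    refine bits_ext fun w hw => ?_
    rw [bitAt_of_lt _ hw]
    dsimp only
    rw [← bitAt_of_lt (L.J p') hw]
    simp only [hmem, List.forall_mem_map, L.sys_all]
    by_cases hs : ∃ i < s, ρ i = w
    · obtain ⟨i, hi, rfl⟩ := hs
      simp only [L.sys_all, Equiv.apply_symm_apply, L.mono.injective.eq_iff]
      rw [bitAt_of_lt f hi, bitAt_of_lt (eS p'.1) hi]
    · push Not at hs
      have hne : w ≠ ρ t := by
        rintro rfl
        by_cases ht : t < s
        · exact hs t ht rfl
        · have := L.le (not_lt.1 ht); omega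
      simp only [hne, false_and, decide_false, Bool.xor_false]
      exact L.rest _ _ _ _ hs
  unfold ctrlNot
  have e : L.J p = L.J (eS.symm f, p'.2) ↔ p.2 = p'.2 ∧ eS p.1 = f := by
    rw [L.J.injective.eq_iff, Prod.ext_iff, Equiv.eq_symm_apply, and_comm]
  simp only [key, e, ← hf]
  by_cases hq : p.2 = p'.2 <;> simp [hq]

theorem gate_rename [DecidableEq Q] (L : Layout N eS ρ Q) (g : Gate) (p p' : S × Q) :
    (g.rename ρ).mat N (L.J p) (L.J p') =
      if p.2 = p'.2 then g.mat s (eS p.1) (eS p'.1) else 0 := by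
  cases g with
  | had t =>
    simp only [Gate.rename, Gate.mat]
    exact L.oneQubit_rename _ _ _ _
  | phase t =>
    simp only [Gate.rename, Gate.mat]
    exact L.oneQubit_rename _ _ _ _
  | flip t => exact L.ctrlNot_rename [] _ _ _
  | cnot c t => exact L.ctrlNot_rename [c] _ _ _
  | toffoli c c' t => exact L.ctrlNot_rename [c, c'] _ _ _

/-- Gates on the subsystem do not change the state of the other wires. -/
theorem gatesMat_rename [Fintype S] [Fintype Q] [DecidableEq Q] (L : Layout N eS ρ Q)
    (gs : List Gate) (p p' : S × Q) :
    gatesMat N (gs.map (Gate.rename ρ)) (L.J p) (L.J p') =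
      if p.2 = p'.2 then gatesMat s gs (eS p.1) (eS p'.1) else 0 := by
  induction gs generalizing p p' with
  | nil =>
    have e : L.J p = L.J p' ↔ p.2 = p'.2 ∧ eS p.1 = eS p'.1 := by
      rw [L.J.injective.eq_iff, Prod.ext_iff, eS.injective.eq_iff, and_comm]
    simp only [List.map_nil, gatesMat, Matrix.one_apply]
    by_cases hq : p.2 = p'.2
    · simp only [e, hq, true_and, if_true]
    · rw [if_neg hq, if_neg fun h => hq (e.1 h).1]
  | cons g gs ih =>
    simp only [List.map_cons, gatesMat, Matrix.mul_apply]
    rw [← L.J.sum_comp, Fintype.sum_prod_type]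
    simp only [ih, L.gate_rename]
    by_cases hq : p.2 = p'.2
    · simp only [hq, if_true]
      rw [← eS.sum_comp]
      refine Finset.sum_congr rfl fun z _ => ?_
      rw [Finset.sum_eq_single p'.2] <;> simp +contextual [eq_comm]
    · rw [if_neg hq]
      refine Finset.sum_eq_zero fun z _ => Finset.sum_eq_zero fun q _ => ?_
      by_cases h1 : p.2 = q
      · subst h1; simp [hq]
      · simp [h1]

/-- Additional wires after the given ones. -/
def pad (N e : ℕ) : Layout (N + e) (Equiv.refl (Bits N)) (gap N e) (Bits e) where
  J := Fin.appendEquiv N e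
  mono := gap_strictMono _ _
  top i := by unfold gap; split_ifs <;> omega
  sys z q i h := by
    change bitAt (Fin.append z q) _ = _
    simp [gap, h, bitAt_append]
  rest z z' q w h := by
    have hw : ¬ w < N := fun hw => h w hw (by simp [gap, hw])
    change bitAt (Fin.append z q) _ = bitAt (Fin.append z' q) _
    simp [bitAt_append, hw]

/-- A subsystem enlarged by fresh wires. -/
def grow (L : Layout N eS ρ Q) (e : ℕ) : Layout (N + e) (encPair eS (encSelf e)) ρ Q where
  J := ((Equiv.prodAssoc S (Bits e) Q).trans (((Equiv.refl S).prodCongr (Equiv.prodComm _ _)).trans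
    ((Equiv.prodAssoc S Q (Bits e)).symm))).trans
      ((L.J.prodCongr (Equiv.refl _)).trans (Fin.appendEquiv N e))
  mono := L.mono
  top i := by rw [add_assoc, L.top, add_assoc]
  sys := by
    rintro ⟨z, c⟩ q i h
    change bitAt (Fin.append (L.J (z, q)) c) (ρ i) = bitAt (Fin.append (eS z) c) i
    by_cases hi : i < s
    · rw [bitAt_append_lt _ _ (L.lt hi), bitAt_append_lt _ _ hi, L.sys_all]
    · obtain ⟨j, rfl⟩ := Nat.exists_eq_add_of_le (not_lt.1 hi)
      rw [L.top, bitAt_append_add, bitAt_append_add]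
  rest := by
    rintro ⟨z, c⟩ ⟨z', c'⟩ q w h
    change bitAt (Fin.append (L.J (z, q)) c) w = bitAt (Fin.append (L.J (z', q)) c') w
    rw [bitAt_append, bitAt_append]
    split_ifs with hw
    · exact L.rest _ _ _ _ fun i hi => h i (by omega)
    · obtain ⟨j, rfl⟩ := Nat.exists_eq_add_of_le (not_lt.1 hw)
      by_cases hj : j < e
      · exact absurd (L.top j) (h (s + j) (by omega))
      · rw [bitAt_of_le _ (by omega), bitAt_of_le _ (by omega)]

@[simp] theorem grow_J (L : Layout N eS ρ Q) (e : ℕ) (z : S) (c : Bits e) (q : Q) :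
    (L.grow e).J ((z, c), q) = Fin.append (L.J (z, q)) c := rfl

/-- Forget a part of the subsystem. -/
def split {S₂ : Type} {s₂ : ℕ} {eS₂ : S₂ ≃ Bits s₂} (L : Layout N (encPair eS eS₂) ρ Q) :
    Layout N eS (ρ ∘ gap s s₂) (Q × S₂) where
  J := ((Equiv.refl S).prodCongr (Equiv.prodComm _ _)).trans
    ((Equiv.prodAssoc S S₂ Q).symm.trans L.J)
  mono := L.mono.comp (gap_strictMono _ _)
  top i := by
    have : gap s s₂ (s + i) = s + s₂ + i := by unfold gap; split_ifs <;> omega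
    rw [Function.comp, this, L.top]
  sys z q i h := by
    have := L.sys_all ((z, q.2), q.1) i
    have hg : gap s s₂ i = i := by unfold gap; split_ifs; rfl
    rw [Function.comp, hg]
    exact this.trans (bitAt_append_lt _ _ h)
  rest := by
    rintro z z' ⟨q, z₂⟩ w h
    change bitAt (L.J ((z, z₂), q)) w = bitAt (L.J ((z', z₂), q)) w
    by_cases hs : ∃ i < s + s₂, ρ i = w
    · obtain ⟨i, hi, rfl⟩ := hs
      rw [L.sys_all, L.sys_all]
      have hi' : ¬ i < s := fun hi' => h i hi' (by simp [gap, hi'])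
      change bitAt (Fin.append (eS z) (eS₂ z₂)) i = bitAt (Fin.append (eS z') (eS₂ z₂)) i
      rw [bitAt_append, bitAt_append, if_neg hi', if_neg hi']
    · push Not at hs
      exact L.rest _ _ _ _ hs

/-- Describe the states of the subsystem in another way. -/
def recode {S' : Type} {s' : ℕ} {eS' : S' ≃ Bits s'} (L : Layout N eS ρ Q) (φ : S' ≃ S)
    (hs : s' = s) (hφ : ∀ z i, bitAt (eS (φ z)) i = bitAt (eS' z) i) : Layout N eS' ρ Q where
  J := (φ.prodCongr (Equiv.refl Q)).trans L.J
  mono := L.mono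
  top i := by rw [hs, L.top]
  sys z q i _ := (L.sys_all (φ z, q) i).trans (hφ z i)
  rest z z' q w h := L.rest _ _ q w (by rwa [hs] at h)

/-- No subsystem. -/
def empty (e : Q ≃ Bits N) : Layout N (Equiv.ofUnique Unit (Bits 0)) (gap 0 N) Q where
  J := (Equiv.uniqueProd Q Unit).trans e
  mono := gap_strictMono _ _
  top i := by simp [gap, add_comm]
  sys _ _ _ h := absurd h (Nat.not_lt_zero _)
  rest _ _ _ _ _ := rfl

end Layout

end

noncomputable section

/-! ### Unitarity of circuits -/

theorem oneQubit_mul (N t : ℕ) (u v : Matrix Bool Bool ℂ) :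
    oneQubit N t u * oneQubit N t v = oneQubit N t (u * v) := by
  ext a c
  rw [Matrix.mul_apply]
  by_cases ht : t < N
  · rw [← (Equiv.funSplitAt (⟨t, ht⟩ : Fin N) Bool).symm.sum_comp, Fintype.sum_prod_type]
    have h1 : ∀ (b d : Bits N), (∀ j : Fin N, (j : ℕ) ≠ t → b j = d j) ↔
        ((Equiv.funSplitAt (⟨t, ht⟩ : Fin N) Bool) b).2 =
          ((Equiv.funSplitAt (⟨t, ht⟩ : Fin N) Bool) d).2 := by
      intro b d
      rw [funext_iff]
      simp only [Equiv.funSplitAt_apply, Subtype.forall, ne_eq, Fin.ext_iff]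
    have h2 : ∀ b : Bits N, bitAt b t = ((Equiv.funSplitAt (⟨t, ht⟩ : Fin N) Bool) b).1 := by
      intro b; rw [bitAt_of_lt _ ht]; rfl
    simp only [oneQubit, if_pos ht, h1, h2, Equiv.apply_symm_apply]
    set a2 := ((Equiv.funSplitAt (⟨t, ht⟩ : Fin N) Bool) a).2
    set c2 := ((Equiv.funSplitAt (⟨t, ht⟩ : Fin N) Bool) c).2
    by_cases hac : a2 = c2
    · rw [if_pos hac, Matrix.mul_apply]
      refine Finset.sum_congr rfl fun b _ => ?_
      rw [Finset.sum_eq_single a2]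
      · simp [hac]
      · intro b2 _ hb
        rw [if_neg (Ne.symm hb), zero_mul]
      · simp
    · rw [if_neg hac]
      refine Finset.sum_eq_zero fun b _ => Finset.sum_eq_zero fun b2 _ => ?_
      by_cases h : a2 = b2
      · rw [if_neg (h ▸ hac : ¬ b2 = c2), mul_zero]
      · rw [if_neg h, zero_mul]
  · have h1 : ∀ b d : Bits N, (∀ j : Fin N, (j : ℕ) ≠ t → b j = d j) ↔ b = d := fun b d =>
      ⟨fun h => funext fun j => h j (by have := j.2; omega), fun h j _ => by rw [h]⟩
    simp only [oneQubit, if_neg ht, h1]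
    simp

theorem oneQubit_one (N t : ℕ) : oneQubit N t 1 = 1 := by
  ext a b
  unfold oneQubit
  by_cases h : a = b
  · subst h; simp
  · rw [Matrix.one_apply_ne h]
    split_ifs with h1 h2
    · refine Matrix.one_apply_ne fun e => h (funext fun j => ?_)
      by_cases hj : (j : ℕ) = t
      · subst hj; simpa using e
      · exact h1 j hj
    · exact absurd (funext fun j => h1 j (by have := j.2; omega)) h
    · rfl

theorem oneQubit_conjTranspose (N t : ℕ) (u : Matrix Bool Bool ℂ) :
    (oneQubit N t u)ᴴ = oneQubit N t uᴴ := by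
  ext a b
  simp only [Matrix.conjTranspose_apply, oneQubit]
  have : (∀ j : Fin N, (j : ℕ) ≠ t → b j = a j) ↔ ∀ j : Fin N, (j : ℕ) ≠ t → a j = b j :=
    forall₂_congr fun _ _ => eq_comm
  simp only [this]
  split_ifs <;> simp

theorem oneQubit_unitary (N t : ℕ) {u : Matrix Bool Bool ℂ}
    (hu : ∀ a b, ∑ c, star (u c a) * u c b = if a = b then 1 else 0) :
    (oneQubit N t u)ᴴ * oneQubit N t u = 1 := by
  have : uᴴ * u = 1 := by
    ext a b
    rw [Matrix.mul_apply, Matrix.one_apply, ← hu a b]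
    rfl
  rw [oneQubit_conjTranspose, oneQubit_mul, this, oneQubit_one]

/-- The map on basis states of a controlled NOT. -/
def ctrlMap (N : ℕ) (cs : List ℕ) (t : ℕ) (b : Bits N) : Bits N := fun j =>
  xor (b j) (decide ((j : ℕ) = t ∧ t ∉ cs ∧ ∀ c ∈ cs, bitAt b c = true))

theorem bitAt_ctrlMap {N : ℕ} (cs : List ℕ) (t : ℕ) (b : Bits N) {w : ℕ} (hw : w < N) :
    bitAt (ctrlMap N cs t b) w =
      xor (bitAt b w) (decide (w = t ∧ t ∉ cs ∧ ∀ c ∈ cs, bitAt b c = true)) := by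
  rw [bitAt_of_lt _ hw, ctrlMap, bitAt_of_lt b hw]

/-- The target is not one of the controls when the map acts at all, so the controls keep their
values and the second flip undoes the first. -/
theorem ctrlMap_involutive (N : ℕ) (cs : List ℕ) (t : ℕ) :
    Function.Involutive (ctrlMap N cs t) := by
  intro b
  refine bits_ext fun w hw => ?_
  rw [bitAt_ctrlMap _ _ _ hw, bitAt_ctrlMap _ _ _ hw]
  by_cases h : w = t ∧ t ∉ cs
  · have : ∀ c ∈ cs, bitAt (ctrlMap N cs t b) c = bitAt b c := by
      intro c hc
      by_cases hcN : c < N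
      · rw [bitAt_ctrlMap _ _ _ hcN]
        have : c ≠ t := fun e => h.2 (e ▸ hc)
        simp [this]
      · rw [bitAt_of_le _ (not_lt.1 hcN), bitAt_of_le _ (not_lt.1 hcN)]
    have e : (∀ c ∈ cs, bitAt (ctrlMap N cs t b) c = true) ↔ ∀ c ∈ cs, bitAt b c = true :=
      forall₂_congr fun c hc => by rw [this c hc]
    simp only [e, Bool.xor_assoc, Bool.xor_self, Bool.xor_false]
  · have h1 : ∀ p : Prop, ¬ (w = t ∧ t ∉ cs ∧ p) := fun p hp => h ⟨hp.1, hp.2.1⟩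
    simp only [h1, decide_false, Bool.xor_false]

theorem ctrlNot_apply (N : ℕ) (cs : List ℕ) (t : ℕ) (a b : Bits N) :
    ctrlNot N cs t a b = if a = ctrlMap N cs t b then 1 else 0 := rfl

theorem ctrlNot_unitary (N : ℕ) (cs : List ℕ) (t : ℕ) :
    (ctrlNot N cs t)ᴴ * ctrlNot N cs t = 1 := by
  ext a b
  simp [Matrix.mul_apply, ctrlNot_apply, Matrix.one_apply, (ctrlMap_involutive N cs t).injective.eq_iff,
    eq_comm]

theorem gate_unitary (N : ℕ) (g : Gate) : (g.mat N)ᴴ * g.mat N = 1 := by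
  have h2 : (((Real.sqrt 2 : ℝ) : ℂ))⁻¹ * (((Real.sqrt 2 : ℝ) : ℂ))⁻¹ = 1 / 2 := by
    rw [← mul_inv, ← Complex.ofReal_mul, Real.mul_self_sqrt (by norm_num)]
    norm_num
  cases g with
  | had t =>
    refine oneQubit_unitary N t ?_
    intro a b
    cases a <;> cases b <;> simp [sgn, Complex.conj_ofReal] <;> rw [h2] <;> norm_num
  | phase t =>
    refine oneQubit_unitary N t ?_
    intro a b
    have : (starRingEnd ℂ) (Complex.exp (Complex.I * (Real.pi / 4))) *
        Complex.exp (Complex.I * (Real.pi / 4)) = 1 := by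
      rw [← Complex.exp_conj, ← Complex.exp_add]
      simp [Complex.conj_ofNat]
    cases a <;> cases b <;> simp [this]
  | flip t => exact ctrlNot_unitary _ _ _
  | cnot c t => exact ctrlNot_unitary _ _ _
  | toffoli c c' t => exact ctrlNot_unitary _ _ _

theorem gatesMat_unitary (N : ℕ) (gs : List Gate) : (gatesMat N gs)ᴴ * gatesMat N gs = 1 := by
  induction gs with
  | nil => simp [gatesMat]
  | cons g gs ih =>
    rw [gatesMat, Matrix.conjTranspose_mul, Matrix.mul_assoc, ← Matrix.mul_assoc _ _ (g.mat N), ih,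
      Matrix.one_mul, gate_unitary]

theorem sum_norm_sq_gatesMat (N : ℕ) (gs : List Gate) (b : Bits N) :
    ∑ a, ‖gatesMat N gs a b‖ ^ 2 = 1 := by
  have h := congrFun (congrFun (gatesMat_unitary N gs) b) b
  rw [Matrix.mul_apply, Matrix.one_apply_eq] at h
  have h2 : ((∑ a, ‖gatesMat N gs a b‖ ^ 2 : ℝ) : ℂ) = 1 := by
    rw [← h]
    push_cast
    refine Finset.sum_congr rfl fun a _ => ?_
    rw [Matrix.conjTranspose_apply, ← Complex.conj_mul']
    rfl
  exact_mod_cast h2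

theorem Circuit.sum_out (C : Circuit) {n m : ℕ} (x : Bits n) :
    ∑ z : Bits m, C.out x z = 1 := by
  unfold Circuit.out
  rw [Finset.sum_comm, ← sum_norm_sq_gatesMat (n + C.anc) C.gates (Fin.append x (zeros C.anc))]
  refine Finset.sum_congr rfl fun a _ => ?_
  rw [Finset.sum_eq_single fun i : Fin m => bitAt a i]
  · simp [Circuit.amp]
  · intro z _ hz
    exact if_neg fun h => hz (funext fun i => (h i).symm)
  · simp

theorem Circuit.out_nonneg (C : Circuit) {n m : ℕ} (x : Bits n) (z : Bits m) : 0 ≤ C.out x z := by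
  refine Finset.sum_nonneg fun a _ => ?_
  split_ifs <;> positivity

/-! ### Permutations of basis states -/

theorem gatesMat_append (N : ℕ) (gs hs : List Gate) :
    gatesMat N (gs ++ hs) = gatesMat N hs * gatesMat N gs := by
  induction gs with
  | nil => simp [gatesMat]
  | cons g gs ih => simp [gatesMat, ih, Matrix.mul_assoc]

/-- The gates act on basis states of `N` wires by the map `f`. -/
def ActsBy (N : ℕ) (gs : List Gate) (f : Bits N → Bits N) : Prop :=
  ∀ a b, gatesMat N gs a b = if a = f b then 1 else 0

theorem ActsBy.append {N : ℕ} {gs hs : List Gate} {f g : Bits N → Bits N} (hg : ActsBy N gs f)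
    (hh : ActsBy N hs g) : ActsBy N (gs ++ hs) (g ∘ f) := by
  intro a b
  rw [gatesMat_append, Matrix.mul_apply]
  simp [hg _ _, hh _ _]

theorem actsBy_nil (N : ℕ) : ActsBy N [] id := fun a b => by simp [gatesMat, Matrix.one_apply]

/-- The map of `cnotRange`. -/
def rangeMap (N a b n : ℕ) (x : Bits N) : Bits N := fun j =>
  xor (x j) (decide (b ≤ j ∧ (j : ℕ) < b + n) && bitAt x (a + (j - b)))

theorem bitAt_rangeMap {N : ℕ} (a b n : ℕ) (x : Bits N) {w : ℕ} (hw : w < N) :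
    bitAt (rangeMap N a b n x) w =
      xor (bitAt x w) (decide (b ≤ w ∧ w < b + n) && bitAt x (a + (w - b))) := by
  rw [bitAt_of_lt _ hw, rangeMap, bitAt_of_lt x hw]

/-- Since the two ranges are disjoint, the earlier gates have not changed the control of the next
one. -/
theorem actsBy_cnotRange {N a b n : ℕ} (ha : a + n ≤ N) (hab : a + n ≤ b ∨ b + n ≤ a) :
    ActsBy N (cnotRange a b n) (rangeMap N a b n) := by
  induction n with
  | zero =>
    have : rangeMap N a b 0 = id := by
      funext x j
      have : ¬ (b ≤ j ∧ (j : ℕ) < b + 0) := by omega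
      simp only [rangeMap, this, decide_false, Bool.false_and, Bool.xor_false, id]
    rw [this]
    exact actsBy_nil N
  | succ n ih =>
    rw [cnotRange_succ]
    have h1 : ActsBy N [.cnot (a + n) (b + n)] (ctrlMap N [a + n] (b + n)) := by
      intro x y
      rw [gatesMat, gatesMat, Matrix.one_mul, Gate.mat, ctrlNot_apply]
    have h := (ih (by omega) (by omega)).append h1
    convert h using 1
    funext x
    refine bits_ext fun w hw => ?_
    rw [Function.comp, bitAt_ctrlMap _ _ _ hw, bitAt_rangeMap _ _ _ _ hw, bitAt_rangeMap _ _ _ _ hw]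
    have hc : bitAt (rangeMap N a b n x) (a + n) = bitAt x (a + n) := by
      rw [bitAt_rangeMap _ _ _ _ (by omega)]
      have : ¬ (b ≤ a + n ∧ a + n < b + n) := by omega
      rw [decide_eq_false this, Bool.false_and, Bool.xor_false]
    simp only [List.mem_singleton, forall_eq, hc]
    by_cases e : w = b + n
    · subst e
      have h1 : ¬ (b ≤ b + n ∧ b + n < b + n) := by omega
      have h2 : b ≤ b + n ∧ b + n < b + (n + 1) := by omega
      have h3 : ¬ b + n = a + n := by omega
      rw [decide_eq_false h1, decide_eq_true h2]
      simp [(show ¬ b = a by omega)]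
    · have h1 : (b ≤ w ∧ w < b + (n + 1)) ↔ (b ≤ w ∧ w < b + n) := by omega
      simp [h1, e]

/-- The gates add `g w` to the last `e` wires, where `w` is the state of the other wires. -/
def Adds (N e : ℕ) (gs : List Gate) (g : Bits N → Bits e) : Prop :=
  ∀ a w c, gatesMat (N + e) gs a (Fin.append w c) =
    if a = Fin.append w (xorBits c (g w)) then 1 else 0

theorem Adds.append {N e : ℕ} {gs hs : List Gate} {g h : Bits N → Bits e} (hg : Adds N e gs g)
    (hh : Adds N e hs h) : Adds N e (gs ++ hs) fun w => xorBits (g w) (h w) := by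
  intro a w c
  have : xorBits (xorBits c (g w)) (h w) = xorBits c (xorBits (g w) (h w)) := by
    funext i; simp [xorBits]
  rw [gatesMat_append, Matrix.mul_apply]
  simp [hg _ _ _, hh _ _ _, this]

theorem adds_nil (N e : ℕ) : Adds N e [] fun _ => zeros e := by
  intro a w c
  have : xorBits c (zeros e) = c := by funext i; simp [xorBits, zeros]
  simp [gatesMat, Matrix.one_apply, this]

/-- The string `f`, moved to the positions from `off` on. -/
def place (e off : ℕ) {len : ℕ} (f : Bits len) : Bits e := fun j =>
  decide (off ≤ j) && bitAt f (j - off)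

theorem bitAt_place {e : ℕ} (off : ℕ) {len : ℕ} (f : Bits len) {i : ℕ} (hi : i < e) :
    bitAt (place e off f) i = (decide (off ≤ i) && bitAt f (i - off)) := by
  rw [bitAt_of_lt _ hi, place]

theorem xorBits_place_eq_append {m n : ℕ} (x : Bits m) (y : Bits n) :
    xorBits (place (m + n) 0 x) (place (m + n) m y) = Fin.append x y := by
  refine bits_ext fun i hi => ?_
  rw [bitAt_xorBits, bitAt_place _ _ hi, bitAt_place _ _ hi, bitAt_append]
  by_cases h : i < m
  · simp [h, not_le.2 h]
  · simp [h, not_lt.1 h, bitAt_of_le x (not_lt.1 h)]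

theorem place_zero {e : ℕ} (f : Bits e) : place e 0 f = f := by
  refine bits_ext fun i hi => ?_
  rw [bitAt_place _ _ hi]; simp

theorem adds_cnotRange {N e a off len : ℕ} (ha : a + len ≤ N) :
    Adds N e (cnotRange a (N + off) len) fun w =>
      place e off (fun i : Fin len => bitAt w (a + i)) := by
  intro x w c
  rw [actsBy_cnotRange (N := N + e) (by omega) (by omega) x]
  congr 2
  refine bits_ext fun i hi => ?_
  rw [bitAt_rangeMap _ _ _ _ hi, bitAt_append, bitAt_append w (xorBits _ _)]
  by_cases h : i < N
  · have : ¬ (N + off ≤ i ∧ i < N + off + len) := by omega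
    simp [h, this]
  · rw [if_neg h, if_neg h, bitAt_xorBits, bitAt_place _ _ (by omega)]
    obtain ⟨j, rfl⟩ := Nat.exists_eq_add_of_le (not_lt.1 h)
    have e1 : N + j - N = j := by omega
    rw [e1]
    congr 1
    by_cases h1 : off ≤ j
    · by_cases h2 : j - off < len
      · have h3 : N + off ≤ N + j ∧ N + j < N + off + len := by omega
        rw [bitAt_of_lt _ h2, bitAt_append_lt _ _ (by omega)]
        simp only [h1, h3, and_self, decide_true, Bool.true_and]
        congr 2; omega
      · have h3 : ¬ (N + off ≤ N + j ∧ N + j < N + off + len) := by omega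
        rw [bitAt_of_le _ (not_lt.1 h2), decide_eq_false h3, Bool.false_and, Bool.and_false]
    · have h3 : ¬ (N + off ≤ N + j ∧ N + j < N + off + len) := by omega
      rw [decide_eq_false h3, decide_eq_false h1, Bool.false_and, Bool.false_and]

/-! ### Amplitudes -/

/-- The amplitudes after running gates on the input `x`, extended by zeros to `N` wires. -/
def amp (N : ℕ) (gs : List Gate) {n : ℕ} (x : Bits n) (a : Bits N) : ℂ :=
  gatesMat N gs a (zext N x)

theorem Circuit.amp_eq (C : Circuit) {n : ℕ} (x : Bits n) :
    C.amp x = _root_.amp (n + C.anc) C.gates x := by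
  funext a
  rw [Circuit.amp, append_zeros_eq_zext]; rfl

theorem amp_pad {N n : ℕ} (h : n ≤ N) (e : ℕ) (gs : List Gate) (x : Bits n) (a : Bits N)
    (c : Bits e) : amp (N + e) (gs.map (Gate.rename (gap N e))) x (Fin.append a c) =
      if c = zeros e then amp N gs x a else 0 := by
  have := (Layout.pad N e).gatesMat_rename gs (a, c) (zext N x, zeros e)
  unfold amp
  rw [zext_add h]
  exact this

/-- The amplitudes after gates on a subsystem and on fresh wires. -/
theorem Layout.amp_grow {N n s : ℕ} {S Q : Type} [Fintype S] [Fintype Q] {eS : S ≃ Bits s}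
    {ρ : ℕ → ℕ} (L : Layout N eS ρ Q) (h : n ≤ N) (e : ℕ) (gs hs : List Gate) (x : Bits n) (z : S)
    (c : Bits e) (q : Q) :
    amp (N + e) (gs.map (Gate.rename (gap N e)) ++ hs.map (Gate.rename ρ)) x
        ((L.grow e).J ((z, c), q)) =
      ∑ z₀, gatesMat (s + e) hs (Fin.append (eS z) c) (Fin.append (eS z₀) (zeros e)) *
        amp N gs x (L.J (z₀, q)) := by
  classical
  rw [amp, gatesMat_append, Matrix.mul_apply, ← (L.grow e).J.sum_comp]
  simp only [(L.grow e).gatesMat_rename]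
  change ∑ p : (S × Bits e) × Q, _ * amp (N + e) (gs.map (Gate.rename (gap N e))) x _ = _
  rw [Fintype.sum_prod_type, Fintype.sum_prod_type]
  refine Finset.sum_congr rfl fun z₀ _ => ?_
  rw [Finset.sum_eq_single (zeros e), Finset.sum_eq_single q]
  · rw [grow_J, amp_pad h, if_pos rfl, if_pos rfl]; rfl
  · intro q' _ hq
    rw [if_neg (Ne.symm hq), zero_mul]
  · simp
  · intro c' _ hc
    refine Finset.sum_eq_zero fun q' _ => ?_
    rw [grow_J, amp_pad h, if_neg hc, mul_zero]
  · simp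

end

noncomputable section

/-! ### Efficient procedures with a quantum register and classical records -/

/-- The empty string. -/
def encUnit : Unit ≃ Bits 0 := Equiv.ofUnique Unit (Bits 0)

/-- An efficient procedure on inputs of length `n` whose state is described by a record in `R` and a
quantum register `S`; `Q` describes the other wires. -/
structure Proc (n : ℕ → ℕ) (R : ℕ → Type) {S : ℕ → Type} {s : ℕ → ℕ}
    (eS : ∀ l, S l ≃ Bits (s l)) where
  N : ℕ → ℕ
  anc : ℕ → ℕ
  hN : ∀ l, N l = n l + anc l
  gates : ℕ → List Gate
  ρ : ℕ → ℕ → ℕ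
  Q : ℕ → Type
  fin : ∀ l, Fintype (Q l)
  L : ∀ l, Layout (N l) (eS l) (ρ l) (Q l)
  reg : ∀ l, Q l → R l
  N_eff : EfficientLength N
  anc_eff : EfficientLength anc
  gates_eff : EffGates gates
  ρ_eff : EffMap ρ

namespace Proc

variable {n : ℕ → ℕ} {R : ℕ → Type} {S : ℕ → Type} {s : ℕ → ℕ} {eS : ∀ l, S l ≃ Bits (s l)}

instance (P : Proc n R eS) (l : ℕ) : Fintype (P.Q l) := P.fin l

theorem le_N (P : Proc n R eS) (l : ℕ) : n l ≤ P.N l := by rw [P.hN]; omega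

/-- The amplitudes of the states of the register, given the other wires. -/
def vec (P : Proc n R eS) (l : ℕ) (x : Bits (n l)) (q : P.Q l) (z : S l) : ℂ :=
  amp (P.N l) (P.gates l) x ((P.L l).J (z, q))

open Classical in
/-- The subnormalized state of the register for the record `r`. -/
def T (P : Proc n R eS) (l : ℕ) (x : Bits (n l)) (r : R l) : Matrix (S l) (S l) ℂ :=
  fun z z' => ∑ q, if P.reg l q = r then P.vec l x q z * star (P.vec l x q z') else 0

/-- The string `f` of length `len`, computed from the record, can be found on consecutive wires. -/
def Readable (P : Proc n R eS) (len : ℕ → ℕ) (f : ∀ l, R l → Bits (len l)) : Prop :=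
  ∃ st, EfficientLength st ∧ EfficientLength len ∧ ∀ l, st l + len l ≤ P.N l ∧
    ∀ z q i, i < len l → bitAt ((P.L l).J (z, q)) (st l + i) = bitAt (f l (P.reg l q)) i

/-- Nothing but the input. -/
def init (n : ℕ → ℕ) (hn : EfficientLength n) :
    Proc n (fun l => Bits (n l)) (fun _ => encUnit) where
  N := n
  anc _ := 0
  hN _ := rfl
  gates _ := []
  ρ l := gap 0 (n l)
  Q l := Bits (n l)
  fin _ := inferInstance
  L _ := Layout.empty (Equiv.refl _)
  reg _ := id
  N_eff := hn
  anc_eff := efficientLength_const 0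
  gates_eff := effGates_nil
  ρ_eff := effMap_gap (efficientLength_const 0) hn

open Classical in
theorem T_init (hn : EfficientLength n) (l : ℕ) (x r : Bits (n l)) (u u' : Unit) :
    (init n hn).T l x r u u' = if r = x then 1 else 0 := by
  have hz : zext (n l) x = x := bits_ext fun i hi => bitAt_zext _ hi
  have hv : ∀ (q : Bits (n l)) (z : Unit), (init n hn).vec l x q z = if q = x then 1 else 0 := by
    intro q z
    change gatesMat (n l) [] q (zext (n l) x) = _
    rw [hz, gatesMat, Matrix.one_apply]
  change ∑ q : Bits (n l), @ite ℂ (q = r) (Classical.propDecidable _)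
    ((init n hn).vec l x q u * star ((init n hn).vec l x q u')) 0 = _
  rw [Finset.sum_eq_single r]
  · rw [if_pos rfl, hv]
    split_ifs <;> simp
  · intro b _ hb
    rw [if_neg hb]
  · simp

theorem readable_init (hn : EfficientLength n) : (init n hn).Readable n (fun _ r => r) :=
  ⟨fun _ => 0, efficientLength_const 0, hn, fun l => ⟨by simp [init], fun z q i _ => by
    rw [zero_add]; rfl⟩⟩

/-- Add fresh wires to the register and run gates on it. -/
def grow (P : Proc n R eS) {e : ℕ → ℕ} (he : EfficientLength e) {hs : ℕ → List Gate}
    (hhs : EffGates hs) : Proc n R (fun l => encPair (eS l) (encSelf (e l))) where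
  N l := P.N l + e l
  anc l := P.anc l + e l
  hN l := by rw [P.hN, add_assoc]
  gates l := (P.gates l).map (Gate.rename (gap (P.N l) (e l))) ++ (hs l).map (Gate.rename (P.ρ l))
  ρ := P.ρ
  Q := P.Q
  fin := P.fin
  L l := (P.L l).grow (e l)
  reg := P.reg
  N_eff := P.N_eff.add he
  anc_eff := P.anc_eff.add he
  gates_eff := (effMap_gap P.N_eff he _ P.gates_eff).append (P.ρ_eff _ hhs)
  ρ_eff := P.ρ_eff

theorem vec_grow [∀ l, Fintype (S l)] (P : Proc n R eS) {e : ℕ → ℕ} (he : EfficientLength e)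
    {hs : ℕ → List Gate} (hhs : EffGates hs) (l : ℕ) (x : Bits (n l)) (q : P.Q l) (z : S l)
    (c : Bits (e l)) : (P.grow he hhs).vec l x q (z, c) =
      ∑ z₀, gatesMat (s l + e l) (hs l) (Fin.append (eS l z) c)
        (Fin.append (eS l z₀) (zeros (e l))) * P.vec l x q z₀ :=
  (P.L l).amp_grow (P.le_N l) (e l) _ _ x z c q

theorem Readable.grow {P : Proc n R eS} {len : ℕ → ℕ} {f : ∀ l, R l → Bits (len l)}
    (h : P.Readable len f) {e : ℕ → ℕ} (he : EfficientLength e) {hs : ℕ → List Gate}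
    (hhs : EffGates hs) : (P.grow he hhs).Readable len f := by
  obtain ⟨st, h1, h2, h3⟩ := h
  refine ⟨st, h1, h2, fun l => ⟨(h3 l).1.trans (Nat.le_add_right _ _), ?_⟩⟩
  rintro ⟨z, c⟩ q i hi
  have := (h3 l).1
  exact (bitAt_append_lt _ _ (by omega)).trans ((h3 l).2 z q i hi)

/-- Use a part of the register for the record or forget it. -/
def split {R' S₂ : ℕ → Type} {s₂ : ℕ → ℕ} {eS₂ : ∀ l, S₂ l ≃ Bits (s₂ l)}
    (P : Proc n R (fun l => encPair (eS l) (eS₂ l))) [∀ l, Fintype (S₂ l)]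
    (g : ∀ l, R l → S₂ l → R' l) (hs : EfficientLength s) (hs₂ : EfficientLength s₂) :
    Proc n R' eS where
  N := P.N
  anc := P.anc
  hN := P.hN
  gates := P.gates
  ρ l := P.ρ l ∘ gap (s l) (s₂ l)
  Q l := P.Q l × S₂ l
  fin _ := inferInstance
  L l := (P.L l).split
  reg l q := g l (P.reg l q.1) q.2
  N_eff := P.N_eff
  anc_eff := P.anc_eff
  gates_eff := P.gates_eff
  ρ_eff := P.ρ_eff.comp (effMap_gap hs hs₂)

-- States of wires outside the register do not interfere in `T`. Moving a part of the register to
-- the record therefore acts as a measurement and selects a diagonal block.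
open Classical in
theorem T_split_mk {S₂ : ℕ → Type} {s₂ : ℕ → ℕ} {eS₂ : ∀ l, S₂ l ≃ Bits (s₂ l)}
    (P : Proc n R (fun l => encPair (eS l) (eS₂ l))) [∀ l, Fintype (S₂ l)]
    (hs : EfficientLength s) (hs₂ : EfficientLength s₂) (l : ℕ) (x : Bits (n l)) (r : R l × S₂ l)
    (z z' : S l) :
    (P.split (R' := fun l => R l × S₂ l) (fun _ => Prod.mk) hs hs₂).T l x r z z' =
      P.T l x r.1 (z, r.2) (z', r.2) := by
  change ∑ q : P.Q l × S₂ l, @ite ℂ ((P.reg l q.1, q.2) = r) (Classical.propDecidable _)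
    (P.vec l x q.1 (z, q.2) * star (P.vec l x q.1 (z', q.2))) 0 = _
  rw [Fintype.sum_prod_type, T]
  refine Finset.sum_congr rfl fun q _ => ?_
  rw [Finset.sum_eq_single r.2]
  · simp [Prod.ext_iff]
  · intro b _ hb
    simp [Prod.ext_iff, hb]
  · simp

-- Forgetting a part of the register without recording it is a partial trace.
open Classical in
theorem T_split_fst {S₂ : ℕ → Type} {s₂ : ℕ → ℕ} {eS₂ : ∀ l, S₂ l ≃ Bits (s₂ l)}
    (P : Proc n R (fun l => encPair (eS l) (eS₂ l))) [∀ l, Fintype (S₂ l)]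
    (hs : EfficientLength s) (hs₂ : EfficientLength s₂) (l : ℕ) (x : Bits (n l)) (r : R l)
    (z z' : S l) :
    (P.split (fun _ r _ => r) hs hs₂).T l x r z z' = ∑ z₂, P.T l x r (z, z₂) (z', z₂) := by
  change ∑ q : P.Q l × S₂ l, (if P.reg l q.1 = r then
    P.vec l x q.1 (z, q.2) * star (P.vec l x q.1 (z', q.2)) else 0) = _
  rw [Fintype.sum_prod_type_right]
  rfl

/-- Describe the states of the register in another way. -/
def recode (P : Proc n R eS) {S' : ℕ → Type} {s' : ℕ → ℕ} (eS' : ∀ l, S' l ≃ Bits (s' l))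
    (φ : ∀ l, S' l ≃ S l) (hs : ∀ l, s' l = s l)
    (hφ : ∀ l z i, bitAt (eS l (φ l z)) i = bitAt (eS' l z) i) : Proc n R eS' where
  N := P.N
  anc := P.anc
  hN := P.hN
  gates := P.gates
  ρ := P.ρ
  Q := P.Q
  fin := P.fin
  L l := (P.L l).recode (φ l) (hs l) (hφ l)
  reg := P.reg
  N_eff := P.N_eff
  anc_eff := P.anc_eff
  gates_eff := P.gates_eff
  ρ_eff := P.ρ_eff

theorem Readable.recode {P : Proc n R eS} {len : ℕ → ℕ} {f : ∀ l, R l → Bits (len l)}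
    (h : P.Readable len f) {S' : ℕ → Type} {s' : ℕ → ℕ} (eS' : ∀ l, S' l ≃ Bits (s' l))
    (φ : ∀ l, S' l ≃ S l) (hs : ∀ l, s' l = s l)
    (hφ : ∀ l z i, bitAt (eS l (φ l z)) i = bitAt (eS' l z) i) :
    (P.recode eS' φ hs hφ).Readable len f := by
  obtain ⟨st, h1, h2, h3⟩ := h
  exact ⟨st, h1, h2, fun l => ⟨(h3 l).1, fun z => (h3 l).2 (φ l z)⟩⟩

/-- Forget the register. -/
def discard (P : Proc n R eS) [∀ l, Fintype (S l)] : Proc n R (fun _ => encUnit) where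
  N := P.N
  anc := P.anc
  hN := P.hN
  gates := P.gates
  ρ l := gap 0 (P.N l)
  Q l := S l × P.Q l
  fin _ := inferInstance
  L l := Layout.empty (P.L l).J
  reg l q := P.reg l q.2
  N_eff := P.N_eff
  anc_eff := P.anc_eff
  gates_eff := P.gates_eff
  ρ_eff := effMap_gap (efficientLength_const 0) P.N_eff

theorem T_discard (P : Proc n R eS) [∀ l, Fintype (S l)] (l : ℕ) (x : Bits (n l)) (r : R l)
    (u u' : Unit) : P.discard.T l x r u u' = (P.T l x r).trace := by
  classical
  change ∑ q : S l × P.Q l, (if P.reg l q.2 = r then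
    P.vec l x q.2 q.1 * star (P.vec l x q.2 q.1) else 0) = _
  rw [Fintype.sum_prod_type]
  rfl

theorem Readable.discard {P : Proc n R eS} [∀ l, Fintype (S l)] {len : ℕ → ℕ}
    {f : ∀ l, R l → Bits (len l)} (h : P.Readable len f) : P.discard.Readable len f := by
  obtain ⟨st, h1, h2, h3⟩ := h
  exact ⟨st, h1, h2, fun l => ⟨(h3 l).1, fun _ q => (h3 l).2 q.1 q.2⟩⟩

/-! #### Loading classical data -/

/-- Efficient gates add `g`, computed from the record, to `e` fresh wires. -/
def Loads (P : Proc n R eS) (e : ℕ → ℕ) (g : ∀ l, R l → Bits (e l)) : Prop :=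
  ∃ ks : ℕ → List Gate, EffGates ks ∧ ∀ l, ∃ gw : Bits (P.N l) → Bits (e l),
    Adds (P.N l) (e l) (ks l) gw ∧ ∀ z q, gw ((P.L l).J (z, q)) = g l (P.reg l q)

theorem loads_nil (P : Proc n R eS) (e : ℕ → ℕ) : P.Loads e fun l _ => zeros (e l) :=
  ⟨fun _ => [], effGates_nil, fun _ => ⟨_, adds_nil _ _, fun _ _ => rfl⟩⟩

theorem Loads.xor {P : Proc n R eS} {e : ℕ → ℕ} {f g : ∀ l, R l → Bits (e l)} (hf : P.Loads e f)
    (hg : P.Loads e g) : P.Loads e fun l r => xorBits (f l r) (g l r) := by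
  obtain ⟨ks, h1, h2⟩ := hf
  obtain ⟨ks', h1', h2'⟩ := hg
  refine ⟨fun l => ks l ++ ks' l, h1.append h1', fun l => ?_⟩
  obtain ⟨gw, h3, h4⟩ := h2 l
  obtain ⟨gw', h3', h4'⟩ := h2' l
  exact ⟨_, h3.append h3', fun z q => by rw [h4, h4']⟩

/-- The string is classical given the record, so it is copied by controlled NOTs whose controls are
its wires. -/
theorem Readable.loads {P : Proc n R eS} {len : ℕ → ℕ} {f : ∀ l, R l → Bits (len l)}
    (h : P.Readable len f) {off : ℕ → ℕ} (hoff : EfficientLength off) (e : ℕ → ℕ) :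
    P.Loads e fun l r => place (e l) (off l) (f l r) := by
  obtain ⟨st, h1, h2, h3⟩ := h
  refine ⟨_, PolyStr.cnotRange h1 (P.N_eff.add hoff) h2, fun l =>
    ⟨_, adds_cnotRange (h3 l).1, fun z q => ?_⟩⟩
  congr 1
  funext i
  rw [(h3 l).2 z q i i.2, bitAt_fin]

theorem Readable.loads_self {P : Proc n R eS} {len : ℕ → ℕ} {f : ∀ l, R l → Bits (len l)}
    (h : P.Readable len f) : P.Loads len f := by
  simpa only [place_zero] using h.loads (efficientLength_const 0) len

/-- Loading adds modulo 2 to fresh wires, and a concatenation is the sum of its two parts at their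
positions. -/
theorem Loads.append {P : Proc n R eS} {a b : ℕ → ℕ} {f : ∀ l, R l → Bits (a l)}
    {g : ∀ l, R l → Bits (b l)} (hf : P.Loads (fun l => a l + b l) fun l r => place _ 0 (f l r))
    (hg : P.Loads (fun l => a l + b l) fun l r => place _ (a l) (g l r)) :
    P.Loads (fun l => a l + b l) fun l r => Fin.append (f l r) (g l r) := by
  simpa only [xorBits_place_eq_append] using hf.xor hg

theorem _root_.amp_adds {N n e : ℕ} (h : n ≤ N) (gs ks : List Gate) {gw : Bits N → Bits e}
    (hk : Adds N e ks gw) (x : Bits n) (a : Bits N) (c : Bits e) :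
    amp (N + e) (gs.map (Gate.rename (gap N e)) ++ ks) x (Fin.append a c) =
      if c = gw a then amp N gs x a else 0 := by
  classical
  rw [amp, gatesMat_append, Matrix.mul_apply, ← (Fin.appendEquiv N e).sum_comp]
  change ∑ p : Bits N × Bits e, gatesMat (N + e) ks (Fin.append a c) (Fin.append p.1 p.2) *
    amp (N + e) (gs.map (Gate.rename (gap N e))) x (Fin.append p.1 p.2) = _
  simp only [amp_pad h, hk _ _ _]
  have hinj : ∀ (a a' : Bits N) (c c' : Bits e),
      Fin.append a c = Fin.append a' c' ↔ a = a' ∧ c = c' := by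
    intro a a' c c'
    have := (Fin.appendEquiv N e (α := Bool)).injective.eq_iff (a := (a, c)) (b := (a', c'))
    rw [Prod.ext_iff] at this
    exact this
  have hx : ∀ c : Bits e, xorBits (zeros e) c = c := fun c => by funext i; simp [xorBits, zeros]
  rw [Fintype.sum_prod_type, Finset.sum_eq_single a, Finset.sum_eq_single (zeros e)]
  · simp [hinj, hx]
  · intro b _ hb
    simp [hb]
  · simp
  · intro b _ hb
    refine Finset.sum_eq_zero fun d _ => ?_
    simp [hinj, Ne.symm hb]
  · simp

/-- Load classical data into the register. -/
def load (P : Proc n R (fun _ => encUnit)) {e : ℕ → ℕ} (he : EfficientLength e)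
    {g : ∀ l, R l → Bits (e l)} (hg : P.Loads e g) : Proc n R (fun l => encSelf (e l)) where
  N l := P.N l + e l
  anc l := P.anc l + e l
  hN l := by rw [P.hN, add_assoc]
  gates l := (P.gates l).map (Gate.rename (gap (P.N l) (e l))) ++ hg.choose l
  ρ := P.ρ
  Q := P.Q
  fin := P.fin
  L l := ((P.L l).grow _).recode (Equiv.uniqueProd (Bits (e l)) Unit).symm (zero_add _).symm
    (fun z i => by
      change bitAt (Fin.append (encUnit ()) z) i = bitAt z i
      rw [bitAt_append, if_neg (Nat.not_lt_zero i), Nat.sub_zero])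
  reg := P.reg
  N_eff := P.N_eff.add he
  anc_eff := P.anc_eff.add he
  gates_eff := (effMap_gap P.N_eff he _ P.gates_eff).append hg.choose_spec.1
  ρ_eff := P.ρ_eff

open Classical in
theorem vec_load (P : Proc n R (fun _ => encUnit)) {e : ℕ → ℕ} (he : EfficientLength e)
    {g : ∀ l, R l → Bits (e l)} (hg : P.Loads e g) (l : ℕ) (x : Bits (n l)) (q : P.Q l)
    (c : Bits (e l)) :
    (P.load he hg).vec l x q c = if c = g l (P.reg l q) then P.vec l x q () else 0 := by
  obtain ⟨gw, h1, h2⟩ := hg.choose_spec.2 l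
  have := amp_adds (P.le_N l) (P.gates l) _ h1 x ((P.L l).J ((), q)) c
  rw [h2] at this
  exact this.trans (if_congr Iff.rfl rfl rfl)

theorem Readable.load {P : Proc n R (fun _ => encUnit)} {len : ℕ → ℕ}
    {f : ∀ l, R l → Bits (len l)} (h : P.Readable len f) {e : ℕ → ℕ} (he : EfficientLength e)
    {g : ∀ l, R l → Bits (e l)} (hg : P.Loads e g) : (P.load he hg).Readable len f := by
  obtain ⟨st, h1, h2, h3⟩ := h
  refine ⟨st, h1, h2, fun l => ⟨(h3 l).1.trans (Nat.le_add_right _ _), fun z q i hi => ?_⟩⟩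
  have := (h3 l).1
  exact (bitAt_append_lt _ _ (by omega)).trans ((h3 l).2 () q i hi)

theorem Readable.split {R' S₂ : ℕ → Type} {s₂ : ℕ → ℕ} {eS₂ : ∀ l, S₂ l ≃ Bits (s₂ l)}
    {P : Proc n R (fun l => encPair (eS l) (eS₂ l))} [∀ l, Fintype (S₂ l)] {len : ℕ → ℕ}
    {f : ∀ l, R l → Bits (len l)} (h : P.Readable len f) {f' : ∀ l, R' l → Bits (len l)}
    {g : ∀ l, R l → S₂ l → R' l} (hf : ∀ l r u, f' l (g l r u) = f l r)
    (hs : EfficientLength s) (hs₂ : EfficientLength s₂) :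
    (P.split g hs hs₂).Readable len f' := by
  obtain ⟨st, h1, h2, h3⟩ := h
  refine ⟨st, h1, h2, fun l => ⟨(h3 l).1, fun z q i hi => ?_⟩⟩
  exact ((h3 l).2 (z, q.2) q.1 i hi).trans (congrArg (bitAt · i) (hf l _ _).symm)

end Proc

end

noncomputable section

/-- The circuits implement the measurements `E`. -/
def Measures {I H : ℕ → Type} {n a : ℕ → ℕ} (eI : ∀ l, I l ≃ Bits (a l))
    (eH : ∀ l, H l ≃ Bits (n l)) (E : ∀ l, I l → Matrix (H l) (H l) ℂ) (C : ℕ → Circuit) : Prop :=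
  ∀ l (x x' : H l) (i : I l) (c : Bits (C l).anc),
    gatesMat (n l + a l + (C l).anc) (C l).gates
        (Fin.append (Fin.append (eH l x') (eI l i)) c)
        (Fin.append (Fin.append (eH l x) (zeros (a l))) (zeros (C l).anc)) =
      if c = zeros (C l).anc then E l i x' x else 0

namespace Proc

variable {n : ℕ → ℕ} {R : ℕ → Type} {S : ℕ → Type} {s : ℕ → ℕ} {eS : ∀ l, S l ≃ Bits (s l)}

open Classical in
theorem T_eq_sum (P : Proc n R eS) (l : ℕ) (x : Bits (n l)) (r : R l) :
    P.T l x r = ∑ q, if P.reg l q = r then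
      Matrix.vecMulVec (P.vec l x q) (star (P.vec l x q)) else 0 := by
  ext z z'
  rw [Matrix.sum_apply]
  refine Finset.sum_congr rfl fun q _ => ?_
  split_ifs <;> rfl

/-! ### Measurements -/

section Measure

variable {I : ℕ → Type} {a : ℕ → ℕ} (eI : ∀ l, I l ≃ Bits (a l))
  {E : ∀ l, I l → Matrix (S l) (S l) ℂ} {C : ℕ → Circuit}

/-- Measure the register with the circuits `C`, keeping the outcome in a coherent way. -/
def measure (P : Proc n R eS) (hs : EfficientLength s) (ha : EfficientLength a)
    (hC : EfficientCircuits C) : Proc n R (fun l => encPair (eS l) (eI l)) :=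
  -- The wires for the outcome come first, without gates; then the workspace is added and the
  -- circuit runs on everything. The split forgets the workspace.
  ((((P.grow ha effGates_nil).grow ((efficientCircuits_iff_anc_gates _).1 hC).1
    ((efficientCircuits_iff_anc_gates _).1 hC).2).split (fun _ r _ => r) (hs.add ha)
    ((efficientCircuits_iff_anc_gates _).1 hC).1)).recode
    (fun l => encPair (eS l) (eI l)) (fun l => (Equiv.refl (S l)).prodCongr (eI l)) (fun _ => rfl)
    (fun _ _ _ => rfl)

theorem vec_grow_nil [∀ l, Fintype (S l)] (P : Proc n R eS) {e : ℕ → ℕ} (he : EfficientLength e)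
    (l : ℕ) (x : Bits (n l)) (q : P.Q l) (z : S l) (c : Bits (e l)) :
    (P.grow he effGates_nil).vec l x q (z, c) = if c = zeros (e l) then P.vec l x q z else 0 := by
  classical
  rw [vec_grow]
  have : ∀ z₀, gatesMat (s l + e l) [] (Fin.append (eS l z) c)
      (Fin.append (eS l z₀) (zeros (e l))) = if z = z₀ ∧ c = zeros (e l) then 1 else 0 := by
    intro z₀
    have h := (encPair (eS l) (encSelf (e l))).injective.eq_iff (a := (z, c))
      (b := (z₀, zeros (e l)))
    rw [Prod.ext_iff] at h
    rw [gatesMat, Matrix.one_apply]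
    exact if_congr h rfl rfl
  simp only [this]
  by_cases hc : c = zeros (e l) <;> simp [hc]

theorem vec_measure [∀ l, Fintype (S l)] (P : Proc n R eS)
    (hs : EfficientLength s) (ha : EfficientLength a) (hC : EfficientCircuits C)
    (hE : Measures eI eS E C) (l : ℕ) (x : Bits (n l)) (q : P.Q l) (d : Bits (C l).anc) (z : S l)
    (i : I l) : (P.measure eI hs ha hC).vec l x (q, d) (z, i) =
      if d = zeros _ then (E l i).mulVec (P.vec l x q) z else 0 := by
  refine (vec_grow (P.grow ha effGates_nil) ((efficientCircuits_iff_anc_gates _).1 hC).1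
    ((efficientCircuits_iff_anc_gates _).1 hC).2 l x q (z, eI l i) d).trans ?_
  rw [Fintype.sum_prod_type]
  simp only [vec_grow_nil]
  have : ∀ z₀ : S l, gatesMat (s l + a l + (C l).anc) (C l).gates
      (Fin.append (encPair (eS l) (encSelf (a l)) (z, eI l i)) d)
      (Fin.append (encPair (eS l) (encSelf (a l)) (z₀, zeros (a l))) (zeros (C l).anc)) =
      if d = zeros _ then E l i z z₀ else 0 := fun z₀ => hE l z₀ z i d
  by_cases hd : d = zeros _
  · simp only [hd, if_true] at this ⊢
    refine Finset.sum_congr rfl fun z₀ _ => ?_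
    rw [Finset.sum_eq_single (zeros (a l)), if_pos rfl, this]
    · intro b _ hb; rw [if_neg hb, mul_zero]
    · simp
  · simp only [hd, if_false] at this ⊢
    refine Finset.sum_eq_zero fun z₀ _ => ?_
    rw [Finset.sum_eq_single (zeros (a l)), if_pos rfl, this, zero_mul]
    · intro b _ hb; rw [if_neg hb, mul_zero]
    · simp

/-- The workspace ends in the state zero, so forgetting it destroys no coherence between outcomes,
and entries with different outcomes `i`, `i'` survive. -/
theorem T_measure [∀ l, Fintype (S l)] (P : Proc n R eS)
    (hs : EfficientLength s) (ha : EfficientLength a) (hC : EfficientCircuits C)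
    (hE : Measures eI eS E C) (l : ℕ) (x : Bits (n l)) (r : R l) (z z' : S l) (i i' : I l) :
    (P.measure eI hs ha hC).T l x r (z, i) (z', i') =
      (E l i * P.T l x r * (E l i')ᴴ) z z' := by
  classical
  let w : P.Q l × Bits (C l).anc → S l × I l → ℂ := fun p => (P.measure eI hs ha hC).vec l x p
  have hw : ∀ (q : P.Q l) (d : Bits (C l).anc) (z : S l) (i : I l), w (q, d) (z, i) =
      if d = zeros _ then (E l i).mulVec (P.vec l x q) z else 0 := fun q d z i =>
    vec_measure eI P hs ha hC hE l x q d z i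
  have h : (P.measure eI hs ha hC).T l x r (z, i) (z', i') = ∑ p : P.Q l × Bits (C l).anc,
      @ite ℂ (P.reg l p.1 = r) (Classical.propDecidable _) (w p (z, i) * star (w p (z', i'))) 0 := rfl
  rw [h, Fintype.sum_prod_type, T_eq_sum, Finset.mul_sum, Finset.sum_mul, Matrix.sum_apply]
  refine Finset.sum_congr rfl fun q _ => ?_
  simp only [hw]
  rw [Finset.sum_eq_single (zeros _), if_pos rfl, if_pos rfl]
  · by_cases hq : P.reg l q = r
    · rw [if_pos hq, if_pos hq, Matrix.mul_vecMulVec, Matrix.vecMulVec_mul, Matrix.vecMulVec_apply,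
        ← Matrix.star_mulVec, Pi.star_apply]
    · rw [if_neg hq, if_neg hq]; simp
  · intro d _ hd
    rw [if_neg hd, zero_mul, ite_self]
  · simp

theorem Readable.measure {P : Proc n R eS} {len : ℕ → ℕ} {f : ∀ l, R l → Bits (len l)}
    (h : P.Readable len f) (hs : EfficientLength s) (ha : EfficientLength a)
    (hC : EfficientCircuits C) : (P.measure eI hs ha hC).Readable len f :=
  (((h.grow ha effGates_nil).grow ((efficientCircuits_iff_anc_gates _).1 hC).1
    ((efficientCircuits_iff_anc_gates _).1 hC).2).split (f' := f) (fun _ _ _ => rfl) (hs.add ha)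
    ((efficientCircuits_iff_anc_gates _).1 hC).1).recode _ _ _ _

/-- Measure the register and keep the outcome in the record. -/
def measureReg [∀ l, Fintype (I l)] (P : Proc n R eS) (hs : EfficientLength s)
    (ha : EfficientLength a) (hC : EfficientCircuits C) : Proc n (fun l => R l × I l) eS :=
  (P.measure eI hs ha hC).split (fun _ => Prod.mk) hs ha

theorem T_measureReg [∀ l, Fintype (S l)] [∀ l, Fintype (I l)] (P : Proc n R eS)
    (hs : EfficientLength s) (ha : EfficientLength a) (hC : EfficientCircuits C)
    (hE : Measures eI eS E C) (l : ℕ) (x : Bits (n l)) (r : R l × I l) :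
    (P.measureReg eI hs ha hC).T l x r = E l r.2 * P.T l x r.1 * (E l r.2)ᴴ := by
  ext z z'
  exact (T_split_mk _ hs ha l x r z z').trans (T_measure eI P hs ha hC hE l x r.1 z z' r.2 r.2)

theorem Readable.measureReg [∀ l, Fintype (I l)] {P : Proc n R eS} {len : ℕ → ℕ}
    {f : ∀ l, R l → Bits (len l)} (h : P.Readable len f) (hs : EfficientLength s)
    (ha : EfficientLength a) (hC : EfficientCircuits C) :
    (P.measureReg eI hs ha hC).Readable len fun l r => f l r.1 :=
  (h.measure eI hs ha hC).split (fun _ _ _ => rfl) hs ha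

/-- Parts of the outcome can be read. -/
theorem readable_outcome [∀ l, Fintype (I l)] (P : Proc n R eS) (hs : EfficientLength s)
    (ha : EfficientLength a) (hC : EfficientCircuits C) {j len : ℕ → ℕ} (hj : EfficientLength j)
    (hlen : EfficientLength len) (h : ∀ l, j l + len l ≤ a l) :
    (P.measureReg eI hs ha hC).Readable len fun l r i => bitAt (eI l r.2) (j l + i) := by
  refine ⟨fun l => P.N l + j l, P.N_eff.add hj, hlen, fun l => ⟨?_, ?_⟩⟩
  · have := h l
    change P.N l + j l + len l ≤ P.N l + a l + (C l).anc
    omega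
  · rintro z ⟨⟨q, d⟩, v⟩ i hi
    change bitAt (Fin.append (Fin.append ((P.L l).J (z, q)) (eI l v)) d) _ =
      bitAt (fun i => bitAt (eI l v) (j l + i)) i
    have := h l
    dsimp only
    rw [bitAt_append_lt _ _ (by omega), add_assoc, bitAt_append_add, bitAt_of_lt _ hi]

end Measure

/-- The measurement of the whole register in the standard basis. -/
theorem measures_basis {H : ℕ → Type} [∀ l, DecidableEq (H l)] {m : ℕ → ℕ}
    (eH : ∀ l, H l ≃ Bits (m l)) :
    Measures eH eH (fun _ i => Matrix.single i i 1) fun l => ⟨0, cnotRange 0 (m l) (m l)⟩ := by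
  intro l x x' i c
  have hc : c = zeros _ := Subsingleton.elim (α := Bits 0) _ _
  have h : ∀ (u v : Bits (m l)) (c : Bits 0), Fin.append (Fin.append u v) c = Fin.append u v := by
    intro u v c
    refine bits_ext fun i hi => ?_
    rw [bitAt_append_lt _ _ hi]
  have hA := adds_cnotRange (N := m l) (e := m l) (a := 0) (off := 0) (len := m l) (by omega)
    (Fin.append (eH l x') (eH l i)) (eH l x) (zeros (m l))
  have hx : xorBits (zeros (m l)) (place (m l) 0 fun i : Fin (m l) => bitAt (eH l x) (0 + i)) =
      eH l x := by
    refine bits_ext fun i hi => ?_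
    rw [bitAt_xorBits, bitAt_zeros, bitAt_place _ _ hi]
    simp [bitAt_of_lt _ hi]
  rw [hx, add_zero] at hA
  rw [if_pos hc]
  refine (congrArg₂ (gatesMat _ _) (h _ _ _) (h _ _ _)).trans (hA.trans ?_)
  have hinj : Fin.append (eH l x') (eH l i) = Fin.append (eH l x) (eH l x) ↔ x' = x ∧ i = x := by
    have := (encPair (eH l) (eH l)).injective.eq_iff (a := (x', i)) (b := (x, x))
    rw [Prod.ext_iff] at this
    exact this
  refine Eq.trans (if_congr ?_ rfl rfl) (Matrix.single_apply i i 1 x' x).symm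
  rw [hinj]
  constructor
  · rintro ⟨rfl, rfl⟩; exact ⟨rfl, rfl⟩
  · rintro ⟨rfl, rfl⟩; exact ⟨rfl, rfl⟩

theorem efficientCircuits_basis {m : ℕ → ℕ} (hm : EfficientLength m) :
    EfficientCircuits fun l => ⟨0, cnotRange 0 (m l) (m l)⟩ :=
  (efficientCircuits_iff_anc_gates _).2 ⟨efficientLength_const 0,
    PolyStr.cnotRange (efficientLength_const 0) hm hm⟩

/-- Measure the whole register in the standard basis. -/
def observe [∀ l, Fintype (S l)] (P : Proc n R eS) (hs : EfficientLength s) :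
    Proc n (fun l => R l × S l) (fun _ => encUnit) :=
  (P.measureReg eS hs hs (efficientCircuits_basis hs)).discard

theorem T_observe [∀ l, Fintype (S l)] (P : Proc n R eS) (hs : EfficientLength s)
    (l : ℕ) (x : Bits (n l)) (r : R l × S l) (u u' : Unit) :
    (P.observe hs).T l x r u u' = P.T l x r.1 r.2 r.2 := by
  classical
  rw [observe, T_discard, T_measureReg eS P hs hs (efficientCircuits_basis hs) (measures_basis eS)]
  simp [Matrix.trace]

theorem Readable.observe [∀ l, Fintype (S l)] {P : Proc n R eS} {len : ℕ → ℕ}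
    {f : ∀ l, R l → Bits (len l)} (h : P.Readable len f) (hs : EfficientLength s) :
    (P.observe hs).Readable len fun l r => f l r.1 :=
  (h.measureReg eS hs hs (efficientCircuits_basis hs)).discard

theorem readable_observed [∀ l, Fintype (S l)] (P : Proc n R eS) (hs : EfficientLength s)
    {j len : ℕ → ℕ} (hj : EfficientLength j) (hlen : EfficientLength len)
    (h : ∀ l, j l + len l ≤ s l) :
    (P.observe hs).Readable len fun l r i => bitAt (eS l r.2) (j l + i) :=
  (readable_outcome eS P hs hs (efficientCircuits_basis hs) hj hlen h).discard

end Proc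

end

noncomputable section

/-! ### Reduced states -/

/-- A string whose length is written in another way. -/
def castBits {a b : ℕ} (h : a = b) : Bits a ≃ Bits b := Equiv.arrowCongr (finCongr h) (Equiv.refl _)

@[simp] theorem bitAt_castBits {a b : ℕ} (h : a = b) (x : Bits a) (i : ℕ) :
    bitAt (castBits h x) i = bitAt x i := by
  subst h; rfl

/-- The reduced state of the first `m` wires. -/
def redState {N : ℕ} (f : Bits N → ℂ) (m : ℕ) : Matrix (Bits m) (Bits m) ℂ :=
  fun z z' => ∑ a : Bits N, ∑ a' : Bits N,
    if (∀ i : Fin m, bitAt a i = z i) ∧ (∀ i : Fin m, bitAt a' i = z' i) ∧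
        (∀ j : Fin N, m ≤ (j : ℕ) → a j = a' j)
    then f a * star (f a') else 0

theorem Circuit.state_eq (C : Circuit) {n : ℕ} (x : Bits n) (m : ℕ) :
    C.state x m = redState (_root_.amp (n + C.anc) C.gates x) m := by
  rw [← C.amp_eq]; rfl

theorem append_inj {m n : ℕ} {a a' : Bits m} {c c' : Bits n} :
    Fin.append a c = Fin.append a' c' ↔ a = a' ∧ c = c' := by
  have := (Fin.appendEquiv m n (α := Bool)).injective.eq_iff (a := (a, c)) (b := (a', c'))
  rw [Prod.ext_iff] at this
  exact this

theorem sum_bits_add {m n : ℕ} {α : Type*} [AddCommMonoid α] (f : Bits (m + n) → α) :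
    ∑ a, f a = ∑ b : Bits m, ∑ c : Bits n, f (Fin.append b c) := by
  rw [← (Fin.appendEquiv m n).sum_comp, Fintype.sum_prod_type]
  rfl

theorem forall_bitAt_append {m r : ℕ} (a z : Bits m) (c : Bits r) :
    (∀ i : Fin m, bitAt (Fin.append a c) i = z i) ↔ a = z := by
  rw [funext_iff]
  refine forall_congr' fun i => ?_
  rw [bitAt_append_lt _ _ i.2, bitAt_fin]

theorem redState_append {m r : ℕ} (f : Bits (m + r) → ℂ) (z z' : Bits m) :
    redState f m z z' = ∑ u : Bits r, f (Fin.append z u) * star (f (Fin.append z' u)) := by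
  have h2 : ∀ (a a' : Bits m) (u u' : Bits r),
      (∀ j : Fin (m + r), m ≤ (j : ℕ) → Fin.append a u j = Fin.append a' u' j) ↔ u = u' := by
    intro a a' u u'
    constructor
    · intro h
      funext i
      have := h (Fin.natAdd m i) (by simp)
      simpa using this
    · rintro rfl j hj
      rw [← bitAt_fin (Fin.append a u), ← bitAt_fin (Fin.append a' u), bitAt_append, bitAt_append,
        if_neg (not_lt.2 hj), if_neg (not_lt.2 hj)]
  unfold redState
  rw [sum_bits_add]
  simp only [sum_bits_add (m := m) (n := r), forall_bitAt_append, h2]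
  rw [Finset.sum_eq_single z]
  · refine Finset.sum_congr rfl fun u _ => ?_
    rw [Finset.sum_eq_single z', Finset.sum_eq_single u]
    · simp
    · intro u' _ hu; rw [if_neg (by tauto)]
    · simp
    · intro b _ hb
      refine Finset.sum_eq_zero fun u' _ => ?_
      rw [if_neg (by tauto)]
    · simp
  · intro b _ hb
    refine Finset.sum_eq_zero fun u _ => Finset.sum_eq_zero fun b' _ => Finset.sum_eq_zero
      fun u' _ => ?_
    rw [if_neg (by tauto)]
  · simp

theorem redState_cast {N m r : ℕ} (h : m + r = N) (f : Bits N → ℂ) (z z' : Bits m) :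
    redState f m z z' =
      ∑ u : Bits r, f (castBits h (Fin.append z u)) * star (f (castBits h (Fin.append z' u))) := by
  subst h
  exact redState_append f z z'

theorem redState_extend {N e : ℕ} {f : Bits N → ℂ} {g : Bits (N + e) → ℂ}
    (h : ∀ a c, g (Fin.append a c) = if c = zeros e then f a else 0) (m : ℕ) :
    redState g m = redState f m := by
  funext z z'
  unfold redState
  rw [sum_bits_add]
  simp only [sum_bits_add (m := N) (n := e)]
  refine Finset.sum_congr rfl fun a _ => ?_
  rw [Finset.sum_eq_single (zeros e)]
  · refine Finset.sum_congr rfl fun a' _ => ?_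
    rw [Finset.sum_eq_single (zeros e)]
    · rw [h, h, if_pos rfl, if_pos rfl]
      have h1 : ∀ (a : Bits N) (i : ℕ), bitAt (Fin.append a (zeros e)) i = bitAt a i := by
        intro a i
        rw [bitAt_append]
        split_ifs with hi
        · rfl
        · rw [bitAt_zeros, bitAt_of_le _ (not_lt.1 hi)]
      have h2 : (∀ j : Fin (N + e), m ≤ (j : ℕ) →
          Fin.append a (zeros e) j = Fin.append a' (zeros e) j) ↔
          ∀ j : Fin N, m ≤ (j : ℕ) → a j = a' j := by
        constructor
        · intro H j hj
          have := H (Fin.castAdd e j) hj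
          simpa using this
        · intro H j hj
          rw [← bitAt_fin (Fin.append a _), ← bitAt_fin (Fin.append a' _), h1, h1]
          by_cases hN : (j : ℕ) < N
          · rw [bitAt_of_lt _ hN, bitAt_of_lt _ hN]; exact H ⟨j, hN⟩ hj
          · rw [bitAt_of_le _ (not_lt.1 hN), bitAt_of_le _ (not_lt.1 hN)]
      simp only [h1, h2]
    · intro c _ hc
      rw [h a' c, if_neg hc]
      simp
    · simp
  · intro c _ hc
    refine Finset.sum_eq_zero fun a' _ => Finset.sum_eq_zero fun c' _ => ?_
    rw [h a c, if_neg hc]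
    simp
  · simp

theorem Circuit.state_diag (C : Circuit) {n m : ℕ} (x : Bits n) (z : Bits m) :
    C.state x m z z = (C.out x z : ℂ) := by
  rw [Circuit.state, Circuit.out]
  push_cast
  refine Finset.sum_congr rfl fun a _ => ?_
  rw [Finset.sum_eq_single a]
  · by_cases h : ∀ i : Fin m, bitAt a i = z i
    · rw [if_pos ⟨h, h, fun _ _ => rfl⟩, if_pos h]
      push_cast
      rw [← Complex.mul_conj']
      rfl
    · rw [if_neg (by tauto), if_neg h]; simp
  · intro a' _ ha
    rw [if_neg]
    rintro ⟨h1, h2, h3⟩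
    refine ha (funext fun j => ?_)
    by_cases hj : m ≤ (j : ℕ)
    · exact (h3 j hj).symm
    · have := (h1 ⟨j, not_le.1 hj⟩).trans (h2 ⟨j, not_le.1 hj⟩).symm
      simpa using this.symm
  · simp

/-! ### Circuits run as subroutines of efficient procedures. -/

namespace Proc

variable {n : ℕ → ℕ} {R : ℕ → Type}

section Call

variable {D : ℕ → Circuit} {p m : ℕ → ℕ} {g : ∀ l, R l → Bits (p l)}

/-- Run the circuits `D` on data computed from the record. -/
def run (P : Proc n R (fun _ => encUnit)) (hp : EfficientLength p)
    (hD : EfficientCircuits D) (hg : P.Loads p g) :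
    Proc n R (fun l => encPair (encSelf (p l)) (encSelf (D l).anc)) :=
  (P.load hp hg).grow ((efficientCircuits_iff_anc_gates _).1 hD).1
    ((efficientCircuits_iff_anc_gates _).1 hD).2

theorem vec_run (P : Proc n R (fun _ => encUnit)) (hp : EfficientLength p)
    (hD : EfficientCircuits D) (hg : P.Loads p g) (l : ℕ) (x : Bits (n l)) (q : P.Q l)
    (c : Bits (p l)) (d : Bits (D l).anc) : (P.run hp hD hg).vec l x q (c, d) =
      amp (p l + (D l).anc) (D l).gates (g l (P.reg l q)) (Fin.append c d) * P.vec l x q () := by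
  refine (vec_grow (P.load hp hg) ((efficientCircuits_iff_anc_gates _).1 hD).1
    ((efficientCircuits_iff_anc_gates _).1 hD).2 l x q c d).trans ?_
  rw [Finset.sum_eq_single (g l (P.reg l q))]
  · rw [vec_load P hp hg, if_pos rfl, amp, ← append_zeros_eq_zext]
    rfl
  · intro b _ hb
    rw [vec_load P hp hg, if_neg hb, mul_zero]
  · simp

theorem T_run (P : Proc n R (fun _ => encUnit)) (hp : EfficientLength p)
    (hD : EfficientCircuits D) (hg : P.Loads p g) (l : ℕ) (x : Bits (n l)) (r : R l)
    (c c' : Bits (p l)) (d d' : Bits (D l).anc) : (P.run hp hD hg).T l x r (c, d) (c', d') =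
      P.T l x r () () * (amp (p l + (D l).anc) (D l).gates (g l r) (Fin.append c d) *
        star (amp (p l + (D l).anc) (D l).gates (g l r) (Fin.append c' d'))) := by
  classical
  rw [T, T, Finset.sum_mul]
  change ∑ q : P.Q l, @ite ℂ (P.reg l q = r) (Classical.propDecidable _)
    ((P.run hp hD hg).vec l x q (c, d) * star ((P.run hp hD hg).vec l x q (c', d'))) 0 = _
  refine Finset.sum_congr rfl fun q _ => ?_
  rw [vec_run, vec_run]
  by_cases hq : P.reg l q = r
  · rw [if_pos hq, if_pos hq, hq]
    simp only [star_mul']; ring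
  · rw [if_neg hq, if_neg hq, zero_mul]

theorem T_grow_nil {S : ℕ → Type} {s : ℕ → ℕ} {eS : ∀ l, S l ≃ Bits (s l)} [∀ l, Fintype (S l)]
    (P : Proc n R eS) {e : ℕ → ℕ} (he : EfficientLength e) (l : ℕ) (x : Bits (n l)) (r : R l)
    (z z' : S l) (c c' : Bits (e l)) : (P.grow he effGates_nil).T l x r (z, c) (z', c') =
      if c = zeros (e l) ∧ c' = zeros (e l) then P.T l x r z z' else 0 := by
  classical
  rw [T]
  change ∑ q : P.Q l, @ite ℂ (P.reg l q = r) (Classical.propDecidable _)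
    ((P.grow he effGates_nil).vec l x q (z, c) * star ((P.grow he effGates_nil).vec l x q (z', c')))
    0 = _
  simp only [vec_grow_nil P he l x]
  by_cases hc : c = zeros (e l)
  · by_cases hc' : c' = zeros (e l)
    · rw [if_pos ⟨hc, hc'⟩]; simp only [hc, hc', if_true]; rfl
    · rw [if_neg (by tauto)]; simp [hc']
  · rw [if_neg (by tauto)]; simp [hc]

/-- The result of running circuits, with the first `m` wires separated from the other ones. -/
def callAux (P : Proc n R (fun _ => encUnit)) (hp : EfficientLength p) (hm : EfficientLength m)
    (hD : EfficientCircuits D) (hg : P.Loads p g) :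
    Proc n R (fun l => encPair (encSelf (m l)) (encSelf (p l + (D l).anc))) :=
  -- The first `m` wires may exceed the wires of `D`. With `m` more wires, all in the state zero,
  -- the total always splits as `m` wires and the rest; this agrees with `Circuit.state`, which
  -- reads missing wires as zero.
  ((P.run hp hD hg).grow hm effGates_nil).recode
    (fun l => encPair (encSelf (m l)) (encSelf (p l + (D l).anc)))
    (fun l => ((Fin.appendEquiv (m l) (p l + (D l).anc)).trans (castBits (add_comm _ _))).trans
      (encPair (encPair (encSelf (p l)) (encSelf (D l).anc)) (encSelf (m l))).symm)
    (fun l => add_comm _ _)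
    (fun l z i => by
      rw [Equiv.trans_apply, Equiv.apply_symm_apply, Equiv.trans_apply, bitAt_castBits]
      rfl)

/-- `G` is the final state of the called circuit, extended by zero amplitudes for nonzero padding.
It depends on the record but not on the other wires, so it factors out of the sum over them. -/
theorem T_callAux (P : Proc n R (fun _ => encUnit)) (hp : EfficientLength p)
    (hm : EfficientLength m) (hD : EfficientCircuits D) (hg : P.Loads p g) (l : ℕ)
    (x : Bits (n l)) (r : R l) : ∃ G : Bits (p l + (D l).anc + m l) → ℂ,
    (∀ a c, G (Fin.append a c) =
      if c = zeros (m l) then amp (p l + (D l).anc) (D l).gates (g l r) a else 0) ∧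
    ∀ z z' u u', (P.callAux hp hm hD hg).T l x r (z, u) (z', u') = P.T l x r () () *
      (G (castBits (add_comm _ _) (Fin.append z u)) *
        star (G (castBits (add_comm _ _) (Fin.append z' u')))) := by
  let e : (Bits (p l) × Bits (D l).anc) ≃ Bits (p l + (D l).anc) :=
    encPair (encSelf (p l)) (encSelf (D l).anc)
  let e' : ((Bits (p l) × Bits (D l).anc) × Bits (m l)) ≃ Bits (p l + (D l).anc + m l) :=
    encPair e (encSelf (m l))
  let G : Bits (p l + (D l).anc + m l) → ℂ := fun a =>
    if (e'.symm a).2 = zeros (m l) then amp (p l + (D l).anc) (D l).gates (g l r)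
      (e (e'.symm a).1) else 0
  refine ⟨G, fun a c => ?_, fun z z' u u' => ?_⟩
  · obtain ⟨b, rfl⟩ := e.surjective a
    have : e'.symm (Fin.append (e b) c) = (b, c) := e'.symm_apply_eq.2 rfl
    simp only [G, this]
  · have hT : ∀ a a' : (Bits (p l) × Bits (D l).anc) × Bits (m l),
        ((P.run hp hD hg).grow hm effGates_nil).T l x r a a' =
        P.T l x r () () * (G (e' a) * star (G (e' a'))) := by
      rintro ⟨⟨c, d⟩, u⟩ ⟨⟨c', d'⟩, u'⟩
      rw [T_grow_nil, T_run]
      simp only [G, Equiv.symm_apply_apply]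
      change _ = _ * ((if u = _ then amp _ _ _ (Fin.append c d) else 0) *
        star (if u' = _ then amp _ _ _ (Fin.append c' d') else 0))
      by_cases h : u = zeros (m l)
      · by_cases h' : u' = zeros (m l)
        · rw [if_pos ⟨h, h'⟩, if_pos h, if_pos h']
        · rw [if_neg (by tauto), if_neg h']; simp
      · rw [if_neg (by tauto), if_neg h]; simp
    refine (hT _ _).trans ?_
    rw [← Equiv.apply_symm_apply e' (castBits _ (Fin.append z u)),
      ← Equiv.apply_symm_apply e' (castBits _ (Fin.append z' u'))]
    rfl

/-- Run the circuits `D` on data computed from the record; the first `m` wires of the result become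
the register. -/
def call (P : Proc n R (fun _ => encUnit)) (hp : EfficientLength p) (hm : EfficientLength m)
    (hD : EfficientCircuits D) (hg : P.Loads p g) : Proc n R (fun l => encSelf (m l)) :=
  (P.callAux hp hm hD hg).split (fun _ r _ => r) hm
    (hp.add ((efficientCircuits_iff_anc_gates _).1 hD).1)

theorem T_call (P : Proc n R (fun _ => encUnit)) (hp : EfficientLength p) (hm : EfficientLength m)
    (hD : EfficientCircuits D) (hg : P.Loads p g) (l : ℕ) (x : Bits (n l)) (r : R l) :
    (P.call hp hm hD hg).T l x r = P.T l x r () () • (D l).state (g l r) (m l) := by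
  obtain ⟨G, hG, h⟩ := T_callAux P hp hm hD hg l x r
  ext z z'
  refine (T_split_fst (P.callAux hp hm hD hg) hm _ l x r z z').trans ?_
  simp only [h]
  rw [← Finset.mul_sum, ← redState_cast (add_comm _ _) G, Matrix.smul_apply, smul_eq_mul,
    Circuit.state_eq, redState_extend hG]

theorem Readable.call {P : Proc n R (fun _ => encUnit)} {len : ℕ → ℕ}
    {f : ∀ l, R l → Bits (len l)} (h : P.Readable len f) (hp : EfficientLength p)
    (hm : EfficientLength m) (hD : EfficientCircuits D) (hg : P.Loads p g) :
    (P.call hp hm hD hg).Readable len f :=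
  ((((h.load hp hg).grow _ _).grow hm effGates_nil).recode _ _ _ _).split
    (fun _ _ _ => rfl) hm (hp.add ((efficientCircuits_iff_anc_gates _).1 hD).1)

end Call

/-! ### The output -/

/-- Add fresh wires that are not used. -/
def pad (P : Proc n R (fun _ => encUnit)) {m : ℕ → ℕ} (hm : EfficientLength m) :
    Proc n R (fun _ => encUnit) := (P.grow hm effGates_nil).discard

theorem T_pad (P : Proc n R (fun _ => encUnit)) {m : ℕ → ℕ} (hm : EfficientLength m) (l : ℕ)
    (x : Bits (n l)) (r : R l) (u u' : Unit) : (P.pad hm).T l x r u u' = P.T l x r () () := by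
  rw [pad, T_discard, Matrix.trace, Fintype.sum_prod_type, Fintype.sum_unique,
    Finset.sum_eq_single (zeros (m l))]
  · exact (T_grow_nil P hm l x r _ _ _ _).trans (if_pos ⟨rfl, rfl⟩)
  · intro b _ hb
    exact (T_grow_nil P hm l x r _ _ _ _).trans (if_neg (by tauto))
  · simp

theorem Readable.pad {P : Proc n R (fun _ => encUnit)} {len : ℕ → ℕ}
    {f : ∀ l, R l → Bits (len l)} (h : P.Readable len f) {m : ℕ → ℕ} (hm : EfficientLength m) :
    (P.pad hm).Readable len f := (h.grow hm effGates_nil).discard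

theorem le_N_pad (P : Proc n R (fun _ => encUnit)) {m : ℕ → ℕ} (hm : EfficientLength m) (l : ℕ) :
    m l ≤ (P.pad hm).N l := Nat.le_add_left _ _

/-- Swap the wires `0, …, n - 1` and `a, …, a + n - 1`. -/
def swapRange (a n : ℕ) : List Gate := cnotRange 0 a n ++ (cnotRange a 0 n ++ cnotRange 0 a n)

/-- The usual three layers of controlled NOTs. Because `n ≤ a` the ranges are disjoint and each
layer is an involution; hence the composite is a bijection, by which sums over basis states can be
reindexed. -/
theorem actsBy_swapRange {N a n : ℕ} (h : n ≤ a) (hN : a + n ≤ N) :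
    ∃ f : Bits N ≃ Bits N, ActsBy N (swapRange a n) f ∧
      ∀ x i, i < n → bitAt (f x) i = bitAt x (a + i) := by
  have h1 := actsBy_cnotRange (N := N) (a := 0) (b := a) (n := n) (by omega) (by omega)
  have h2 := actsBy_cnotRange (N := N) (a := a) (b := 0) (n := n) hN (by omega)
  have inv : ∀ {c d : ℕ}, (c + n ≤ d ∨ d + n ≤ c) → c + n ≤ N →
      Function.Involutive (rangeMap N c d n) := by
    intro c d hcd hc x
    refine bits_ext fun w hw => ?_
    rw [bitAt_rangeMap _ _ _ _ hw, bitAt_rangeMap _ _ _ _ hw]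
    by_cases hd : d ≤ w ∧ w < d + n
    · rw [bitAt_rangeMap _ _ _ _ (by omega)]
      have : ¬ (d ≤ c + (w - d) ∧ c + (w - d) < d + n) := by omega
      rw [decide_eq_true hd, decide_eq_false this]
      simp
    · rw [decide_eq_false hd]; simp
  have i1 := inv (c := 0) (d := a) (by omega) (by omega)
  have i2 := inv (c := a) (d := 0) (by omega) hN
  refine ⟨(i1.toPerm).trans ((i2.toPerm).trans i1.toPerm), h1.append (h2.append h1), ?_⟩
  intro x i hi
  change bitAt (rangeMap N 0 a n (rangeMap N a 0 n (rangeMap N 0 a n x))) i = _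
  have e0 : ¬ (a ≤ i ∧ i < a + n) := by omega
  have e1 : 0 ≤ i ∧ i < 0 + n := by omega
  have e2 : a ≤ a + i ∧ a + i < a + n := by omega
  have e3 : 0 + (a + i - a) = i := by omega
  rw [bitAt_rangeMap _ _ _ _ (by omega), decide_eq_false e0, bitAt_rangeMap _ _ _ _ (by omega),
    decide_eq_true e1, bitAt_rangeMap _ _ _ _ (by omega), decide_eq_false e0, Nat.sub_zero,
    bitAt_rangeMap _ _ _ _ (by omega), decide_eq_true e2, e3]
  cases bitAt x i <;> cases bitAt x (a + i) <;> rfl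

open Classical in
/-- An efficient procedure can output data computed from the record. -/
theorem exists_circuits [∀ l, Fintype (R l)] (P : Proc n R (fun _ => encUnit)) {m : ℕ → ℕ}
    (hm : EfficientLength m) {g : ∀ l, R l → Bits (m l)} (hg : (P.pad hm).Loads m g) :
    ∃ A : ℕ → Circuit, EfficientCircuits A ∧ ∀ l (x : Bits (n l)) (z : Bits (m l)),
      ((A l).out x z : ℂ) = ∑ r, if g l r = z then P.T l x r () () else 0 := by
  set P' := (P.pad hm).load hm hg with hP'
  -- `Circuit.out` reads the first wires, but loaded data sits on the last `m` wires. The padding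
  -- guarantees `m` wires in front of them, so the two ranges can be swapped.
  refine ⟨fun l => ⟨P'.anc l, P'.gates l ++ swapRange ((P.pad hm).N l) (m l)⟩, ?_, ?_⟩
  · refine (efficientCircuits_iff_anc_gates _).2 ⟨P'.anc_eff, P'.gates_eff.append ?_⟩
    have h1 := PolyStr.cnotRange (efficientLength_const 0) (P.pad hm).N_eff hm
    have h2 := PolyStr.cnotRange (P.pad hm).N_eff (efficientLength_const 0) hm
    exact EffGates.append h1 (EffGates.append h2 h1)
  · intro l x z
    obtain ⟨f, hf, hf'⟩ := actsBy_swapRange (P.le_N_pad hm l) (le_refl ((P.pad hm).N l + m l))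
    have e1 : ∀ (N : ℕ) (gs : List Gate) (anc : ℕ), N = n l + anc →
        (Circuit.mk anc gs).out x z = ∑ a : Bits N, if ∀ i : Fin (m l), bitAt a i = z i then
          ‖amp N gs x a‖ ^ 2 else 0 := by
      rintro N gs anc rfl
      rw [Circuit.out, Circuit.amp_eq]
    rw [e1 ((P.pad hm).N l + m l) _ _ (P'.hN l), ← f.sum_comp]
    have e2 : ∀ a, amp ((P.pad hm).N l + m l) (P'.gates l ++ swapRange ((P.pad hm).N l) (m l)) x
        (f a) = amp ((P.pad hm).N l + m l) (P'.gates l) x a := by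
      intro a
      rw [amp, gatesMat_append, Matrix.mul_apply, Finset.sum_eq_single a]
      · rw [hf, if_pos rfl, one_mul]; rfl
      · intro b _ hb
        rw [hf, if_neg (fun h => hb (f.injective h).symm), zero_mul]
      · simp
    simp only [e2]
    have e3 : ∀ a : Bits ((P.pad hm).N l + m l), (∀ i : Fin (m l), bitAt (f a) i = z i) ↔
        ∀ i : Fin (m l), bitAt a ((P.pad hm).N l + i) = z i :=
      fun a => forall_congr' fun i => by rw [hf' a i i.2]
    simp only [e3]
    have e4 : ∑ a : Bits ((P.pad hm).N l + m l),
        (if ∀ i : Fin (m l), bitAt a ((P.pad hm).N l + i) = z i then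
          ‖amp ((P.pad hm).N l + m l) (P'.gates l) x a‖ ^ 2 else 0) =
        ∑ q : (P.pad hm).Q l, if g l ((P.pad hm).reg l q) = z then
          ‖(P.pad hm).vec l x q ()‖ ^ 2 else 0 := by
      rw [sum_bits_add, ← ((P.pad hm).L l).J.sum_comp, Fintype.sum_prod_type,
        Fintype.sum_unique]
      refine Finset.sum_congr rfl fun q _ => ?_
      have e5 : ∀ c : Bits (m l), (∀ i : Fin (m l), bitAt (Fin.append
          (((P.pad hm).L l).J (default, q)) c) ((P.pad hm).N l + i) = z i) ↔ c = z := by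
        intro c
        rw [funext_iff]
        exact forall_congr' fun i => by rw [bitAt_append_add, bitAt_fin]
      simp only [e5]
      rw [Finset.sum_ite_eq' Finset.univ z, if_pos (Finset.mem_univ _)]
      have := vec_load (P.pad hm) hm hg l x q z
      have e6 : amp ((P.pad hm).N l + m l) (P'.gates l) x
          (Fin.append (((P.pad hm).L l).J (default, q)) z) = P'.vec l x q z := rfl
      rw [e6, this]
      by_cases hz : z = g l ((P.pad hm).reg l q)
      · rw [if_pos hz, if_pos hz.symm]
      · rw [if_neg hz, if_neg (Ne.symm hz)]; simp
    rw [e4]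
    simp only [← T_pad P hm l x _ () ()]
    push_cast
    have e8 : ∀ r, (if g l r = z then (P.pad hm).T l x r () () else 0) =
        ∑ q, (if (P.pad hm).reg l q = r then (if g l ((P.pad hm).reg l q) = z then
        (P.pad hm).vec l x q () * star ((P.pad hm).vec l x q ()) else 0) else 0) := by
      intro r
      by_cases hr : g l r = z
      · rw [if_pos hr, T]
        refine Finset.sum_congr rfl fun q _ => ?_
        by_cases hq : (P.pad hm).reg l q = r
        · rw [if_pos hq, if_pos hq, if_pos (hq ▸ hr)]
        · rw [if_neg hq, if_neg hq]
      · rw [if_neg hr]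
        refine (Finset.sum_eq_zero fun q _ => ?_).symm
        by_cases hq : (P.pad hm).reg l q = r
        · rw [if_pos hq, if_neg (hq ▸ hr)]
        · rw [if_neg hq]
    rw [Finset.sum_congr rfl fun r _ => e8 r, Finset.sum_comm]
    refine Finset.sum_congr rfl fun q _ => ?_
    rw [Finset.sum_ite_eq Finset.univ, if_pos (Finset.mem_univ _)]
    split_ifs
    · push_cast
      rw [← Complex.mul_conj']; rfl
    · rfl

end Proc

end

noncomputable section

/-- A part of a string. -/
def sub {n : ℕ} (x : Bits n) (j len : ℕ) : Bits len := fun i => bitAt x (j + i)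

theorem sub_append_left {m n : ℕ} (x : Bits m) (y : Bits n) : sub (Fin.append x y) 0 m = x := by
  funext i
  rw [sub, zero_add, bitAt_append_lt _ _ i.2, bitAt_fin]

theorem sub_append_right {m n : ℕ} (x : Bits m) (y : Bits n) : sub (Fin.append x y) m n = y := by
  funext i
  rw [sub, bitAt_append_add, bitAt_fin]

theorem Proc.Readable.congr {n : ℕ → ℕ} {R : ℕ → Type} {S : ℕ → Type} {s : ℕ → ℕ}
    {eS : ∀ l, S l ≃ Bits (s l)} {P : Proc n R eS} {len : ℕ → ℕ} {f g : ∀ l, R l → Bits (len l)}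
    (h : P.Readable len f) (hfg : ∀ l r, f l r = g l r) : P.Readable len g := by
  have : f = g := funext fun l => funext fun r => hfg l r
  exact this ▸ h

/-- An efficient deterministic function has deterministic output. -/
theorem Circuit.out_of_prob_eq_one {C : Circuit} {n m : ℕ} {β : Type} {x : Bits n} {e : β ≃ Bits m}
    {b : β} (h : C.prob x e {b} = 1) (z : Bits m) : C.out x z = if z = e b then 1 else 0 := by
  classical
  have h1 : C.out x (e b) = 1 := by
    rw [Circuit.prob, Finset.sum_eq_single (e b)] at h
    · simpa using h
    · intro z _ hz
      rw [if_neg]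
      rw [Set.mem_singleton_iff, e.symm_apply_eq]
      exact hz
    · simp
  split_ifs with hz
  · rw [hz, h1]
  · have h2 := C.sum_out (m := m) x
    rw [← Finset.add_sum_erase _ _ (Finset.mem_univ (e b)), h1] at h2
    have h3 : ∑ z ∈ Finset.univ.erase (e b), C.out x z = 0 := by linarith
    exact (Finset.sum_eq_zero_iff_of_nonneg fun z _ => C.out_nonneg x z).1 h3 z
      (Finset.mem_erase.2 ⟨hz, Finset.mem_univ _⟩)

/-! ### Blocks -/

/-- A diagonal block. -/
def blk {H O : Type} (X : Matrix (H × O) (H × O) ℂ) (o : O) : Matrix H H ℂ :=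
  fun u u' => X (u, o) (u', o)

theorem blk_conj {H O : Type} [Fintype H] [Fintype O] [DecidableEq O] (K K' : O → Matrix H H ℂ)
    (X : Matrix (H × O) (H × O) ℂ) (o : O) :
    blk (Matrix.blockDiagonal K * X * (Matrix.blockDiagonal K')ᴴ) o =
      K o * blk X o * (K' o)ᴴ := by
  ext u u'
  simp only [blk, Matrix.mul_apply, Matrix.conjTranspose_apply, Fintype.sum_prod_type,
    Matrix.blockDiagonal_apply, ite_mul, zero_mul, Finset.sum_ite_eq, Finset.mem_univ, if_true,
    apply_ite star, star_zero, mul_ite, mul_zero]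

theorem blk_blockDiagonal {H O : Type} [DecidableEq O] (K : O → Matrix H H ℂ) (o : O) :
    blk (Matrix.blockDiagonal K) o = K o := by
  ext u u'
  simp [blk, Matrix.blockDiagonal_apply]

/-- Order a pair: `a` goes to the second place if `j` is true, and to the first place otherwise. -/
def ordered {α : Type} (j : Bool) (a b : α) : α × α := if j then (b, a) else (a, b)

/-! ### Experiments with a device as efficient procedures. -/

namespace Device

variable {F : ENTCF} (D : Device F)

/-- Pairs of preimage answers. -/
abbrev Ans (F : ENTCF) (l : ℕ) : Type := (Bool × F.W l) × (Bool × F.W l)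

def encAns (F : ENTCF) (l : ℕ) : Ans F l ≃ Bits (1 + F.w l + (1 + F.w l)) :=
  encPair (encPair encBit (encSelf _)) (encPair encBit (encSelf _))

def encV : Bool × Bool ≃ Bits (1 + 1) := encPair encBit encBit

/-- The images and the strings `d`. -/
abbrev Obs (F : ENTCF) (l : ℕ) : Type := (F.Y l × F.Y l) × (F.W l × F.W l)

/-- An efficient measurement of the registers `D, Y`. -/
structure MeasHY where
  E : ∀ l, Ans F l → F.Y l × F.Y l → Matrix (Bits (D.nD l)) (Bits (D.nD l)) ℂ
  C : ℕ → Circuit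
  eff : EfficientCircuits C
  spec : Measures (encAns F) D.encHY (fun l r => Matrix.blockDiagonal (E l r)) C

/-- An efficient measurement of the registers `D, Y, R`. -/
structure MeasHYR where
  E : ∀ l, Bool × Bool → Obs F l → Matrix (Bits (D.nD l)) (Bits (D.nD l)) ℂ
  C : ℕ → Circuit
  eff : EfficientCircuits C
  spec : Measures (fun _ => encV) D.encHYR (fun l v => Matrix.blockDiagonal (E l v)) C

/-- An experiment: the verifier inserts the given key at the place `j` and a key of type `θ`,
generated with a trapdoor, at the other place, prepares the state, measures `A` and the strings `d`,
then `B₁, B₂, B₃`, and finally decodes the image for the generated key. -/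
structure Experiment where
  eff : D.Efficient
  j : Bool
  θ : Bool
  A : D.MeasHY
  B₁ : D.MeasHYR
  B₂ : D.MeasHYR
  B₃ : D.MeasHYR

namespace Experiment

variable {D} (X : D.Experiment)

include X in
theorem nY_eff : EfficientLength fun l => D.nD l + (F.m l + F.m l) :=
  X.eff.nD_eff.add (F.m_eff.add F.m_eff)

include X in
theorem nYR_eff : EfficientLength fun l => D.nD l + ((F.m l + F.m l) + (F.w l + F.w l)) :=
  X.eff.nD_eff.add ((F.m_eff.add F.m_eff).add (F.w_eff.add F.w_eff))

theorem ans_eff (F : ENTCF) : EfficientLength fun l => 1 + F.w l + (1 + F.w l) :=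
  ((efficientLength_const 1).add F.w_eff).add ((efficientLength_const 1).add F.w_eff)

/-- Generate a key with a trapdoor. -/
def gen : Proc F.κ (fun l => Bits (F.κ l) × Bits (F.κ l + F.τ l)) (fun _ => encUnit) :=
  ((Proc.init F.κ F.κ_eff).call (efficientLength_const 0) (F.κ_eff.add F.τ_eff) (F.gen_eff X.θ)
    ((Proc.init F.κ F.κ_eff).loads_nil fun _ => 0)).observe (F.κ_eff.add F.τ_eff)

/-- The generation circuit has no input, and its observed output enters the record with its
probability, next to the given key, which is only copied. -/
theorem T_gen (l : ℕ) (x : Bits (F.κ l)) (r : Bits (F.κ l) × Bits (F.κ l + F.τ l)) :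
    X.gen.T l x r () () = if r.1 = x then ((F.gen X.θ l).out (zeros 0) r.2 : ℂ) else 0 := by
  rw [gen, Proc.T_observe, Proc.T_call, Proc.T_init, Matrix.smul_apply, smul_eq_mul,
    Circuit.state_diag]
  split_ifs <;> simp

theorem readable_gen_key : X.gen.Readable F.κ fun _ r => r.1 :=
  ((Proc.readable_init F.κ_eff).call _ _ _ _).observe _

theorem readable_gen_new : X.gen.Readable F.κ fun l r => sub r.2 0 (F.κ l) :=
  Proc.readable_observed _ (F.κ_eff.add F.τ_eff) (efficientLength_const 0) F.κ_eff
    (fun l => by omega)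

theorem readable_gen_trapdoor : X.gen.Readable F.τ fun l r => sub r.2 (F.κ l) (F.τ l) :=
  Proc.readable_observed _ (F.κ_eff.add F.τ_eff) F.κ_eff F.τ_eff (fun _ => le_rfl)

/-- The pair of keys. -/
def keys (l : ℕ) (r : Bits (F.κ l) × Bits (F.κ l + F.τ l)) : Bits (F.κ l) × Bits (F.κ l) :=
  ordered X.j r.1 (sub r.2 0 (F.κ l))

theorem loads_keys : X.gen.Loads (fun l => F.κ l + F.κ l) fun l r =>
    encPair (encSelf (F.κ l)) (encSelf (F.κ l)) (X.keys l r) := by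
  have h1 := X.readable_gen_key.loads (efficientLength_const 0) fun l => F.κ l + F.κ l
  have h2 := X.readable_gen_key.loads F.κ_eff fun l => F.κ l + F.κ l
  have h3 := X.readable_gen_new.loads (efficientLength_const 0) fun l => F.κ l + F.κ l
  have h4 := X.readable_gen_new.loads F.κ_eff fun l => F.κ l + F.κ l
  unfold keys ordered
  cases X.j
  · exact h1.append h4
  · exact h3.append h2

/-- Prepare the state. -/
def prep : Proc F.κ (fun l => Bits (F.κ l) × Bits (F.κ l + F.τ l)) D.encHY :=
  (X.gen.call (F.κ_eff.add F.κ_eff) X.nY_eff X.eff.ψ_eff.choose_spec.1 X.loads_keys).recode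
    D.encHY D.encHY (fun _ => rfl) (fun _ _ _ => rfl)

theorem T_prep (l : ℕ) (x : Bits (F.κ l)) (r : Bits (F.κ l) × Bits (F.κ l + F.τ l)) :
    X.prep.T l x r = X.gen.T l x r () () •
      Matrix.blockDiagonal (D.ψ l (X.keys l r).1 (X.keys l r).2) := by
  have h := X.eff.ψ_eff.choose_spec.2 l (X.keys l r)
  ext z z'
  refine (congrFun (congrFun (Proc.T_call X.gen (F.κ_eff.add F.κ_eff) X.nY_eff
    X.eff.ψ_eff.choose_spec.1 X.loads_keys l x r) (D.encHY l z)) (D.encHY l z')).trans ?_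
  rw [Matrix.smul_apply, Matrix.smul_apply]
  congr 1
  refine (congrFun (congrFun h (D.encHY l z)) (D.encHY l z')).trans ?_
  simp

/-- Measure `A`. -/
def stA : Proc F.κ (fun l => (Bits (F.κ l) × Bits (F.κ l + F.τ l)) × Ans F l) D.encHY :=
  X.prep.measureReg (encAns F) X.nY_eff (ans_eff F) X.A.eff

/-- Measure the strings `d`. -/
def stM : Proc F.κ (fun l => (Bits (F.κ l) × Bits (F.κ l + F.τ l)) × Ans F l) D.encHYR :=
  -- This outcome is not added to the record but stays a part of the register: it is the register
  -- `R` on which the next measurements act.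
  (X.stA.measure (fun l => encPair (encSelf (F.w l)) (encSelf (F.w l))) X.nY_eff
    (F.w_eff.add F.w_eff) X.eff.M_eff.choose_spec.1).recode D.encHYR
    (fun _ => (Equiv.prodAssoc _ _ _).symm) (fun _ => (add_assoc _ _ _).symm) (by
      rintro l ⟨u, y, d⟩ i
      change bitAt (Fin.append (Fin.append u (Fin.append y.1 y.2)) (Fin.append d.1 d.2)) i =
        bitAt (Fin.append u (Fin.append (Fin.append y.1 y.2) (Fin.append d.1 d.2))) i
      simp only [bitAt_append]
      split_ifs <;> first | rfl | omega | (congr 1; omega))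

/-- The subnormalized states after the measurement of the strings `d`. -/
theorem blk_stM (l : ℕ) (x : Bits (F.κ l)) (r : (Bits (F.κ l) × Bits (F.κ l + F.τ l)) × Ans F l)
    (o : Obs F l) : blk (X.stM.T l x r) o = X.gen.T l x r.1 () () •
      (D.M l o.2 o.1 * (X.A.E l r.2 o.1 * D.ψ l (X.keys l r.1).1 (X.keys l r.1).2 o.1 *
        (X.A.E l r.2 o.1)ᴴ) * (D.M l o.2 o.1)ᴴ) := by
  have h1 : blk (X.stM.T l x r) o = blk (Matrix.blockDiagonal (D.M l o.2) * X.stA.T l x r *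
      (Matrix.blockDiagonal (D.M l o.2))ᴴ) o.1 := by
    ext u u'
    exact Proc.T_measure _ X.stA X.nY_eff (F.w_eff.add F.w_eff) X.eff.M_eff.choose_spec.1
      X.eff.M_eff.choose_spec.2 l x r (u, o.1) (u', o.1) o.2 o.2
  have h2 := Proc.T_measureReg (encAns F) X.prep X.nY_eff (ans_eff F) X.A.eff X.A.spec l x r
  rw [h1, blk_conj]
  change _ * blk (X.stA.T l x r) o.1 * _ = _
  rw [stA, h2, blk_conj, T_prep]
  have h3 : ∀ (c : ℂ) (Z : Matrix (D.HY l) (D.HY l) ℂ) y, blk (c • Z) y = c • blk Z y :=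
    fun _ _ _ => rfl
  rw [h3, blk_blockDiagonal]
  simp only [Matrix.mul_smul, Matrix.smul_mul]

theorem encV_eff : EfficientLength fun _ => 1 + 1 := efficientLength_const _

abbrev Rec₁ (F : ENTCF) (l : ℕ) : Type :=
  ((Bits (F.κ l) × Bits (F.κ l + F.τ l)) × Ans F l) × (Bool × Bool)

def st₁ : Proc F.κ (Rec₁ F) D.encHYR :=
  X.stM.measureReg (fun _ => encV) X.nYR_eff encV_eff X.B₁.eff

def st₂ : Proc F.κ (fun l => Rec₁ F l × (Bool × Bool)) D.encHYR :=
  X.st₁.measureReg (fun _ => encV) X.nYR_eff encV_eff X.B₂.eff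

def st₃ : Proc F.κ (fun l => (Rec₁ F l × (Bool × Bool)) × (Bool × Bool)) D.encHYR :=
  X.st₂.measureReg (fun _ => encV) X.nYR_eff encV_eff X.B₃.eff

/-- The operator for given results of all measurements. -/
def K (l : ℕ) (a : Ans F l) (v₁ v₂ v₃ : Bool × Bool) (o : Obs F l) :
    Matrix (Bits (D.nD l)) (Bits (D.nD l)) ℂ :=
  X.B₃.E l v₃ o * (X.B₂.E l v₂ o * (X.B₁.E l v₁ o * (D.M l o.2 o.1 * X.A.E l a o.1)))

/-- Only the diagonal blocks for the images and strings `d` are followed. The last three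
measurements are block diagonal, and the final observation of all registers ignores the other
blocks. -/
theorem blk_st₃ (l : ℕ) (x : Bits (F.κ l)) (r : (Rec₁ F l × (Bool × Bool)) × (Bool × Bool))
    (o : Obs F l) : blk (X.st₃.T l x r) o = X.gen.T l x r.1.1.1.1 () () •
      (X.K l r.1.1.1.2 r.1.1.2 r.1.2 r.2 o *
        D.ψ l (X.keys l r.1.1.1.1).1 (X.keys l r.1.1.1.1).2 o.1 *
        (X.K l r.1.1.1.2 r.1.1.2 r.1.2 r.2 o)ᴴ) := by
  have h1 := Proc.T_measureReg (fun _ => encV) X.stM X.nYR_eff encV_eff X.B₁.eff X.B₁.spec l x r.1.1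
  have h2 := Proc.T_measureReg (fun _ => encV) X.st₁ X.nYR_eff encV_eff X.B₂.eff X.B₂.spec l x r.1
  have h3 := Proc.T_measureReg (fun _ => encV) X.st₂ X.nYR_eff encV_eff X.B₃.eff X.B₃.spec l x r
  have e1 : blk (X.st₁.T l x r.1.1) o = X.B₁.E l r.1.1.2 o * blk (X.stM.T l x r.1.1.1) o *
      (X.B₁.E l r.1.1.2 o)ᴴ := by rw [st₁, h1, blk_conj]
  have e2 : blk (X.st₂.T l x r.1) o = X.B₂.E l r.1.2 o * blk (X.st₁.T l x r.1.1) o *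
      (X.B₂.E l r.1.2 o)ᴴ := by rw [st₂, h2, blk_conj]
  have e3 : blk (X.st₃.T l x r) o = X.B₃.E l r.2 o * blk (X.st₂.T l x r.1) o *
      (X.B₃.E l r.2 o)ᴴ := by rw [st₃, h3, blk_conj]
  rw [e3, e2, e1, blk_stM]
  simp only [Matrix.mul_smul, Matrix.smul_mul, K, Matrix.conjTranspose_mul, Matrix.mul_assoc]

abbrev Rec₂ (F : ENTCF) (D : Device F) (l : ℕ) : Type :=
  ((Rec₁ F l × (Bool × Bool)) × (Bool × Bool)) × D.HYR l

/-- Observe all registers. -/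
def stO : Proc F.κ (Rec₂ F D) (fun _ => encUnit) := X.st₃.observe X.nYR_eff

/-- The image for the generated key. -/
def otherImage (l : ℕ) (z : D.HYR l) : F.Y l := if X.j then z.2.1.1 else z.2.1.2

theorem sub_encHYR (l : ℕ) (z : D.HYR l) :
    sub (D.encHYR l z) (D.nD l) (F.m l) = z.2.1.1 ∧
    sub (D.encHYR l z) (D.nD l + F.m l) (F.m l) = z.2.1.2 ∧
    sub (D.encHYR l z) (D.nD l + (F.m l + F.m l)) (F.w l) = z.2.2.1 ∧
    sub (D.encHYR l z) (D.nD l + (F.m l + F.m l + F.w l)) (F.w l) = z.2.2.2 := by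
  obtain ⟨u, ⟨y₁, y₂⟩, d₁, d₂⟩ := z
  have h : D.encHYR l (u, (y₁, y₂), d₁, d₂) =
    Fin.append u (Fin.append (Fin.append y₁ y₂) (Fin.append d₁ d₂)) := rfl
  rw [h]
  refine ⟨?_, ?_, ?_, ?_⟩ <;> funext i
  · rw [sub, bitAt_append_add, bitAt_append_lt _ _ (by omega), bitAt_append_lt _ _ i.2, bitAt_fin]
  · rw [sub, add_assoc _ _ (i : ℕ), bitAt_append_add, bitAt_append_lt _ _ (by omega),
      bitAt_append_add, bitAt_fin]
  · rw [sub, add_assoc _ _ (i : ℕ), bitAt_append_add, bitAt_append_add, bitAt_append_lt _ _ i.2,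
      bitAt_fin]
  · rw [sub, add_assoc _ _ (i : ℕ), bitAt_append_add, add_assoc _ _ (i : ℕ), bitAt_append_add,
      bitAt_append_add, bitAt_fin]

theorem readable_otherImage : X.stO.Readable F.m fun l r => X.otherImage l r.2 := by
  have h1 := Proc.readable_observed X.st₃ X.nYR_eff X.eff.nD_eff F.m_eff (fun l => by omega)
  have h2 := Proc.readable_observed X.st₃ X.nYR_eff (X.eff.nD_eff.add F.m_eff) F.m_eff
    (fun l => by omega)
  by_cases hj : X.j = true
  · refine h1.congr fun l r => ?_
    rw [otherImage, if_pos hj, ← (sub_encHYR l r.2).1]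
    rfl
  · refine h2.congr fun l r => ?_
    rw [otherImage, if_neg hj, ← (sub_encHYR l r.2).2.1]
    rfl

theorem readable_stO {len : ℕ → ℕ} {f : ∀ l, Bits (F.κ l) × Bits (F.κ l + F.τ l) → Bits (len l)}
    (h : X.gen.Readable len f) : X.stO.Readable len fun l r => f l r.1.1.1.1.1 :=
  ((((((h.call _ _ _ _).recode _ _ _ _).measureReg _ _ _ _).measure _ _ _ _).recode _ _ _ _
    |>.measureReg _ _ _ _).measureReg _ _ _ _ |>.measureReg _ _ _ _).observe _

/-- The input of the decoding. -/
def decIn (l : ℕ) (r : Rec₂ F D l) : Bits (F.τ l) × F.Y l :=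
  (sub r.1.1.1.1.1.2 (F.κ l) (F.τ l), X.otherImage l r.2)

theorem loads_decIn : X.stO.Loads (fun l => F.τ l + F.m l) fun l r =>
    encPair (encSelf (F.τ l)) (encSelf (F.m l)) (X.decIn l r) :=
  ((X.readable_stO X.readable_gen_trapdoor).loads (efficientLength_const 0) _).append
    (X.readable_otherImage.loads F.τ_eff _)

theorem dec_eff (F : ENTCF) : EfficientLength fun l => 1 + F.w l :=
  (efficientLength_const 1).add F.w_eff

/-- Decode the image for the generated key. -/
def final : Proc F.κ (fun l => Rec₂ F D l × Bits (1 + F.w l)) (fun _ => encUnit) :=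
  (X.stO.call (F.τ_eff.add F.m_eff) (dec_eff F) F.invG_eff.choose_spec.1 X.loads_decIn).observe
    (dec_eff F)

/-- Inversion with the trapdoor is an exact deterministic function, so the decoded string has only
one possible value for each record. -/
theorem T_final (l : ℕ) (x : Bits (F.κ l)) (r : Rec₂ F D l × Bits (1 + F.w l)) :
    X.final.T l x r () () = if r.2 = encPair encBit (encSelf _) (F.invG l (X.decIn l r.1)) then
      X.st₃.T l x r.1.1 r.1.2 r.1.2 else 0 := by
  have h := Circuit.out_of_prob_eq_one (F.invG_eff.choose_spec.2 l (X.decIn l r.1)) r.2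
  rw [final, Proc.T_observe, Proc.T_call, stO, Proc.T_observe, Matrix.smul_apply, smul_eq_mul,
    Circuit.state_diag, h]
  split_ifs <;> simp

theorem readable_final {len : ℕ → ℕ} {f : ∀ l, Rec₂ F D l → Bits (len l)}
    (h : X.stO.Readable len f) : X.final.Readable len fun l r => f l r.1 :=
  (h.call _ _ _ _).observe _

end Experiment

end Device

end

/-! ### Reading the results of an experiment, and their distribution. -/

noncomputable section

/-- A component of a pair: the second one if `i` is true, and the first one otherwise. -/
def sel {α : Type} (i : Bool) (p : α × α) : α := if i then p.2 else p.1

@[simp] theorem sel_ordered {α : Type} (j : Bool) (a b : α) : sel j (ordered j a b) = a := by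
  cases j <;> rfl

@[simp] theorem sel_not_ordered {α : Type} (j : Bool) (a b : α) :
    sel (!j) (ordered j a b) = b := by cases j <;> rfl

theorem encBit_xor (a b : Bool) : encBit (xor a b) = xorBits (encBit a) (encBit b) := by
  funext i; rfl

theorem sub_encPair {α β : Type} {m n : ℕ} (e : α ≃ Bits m) (f : β ≃ Bits n) (p : α × β) {j k : ℕ} :
    (j + k ≤ m → sub (encPair e f p) j k = sub (e p.1) j k) ∧
    sub (encPair e f p) (m + j) k = sub (f p.2) j k := by
  have h : encPair e f p = Fin.append (e p.1) (f p.2) := rfl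
  rw [h]
  refine ⟨fun hjk => ?_, ?_⟩ <;> funext i
  · rw [sub, bitAt_append_lt _ _ (by omega), sub]
  · rw [sub, add_assoc _ _ (i : ℕ), bitAt_append_add, sub]

theorem sub_zero_self {n : ℕ} (x : Bits n) : sub x 0 n = x := by
  funext i; rw [sub, zero_add, bitAt_fin]

namespace Device

variable {F : ENTCF} {D : Device F}

/-- The position of the answer for the place `i`. -/
def ansPos (F : ENTCF) (i : Bool) (l : ℕ) : ℕ := if i then 1 + F.w l else 0

theorem ansPos_eff (F : ENTCF) (i : Bool) : EfficientLength (ansPos F i) := by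
  cases i
  · exact efficientLength_const 0
  · exact (efficientLength_const 1).add F.w_eff

theorem sub_encAns (i : Bool) (l : ℕ) (a : Ans F l) :
    sub (encAns F l a) (ansPos F i l) 1 = encBit (sel i a).1 ∧
    sub (encAns F l a) (ansPos F i l + 1) (F.w l) = (sel i a).2 ∧
    sub (encAns F l a) (ansPos F i l) (1 + F.w l) = encPair encBit (encSelf _) (sel i a) := by
  have hp : ∀ p : Bool × F.W l, sub (encPair encBit (encSelf (F.w l)) p) 0 1 = encBit p.1 ∧
      sub (encPair encBit (encSelf (F.w l)) p) 1 (F.w l) = p.2 := by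
    intro p
    refine ⟨((sub_encPair _ _ p).1 (by omega)).trans (sub_zero_self _), ?_⟩
    exact (sub_encPair _ _ p (j := 0)).2.trans (sub_zero_self _)
  have h : ∀ j k, (j + k ≤ 1 + F.w l → sub (encAns F l a) j k =
      sub (encPair encBit (encSelf _) a.1) j k) ∧
      sub (encAns F l a) (1 + F.w l + j) k = sub (encPair encBit (encSelf _) a.2) j k :=
    fun j k => sub_encPair _ _ a
  cases i
  · refine ⟨((h 0 1).1 (by omega)).trans (hp _).1, ?_, ((h 0 _).1 (by omega)).trans (sub_zero_self _)⟩
    exact ((h 1 _).1 (by omega)).trans (hp _).2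
  · exact ⟨((h 0 1).2).trans (hp _).1, ((h 1 _).2).trans (hp _).2, ((h 0 _).2).trans (sub_zero_self _)⟩

theorem sub_encV (i : Bool) (v : Bool × Bool) :
    sub (encV v) (if i then 1 else 0) 1 = encBit (sel i v) := by
  cases i
  · exact ((sub_encPair encBit encBit v (j := 0) (k := 1)).1 le_rfl).trans (sub_zero_self _)
  · exact ((sub_encPair encBit encBit v (j := 0) (k := 1)).2).trans (sub_zero_self _)

namespace Experiment

variable (X : D.Experiment)

/-- The record of the results at the end of the experiment. -/
abbrev Rec (F : ENTCF) (D : Device F) (l : ℕ) : Type := Rec₂ F D l × Bits (1 + F.w l)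

/-- The results: the answers, the bits, the images and the strings `d`, the decoded image. -/
def results (l : ℕ) (r : Rec F D l) :
    (Ans F l × ((Bool × Bool) × (Bool × Bool) × (Bool × Bool))) × Obs F l × (Bool × F.W l) :=
  ((r.1.1.1.1.1.2, (r.1.1.1.1.2, r.1.1.1.2, r.1.1.2)), r.1.2.2,
    (encPair encBit (encSelf _)).symm r.2)

theorem readable_ans {j len : ℕ → ℕ} (hj : EfficientLength j) (hlen : EfficientLength len)
    (h : ∀ l, j l + len l ≤ 1 + F.w l + (1 + F.w l)) :
    X.final.Readable len fun l r => sub (encAns F l (results l r).1.1) (j l) (len l) :=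
  X.readable_final ((((((Proc.readable_outcome (encAns F) X.prep X.nY_eff (ans_eff F) X.A.eff hj
    hlen h).measure _ _ _ _).recode _ _ _ _).measureReg _ _ _ _).measureReg _ _ _ _
      |>.measureReg _ _ _ _).observe _)

theorem readable_ans_bit (i : Bool) :
    X.final.Readable (fun _ => 1) fun l r => encBit (sel i (results l r).1.1).1 :=
  (X.readable_ans (ansPos_eff F i) (efficientLength_const 1)
    (fun l => by cases i <;> simp [ansPos] <;> omega)).congr fun l _ => (sub_encAns i l _).1

theorem readable_ans_pair (i : Bool) :
    X.final.Readable (fun l => 1 + F.w l) fun l r =>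
      encPair encBit (encSelf _) (sel i (results l r).1.1) :=
  (X.readable_ans (ansPos_eff F i) (dec_eff F)
    (fun l => by cases i <;> simp [ansPos])).congr fun l _ => (sub_encAns i l _).2.2

theorem bit_eff (i : Bool) : EfficientLength fun _ => if i then 1 else 0 := efficientLength_const _

theorem readable_v₁ (i : Bool) :
    X.final.Readable (fun _ => 1) fun l r => encBit (sel i (results l r).1.2.1) :=
  (X.readable_final (((Proc.readable_outcome (fun _ => encV) X.stM X.nYR_eff encV_eff X.B₁.eff
    (bit_eff i) (efficientLength_const 1) (fun l => by cases i <;> simp)).measureReg _ _ _ _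
      |>.measureReg _ _ _ _).observe _)).congr fun l _ => sub_encV i _

theorem readable_v₂ (i : Bool) :
    X.final.Readable (fun _ => 1) fun l r => encBit (sel i (results l r).1.2.2.1) :=
  (X.readable_final (((Proc.readable_outcome (fun _ => encV) X.st₁ X.nYR_eff encV_eff X.B₂.eff
    (bit_eff i) (efficientLength_const 1) (fun l => by cases i <;> simp)).measureReg _ _ _ _).observe
      _)).congr fun l _ => sub_encV i _

theorem readable_v₃ (i : Bool) :
    X.final.Readable (fun _ => 1) fun l r => encBit (sel i (results l r).1.2.2.2) :=
  (X.readable_final ((Proc.readable_outcome (fun _ => encV) X.st₂ X.nYR_eff encV_eff X.B₃.eff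
    (bit_eff i) (efficientLength_const 1) (fun l => by cases i <;> simp)).observe
      _)).congr fun l _ => sub_encV i _

theorem readable_d (i : Bool) :
    X.final.Readable F.w fun l r => sel i (results l r).2.1.2 := by
  have h1 := Proc.readable_observed X.st₃ X.nYR_eff (X.eff.nD_eff.add (F.m_eff.add F.m_eff)) F.w_eff
    (fun l => by omega)
  have h2 := Proc.readable_observed X.st₃ X.nYR_eff
    (X.eff.nD_eff.add ((F.m_eff.add F.m_eff).add F.w_eff)) F.w_eff (fun l => by omega)
  cases i
  · exact (X.readable_final h1).congr fun l r => (sub_encHYR l r.1.2).2.2.1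
  · exact (X.readable_final h2).congr fun l r => (sub_encHYR l r.1.2).2.2.2

theorem readable_dec :
    X.final.Readable (fun _ => 1) fun l r => encBit (results l r).2.2.1 := by
  have h := Proc.readable_observed (X.stO.call (F.τ_eff.add F.m_eff) (dec_eff F)
    F.invG_eff.choose_spec.1 X.loads_decIn) (dec_eff F) (efficientLength_const 0)
    (efficientLength_const 1) (fun l => by omega)
  refine Proc.Readable.congr (P := X.final) h fun l r => ?_
  have := (sub_encPair encBit (encSelf (F.w l)) (results l r).2.2 (j := 0) (k := 1)).1 le_rfl
  rw [sub_zero_self] at this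
  rw [← this, results, Equiv.apply_symm_apply]
  rfl

/-- The probability of given results, for given keys. -/
def weight (l : ℕ) (k : Bits (F.κ l) × Bits (F.κ l)) (a : Ans F l)
    (v : (Bool × Bool) × (Bool × Bool) × (Bool × Bool)) (o : Obs F l) : ℝ :=
  (X.K l a v.1 v.2.1 v.2.2 o * D.ψ l k.1 k.2 o.1 * (X.K l a v.1 v.2.1 v.2.2 o)ᴴ).trace.re

/-- The output distribution of an experiment. -/
theorem exists_circuits {m : ℕ → ℕ} (hm : EfficientLength m)
    (G : ∀ l, (Ans F l × ((Bool × Bool) × (Bool × Bool) × (Bool × Bool))) × Obs F l ×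
      (Bool × F.W l) → Bits (m l))
    (hG : (X.final.pad hm).Loads m fun l r => G l (results l r)) :
    ∃ A : ℕ → Circuit, EfficientCircuits A ∧ ∀ l (x : Bits (F.κ l)) (z : Bits (m l)),
      (A l).out x z = ∑ k, ∑ t, F.genProb X.θ l k t * ∑ p : Ans F l × _, ∑ o : Obs F l,
        if G l (p, o, F.invG l (t, sel (!X.j) o.1)) = z then
          X.weight l (ordered X.j x k) p.1 p.2 o else 0 := by
  classical
  obtain ⟨A, hA, h⟩ := X.final.exists_circuits hm hG
  refine ⟨A, hA, fun l x z => ?_⟩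
  have key : ((A l).out x z : ℂ) = ∑ k, ∑ t, (F.genProb X.θ l k t : ℂ) * ∑ p : Ans F l × _,
      ∑ o : Obs F l, if G l (p, o, F.invG l (t, sel (!X.j) o.1)) = z then
        (X.K l p.1 p.2.1 p.2.2.1 p.2.2.2 o * D.ψ l (ordered X.j x k).1 (ordered X.j x k).2 o.1 *
          (X.K l p.1 p.2.1 p.2.2.1 p.2.2.2 o)ᴴ).trace else 0 := by
    rw [h]
    have hsum : ∀ o : Obs F l, ∀ r : (Rec₁ F l × (Bool × Bool)) × (Bool × Bool),
        ∑ u, X.st₃.T l x r (u, o) (u, o) = (blk (X.st₃.T l x r) o).trace := fun _ _ => rfl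
    -- The sum over decoded strings has a single nonzero term, which is the value of the inversion.
    have e1 : ∀ r : Rec₂ F D l, ∑ y : Bits (1 + F.w l), (if G l (results l (r, y)) = z then
        X.final.T l x (r, y) () () else 0) =
        if G l ((r.1.1.1.1.2, (r.1.1.1.2, r.1.1.2, r.1.2)), r.2.2, F.invG l (X.decIn l r)) = z then
          X.st₃.T l x r.1 r.2 r.2 else 0 := by
      intro r
      rw [Finset.sum_eq_single (encPair encBit (encSelf _) (F.invG l (X.decIn l r)))]
      · rw [T_final, if_pos rfl]
        simp only [results, Equiv.symm_apply_apply]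
      · intro y _ hy
        rw [T_final, if_neg hy, ite_self]
      · simp
    have e2 : ∀ o : Obs F l, X.otherImage l ((zeros (D.nD l), o) : D.HYR l) = sel (!X.j) o.1 := by
      intro o
      rw [otherImage, sel]
      cases X.j <;> rfl
    have e3 : ∀ (g : Bits (F.κ l) × Bits (F.κ l + F.τ l)) (a : Ans F l)
        (v₁ v₂ v₃ : Bool × Bool), (∑ u : Bits (D.nD l), ∑ o : Obs F l,
        if G l ((a, (v₁, v₂, v₃)), o, F.invG l (X.decIn l (((((g, a), v₁), v₂), v₃), u, o))) = z then
          X.st₃.T l x ((((g, a), v₁), v₂), v₃) (u, o) (u, o) else 0) =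
        if g.1 = x then ((F.gen X.θ l).out (zeros 0) g.2 : ℂ) * ∑ o : Obs F l,
          if G l ((a, (v₁, v₂, v₃)), o, F.invG l (sub g.2 (F.κ l) (F.τ l), sel (!X.j) o.1)) = z then
            (X.K l a v₁ v₂ v₃ o * D.ψ l (X.keys l g).1 (X.keys l g).2 o.1 *
              (X.K l a v₁ v₂ v₃ o)ᴴ).trace else 0 else 0 := by
      intro g a v₁ v₂ v₃
      refine Finset.sum_comm.trans ?_
      have e4 : ∀ o : Obs F l, (∑ u : Bits (D.nD l),
          if G l ((a, (v₁, v₂, v₃)), o, F.invG l (X.decIn l (((((g, a), v₁), v₂), v₃), u, o))) = z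
          then X.st₃.T l x ((((g, a), v₁), v₂), v₃) (u, o) (u, o) else 0) =
          if g.1 = x then ((F.gen X.θ l).out (zeros 0) g.2 : ℂ) *
            if G l ((a, (v₁, v₂, v₃)), o, F.invG l (sub g.2 (F.κ l) (F.τ l), sel (!X.j) o.1)) = z
            then (X.K l a v₁ v₂ v₃ o * D.ψ l (X.keys l g).1 (X.keys l g).2 o.1 *
              (X.K l a v₁ v₂ v₃ o)ᴴ).trace else 0 else 0 := by
        intro o
        have e5 : ∀ u : Bits (D.nD l), X.decIn l (((((g, a), v₁), v₂), v₃), u, o) =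
            (sub g.2 (F.κ l) (F.τ l), sel (!X.j) o.1) := fun u => by rw [← e2]; rfl
        simp only [e5]
        by_cases hz : G l ((a, (v₁, v₂, v₃)), o,
            F.invG l (sub g.2 (F.κ l) (F.τ l), sel (!X.j) o.1)) = z
        · simp only [if_pos hz]
          refine (hsum o _).trans ?_
          rw [blk_st₃, T_gen, Matrix.trace_smul, smul_eq_mul, ite_mul, zero_mul]
        · simp only [if_neg hz, Finset.sum_const_zero, mul_zero, ite_self]
      rw [Finset.sum_congr rfl fun o _ => e4 o]
      split_ifs with hg
      · rw [Finset.mul_sum]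
      · exact Finset.sum_const_zero
    simp only [Fintype.sum_prod_type (f := fun r : Rec F D l => _), e1]
    simp only [Fintype.sum_prod_type (f := fun r : Rec₂ F D l => _),
      Fintype.sum_prod_type (f := fun r : (Rec₁ F l × (Bool × Bool)) × (Bool × Bool) => _),
      Fintype.sum_prod_type (f := fun r : Rec₁ F l × (Bool × Bool) => _),
      Fintype.sum_prod_type (f := fun r : Rec₁ F l => _),
      Fintype.sum_prod_type (f := fun r : (Bits (F.κ l) × Bits (F.κ l + F.τ l)) × Ans F l => _),
      Fintype.sum_prod_type (f := fun r : D.HYR l => _),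
      Fintype.sum_prod_type (f := fun r : Ans F l × ((Bool × Bool) × (Bool × Bool) × (Bool × Bool)) => _),
      Fintype.sum_prod_type (f := fun r : (Bool × Bool) × (Bool × Bool) × (Bool × Bool) => _),
      Fintype.sum_prod_type (f := fun r : (Bool × Bool) × (Bool × Bool) => _)]
    refine (Finset.sum_congr rfl fun g _ => Finset.sum_congr rfl fun a _ =>
      Finset.sum_congr rfl fun v₁ _ => Finset.sum_congr rfl fun v₂ _ =>
      Finset.sum_congr rfl fun v₃ _ => e3 g a v₁ v₂ v₃).trans ?_
    -- The record keeps the given key, so only its value `x` contributes; the remaining string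
    -- splits into the generated key and its trapdoor.
    rw [Fintype.sum_prod_type, Finset.sum_eq_single x]
    · rw [sum_bits_add]
      refine Finset.sum_congr rfl fun k _ => Finset.sum_congr rfl fun t _ => ?_
      simp only [if_true, sub_append_right, keys, sub_append_left, Finset.mul_sum]
      rfl
    · intro k _ hk
      simp only [if_neg hk, Finset.sum_const_zero]
    · simp
  have := congrArg Complex.re key
  rw [Complex.ofReal_re] at this
  rw [this]
  simp only [Complex.re_sum, Complex.re_ofReal_mul, weight, apply_ite Complex.re, Complex.zero_re]

end Experiment

end Device

end

/-! ### Measurements that do nothing, ask a question, or erase an answer. -/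

noncomputable section

theorem bitAt_update {N t : ℕ} (a : Bits N) (ht : t < N) (w : Bool) (j : ℕ) :
    bitAt (Function.update a ⟨t, ht⟩ w) j = if j = t then w else bitAt a j := by
  by_cases hj : j < N
  · rw [bitAt_of_lt _ hj, bitAt_of_lt _ hj]
    by_cases h : j = t
    · subst h; simp
    · rw [if_neg h, Function.update_of_ne (by simpa [Fin.ext_iff] using h)]
  · rw [bitAt_of_le _ (by omega), bitAt_of_le _ (by omega), if_neg (by omega)]

theorem oneQubit_mul_apply {N t : ℕ} (ht : t < N) (u : Matrix Bool Bool ℂ)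
    (A : Matrix (Bits N) (Bits N) ℂ) (a c : Bits N) : (oneQubit N t u * A) a c =
      ∑ w, u (bitAt a t) w * A (Function.update a ⟨t, ht⟩ w) c := by
  rw [Matrix.mul_apply]
  have h : ∀ w, u (bitAt a t) w * A (Function.update a ⟨t, ht⟩ w) c =
      ∑ b, if b = Function.update a ⟨t, ht⟩ w then u (bitAt a t) (bitAt b t) * A b c else 0 := by
    intro w
    rw [Finset.sum_ite_eq' Finset.univ, if_pos (Finset.mem_univ _), bitAt_update, if_pos rfl]
  simp only [h]
  rw [Finset.sum_comm]
  refine Finset.sum_congr rfl fun b _ => ?_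
  rw [oneQubit, if_pos ht]
  have h2 : ∀ w, b = Function.update a ⟨t, ht⟩ w ↔
      (∀ j : Fin N, (j : ℕ) ≠ t → a j = b j) ∧ w = b ⟨t, ht⟩ := by
    intro w
    constructor
    · rintro rfl
      refine ⟨fun j hj => ?_, by simp⟩
      rw [Function.update_of_ne (by simpa [Fin.ext_iff] using hj)]
    · rintro ⟨h1, rfl⟩
      funext j
      by_cases hj : (j : ℕ) = t
      · have : j = ⟨t, ht⟩ := Fin.ext hj
        subst this; simp
      · rw [Function.update_of_ne (by simpa [Fin.ext_iff] using hj), h1 j hj]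
  simp only [h2, ite_and]
  split_ifs <;> simp

namespace Device

variable {F : ENTCF} {D : Device F}

theorem efficientCircuits_nil : EfficientCircuits fun _ => ⟨0, []⟩ :=
  (efficientCircuits_iff_anc_gates _).2 ⟨efficientLength_const 0, effGates_nil⟩

/-- The empty circuit leaves the outcome register at zero, so the zero string is the only outcome
with a nonzero operator, which is the identity. -/
theorem measures_nil {I H O : ℕ → Type} [∀ l, DecidableEq (H l)] [∀ l, DecidableEq (O l)]
    {n a : ℕ → ℕ} (eI : ∀ l, I l ≃ Bits (a l)) (eH : ∀ l, H l × O l ≃ Bits (n l)) :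
    Measures eI eH (fun l i => Matrix.blockDiagonal fun _ : O l =>
      if eI l i = zeros (a l) then (1 : Matrix (H l) (H l) ℂ) else 0) fun _ => ⟨0, []⟩ := by
  intro l x x' i c
  have hc : c = zeros 0 := funext fun j => j.elim0
  subst hc
  rw [if_pos rfl, gatesMat, Matrix.one_apply]
  have h : Fin.append (Fin.append (eH l x') (eI l i)) (zeros 0) =
      Fin.append (Fin.append (eH l x) (zeros (a l))) (zeros 0) ↔ x' = x ∧ eI l i = zeros _ := by
    rw [append_inj, append_inj, (eH l).injective.eq_iff, and_iff_left rfl]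
  refine (if_congr h rfl rfl).trans ?_
  obtain ⟨u, o⟩ := x
  obtain ⟨u', o'⟩ := x'
  by_cases hi : eI l i = zeros _
  · simp only [hi, if_true, and_true]
    rw [← Matrix.one_apply, ← Matrix.blockDiagonal_one]; rfl
  · simp [hi, Matrix.blockDiagonal_apply]

/-- The measurement that does nothing. -/
def MeasHY.idle : D.MeasHY where
  E l a _ := if encAns F l a = zeros _ then 1 else 0
  C _ := ⟨0, []⟩
  eff := efficientCircuits_nil
  spec := measures_nil (encAns F) D.encHY

/-- The measurement that does nothing. -/
def MeasHYR.idle : D.MeasHYR where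
  E _ v _ := if encV v = zeros _ then 1 else 0
  C _ := ⟨0, []⟩
  eff := efficientCircuits_nil
  spec := measures_nil (fun _ => encV) D.encHYR

/-- The measurement of the preimages. -/
def MeasHY.preimage (hD : D.Efficient) : D.MeasHY where
  E l a y := D.Pi l a y
  C := hD.Pi_eff.choose
  eff := hD.Pi_eff.choose_spec.1
  spec := hD.Pi_eff.choose_spec.2

/-- The measurement for the questions `q`. -/
def MeasHYR.question (hD : D.Efficient) (q : Bool × Bool) : D.MeasHYR where
  E l v o := D.P l q v o
  C := (hD.P_eff q).choose
  eff := (hD.P_eff q).choose_spec.1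
  spec := (hD.P_eff q).choose_spec.2

theorem bitAt_encV (v : Bool × Bool) (j : ℕ) :
    bitAt (encV v) j = if j = 0 then v.1 else if j = 1 then v.2 else false := by
  have h : encV v = Fin.append (encBit v.1) (encBit v.2) := rfl
  match j with
  | 0 => rfl
  | 1 => rfl
  | j + 2 => rw [bitAt_of_le _ (by omega)]; simp

/-- The measurement `B`, with the answer at the place `i` kept and the other one turned into a
uniformly random sign. -/
def MeasHYR.erase (hD : D.Efficient) (B : D.MeasHYR) (i : Bool) : D.MeasHYR where
  -- A Hadamard gate on the wire of the unwanted answer replaces measuring it. The outcome 0 on that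
  -- wire then carries the sum over both values of the answer, the marginal projector, divided by
  -- √2; measuring the full answer would disturb the state more than the marginal observable does.
  E l v o := ∑ w, (((Real.sqrt 2 : ℝ) : ℂ)⁻¹ * sgn (sel (!i) v && w)) • B.E l (ordered i (sel i v) w) o
  C l := ⟨(B.C l).anc, (B.C l).gates ++
    [.had (D.nD l + ((F.m l + F.m l) + (F.w l + F.w l)) + if i then 0 else 1)]⟩
  eff := by
    have h := (efficientCircuits_iff_anc_gates _).1 B.eff
    refine (efficientCircuits_iff_anc_gates _).2 ⟨h.1, EffGates.append h.2 (effGates_had ?_)⟩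
    exact (hD.nD_eff.add ((F.m_eff.add F.m_eff).add (F.w_eff.add F.w_eff))).add
      (efficientLength_const _)
  spec := by
    intro l x x' v
    set n := D.nD l + ((F.m l + F.m l) + (F.w l + F.w l)) with hn
    set p := if i then 0 else 1 with hp
    have hp2 : p < 2 := by rw [hp]; split_ifs <;> omega
    intro (c : Bits (B.C l).anc)
    have ht : n + p < n + (1 + 1) + (B.C l).anc := by omega
    have hv : bitAt (encV v) p = sel (!i) v := by
      rw [bitAt_encV, hp]; cases i <;> rfl
    have hbit : bitAt (Fin.append (Fin.append (D.encHYR l x') (encV v)) c) (n + p) = sel (!i) v := by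
      rw [bitAt_append_lt _ _ (by omega), bitAt_append_add, hv]
    have hupd : ∀ w, Function.update (Fin.append (Fin.append (D.encHYR l x') (encV v)) c)
        ⟨n + p, ht⟩ w = Fin.append (Fin.append (D.encHYR l x') (encV (ordered i (sel i v) w))) c := by
      intro w
      refine bits_ext fun j _ => ?_
      rw [bitAt_update, bitAt_append, bitAt_append, bitAt_append, bitAt_append, bitAt_encV,
        bitAt_encV, hp]
      cases i <;> simp only [ordered, sel, if_true, if_false, Bool.false_eq_true] <;> split_ifs <;>
        first | rfl | omega
    have hstep : gatesMat (n + (1 + 1) + (B.C l).anc) ((B.C l).gates ++ [Gate.had (n + p)]) =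
        oneQubit _ (n + p) (fun a b => ((Real.sqrt 2 : ℝ) : ℂ)⁻¹ * sgn (a && b)) *
          gatesMat _ (B.C l).gates := by
      rw [gatesMat_append]
      congr 1
      exact Matrix.one_mul _
    refine (congrFun (congrFun hstep _) _).trans ?_
    refine (oneQubit_mul_apply ht _ _ _ _).trans ?_
    have hB : ∀ w, gatesMat (n + (1 + 1) + (B.C l).anc) (B.C l).gates (Function.update
        (Fin.append (Fin.append (D.encHYR l x') (encV v)) c) ⟨n + p, ht⟩ w)
        (Fin.append (Fin.append (D.encHYR l x) (zeros (1 + 1))) (zeros (B.C l).anc)) =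
        if c = zeros (B.C l).anc then
          Matrix.blockDiagonal (B.E l (ordered i (sel i v) w)) x' x else 0 := by
      intro w
      rw [hupd]
      exact B.spec l x x' _ c
    refine (Finset.sum_congr rfl fun w _ => congrArg₂ (fun b z => ((Real.sqrt 2 : ℝ) : ℂ)⁻¹ *
      sgn (b && w) * z) hbit (hB w)).trans ?_
    split_ifs with hc
    · have hbd : (Matrix.blockDiagonal fun o => ∑ w,
          (((Real.sqrt 2 : ℝ) : ℂ)⁻¹ * sgn (sel (!i) v && w)) • B.E l (ordered i (sel i v) w) o) =
          ∑ w, (((Real.sqrt 2 : ℝ) : ℂ)⁻¹ * sgn (sel (!i) v && w)) •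
            Matrix.blockDiagonal (B.E l (ordered i (sel i v) w)) := by
        ext a b
        rw [Matrix.sum_apply]
        simp only [Matrix.blockDiagonal_apply, Matrix.sum_apply, Matrix.smul_apply, smul_eq_mul]
        split_ifs <;> simp
      refine Eq.trans ?_ (congrFun (congrFun hbd x') x).symm
      rw [Matrix.sum_apply]
      rfl
    · simp

end Device

end

noncomputable section

/-! ### Projective measurements -/

namespace IsProjectiveMeasurement

variable {I H O : Type} [Fintype I] [DecidableEq I] [Fintype H] [DecidableEq H]

theorem block [Fintype O] [DecidableEq O] {E : I → O → Matrix H H ℂ}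
    (h : IsProjectiveMeasurement fun i => Matrix.blockDiagonal (E i)) (o : O) :
    IsProjectiveMeasurement fun i => E i o := by
  have hb : ∀ {A B : O → Matrix H H ℂ}, Matrix.blockDiagonal A = Matrix.blockDiagonal B → A o = B o :=
    fun hAB => congrFun (Matrix.blockDiagonal_injective hAB) o
  refine ⟨fun i => ?_, fun i j => ?_, ?_⟩
  · have := h.1 i
    rw [Matrix.IsHermitian, Matrix.blockDiagonal_conjTranspose] at this
    exact hb this
  · have := h.2.1 i j
    rw [← Matrix.blockDiagonal_mul] at this
    split_ifs with hij
    · rw [if_pos hij] at this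
      exact hb this
    · rw [if_neg hij, ← Matrix.blockDiagonal_zero] at this
      exact hb this
  · have h1 : (∑ i, Matrix.blockDiagonal (E i)) = Matrix.blockDiagonal (∑ i, E i) :=
      (map_sum (Matrix.blockDiagonalAddMonoidHom H H O ℂ) E Finset.univ).symm
    have h2 := h.2.2
    rw [h1, ← Matrix.blockDiagonal_one] at h2
    have := hb h2
    rwa [Finset.sum_apply] at this

variable {E : I → Matrix H H ℂ} (h : IsProjectiveMeasurement E)
include h

theorem isHermitian_sum (s : Finset I) : (∑ i ∈ s, E i).IsHermitian := by
  rw [Matrix.IsHermitian, Matrix.conjTranspose_sum]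
  exact Finset.sum_congr rfl fun i _ => h.1 i

theorem sum_mul_sum (s t : Finset I) : (∑ i ∈ s, E i) * ∑ i ∈ t, E i = ∑ i ∈ s ∩ t, E i := by
  rw [Finset.sum_mul_sum]
  simp only [h.2.1, Finset.sum_ite_eq]
  rw [Finset.sum_ite_mem]

/-- Coarse graining. -/
theorem fiber {J : Type} [Fintype J] [DecidableEq J] (φ : I → J) :
    IsProjectiveMeasurement fun j => ∑ i with φ i = j, E i := by
  refine ⟨fun j => h.isHermitian_sum _, fun j j' => ?_, ?_⟩
  · rw [h.sum_mul_sum]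
    split_ifs with hj
    · subst hj; rw [Finset.inter_self]
    · refine Finset.sum_eq_zero fun i hi => ?_
      simp only [Finset.mem_inter, Finset.mem_filter, Finset.mem_univ, true_and] at hi
      exact absurd (hi.1.symm.trans hi.2) hj
  · rw [Finset.sum_fiberwise, h.2.2]

theorem mul_self (i : I) : E i * E i = E i := by rw [h.2.1, if_pos rfl]

theorem isHermitian (i : I) : (E i)ᴴ = E i := h.1 i

end IsProjectiveMeasurement

/-! ### Key generation -/

namespace FunctionFamilies

variable (F : FunctionFamilies)

theorem genProb_nonneg (θ : Bool) (l : ℕ) (k : Bits (F.κ l)) (t : Bits (F.τ l)) :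
    0 ≤ F.genProb θ l k t := Circuit.out_nonneg _ _ _

theorem keyProb_nonneg (θ : Bool) (l : ℕ) (k : Bits (F.κ l)) : 0 ≤ F.keyProb θ l k :=
  Finset.sum_nonneg fun t _ => F.genProb_nonneg θ l k t

theorem sum_keyProb (θ : Bool) (l : ℕ) : ∑ k, F.keyProb θ l k = 1 := by
  have h := (F.gen θ l).sum_out (m := F.κ l + F.τ l) (zeros 0)
  rwa [sum_bits_add] at h

theorem IsKey.exists_keyPair {F : FunctionFamilies} {θ : Bool} {l : ℕ} {k : Bits (F.κ l)}
    (h : F.IsKey θ l k) : ∃ t, F.IsKeyPair θ l k t := by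
  obtain ⟨t, -, ht⟩ := Finset.exists_ne_zero_of_sum_ne_zero h
  exact ⟨t, ht⟩

/-- The probability of a pair of keys. -/
def pairProb (θ : Bool × Bool) (l : ℕ) (k : Bits (F.κ l) × Bits (F.κ l)) : ℝ :=
  F.keyProb θ.1 l k.1 * F.keyProb θ.2 l k.2

theorem pairProb_nonneg (θ : Bool × Bool) (l : ℕ) (k : Bits (F.κ l) × Bits (F.κ l)) :
    0 ≤ F.pairProb θ l k := mul_nonneg (F.keyProb_nonneg _ _ _) (F.keyProb_nonneg _ _ _)

theorem sum_pairProb (θ : Bool × Bool) (l : ℕ) : ∑ k, F.pairProb θ l k = 1 := by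
  simp only [pairProb]
  rw [Fintype.sum_prod_type]
  simp only [← Finset.mul_sum, F.sum_keyProb, mul_one]

theorem pairProb_ordered (i a b : Bool) (l : ℕ) (k k' : Bits (F.κ l)) :
    F.pairProb (ordered i a b) l (ordered i k k') = F.keyProb a l k * F.keyProb b l k' := by
  cases i
  · rfl
  · exact mul_comm _ _

end FunctionFamilies

theorem ordered_sel {α : Type} (i : Bool) (p : α × α) : ordered i (sel i p) (sel (!i) p) = p := by
  cases i <;> rfl

theorem sum_ordered {α : Type} {M : Type*} [Fintype α] [AddCommMonoid M] (i : Bool)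
    (f : α × α → M) : ∑ a, ∑ b, f (ordered i a b) = ∑ p, f p := by
  rw [Fintype.sum_prod_type]
  cases i
  · rfl
  · exact Finset.sum_comm

theorem ENTCF.avg_eq (F : ENTCF) (θ₁ θ₂ : Bool) (l : ℕ) (g : Bits (F.κ l) → Bits (F.κ l) → ℝ) :
    F.avg θ₁ θ₂ l g = ∑ k, F.pairProb (θ₁, θ₂) l k * g k.1 k.2 := by
  rw [Fintype.sum_prod_type]; rfl

/-! ### Devices -/

namespace Device

variable {F : ENTCF} (D : Device F)

theorem Pi_block (l : ℕ) (y : F.Y l × F.Y l) : IsProjectiveMeasurement fun a => D.Pi l a y :=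
  (D.Pi_proj l).block y

theorem M_block (l : ℕ) (y : F.Y l × F.Y l) : IsProjectiveMeasurement fun d => D.M l d y :=
  (D.M_proj l).block y

theorem P_block (l : ℕ) (q : Bool × Bool) (o : Obs F l) :
    IsProjectiveMeasurement fun v => D.P l q v o :=
  (D.P_proj l q).block o

theorem posSemidef_block (l : ℕ) (k : Bits (F.κ l) × Bits (F.κ l)) (y : F.Y l × F.Y l) :
    (D.ψ l k.1 k.2 y).PosSemidef := by
  have h := (D.ψ_pos l k.1 k.2).submatrix fun u : Bits (D.nD l) => (u, y)
  convert h using 1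
  ext u u'
  simp [Matrix.blockDiagonal_apply]

theorem sum_trace_block (l : ℕ) (k : Bits (F.κ l) × Bits (F.κ l)) :
    ∑ y, (D.ψ l k.1 k.2 y).trace = 1 := by
  rw [← D.ψ_trace l k.1 k.2, Matrix.trace_blockDiagonal]

open scoped MatrixOrder Matrix.Norms.L2Operator in
theorem exists_root (l : ℕ) (k : Bits (F.κ l) × Bits (F.κ l)) (y : F.Y l × F.Y l) :
    ∃ B : Matrix (Bits (D.nD l)) (Bits (D.nD l)) ℂ, B * Bᴴ = D.ψ l k.1 k.2 y := by
  obtain ⟨B, hB⟩ := CStarAlgebra.nonneg_iff_eq_star_mul_self.mp (D.posSemidef_block l k y).nonneg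
  exact ⟨Bᴴ, by rw [hB, Matrix.conjTranspose_conjTranspose, Matrix.star_eq_conjTranspose]⟩

/-- A purification of the state. -/
def root (l : ℕ) (k : Bits (F.κ l) × Bits (F.κ l)) (y : F.Y l × F.Y l) :
    Matrix (Bits (D.nD l)) (Bits (D.nD l)) ℂ := (D.exists_root l k y).choose

theorem root_mul (l : ℕ) (k : Bits (F.κ l) × Bits (F.κ l)) (y : F.Y l × F.Y l) :
    D.root l k y * (D.root l k y)ᴴ = D.ψ l k.1 k.2 y := (D.exists_root l k y).choose_spec

/-- The projector of the answer `b` at the place `i` to the questions `q`. -/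
def marg (l : ℕ) (q : Bool × Bool) (i b : Bool) (o : Obs F l) :
    Matrix (Bits (D.nD l)) (Bits (D.nD l)) ℂ := ∑ v with sel i v = b, D.P l q v o

theorem marg_proj (l : ℕ) (q : Bool × Bool) (i : Bool) (o : Obs F l) :
    IsProjectiveMeasurement fun b => D.marg l q i b o := (D.P_block l q o).fiber (sel i)

theorem marg_add (l : ℕ) (q : Bool × Bool) (i : Bool) (o : Obs F l) :
    D.marg l q i false o + D.marg l q i true o = 1 := by
  rw [← (D.marg_proj l q i o).2.2, Fintype.sum_bool, add_comm]

/-- The observable of the answer at the place `i` to the questions `q`. -/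
def obs (l : ℕ) (q : Bool × Bool) (i : Bool) (o : Obs F l) :
    Matrix (Bits (D.nD l)) (Bits (D.nD l)) ℂ := ∑ v, sgn (sel i v) • D.P l q v o

theorem obs_eq (l : ℕ) (q : Bool × Bool) (i : Bool) (o : Obs F l) :
    D.obs l q i o = D.marg l q i false o - D.marg l q i true o := by
  cases i <;> simp [obs, marg, Finset.sum_filter, Fintype.sum_prod_type, sel, sgn] <;> abel

theorem obs_isHermitian (l : ℕ) (q : Bool × Bool) (i : Bool) (o : Obs F l) :
    (D.obs l q i o)ᴴ = D.obs l q i o := by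
  rw [obs_eq, Matrix.conjTranspose_sub, (D.marg_proj l q i o).isHermitian,
    (D.marg_proj l q i o).isHermitian]

theorem obs_mul_self (l : ℕ) (q : Bool × Bool) (i : Bool) (o : Obs F l) :
    D.obs l q i o * D.obs l q i o = 1 := by
  have h := (D.marg_proj l q i o).2.1
  rw [obs_eq, ← D.marg_add l q i o]
  simp only [sub_mul, mul_sub, h]
  simp

theorem marg_eq (l : ℕ) (q : Bool × Bool) (i b : Bool) (o : Obs F l) :
    D.marg l q i b o = (1 / 2 : ℂ) • (1 + sgn b • D.obs l q i o) := by
  rw [obs_eq, ← D.marg_add l q i o]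
  ext u u'
  cases b <;> simp [sgn] <;> ring

theorem sum_sgn_PFull (l : ℕ) (q : Bool × Bool) (i : Bool) :
    ∑ v : Bool × Bool, sgn (sel i v) • D.PFull l q v = Matrix.blockDiagonal (D.obs l q i) := by
  ext a b
  simp only [Matrix.sum_apply, Matrix.smul_apply, PFull, Matrix.blockDiagonal_apply, obs]
  split_ifs with h
  · rfl
  · simp

end Device

end

noncomputable section

/-! ### Negligible functions -/

namespace Negligible

theorem add {μ ν : ℕ → ℝ} (hμ : Negligible μ) (hν : Negligible ν) :
    Negligible fun l => μ l + ν l := by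
  refine ⟨fun l => add_nonneg (hμ.1 l) (hν.1 l), fun p => ?_⟩
  simpa only [add_mul, add_zero] using (hμ.2 p).add (hν.2 p)

theorem const_mul {μ : ℕ → ℝ} (hμ : Negligible μ) {c : ℝ} (hc : 0 ≤ c) :
    Negligible fun l => c * μ l := by
  refine ⟨fun l => mul_nonneg hc (hμ.1 l), fun p => ?_⟩
  simpa only [mul_assoc, mul_zero] using (hμ.2 p).const_mul c

/-- For a polynomial `p` apply the hypothesis to `p ^ 2` and take square roots. -/
theorem sqrt {μ : ℕ → ℝ} (hμ : Negligible μ) : Negligible fun l => √(μ l) := by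
  refine ⟨fun l => Real.sqrt_nonneg _, fun p => ?_⟩
  have h := (hμ.2 (p ^ 2)).sqrt
  rw [Real.sqrt_zero] at h
  rw [tendsto_zero_iff_norm_tendsto_zero]
  refine h.congr fun l => ?_
  rw [Polynomial.eval_pow, Real.sqrt_mul (hμ.1 l), Real.sqrt_sq_eq_abs, norm_mul,
    Real.norm_of_nonneg (Real.sqrt_nonneg _), Real.norm_eq_abs]

end Negligible

/-! ### Decoding -/

/-- The sign `(-1)^b`, as a real number. -/
def sgnR (b : Bool) : ℝ := if b then -1 else 1

namespace ENTCF

variable {F : ENTCF} {l : ℕ} {k : Bits (F.κ l)} {y : F.Y l}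

theorem xHat_eq_some_iff_mem {θ b : Bool} {x : F.W l} (h : F.xHat θ l k y b = some x) :
    x ∈ F.X l ∧ y ∈ (F.f θ l k b x).support := by
  rw [xHat] at h
  split_ifs at h with hx
  obtain rfl := Option.some.inj h
  exact hx.choose_spec

/-- For a claw-free key the supports for a fixed bit are disjoint because inversion with a trapdoor
determines the preimage, and every key that occurs has some trapdoor. -/
theorem xHat_true_eq (hk : F.IsKey true l k) {b : Bool} {x : F.W l} (hx : x ∈ F.X l)
    (hy : y ∈ (F.f true l k b x).support) : F.xHat true l k y b = some x := by
  have h : ∃ x ∈ F.X l, y ∈ (F.f true l k b x).support := ⟨x, hx, hy⟩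
  obtain ⟨t, ht⟩ := hk.exists_keyPair
  rw [xHat, dif_pos h, ← F.invF_spec l k t ht b _ h.choose_spec.1 y h.choose_spec.2,
    F.invF_spec l k t ht b x hx y hy]

theorem invG_eq_of_bHat {t : Bits (F.τ l)} (ht : F.IsKeyPair false l k t) {b : Bool}
    (h : F.bHat l k y = some b) : (F.invG l (t, y)).1 = b := by
  rw [bHat] at h
  split_ifs at h with hx
  obtain rfl := Option.some.inj h
  obtain ⟨x, hx, hy⟩ := hx.choose_spec
  rw [F.invG_spec l k t ht _ x hx y hy]

theorem mem_correct {θ : Bool} {r : Bool × F.W l} : r ∈ F.correct θ l k y ↔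
    (θ = false → F.bHat l k y = some r.1) ∧ F.xHat θ l k y r.1 = some r.2 := by
  rw [correct, Finset.mem_filter, and_iff_right (Finset.mem_univ _)]

/-- An injective key fixes the bit through b̂, and then the preimage. For a claw-free key both bits
can be correct, so their equality has to be assumed. -/
theorem correct_unique {θ : Bool} {r r' : Bool × F.W l} (h : r ∈ F.correct θ l k y)
    (h' : r' ∈ F.correct θ l k y) (hθ : θ = true → r.1 = r'.1) : r = r' := by
  rw [mem_correct] at h h'
  have h1 : r.1 = r'.1 := by
    cases θ
    · exact Option.some.inj ((h.1 rfl).symm.trans (h'.1 rfl))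
    · exact hθ rfl
  refine Prod.ext h1 (Option.some.inj ?_)
  rw [← h.2, ← h'.2, h1]

open Classical in
/-- The sign of the guess `e` of a hardcore bit. -/
def hardcoreSign (F : ENTCF) (l : ℕ) (k : Bits (F.κ l))
    (r : (Bool × Bits (F.w l)) × (Bits (F.w l) × Bool)) : ℝ :=
  (if r ∈ F.hardcoreSet l k then 1 else 0) - if r ∈ F.hardcoreSetFlipped l k then 1 else 0

theorem abs_hardcoreSign_le (r : (Bool × Bits (F.w l)) × (Bits (F.w l) × Bool)) :
    |F.hardcoreSign l k r| ≤ 1 := by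
  rw [hardcoreSign]
  split_ifs <;> norm_num

theorem exists_claw (hk : F.IsKey true l k) {r : Bool × F.W l} (hr : r.2 ∈ F.X l) :
    ∃ x₀ x₁, F.IsClaw l k x₀ x₁ ∧ (if r.1 then x₁ else x₀) = r.2 ∧
      ∀ x₀' x₁', F.IsClaw l k x₀' x₁' → (if r.1 then x₁' else x₀') = r.2 → x₀' = x₀ ∧ x₁' = x₁ := by
  obtain ⟨b, x⟩ := r
  cases b
  · obtain ⟨x₁, h1, h2⟩ := (F.matching l k hk).1 x hr
    refine ⟨x, x₁, h1, rfl, fun x₀' x₁' h h' => ?_⟩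
    obtain rfl : x₀' = x := h'
    exact ⟨rfl, h2 _ h⟩
  · obtain ⟨x₀, h1, h2⟩ := (F.matching l k hk).2 x hr
    refine ⟨x₀, x, h1, rfl, fun x₀' x₁' h h' => ?_⟩
    obtain rfl : x₁' = x := h'
    exact ⟨h2 _ h, rfl⟩

/-- For a correct preimage, the sign of a guess is determined by `û`. -/
theorem hardcoreSign_eq (hk : F.IsKey true l k) {r : Bool × F.W l}
    (hr : r ∈ F.correct true l k y) (d : F.W l) (e : Bool) :
    F.hardcoreSign l k (r, (d, e)) = (F.uHat l k y d).elim 0 fun u => sgnR (xor e u) := by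
  classical
  obtain ⟨hx, hy⟩ := xHat_eq_some_iff_mem (mem_correct.1 hr).2
  obtain ⟨x₀, x₁, hc, h1, h2⟩ := exists_claw hk hx
  -- The two members of a claw have the same image distribution, so an image of one of them is an
  -- image of both.
  have hy0 : y ∈ (F.f true l k false x₀).support := by
    obtain ⟨b, x⟩ := r
    cases b
    · obtain rfl : x₀ = x := h1; exact hy
    · obtain rfl : x₁ = x := h1; rw [hc.2.2]; exact hy
  have hy1 : y ∈ (F.f true l k true x₁).support := by rw [← hc.2.2]; exact hy0
  have hu : F.uHat l k y d = if d ∈ F.good l k false x₀ ∧ d ∈ F.good l k true x₁ then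
      some (dotBits d (xorBits x₀ x₁)) else none := by
    rw [uHat, xHat_true_eq hk hc.1 hy0, xHat_true_eq hk hc.2.1 hy1]
  have hm : ∀ e', (r, (d, e')) ∈ F.hardcoreSet l k ↔
      (d ∈ F.good l k false x₀ ∧ d ∈ F.good l k true x₁) ∧ e' = dotBits d (xorBits x₀ x₁) := by
    intro e'
    constructor
    · rintro ⟨x₀', x₁', hc', h, hg0, hg1, he⟩
      obtain ⟨rfl, rfl⟩ := h2 x₀' x₁' hc' h.symm
      exact ⟨⟨hg0, hg1⟩, he⟩
    · rintro ⟨⟨hg0, hg1⟩, he⟩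
      exact ⟨x₀, x₁, hc, h1.symm, hg0, hg1, he⟩
  have hm' : (r, (d, e)) ∈ F.hardcoreSetFlipped l k ↔
      (d ∈ F.good l k false x₀ ∧ d ∈ F.good l k true x₁) ∧ (!e) = dotBits d (xorBits x₀ x₁) :=
    hm (!e)
  rw [hardcoreSign, hu]
  simp only [hm, hm']
  by_cases hg : d ∈ F.good l k false x₀ ∧ d ∈ F.good l k true x₁
  · simp only [hg, and_self, true_and, if_true, Option.elim_some]
    cases e <;> cases dotBits d (xorBits x₀ x₁) <;> simp [sgnR]
  · simp [hg]

end ENTCF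

end

noncomputable section

/-! ### Approximate anticommutation -/

section Hilbert

variable {E : Type*} [NormedAddCommGroup E] [InnerProductSpace ℂ E]

theorem norm_eq_of_symmetric_involution {Z : E →ₗ[ℂ] E} (hZ : Z.IsSymmetric)
    (hZ2 : ∀ x, Z (Z x) = x) (x : E) : ‖Z x‖ = ‖x‖ := by
  have h : ‖Z x‖ ^ 2 = ‖x‖ ^ 2 := by
    rw [← inner_self_eq_norm_sq (𝕜 := ℂ), ← inner_self_eq_norm_sq (𝕜 := ℂ), hZ, hZ2]
  exact (sq_eq_sq₀ (norm_nonneg _) (norm_nonneg _)).1 h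

/-- The loss is of first order in `δ`. Applied with a distance of order √γ_T, this is what limits
the final bound to the square root of γ_T. -/
theorem re_inner_sub_re_inner_le {T : E →ₗ[ℂ] E} (hT : ∀ x, ‖T x‖ ≤ ‖x‖) {x y : E} {δ : ℝ}
    (hx : ‖x‖ ≤ 1) (h : ‖x - y‖ ≤ δ) :
    |(inner ℂ x (T x)).re - (inner ℂ y (T y)).re| ≤ δ * (2 + δ) := by
  have hδ : 0 ≤ δ := (norm_nonneg _).trans h
  have hy : ‖y‖ ≤ 1 + δ := by
    have : y = x - (x - y) := by abel
    rw [this]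
    exact (norm_sub_le _ _).trans (add_le_add hx h)
  have e : inner ℂ x (T x) - inner ℂ y (T y) = inner ℂ (x - y) (T x) + inner ℂ y (T (x - y)) := by
    rw [map_sub, inner_sub_left, inner_sub_right]; ring
  rw [← Complex.sub_re, e]
  refine (Complex.abs_re_le_norm _).trans ((norm_add_le _ _).trans ?_)
  have h1 : ‖inner ℂ (x - y) (T x)‖ ≤ δ * 1 := (norm_inner_le_norm _ _).trans
    (mul_le_mul h ((hT x).trans hx) (norm_nonneg _) hδ)
  have h2 : ‖inner ℂ y (T (x - y))‖ ≤ (1 + δ) * δ := (norm_inner_le_norm _ _).trans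
    (mul_le_mul hy ((hT _).trans h) (norm_nonneg _) (by linarith))
  linarith

/-- If the outcome of `Z` is approximately known from a decomposition `ξ ≈ η₀ + η₁`, if `X`
approximately agrees with `S` on `ξ`, and if it is uncorrelated with `S` on `η₀` and `η₁`, then
`Z` and `X` approximately anticommute on `ξ`. -/
theorem anticommute_of_uncorrelated {Z X S : E →ₗ[ℂ] E} (hZ : Z.IsSymmetric) (hX : X.IsSymmetric)
    (hS : S.IsSymmetric) (hZ2 : ∀ x, Z (Z x) = x) (hX2 : ∀ x, X (X x) = x)
    (hS1 : ∀ x, ‖S x‖ ≤ ‖x‖) (hSZ : ∀ x, S (Z x) = Z (S x)) {ξ η₀ η₁ : E} {ε₁ ε₂ ε₃ γ : ℝ}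
    (hξ : ‖ξ‖ ≤ 1) (h₀ : ‖(1 / 2 : ℂ) • (η₀ - Z η₀)‖ ^ 2 ≤ ε₁)
    (h₁ : ‖(1 / 2 : ℂ) • (η₁ + Z η₁)‖ ^ 2 ≤ ε₁) (h₂ : ‖ξ - η₀ - η₁‖ ^ 2 ≤ ε₂)
    (h₃ : (inner ℂ η₀ (S (X η₀)) + inner ℂ η₁ (S (X η₁))).re ≤ ε₃)
    (h₄ : 1 - 2 * γ ≤ (inner ℂ ξ (S (X ξ))).re) :
    ‖Z (X ξ) + X (Z ξ)‖ ^ 2 ≤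
      16 * γ + 8 * (ε₃ + 2 * ((√ε₂ + 2 * √ε₁) * (2 + (√ε₂ + 2 * √ε₁)))) := by
  have nZ := norm_eq_of_symmetric_involution hZ hZ2
  have nX := norm_eq_of_symmetric_involution hX hX2
  have half : ‖(1 / 2 : ℂ)‖ = 1 / 2 := by norm_num
  have nP : ∀ x, ‖(1 / 2 : ℂ) • (x + Z x)‖ ≤ ‖x‖ := fun x => by
    rw [norm_smul, half]
    have := norm_add_le x (Z x)
    rw [nZ] at this; linarith
  have nQ : ∀ x, ‖(1 / 2 : ℂ) • (x - Z x)‖ ≤ ‖x‖ := fun x => by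
    rw [norm_smul, half]
    have := norm_sub_le x (Z x)
    rw [nZ] at this; linarith
  have b₀ := Real.le_sqrt_of_sq_le h₀
  have b₁ := Real.le_sqrt_of_sq_le h₁
  have b₂ := Real.le_sqrt_of_sq_le h₂
  set δ := √ε₂ + 2 * √ε₁ with hδ
  -- With P, Q the projections onto the eigenspaces of Z for 1 and -1, Pξ - η₀ = P(ξ - η₀ - η₁) -
  -- Qη₀ + Pη₁, and each of the three terms is small.
  have d₀ : ‖(1 / 2 : ℂ) • (ξ + Z ξ) - η₀‖ ≤ δ := by
    have e : (1 / 2 : ℂ) • (ξ + Z ξ) - η₀ = (1 / 2 : ℂ) • ((ξ - η₀ - η₁) + Z (ξ - η₀ - η₁)) -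
        (1 / 2 : ℂ) • (η₀ - Z η₀) + (1 / 2 : ℂ) • (η₁ + Z η₁) := by
      simp only [map_sub]; module
    rw [e]
    refine (norm_add_le _ _).trans ?_
    have := norm_sub_le ((1 / 2 : ℂ) • ((ξ - η₀ - η₁) + Z (ξ - η₀ - η₁))) ((1 / 2 : ℂ) • (η₀ - Z η₀))
    have := nP (ξ - η₀ - η₁)
    linarith
  have d₁ : ‖(1 / 2 : ℂ) • (ξ - Z ξ) - η₁‖ ≤ δ := by
    have e : (1 / 2 : ℂ) • (ξ - Z ξ) - η₁ = (1 / 2 : ℂ) • ((ξ - η₀ - η₁) - Z (ξ - η₀ - η₁)) -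
        (1 / 2 : ℂ) • (η₁ + Z η₁) + (1 / 2 : ℂ) • (η₀ - Z η₀) := by
      simp only [map_sub]; module
    rw [e]
    refine (norm_add_le _ _).trans ?_
    have := norm_sub_le ((1 / 2 : ℂ) • ((ξ - η₀ - η₁) - Z (ξ - η₀ - η₁))) ((1 / 2 : ℂ) • (η₁ + Z η₁))
    have := nQ (ξ - η₀ - η₁)
    linarith
  have nT : ∀ x, ‖(S ∘ₗ X) x‖ ≤ ‖x‖ := fun x => (hS1 _).trans (nX x).le
  have c₀ := (abs_le.1 (re_inner_sub_re_inner_le nT ((nP ξ).trans hξ) d₀)).2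
  have c₁ := (abs_le.1 (re_inner_sub_re_inner_le nT ((nQ ξ).trans hξ) d₁)).2
  -- The mixed terms between ξ and Zξ cancel when the two eigenspace components are added, so the
  -- left side is twice the sum over the components, which are close to η₀ and η₁.
  have key : (inner ℂ ξ (S (X ξ))).re + (inner ℂ (Z ξ) (S (X (Z ξ)))).re ≤
      2 * (ε₃ + 2 * (δ * (2 + δ))) := by
    have e : inner ℂ ξ (S (X ξ)) + inner ℂ (Z ξ) (S (X (Z ξ))) =
        2 * (inner ℂ ((1 / 2 : ℂ) • (ξ + Z ξ)) ((S ∘ₗ X) ((1 / 2 : ℂ) • (ξ + Z ξ))) +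
          inner ℂ ((1 / 2 : ℂ) • (ξ - Z ξ)) ((S ∘ₗ X) ((1 / 2 : ℂ) • (ξ - Z ξ)))) := by
      simp only [LinearMap.comp_apply, map_smul, map_add, map_sub, inner_smul_left,
        inner_smul_right, inner_add_left, inner_add_right, inner_sub_left, inner_sub_right]
      simp only [map_div₀, map_one, Complex.conj_ofNat]
      ring
    rw [← Complex.add_re, e]
    simp only [LinearMap.comp_apply] at c₀ c₁ ⊢
    rw [Complex.add_re] at h₃
    rw [Complex.mul_re, Complex.add_re, Complex.re_ofNat, Complex.im_ofNat]
    linarith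
  have sq1 : ∀ x : E, ‖x‖ ≤ 1 → ‖x‖ ^ 2 ≤ 1 := fun x hx => by
    nlinarith [norm_nonneg x]
  -- Both vectors have norm at most 1 and the real part of their inner product is at least 1 - 2γ.
  have f₁ : ‖X ξ - S ξ‖ ^ 2 ≤ 4 * γ := by
    rw [norm_sub_sq (𝕜 := ℂ)]
    have h1 := sq1 _ ((nX ξ).trans_le hξ)
    have h2 := sq1 _ ((hS1 ξ).trans hξ)
    have h3 : RCLike.re (inner ℂ (X ξ) (S ξ)) = (inner ℂ ξ (S (X ξ))).re := by
      rw [inner_re_symm, hS]; rfl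
    rw [h3]; linarith
  have hZξ : ‖Z ξ‖ ≤ 1 := (nZ ξ).trans_le hξ
  -- By `key` and `h₄`, the inner product at Zξ has real part at most -1 up to errors, so X is close
  -- to -S there.
  have f₂ : ‖X (Z ξ) + S (Z ξ)‖ ^ 2 ≤ 4 * γ + 4 * (ε₃ + 2 * (δ * (2 + δ))) := by
    rw [norm_add_sq (𝕜 := ℂ)]
    have h1 := sq1 _ ((nX _).trans_le hZξ)
    have h2 := sq1 _ ((hS1 _).trans hZξ)
    have h3 : RCLike.re (inner ℂ (X (Z ξ)) (S (Z ξ))) = (inner ℂ (Z ξ) (S (X (Z ξ)))).re := by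
      rw [inner_re_symm, hS]; rfl
    rw [h3]; linarith
  -- Add and subtract ZSξ = SZξ; then (a + b)² ≤ 2a² + 2b².
  have e : Z (X ξ) + X (Z ξ) = Z (X ξ - S ξ) + (X (Z ξ) + S (Z ξ)) := by
    rw [map_sub, hSZ]; abel
  rw [e]
  have g := norm_add_le (Z (X ξ - S ξ)) (X (Z ξ) + S (Z ξ))
  rw [nZ] at g
  have g2 := pow_le_pow_left₀ (norm_nonneg _) g 2
  nlinarith [sq_nonneg (‖X ξ - S ξ‖ - ‖X (Z ξ) + S (Z ξ)‖)]

end Hilbert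

/-! ### Families of matrices as vectors -/

section VecOf

variable {ι H : Type}

/-- A family of matrices as a vector, with the Hilbert–Schmidt inner product. -/
def vecOf (Φ : ι → Matrix H H ℂ) : EuclideanSpace ℂ (ι × H × H) :=
  WithLp.toLp 2 fun p => Φ p.1 p.2.1 p.2.2

/-- The family of matrices given by a vector. -/
def famOf (v : EuclideanSpace ℂ (ι × H × H)) : ι → Matrix H H ℂ := fun j u u' => v (j, u, u')

theorem vecOf_famOf (v : EuclideanSpace ℂ (ι × H × H)) : vecOf (famOf v) = v := rfl

theorem vecOf_add (Φ Ψ : ι → Matrix H H ℂ) : vecOf (Φ + Ψ) = vecOf Φ + vecOf Ψ := rfl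

theorem vecOf_sub (Φ Ψ : ι → Matrix H H ℂ) : vecOf (Φ - Ψ) = vecOf Φ - vecOf Ψ := rfl

theorem vecOf_smul (c : ℂ) (Φ : ι → Matrix H H ℂ) : vecOf (c • Φ) = c • vecOf Φ := rfl

variable [Fintype ι] [Fintype H]

theorem inner_vecOf (Φ Ψ : ι → Matrix H H ℂ) :
    inner ℂ (vecOf Φ) (vecOf Ψ) = ∑ j, (Ψ j * (Φ j)ᴴ).trace := by
  rw [EuclideanSpace.inner_eq_star_dotProduct, dotProduct]
  simp only [Fintype.sum_prod_type]
  rfl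

theorem norm_sq_vecOf (Φ : ι → Matrix H H ℂ) :
    ‖vecOf Φ‖ ^ 2 = ∑ j, (Φ j * (Φ j)ᴴ).trace.re := by
  rw [← inner_self_eq_norm_sq (𝕜 := ℂ), inner_vecOf]
  exact Complex.re_sum _ _

/-- Multiplication by a family of matrices, from the left. -/
def mulOp (T : ι → Matrix H H ℂ) : EuclideanSpace ℂ (ι × H × H) →ₗ[ℂ] EuclideanSpace ℂ (ι × H × H) where
  toFun v := WithLp.toLp 2 fun p => ∑ w, T p.1 p.2.1 w * v (p.1, w, p.2.2)
  map_add' v w := by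
    ext p
    simp [mul_add, Finset.sum_add_distrib]
  map_smul' c v := by
    ext p
    simp [Finset.mul_sum, mul_left_comm]

theorem mulOp_vecOf (T Φ : ι → Matrix H H ℂ) : mulOp T (vecOf Φ) = vecOf fun j => T j * Φ j := rfl

theorem mulOp_mulOp (T U : ι → Matrix H H ℂ) (v : EuclideanSpace ℂ (ι × H × H)) :
    mulOp T (mulOp U v) = mulOp (fun j => T j * U j) v := by
  rw [← vecOf_famOf v, mulOp_vecOf, mulOp_vecOf, mulOp_vecOf]
  simp only [Matrix.mul_assoc]

theorem mulOp_isSymmetric {T : ι → Matrix H H ℂ} (hT : ∀ j, (T j)ᴴ = T j) :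
    (mulOp T).IsSymmetric := by
  intro v w
  rw [← vecOf_famOf v, ← vecOf_famOf w, mulOp_vecOf, mulOp_vecOf, inner_vecOf, inner_vecOf]
  refine Finset.sum_congr rfl fun j _ => ?_
  rw [Matrix.conjTranspose_mul, hT, ← Matrix.mul_assoc, Matrix.trace_mul_comm, Matrix.mul_assoc]

theorem trace_mul_conjTranspose_re_nonneg (A : Matrix H H ℂ) : 0 ≤ (A * Aᴴ).trace.re :=
  (Complex.le_def.1 (Matrix.posSemidef_self_mul_conjTranspose A).trace_nonneg).1

variable [DecidableEq H]

theorem mulOp_involution {T : ι → Matrix H H ℂ} (hT : ∀ j, T j * T j = 1)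
    (v : EuclideanSpace ℂ (ι × H × H)) : mulOp T (mulOp T v) = v := by
  rw [mulOp_mulOp, ← vecOf_famOf v, mulOp_vecOf]
  simp only [hT, Matrix.one_mul]

theorem norm_mulOp_real_le {s : ι → ℝ} (hs : ∀ j, |s j| ≤ 1) (v : EuclideanSpace ℂ (ι × H × H)) :
    ‖mulOp (fun j => (s j : ℂ) • (1 : Matrix H H ℂ)) v‖ ≤ ‖v‖ := by
  refine (sq_le_sq₀ (norm_nonneg _) (norm_nonneg _)).1 ?_
  rw [← vecOf_famOf v, mulOp_vecOf, norm_sq_vecOf, norm_sq_vecOf]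
  refine Finset.sum_le_sum fun j _ => ?_
  have h : ((s j : ℂ) • (1 : Matrix H H ℂ) * famOf v j) *
      ((s j : ℂ) • (1 : Matrix H H ℂ) * famOf v j)ᴴ =
      ((s j ^ 2 : ℝ) : ℂ) • (famOf v j * (famOf v j)ᴴ) := by
    rw [Matrix.smul_mul, Matrix.one_mul, Matrix.conjTranspose_smul, Matrix.smul_mul,
      Matrix.mul_smul, smul_smul, Complex.star_def, Complex.conj_ofReal]
    push_cast; ring_nf
  rw [h, Matrix.trace_smul, smul_eq_mul, Complex.re_ofReal_mul]
  refine mul_le_of_le_one_left (trace_mul_conjTranspose_re_nonneg _) ?_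
  exact (sq_le_one_iff_abs_le_one _).2 (hs j)

end VecOf

end

/-! ### Expectations in experiments and the two cryptographic assumptions. -/

noncomputable section

theorem sum_encBit (f : Bits 1 → ℝ) : ∑ z, f z = f (encBit false) + f (encBit true) := by
  rw [← encBit.sum_comp, Fintype.sum_bool, add_comm]

namespace Device

variable {F : ENTCF} {D : Device F}

namespace Experiment

variable (X : D.Experiment)

/-- The results of all measurements of the device. -/
abbrev Out (F : ENTCF) (l : ℕ) : Type :=
  Ans F l × ((Bool × Bool) × (Bool × Bool) × (Bool × Bool))

/-- The expectation of a function of the given key, the generated key, its trapdoor, and the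
results, if the given key has type `θ`. -/
def expect (θ : Bool) (l : ℕ)
    (f : Bits (F.κ l) → Bits (F.κ l) → Bits (F.τ l) → Out F l → Obs F l → ℝ) : ℝ :=
  ∑ x, ∑ k, ∑ t, F.keyProb θ l x * F.genProb X.θ l k t *
    ∑ p : Out F l, ∑ o, f x k t p o * X.weight l (ordered X.j x k) p.1 p.2 o

/-- Everything the verifier knows at the end of the experiment, except the keys. -/
abbrev Res (F : ENTCF) (l : ℕ) : Type := Out F l × Obs F l × (Bool × F.W l)

/-- The results, with the decoded image. -/
def res (l : ℕ) (t : Bits (F.τ l)) (p : Out F l) (o : Obs F l) : Res F l :=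
  (p, o, F.invG l (t, sel (!X.j) o.1))

theorem exists_circuits_expect {m : ℕ → ℕ} (hm : EfficientLength m)
    (G : ∀ l, Res F l → Bits (m l)) (hG : (X.final.pad hm).Loads m fun l r => G l (results l r)) :
    ∃ A : ℕ → Circuit, EfficientCircuits A ∧ ∀ θ l (φ : Bits (F.κ l) → Bits (m l) → ℝ),
      ∑ x, F.keyProb θ l x * ∑ z, φ x z * (A l).out x z =
        X.expect θ l fun x _ t p o => φ x (G l (X.res l t p o)) := by
  obtain ⟨A, hA, h⟩ := X.exists_circuits hm G hG
  refine ⟨A, hA, fun θ l φ => Finset.sum_congr rfl fun x _ => ?_⟩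
  have e : ∀ z, φ x z * (A l).out x z = ∑ k, ∑ t, F.genProb X.θ l k t * ∑ p : Out F l, ∑ o,
      if G l (X.res l t p o) = z then
        φ x (G l (X.res l t p o)) * X.weight l (ordered X.j x k) p.1 p.2 o else 0 := by
    intro z
    rw [h]
    simp only [Finset.mul_sum]
    refine Finset.sum_congr rfl fun k _ => Finset.sum_congr rfl fun t _ =>
      Finset.sum_congr rfl fun p _ => Finset.sum_congr rfl fun o _ => ?_
    rw [res]
    split_ifs with hz
    · rw [hz]; ring
    · simp
  rw [Finset.sum_congr rfl fun z _ => e z, Finset.sum_comm, Finset.mul_sum]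
  refine Finset.sum_congr rfl fun k _ => ?_
  rw [Finset.sum_comm, Finset.mul_sum]
  refine Finset.sum_congr rfl fun t _ => ?_
  rw [← Finset.mul_sum, Finset.sum_comm, mul_assoc]
  congr 2
  refine Finset.sum_congr rfl fun p _ => ?_
  rw [Finset.sum_comm]
  refine Finset.sum_congr rfl fun o _ => ?_
  rw [Finset.sum_ite_eq, if_pos (Finset.mem_univ _)]

/-- Injective invariance: an efficiently computed bit has nearly the same distribution for both
types of the given key. -/
theorem expect_invariance (G : ∀ l, Res F l → Bool)
    (hG : (X.final.pad (efficientLength_const 1)).Loads (fun _ => 1)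
      fun l r => encBit (G l (results l r))) :
    ∃ μ, Negligible μ ∧ ∀ l,
      |X.expect true l (fun _ _ t p o => if G l (X.res l t p o) = false then 1 else 0) -
        X.expect false l fun _ _ t p o => if G l (X.res l t p o) = false then 1 else 0| ≤ μ l ∧
      |X.expect true l (fun _ _ t p o => sgnR (G l (X.res l t p o))) -
        X.expect false l fun _ _ t p o => sgnR (G l (X.res l t p o))| ≤ 2 * μ l := by
  obtain ⟨A, hA, h⟩ := X.exists_circuits_expect (efficientLength_const 1)
    (fun l r => encBit (G l r)) hG
  obtain ⟨μ, hμ, hb⟩ := F.invariance A hA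
  have e1 : ∀ θ l, X.expect θ l (fun _ _ t p o => if G l (X.res l t p o) = false then 1 else 0) =
      ∑ k, F.keyProb θ l k * (A l).prob k encBit {false} := by
    intro θ l
    have := h θ l fun _ z => if encBit.symm z = false then 1 else 0
    simp only [Equiv.symm_apply_apply] at this
    rw [← this]
    refine Finset.sum_congr rfl fun x _ => ?_
    rw [Circuit.prob]
    simp only [Set.mem_singleton_iff, ite_mul, one_mul, zero_mul]
  -- The sign has expectation twice the probability of `false` minus one, because the outcome
  -- probabilities and the key probabilities add up to 1.
  have e2 : ∀ θ l, X.expect θ l (fun _ _ t p o => sgnR (G l (X.res l t p o))) =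
      2 * X.expect θ l (fun _ _ t p o => if G l (X.res l t p o) = false then 1 else 0) - 1 := by
    intro θ l
    have h1 := h θ l fun _ z => sgnR (encBit.symm z)
    have h2 := h θ l fun _ z => if encBit.symm z = false then 1 else 0
    simp only [Equiv.symm_apply_apply] at h1 h2
    rw [← h1, ← h2]
    refine Eq.trans ?_ (congrArg (fun s => 2 * _ - s) (F.sum_keyProb θ l))
    rw [Finset.mul_sum, ← Finset.sum_sub_distrib]
    refine Finset.sum_congr rfl fun x _ => ?_
    have h3 := (A l).sum_out (m := 1) x
    rw [sum_encBit] at h3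
    rw [sum_encBit, sum_encBit]
    simp only [Equiv.symm_apply_apply, sgnR, if_true, if_false, Bool.false_eq_true,
      Bool.true_eq_false]
    linear_combination -F.keyProb θ l x * h3
  refine ⟨μ, hμ, fun l => ⟨?_, ?_⟩⟩
  · rw [e1, e1]; exact hb l
  · rw [e2, e2, e1, e1, sub_sub_sub_cancel_right, ← mul_sub, abs_mul, abs_two]
    exact mul_le_mul_of_nonneg_left (hb l) zero_le_two

/-- Adaptive hardcore bit. -/
theorem expect_hardcore (G : ∀ l, Res F l → (Bool × Bits (F.w l)) × (Bits (F.w l) × Bool))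
    (hG : (X.final.pad ((dec_eff F).add (F.w_eff.add (efficientLength_const 1)))).Loads
      (fun l => 1 + F.w l + (F.w l + 1)) fun l r =>
        encPair (encPair encBit (encSelf _)) (encPair (encSelf _) encBit) (G l (results l r))) :
    ∃ μ, Negligible μ ∧ ∀ l,
      |X.expect true l fun x _ t p o => F.hardcoreSign l x (G l (X.res l t p o))| ≤ μ l := by
  classical
  obtain ⟨A, hA, h⟩ := X.exists_circuits_expect _ (fun l r =>
    encPair (encPair encBit (encSelf _)) (encPair (encSelf _) encBit) (G l r)) hG
  obtain ⟨μ, hμ, hb⟩ := F.hardcore A hA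
  refine ⟨μ, hμ, fun l => ?_⟩
  have := h true l fun x z => F.hardcoreSign l x
    ((encPair (encPair encBit (encSelf _)) (encPair (encSelf _) encBit)).symm z)
  simp only [Equiv.symm_apply_apply] at this
  rw [← this]
  refine le_trans (le_of_eq ?_) (hb l)
  congr 1
  refine Finset.sum_congr rfl fun x _ => ?_
  rw [Circuit.prob, Circuit.prob, ← Finset.sum_sub_distrib]
  congr 1
  refine Finset.sum_congr rfl fun z _ => ?_
  rw [ENTCF.hardcoreSign, sub_mul]
  congr 1 <;> rw [ite_mul, one_mul, zero_mul]

end Experiment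

end Device

end

/-! ### Weights of operators, and experiments with a single question. -/

noncomputable section

theorem ordered_not {α : Type} (i : Bool) (a b : α) : ordered (!i) a b = ordered i b a := by
  cases i <;> rfl

namespace IsProjectiveMeasurement

variable {I H : Type} [Fintype I] [DecidableEq I] [Fintype H] [DecidableEq H]
  {E : I → Matrix H H ℂ} (h : IsProjectiveMeasurement E)
include h

theorem trace_conj (i : I) (A : Matrix H H ℂ) : (E i * A * (E i)ᴴ).trace = (E i * A).trace := by
  rw [Matrix.trace_mul_comm, ← Matrix.mul_assoc, h.isHermitian, h.mul_self]

theorem trace_conj_sum (s : Finset I) (A : Matrix H H ℂ) :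
    ((∑ i ∈ s, E i) * A * (∑ i ∈ s, E i)ᴴ).trace = ((∑ i ∈ s, E i) * A).trace := by
  rw [Matrix.trace_mul_comm, ← Matrix.mul_assoc, h.isHermitian_sum s, h.sum_mul_sum,
    Finset.inter_self]

theorem sum_trace_conj_eq (s : Finset I) (A : Matrix H H ℂ) :
    ∑ i ∈ s, (E i * A * (E i)ᴴ).trace = ((∑ i ∈ s, E i) * A * (∑ i ∈ s, E i)ᴴ).trace := by
  rw [h.trace_conj_sum, Finset.sum_mul, Matrix.trace_sum]
  exact Finset.sum_congr rfl fun i _ => h.trace_conj i A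

end IsProjectiveMeasurement

namespace Device

variable {F : ENTCF} (D : Device F)

/-- The weight of the state after the operator `L`. -/
def wgt (l : ℕ) (k : Bits (F.κ l) × Bits (F.κ l)) (o : Obs F l)
    (L : Matrix (Bits (D.nD l)) (Bits (D.nD l)) ℂ) : ℝ :=
  (L * D.ψ l k.1 k.2 o.1 * Lᴴ).trace.re

@[simp] theorem wgt_zero (l : ℕ) (k : Bits (F.κ l) × Bits (F.κ l)) (o : Obs F l) :
    D.wgt l k o 0 = 0 := by simp [wgt]

theorem wgt_eq (l : ℕ) (k : Bits (F.κ l) × Bits (F.κ l)) (o : Obs F l)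
    (L : Matrix (Bits (D.nD l)) (Bits (D.nD l)) ℂ) :
    D.wgt l k o L = ((L * D.root l k o.1) * (L * D.root l k o.1)ᴴ).trace.re := by
  rw [wgt, ← D.root_mul, Matrix.conjTranspose_mul]
  simp only [Matrix.mul_assoc]

theorem wgt_nonneg (l : ℕ) (k : Bits (F.κ l) × Bits (F.κ l)) (o : Obs F l)
    (L : Matrix (Bits (D.nD l)) (Bits (D.nD l)) ℂ) : 0 ≤ D.wgt l k o L := by
  rw [wgt_eq]; exact trace_mul_conjTranspose_re_nonneg _

theorem wgt_smul (l : ℕ) (k : Bits (F.κ l) × Bits (F.κ l)) (o : Obs F l) (c : ℂ)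
    (L : Matrix (Bits (D.nD l)) (Bits (D.nD l)) ℂ) :
    D.wgt l k o (c • L) = ‖c‖ ^ 2 * D.wgt l k o L := by
  rw [wgt, wgt, Matrix.conjTranspose_smul, Matrix.smul_mul, Matrix.smul_mul, Matrix.mul_smul,
    smul_smul, Matrix.trace_smul, smul_eq_mul, Complex.star_def, Complex.mul_conj,
    Complex.re_ofReal_mul, Complex.normSq_eq_norm_sq]

/-- The cross terms between orthogonal projectors vanish under the trace. -/
theorem sum_wgt_mul (l : ℕ) (k : Bits (F.κ l) × Bits (F.κ l)) (o : Obs F l) {I : Type} [Fintype I]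
    [DecidableEq I] {E : I → Matrix (Bits (D.nD l)) (Bits (D.nD l)) ℂ}
    (h : IsProjectiveMeasurement E) (s : Finset I) (L : Matrix (Bits (D.nD l)) (Bits (D.nD l)) ℂ) :
    ∑ i ∈ s, D.wgt l k o (E i * L) = D.wgt l k o ((∑ i ∈ s, E i) * L) := by
  have := congrArg Complex.re (h.sum_trace_conj_eq s (L * D.ψ l k.1 k.2 o.1 * Lᴴ))
  rw [Complex.re_sum] at this
  simpa only [wgt, Matrix.conjTranspose_mul, Matrix.mul_assoc] using this

theorem sum_wgt_mul_univ (l : ℕ) (k : Bits (F.κ l) × Bits (F.κ l)) (o : Obs F l) {I : Type}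
    [Fintype I] [DecidableEq I] {E : I → Matrix (Bits (D.nD l)) (Bits (D.nD l)) ℂ}
    (h : IsProjectiveMeasurement E) (L : Matrix (Bits (D.nD l)) (Bits (D.nD l)) ℂ) :
    ∑ i, D.wgt l k o (E i * L) = D.wgt l k o L := by
  rw [D.sum_wgt_mul l k o h, h.2.2, Matrix.one_mul]

/-- The weight of an answer at one place. -/
theorem sum_ite_wgt (l : ℕ) (k : Bits (F.κ l) × Bits (F.κ l)) (o : Obs F l) (q : Bool × Bool)
    (i b : Bool) (L : Matrix (Bits (D.nD l)) (Bits (D.nD l)) ℂ) :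
    ∑ v, (if xor (sel i v) b = false then 1 else 0) * D.wgt l k o (D.P l q v o * L) =
      D.wgt l k o (D.marg l q i b o * L) := by
  rw [marg, ← D.sum_wgt_mul l k o (D.P_block l q o), Finset.sum_filter]
  refine Finset.sum_congr rfl fun v _ => ?_
  rw [ite_mul, one_mul, zero_mul]
  refine if_congr ?_ rfl rfl
  cases sel i v <;> cases b <;> simp

theorem sum_sgnR_wgt (l : ℕ) (k : Bits (F.κ l) × Bits (F.κ l)) (o : Obs F l) (q : Bool × Bool)
    (i : Bool) (L : Matrix (Bits (D.nD l)) (Bits (D.nD l)) ℂ) :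
    ∑ v, sgnR (sel i v) * D.wgt l k o (D.P l q v o * L) =
      (D.obs l q i o * (L * D.ψ l k.1 k.2 o.1 * Lᴴ)).trace.re := by
  rw [obs, Finset.sum_mul, Matrix.trace_sum, Complex.re_sum]
  refine Finset.sum_congr rfl fun v _ => ?_
  have := (D.P_block l q o).trace_conj v (L * D.ψ l k.1 k.2 o.1 * Lᴴ)
  rw [Matrix.smul_mul, Matrix.trace_smul, ← this, wgt]
  simp only [Matrix.conjTranspose_mul, Matrix.mul_assoc]
  cases sel i v <;> simp [sgn, sgnR]

namespace Experiment

variable {D}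

/-- The experiment with a single question after the strings `d`. -/
def single (hD : D.Efficient) (j θ : Bool) (A : D.MeasHY) (q : Bool × Bool) : D.Experiment :=
  ⟨hD, j, θ, A, .question hD q, .idle, .idle⟩

/-- An idle measurement always returns the zero string, so the second and third answers are fixed
and drop out of later sums. -/
theorem weight_single (hD : D.Efficient) (j θ : Bool) (A : D.MeasHY) (q : Bool × Bool) (l : ℕ)
    (k : Bits (F.κ l) × Bits (F.κ l)) (p : Out F l) (o : Obs F l) :
    (single hD j θ A q).weight l k p.1 p.2 o =
      if p.2.2.1 = encV.symm (zeros _) then if p.2.2.2 = encV.symm (zeros _) then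
        D.wgt l k o (D.P l q p.2.1 o * (D.M l o.2 o.1 * A.E l p.1 o.1)) else 0 else 0 := by
  have h : (single hD j θ A q).K l p.1 p.2.1 p.2.2.1 p.2.2.2 o =
      if p.2.2.1 = encV.symm (zeros _) then if p.2.2.2 = encV.symm (zeros _) then
        D.P l q p.2.1 o * (D.M l o.2 o.1 * A.E l p.1 o.1) else 0 else 0 := by
    simp only [K, single, MeasHYR.idle, MeasHYR.question, ← Equiv.eq_symm_apply]
    split_ifs <;> simp
  change D.wgt l k o ((single hD j θ A q).K l p.1 p.2.1 p.2.2.1 p.2.2.2 o) = _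
  rw [h]
  split_ifs <;> simp

theorem sum_single (hD : D.Efficient) (j θ : Bool) (A : D.MeasHY) (q : Bool × Bool) (l : ℕ)
    (k : Bits (F.κ l) × Bits (F.κ l)) (f : Ans F l → Bool × Bool → Obs F l → ℝ) :
    ∑ p : Out F l, ∑ o, f p.1 p.2.1 o * (single hD j θ A q).weight l k p.1 p.2 o =
      ∑ a, ∑ o, ∑ v, f a v o * D.wgt l k o (D.P l q v o * (D.M l o.2 o.1 * A.E l a o.1)) := by
  simp only [weight_single, mul_ite, mul_zero]
  simp only [Fintype.sum_prod_type (f := fun p : Out F l => _),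
    Fintype.sum_prod_type (f := fun p : (Bool × Bool) × (Bool × Bool) × (Bool × Bool) => _),
    Fintype.sum_prod_type (f := fun p : (Bool × Bool) × (Bool × Bool) => _)]
  refine Finset.sum_congr rfl fun a _ => ?_
  rw [Finset.sum_comm (s := (Finset.univ : Finset (Obs F l)))]
  refine Finset.sum_congr rfl fun v _ => ?_
  rw [Finset.sum_eq_single (encV.symm (zeros _)), Finset.sum_eq_single (encV.symm (zeros _))]
  · refine Finset.sum_congr rfl fun o _ => ?_
    rw [if_pos rfl, if_pos rfl]
  · intro b _ hb
    simp only [if_neg hb, ite_self, Finset.sum_const_zero]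
  · simp
  · intro b _ hb
    simp only [if_neg hb, Finset.sum_const_zero]
  · simp

theorem sum_single_idle (hD : D.Efficient) (j θ : Bool) (q : Bool × Bool) (l : ℕ)
    (k : Bits (F.κ l) × Bits (F.κ l)) (f : Bool × Bool → Obs F l → ℝ) :
    ∑ p : Out F l, ∑ o, f p.2.1 o * (single hD j θ .idle q).weight l k p.1 p.2 o =
      ∑ o, ∑ v, f v o * D.wgt l k o (D.P l q v o * D.M l o.2 o.1) := by
  rw [sum_single hD j θ .idle q l k fun _ v o => f v o,
    Finset.sum_eq_single ((encAns F l).symm (zeros _))]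
  · refine Finset.sum_congr rfl fun o _ => Finset.sum_congr rfl fun v _ => ?_
    simp only [MeasHY.idle, Equiv.apply_symm_apply, if_true, Matrix.mul_one]
  · intro a _ ha
    refine Finset.sum_eq_zero fun o _ => Finset.sum_eq_zero fun v _ => ?_
    rw [Ne, Equiv.eq_symm_apply] at ha
    simp only [MeasHY.idle, if_neg ha, wgt_zero, mul_zero]
  · simp

theorem sum_genProb_mul {θ : Bool} {l : ℕ} (k : Bits (F.κ l)) (c d : ℝ) :
    ∑ t, c * F.genProb θ l k t * d = c * F.keyProb θ l k * d := by
  rw [← Finset.sum_mul, ← Finset.mul_sum]; rfl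

end Experiment

end Device

end

/-! ### The three single-question experiments behind the estimates. -/

noncomputable section

theorem place_xorBits {e off len : ℕ} (f g : Bits len) :
    place e off (xorBits f g) = xorBits (place e off f) (place e off g) := by
  refine bits_ext fun i hi => ?_
  rw [bitAt_xorBits, bitAt_place _ _ hi, bitAt_place _ _ hi, bitAt_place _ _ hi, bitAt_xorBits]
  cases decide (off ≤ i) <;> simp

theorem place_append {e off m n : ℕ} (f : Bits m) (g : Bits n) :
    place e off (Fin.append f g) = xorBits (place e off f) (place e (off + m) g) := by
  refine bits_ext fun i hi => ?_
  rw [bitAt_xorBits, bitAt_place _ _ hi, bitAt_place _ _ hi, bitAt_place _ _ hi, bitAt_append]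
  by_cases h1 : off ≤ i
  · by_cases h2 : i < off + m
    · have h3 : i - off < m := by omega
      have h5 : ¬ off + m ≤ i := by omega
      simp [h1, h3, h5]
    · have h3 : ¬ i - off < m := by omega
      have h5 : off + m ≤ i := by omega
      have h6 : i - off - m = i - (off + m) := by omega
      simp [h1, h3, h5, h6, bitAt_of_le f (not_lt.1 h3)]
  · have h5 : ¬ off + m ≤ i := by omega
    simp [h1, h5]

namespace Device

variable {F : ENTCF} {D : Device F}

namespace Experiment

/-- The probability that the answer at the place `i` agrees with the decoded image. -/
def imageProb (D : Device F) (i θ : Bool) (l : ℕ) : ℝ :=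
  ∑ j : (Bits (F.κ l) × Bits (F.τ l)) × Bits (F.κ l),
    F.genProb false l j.1.1 j.1.2 * F.keyProb θ l j.2 *
      ∑ o, D.wgt l (ordered i j.1.1 j.2) o
        (D.marg l (false, false) i (F.invG l (j.1.2, sel i o.1)).1 o * D.M l o.2 o.1)

/-- The probability that the answer at the place `i` agrees with the bit of the preimage that has
been measured before. -/
def preimageProb (D : Device F) (i θ : Bool) (l : ℕ) : ℝ :=
  ∑ k, F.pairProb (ordered i θ false) l k * ∑ a : Ans F l, ∑ o,
    D.wgt l k o (D.marg l (false, false) i (sel i a).1 o * (D.M l o.2 o.1 * D.Pi l a o.1))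

/-- The experimenter generates the injective key at the place `i` with its trapdoor, so the
comparison with the decoded image is efficient. The key whose type changes is the given one at the
other place. -/
theorem imageProb_invariance (hD : D.Efficient) (i : Bool) :
    ∃ μ, Negligible μ ∧ ∀ l, |imageProb D i true l - imageProb D i false l| ≤ μ l := by
  let X := single hD (!i) false .idle (false, false)
  obtain ⟨μ, hμ, h⟩ := X.expect_invariance (fun l r => xor (sel i r.1.2.1) r.2.2.1) (by
    simp only [encBit_xor]
    exact ((X.readable_v₁ i).pad _).loads_self.xor ((X.readable_dec).pad _).loads_self)
  have e : ∀ θ l, X.expect θ l (fun _ _ t p o =>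
      if xor (sel i (X.res l t p o).1.2.1) (X.res l t p o).2.2.1 = false then 1 else 0) =
      imageProb D i θ l := by
    intro θ l
    rw [imageProb, Fintype.sum_prod_type, Fintype.sum_prod_type, expect, Finset.sum_comm]
    refine Finset.sum_congr rfl fun k _ => ?_
    rw [Finset.sum_comm]
    refine Finset.sum_congr rfl fun t _ => Finset.sum_congr rfl fun x _ => ?_
    rw [mul_comm (F.keyProb θ l x)]
    congr 1
    have := sum_single_idle hD (!i) false (false, false) l (ordered (!i) x k) fun v o =>
      if xor (sel i v) (F.invG l (t, sel i o.1)).1 = false then 1 else 0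
    rw [ordered_not] at this
    simp only [sum_ite_wgt] at this
    rw [← this, ← ordered_not]
    simp only [res, X, single, Bool.not_not]
  exact ⟨μ, hμ, fun l => by simpa only [e] using (h l).1⟩

/-- The answer is compared with a measured preimage, so no trapdoor for the key at the place `i` is
needed and that key can be the given one. -/
theorem preimageProb_invariance (hD : D.Efficient) (i : Bool) :
    ∃ μ, Negligible μ ∧ ∀ l, |preimageProb D i true l - preimageProb D i false l| ≤ μ l := by
  let X := single hD i false (.preimage hD) (false, false)
  obtain ⟨μ, hμ, h⟩ := X.expect_invariance (fun l r => xor (sel i r.1.2.1) (sel i r.1.1).1) (by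
    simp only [encBit_xor]
    exact ((X.readable_v₁ i).pad _).loads_self.xor ((X.readable_ans_bit i).pad _).loads_self)
  have e : ∀ θ l, X.expect θ l (fun _ _ t p o =>
      if xor (sel i (X.res l t p o).1.2.1) (sel i (X.res l t p o).1.1).1 = false then 1 else 0) =
      preimageProb D i θ l := by
    intro θ l
    rw [preimageProb, ← sum_ordered i, expect]
    refine Finset.sum_congr rfl fun x _ => Finset.sum_congr rfl fun k _ => ?_
    rw [F.pairProb_ordered, ← sum_genProb_mul]
    refine Finset.sum_congr rfl fun t _ => ?_
    have := sum_single hD i false (.preimage hD) (false, false) l (ordered i x k) fun a v _ =>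
      if xor (sel i v) (sel i a).1 = false then 1 else 0
    simp only [sum_ite_wgt] at this
    exact congrArg _ this
  exact ⟨μ, hμ, fun l => by simpa only [e] using (h l).1⟩

/-- The advantage of the adversary that measures a preimage and the string `d` and uses the answer
at the place `i` and the other image to guess the hardcore bit. -/
def hardcoreAdv (D : Device F) (i : Bool) (l : ℕ) : ℝ :=
  ∑ x, ∑ k, ∑ t, F.keyProb true l x * F.genProb false l k t * ∑ a : Ans F l, ∑ o : Obs F l, ∑ v,
    F.hardcoreSign l x (sel i a, (sel i o.2, xor (sel i v) (F.invG l (t, sel (!i) o.1)).1)) *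
      D.wgt l (ordered i x k) o (D.P l (true, true) v o * (D.M l o.2 o.1 * D.Pi l a o.1))

/-- The given key is claw-free and sits at the place `i`. Preimage and string `d` come from the
device, and the guess is its X answer added to the bit of the other image, which is decoded with the
generated trapdoor. -/
theorem abs_hardcoreAdv_le (hD : D.Efficient) (i : Bool) :
    ∃ μ, Negligible μ ∧ ∀ l, |hardcoreAdv D i l| ≤ μ l := by
  let X := single hD i false (.preimage hD) (true, true)
  obtain ⟨μ, hμ, h⟩ := X.expect_hardcore
    (fun l r => (sel i r.1.1, (sel i r.2.1.2, xor (sel i r.1.2.1) r.2.2.1))) (by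
    have h1 := ((X.readable_ans_pair i).pad ((dec_eff F).add (F.w_eff.add
      (efficientLength_const 1)))).loads (efficientLength_const 0) fun l => 1 + F.w l + (F.w l + 1)
    have h2 := ((X.readable_d i).pad ((dec_eff F).add (F.w_eff.add
      (efficientLength_const 1)))).loads (dec_eff F) fun l => 1 + F.w l + (F.w l + 1)
    have h3 := ((X.readable_v₁ i).pad ((dec_eff F).add (F.w_eff.add (efficientLength_const
      1)))).loads ((dec_eff F).add F.w_eff) fun l => 1 + F.w l + (F.w l + 1)
    have h4 := (X.readable_dec.pad ((dec_eff F).add (F.w_eff.add (efficientLength_const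
      1)))).loads ((dec_eff F).add F.w_eff) fun l => 1 + F.w l + (F.w l + 1)
    -- The output is assembled modulo 2: the preimage, the string `d` after it, and two bits added
    -- on the last wire.
    refine Eq.mp (congrArg _ (funext fun l => funext fun r => ?_)) (h1.xor (h2.xor (h3.xor h4)))
    rw [← place_xorBits, ← encBit_xor, ← place_append, xorBits_place_eq_append]
    rfl)
  refine ⟨μ, hμ, fun l => le_of_eq_of_le (congrArg _ ?_) (h l)⟩
  refine Finset.sum_congr rfl fun x _ => Finset.sum_congr rfl fun k _ =>
    Finset.sum_congr rfl fun t _ => congrArg _ ?_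
  exact (sum_single hD i false (.preimage hD) (true, true) l (ordered i x k) fun a v o =>
    F.hardcoreSign l x (sel i a, (sel i o.2, xor (sel i v) (F.invG l (t, sel (!i) o.1)).1))).symm

end Experiment

end Device

end

/-! ### The squared anticommutator as an expectation in an experiment. -/

noncomputable section

theorem Negligible.sum {ι : Type*} (s : Finset ι) {μ : ι → ℕ → ℝ} (h : ∀ i ∈ s, Negligible (μ i)) :
    Negligible fun l => ∑ i ∈ s, μ i l := by
  refine ⟨fun l => Finset.sum_nonneg fun i hi => (h i hi).1 l, fun p => ?_⟩
  simp only [Finset.sum_mul]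
  simpa using tendsto_finsetSum s fun i hi => (h i hi).2 p

section Anticommutator

variable {H : Type} [Fintype H] [DecidableEq H]

/-- Measuring X without keeping the result turns ρ into (ρ + XρX)/2. Measuring Z with the sign of
its result turns σ into (Zσ + σZ)/2. The trace of Z against the composite has four terms, which by
cyclicity and Z² = X² = 1 are those of the square of ZX + XZ. -/
theorem four_mul_trace_eq {Z X σ : Matrix H H ℂ} (hZ : Z * Z = 1) (hX : X * X = 1)
    {p q : Bool → Matrix H H ℂ} (hp : ∀ b, p b = (1 / 2 : ℂ) • (1 + sgn b • Z))
    (hq : ∀ b, q b = (1 / 2 : ℂ) • (1 + sgn b • X)) :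
    4 * ∑ b, ∑ c, sgn b * (Z * (q c * (p b * σ * p b) * q c)).trace =
      ((Z * X + X * Z) * (Z * X + X * Z) * σ).trace := by
  have h1 : ∀ ρ : Matrix H H ℂ, ∑ c, q c * ρ * q c = (1 / 2 : ℂ) • (ρ + X * ρ * X) := by
    intro ρ
    simp only [hq, Fintype.sum_bool, sgn, if_true, if_false, Bool.false_eq_true, one_smul,
      neg_smul, mul_add, add_mul, neg_mul, smul_mul_assoc, mul_smul_comm, smul_smul,
      one_mul, mul_one]
    module
  have h2 : ∑ b, sgn b • (p b * σ * p b) = (1 / 2 : ℂ) • (Z * σ + σ * Z) := by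
    simp only [hp, Fintype.sum_bool, sgn, if_true, if_false, Bool.false_eq_true, one_smul,
      neg_smul, mul_add, add_mul, neg_mul, smul_mul_assoc, mul_smul_comm, smul_smul,
      one_mul, mul_one]
    module
  have h3 : ∑ b, ∑ c, sgn b * (Z * (q c * (p b * σ * p b) * q c)).trace =
      (Z * ∑ c, q c * (∑ b, sgn b • (p b * σ * p b)) * q c).trace := by
    rw [Finset.sum_comm, Finset.mul_sum, Matrix.trace_sum]
    refine Finset.sum_congr rfl fun c _ => ?_
    rw [Finset.mul_sum, Finset.sum_mul, Finset.mul_sum, Matrix.trace_sum]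
    refine Finset.sum_congr rfl fun b _ => ?_
    rw [mul_smul_comm, smul_mul_assoc, mul_smul_comm, Matrix.trace_smul, smul_eq_mul]
  have c1 : (Z * (σ * Z)).trace = σ.trace := by
    rw [Matrix.trace_mul_comm, Matrix.mul_assoc, hZ, Matrix.mul_one]
  have c2 : (Z * (X * (Z * σ) * X)).trace = (X * Z * (X * Z) * σ).trace := by
    rw [Matrix.mul_assoc X, ← Matrix.mul_assoc Z X, ← Matrix.mul_assoc (Z * X),
      Matrix.trace_mul_comm]
    simp only [Matrix.mul_assoc]
  have c3 : (Z * (X * (σ * Z) * X)).trace = (Z * X * (Z * X) * σ).trace := by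
    have : Z * (X * (σ * Z) * X) = (Z * X * σ) * (Z * X) := by simp only [Matrix.mul_assoc]
    rw [this, Matrix.trace_mul_comm]
    simp only [Matrix.mul_assoc]
  have c4 : Z * X * (X * Z) = 1 := by
    rw [Matrix.mul_assoc, ← Matrix.mul_assoc X, hX, Matrix.one_mul, hZ]
  have c5 : X * Z * (Z * X) = 1 := by
    rw [Matrix.mul_assoc, ← Matrix.mul_assoc Z, hZ, Matrix.one_mul, hX]
  rw [h3, h1, h2]
  simp only [Matrix.mul_add, Matrix.add_mul, Matrix.mul_smul, Matrix.smul_mul, Matrix.trace_add,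
    Matrix.trace_smul, smul_eq_mul, c1, c2, c3, c4, c5, Matrix.one_mul]
  rw [← Matrix.mul_assoc Z Z, hZ, Matrix.one_mul]
  ring

end Anticommutator

namespace Device

variable {F : ENTCF} {D : Device F}

/-- The last measurement only contributes the expectation of a sign of its answer at `i`, so the
full question can be asked there. The first two have to be the marginal measurements, as the state
after them matters. -/
theorem sum_marg_anticomm (D : Device F) (l : ℕ) (i : Bool) (k : Bits (F.κ l) × Bits (F.κ l))
    (o : Obs F l) (L : Matrix (Bits (D.nD l)) (Bits (D.nD l)) ℂ) :
    4 * ∑ b, ∑ c, ∑ v, sgnR (xor b (sel i v)) * D.wgt l k o (D.P l (false, false) v o *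
      (D.marg l (true, true) i c o * (D.marg l (false, false) i b o * L))) =
      stateNormSq (anticomm (D.obs l (false, false) i o) (D.obs l (true, true) i o))
        (L * D.ψ l k.1 k.2 o.1 * Lᴴ) := by
  have h := four_mul_trace_eq (σ := L * D.ψ l k.1 k.2 o.1 * Lᴴ)
    (D.obs_mul_self l (false, false) i o) (D.obs_mul_self l (true, true) i o)
    (fun b => D.marg_eq l (false, false) i b o) (fun b => D.marg_eq l (true, true) i b o)
  have hN : (anticomm (D.obs l (false, false) i o) (D.obs l (true, true) i o))ᴴ =
      anticomm (D.obs l (false, false) i o) (D.obs l (true, true) i o) := by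
    rw [anticomm, Matrix.conjTranspose_add, Matrix.conjTranspose_mul, Matrix.conjTranspose_mul,
      obs_isHermitian, obs_isHermitian, add_comm]
  rw [stateNormSq, hN, anticomm, ← h]
  have h4 : (4 : ℂ) = ((4 : ℝ) : ℂ) := by norm_num
  rw [h4, Complex.re_ofReal_mul, Complex.re_sum]
  congr 1
  refine Finset.sum_congr rfl fun b _ => ?_
  rw [Complex.re_sum]
  refine Finset.sum_congr rfl fun c _ => ?_
  have e : ∀ v, sgnR (xor b (sel i v)) = sgnR b * sgnR (sel i v) := fun v => by
    cases b <;> cases sel i v <;> simp [sgnR]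
  simp only [e, mul_assoc, ← Finset.mul_sum]
  rw [sum_sgnR_wgt]
  have e2 : sgn b = ((sgnR b : ℝ) : ℂ) := by cases b <;> simp [sgn, sgnR]
  rw [e2, Complex.re_ofReal_mul]
  simp only [Matrix.conjTranspose_mul, (D.marg_proj l _ i o).isHermitian, Matrix.mul_assoc]

theorem stateNormSq_anticomm (D : Device F) (l : ℕ) (i : Bool) (k : Bits (F.κ l) × Bits (F.κ l)) :
    stateNormSq (anticomm (Matrix.blockDiagonal (D.obs l (false, false) i))
      (Matrix.blockDiagonal (D.obs l (true, true) i))) (D.σ l k.1 k.2) =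
    ∑ o : Obs F l, stateNormSq (anticomm (D.obs l (false, false) i o) (D.obs l (true, true) i o))
        (D.M l o.2 o.1 * D.ψ l k.1 k.2 o.1 * (D.M l o.2 o.1)ᴴ) := by
  have h : anticomm (Matrix.blockDiagonal (D.obs l (false, false) i))
      (Matrix.blockDiagonal (D.obs l (true, true) i)) =
      Matrix.blockDiagonal fun o => anticomm (D.obs l (false, false) i o)
        (D.obs l (true, true) i o) := by
    rw [anticomm, ← Matrix.blockDiagonal_mul, ← Matrix.blockDiagonal_mul,
      ← Matrix.blockDiagonal_add]
    rfl
  rw [stateNormSq, h, Matrix.blockDiagonal_conjTranspose, ← Matrix.blockDiagonal_mul, σ,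
    ← Matrix.blockDiagonal_mul, Matrix.trace_blockDiagonal, Complex.re_sum]
  refine Finset.sum_congr rfl fun o _ => ?_
  rw [stateNormSq, σBlock, (D.M_block l o.1).isHermitian]

namespace Experiment

/-- The experiment with three questions, of which only the answers at the place `i` are kept for
the first two. -/
def triple (hD : D.Efficient) (i j θ : Bool) : D.Experiment :=
  ⟨hD, j, θ, .idle, .erase hD (.question hD (false, false)) i,
    .erase hD (.question hD (true, true)) i, .question hD (false, false)⟩

/-- The parity of the first and the last answer, with random signs. -/
def parity (i : Bool) (c : Bool × Bool) (v : (Bool × Bool) × (Bool × Bool) × (Bool × Bool)) : Bool :=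
  xor (xor (sel i v.1) (sel i v.2.2)) (xor (c.1 && sel (!i) v.1) (c.2 && sel (!i) v.2.1))

/-- Summing over the characters `c` of the two erased bits selects the value 0 for both, with a
factor 4. -/
theorem sum_sgnR_parity (i : Bool) (v : (Bool × Bool) × (Bool × Bool) × (Bool × Bool)) :
    ∑ c, sgnR (parity i c v) = if sel (!i) v.1 = false then if sel (!i) v.2.1 = false then
      4 * sgnR (xor (sel i v.1) (sel i v.2.2)) else 0 else 0 := by
  rw [Fintype.sum_prod_type]
  simp only [parity, Fintype.sum_bool]
  cases sel (!i) v.1 <;> cases sel (!i) v.2.1 <;> cases xor (sel i v.1) (sel i v.2.2) <;>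
    norm_num [sgnR]

/-- The expected squared anticommutator. -/
def anticommProb (D : Device F) (i : Bool) (θ : Bool × Bool) (l : ℕ) : ℝ :=
  ∑ k, F.pairProb θ l k * stateNormSq (anticomm (Matrix.blockDiagonal (D.obs l (false, false) i))
    (Matrix.blockDiagonal (D.obs l (true, true) i))) (D.σ l k.1 k.2)

/-- When an erased bit is 0, the operator is the marginal projector divided by √2. Two of them give
the factor 1/4 in the weight. -/
theorem weight_triple (hD : D.Efficient) (i j θ : Bool) (l : ℕ) (k : Bits (F.κ l) × Bits (F.κ l))
    (o : Obs F l) (b c : Bool) (v : Bool × Bool) :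
    (triple hD i j θ).weight l k ((encAns F l).symm (zeros _))
      (ordered i b false, ordered i c false, v) o = 1 / 4 * D.wgt l k o
        (D.P l (false, false) v o * (D.marg l (true, true) i c o *
          (D.marg l (false, false) i b o * D.M l o.2 o.1))) := by
  have hm : ∀ q b, ∑ w, (((Real.sqrt 2 : ℝ) : ℂ)⁻¹ *
      sgn (sel (!i) (ordered i b false) && w)) • D.P l q (ordered i (sel i (ordered i b false)) w) o =
      ((Real.sqrt 2 : ℝ) : ℂ)⁻¹ • D.marg l q i b o := by
    intro q b
    have hb : D.marg l q i b o = ∑ w, D.P l q (ordered i b w) o := by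
      rw [marg, Finset.sum_filter, ← sum_ordered i, Finset.sum_eq_single b]
      · simp
      · intro b' _ hb
        simp [hb]
      · simp
    rw [hb, Finset.smul_sum]
    simp [sgn]
  change D.wgt l k o ((triple hD i j θ).K l ((encAns F l).symm (zeros _)) (ordered i b false)
    (ordered i c false) v o) = _
  have h2 : ‖((Real.sqrt 2 : ℝ) : ℂ)⁻¹ * ((Real.sqrt 2 : ℝ) : ℂ)⁻¹‖ ^ 2 = 1 / 4 := by
    rw [← mul_inv, ← Complex.ofReal_mul, Real.mul_self_sqrt zero_le_two]
    norm_num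
  have h3 : (triple hD i j θ).K l ((encAns F l).symm (zeros _)) (ordered i b false)
      (ordered i c false) v o = (((Real.sqrt 2 : ℝ) : ℂ)⁻¹ * ((Real.sqrt 2 : ℝ) : ℂ)⁻¹) •
        (D.P l (false, false) v o * (D.marg l (true, true) i c o *
          (D.marg l (false, false) i b o * D.M l o.2 o.1))) := by
    simp only [K, triple, MeasHYR.erase, MeasHYR.question, MeasHY.idle, Equiv.apply_symm_apply,
      if_true, Matrix.mul_one, hm, Matrix.smul_mul, Matrix.mul_smul, smul_smul]
  rw [h3, wgt_smul, h2]

theorem weight_triple_eq_zero (hD : D.Efficient) (i j θ : Bool) (l : ℕ)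
    (k : Bits (F.κ l) × Bits (F.κ l)) (o : Obs F l) {a : Ans F l}
    (ha : a ≠ (encAns F l).symm (zeros _))
    (v : (Bool × Bool) × (Bool × Bool) × (Bool × Bool)) :
    (triple hD i j θ).weight l k a v o = 0 := by
  rw [Ne, Equiv.eq_symm_apply] at ha
  have : (triple hD i j θ).K l a v.1 v.2.1 v.2.2 o = 0 := by
    simp [K, triple, MeasHY.idle, ha]
  change D.wgt l k o ((triple hD i j θ).K l a v.1 v.2.1 v.2.2 o) = 0
  rw [this, wgt_zero]

/-- The factor 4 from the sum over `c` cancels the factor 1/4 of the weights; the factor 4 in front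
is that of `four_mul_trace_eq`. -/
theorem sum_expect_triple (hD : D.Efficient) (i j θ θ' : Bool) (l : ℕ) :
    4 * ∑ c, (triple hD i j θ).expect θ' l (fun _ _ _ p _ => sgnR (parity i c p.2)) =
      anticommProb D i (ordered j θ' θ) l := by
  have key : ∀ k, 4 * ∑ c, ∑ p : Out F l, ∑ o, sgnR (parity i c p.2) *
      (triple hD i j θ).weight l k p.1 p.2 o =
      stateNormSq (anticomm (Matrix.blockDiagonal (D.obs l (false, false) i))
        (Matrix.blockDiagonal (D.obs l (true, true) i))) (D.σ l k.1 k.2) := by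
    intro k
    rw [stateNormSq_anticomm]
    simp only [← sum_marg_anticomm]
    rw [← Finset.mul_sum, Finset.sum_comm]
    congr 1
    have e : ∀ p : Out F l, ∑ c, ∑ o, sgnR (parity i c p.2) *
        (triple hD i j θ).weight l k p.1 p.2 o = ∑ o, if sel (!i) p.2.1 = false then
          if sel (!i) p.2.2.1 = false then 4 * sgnR (xor (sel i p.2.1) (sel i p.2.2.2)) *
            (triple hD i j θ).weight l k p.1 p.2 o else 0 else 0 := by
      intro p
      rw [Finset.sum_comm]
      refine Finset.sum_congr rfl fun o _ => ?_
      rw [← Finset.sum_mul, sum_sgnR_parity, ite_mul, ite_mul, zero_mul]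
    simp only [e]
    rw [Finset.sum_comm]
    refine Finset.sum_congr rfl fun o _ => ?_
    rw [Fintype.sum_prod_type, Finset.sum_eq_single ((encAns F l).symm (zeros _))]
    · simp only [Fintype.sum_prod_type
        (f := fun p : (Bool × Bool) × (Bool × Bool) × (Bool × Bool) => _),
        Fintype.sum_prod_type (f := fun p : (Bool × Bool) × (Bool × Bool) => _)]
      rw [← sum_ordered i]
      refine Finset.sum_congr rfl fun b _ => ?_
      rw [Finset.sum_eq_single false]
      · rw [← sum_ordered i]
        refine Finset.sum_congr rfl fun c _ => ?_
        rw [Finset.sum_eq_single false]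
        · refine Finset.sum_congr rfl fun v _ => ?_
          simp only [sel_ordered, sel_not_ordered, if_true, weight_triple]
          ring
        · intro w _ hw
          simp only [sel_not_ordered, if_neg hw, ite_self, Finset.sum_const_zero]
        · simp
      · intro w _ hw
        simp only [sel_not_ordered, if_neg hw, Finset.sum_const_zero]
      · simp
    · intro a _ ha
      simp only [weight_triple_eq_zero hD i j θ l k o ha, mul_zero, ite_self,
        Finset.sum_const_zero]
    · simp
  rw [anticommProb, ← sum_ordered (α := Bits (F.κ l)) j]
  simp only [← key, expect, F.pairProb_ordered]
  have e : ∀ (c : Bool × Bool) (x k : Bits (F.κ l)),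
      ∑ t, F.keyProb θ' l x * F.genProb (triple hD i j θ).θ l k t * ∑ p : Out F l, ∑ o,
        sgnR (parity i c p.2) *
          (triple hD i j θ).weight l (ordered (triple hD i j θ).j x k) p.1 p.2 o =
      F.keyProb θ' l x * F.keyProb θ l k * ∑ p : Out F l, ∑ o,
        sgnR (parity i c p.2) * (triple hD i j θ).weight l (ordered j x k) p.1 p.2 o :=
    fun c x k => sum_genProb_mul k _ _
  simp only [e]
  rw [Finset.sum_comm, Finset.mul_sum]
  refine Finset.sum_congr rfl fun x _ => ?_
  rw [Finset.sum_comm, Finset.mul_sum]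
  refine Finset.sum_congr rfl fun k _ => ?_
  rw [← Finset.mul_sum]
  ring

theorem loads_and {R : ℕ → Type} {n : ℕ → ℕ} {P : Proc n R fun _ => encUnit} {f : ∀ l, R l → Bool}
    (h : P.Loads (fun _ => 1) fun l r => encBit (f l r)) (c : Bool) :
    P.Loads (fun _ => 1) fun l r => encBit (c && f l r) := by
  cases c
  · exact P.loads_nil _
  · exact h

/-- For each of the four values of `c` the parity is an efficiently computed bit, to which injective
invariance applies. No decoding is involved, so the generated key may be of either type. -/
theorem anticommProb_invariance (hD : D.Efficient) (i j θ : Bool) :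
    ∃ μ, Negligible μ ∧ ∀ l,
      |anticommProb D i (ordered j true θ) l - anticommProb D i (ordered j false θ) l| ≤ μ l := by
  let X := triple hD i j θ
  have h : ∀ c : Bool × Bool, ∃ μ, Negligible μ ∧ ∀ l,
      |X.expect true l (fun _ _ _ p _ => sgnR (parity i c p.2)) -
        X.expect false l fun _ _ _ p _ => sgnR (parity i c p.2)| ≤ 2 * μ l := by
    intro c
    obtain ⟨μ, hμ, h⟩ := X.expect_invariance (fun l r => parity i c r.1.2) (by
      simp only [parity, encBit_xor]
      exact (((X.readable_v₁ i).pad _).loads_self.xor ((X.readable_v₃ i).pad _).loads_self).xor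
        ((loads_and ((X.readable_v₁ (!i)).pad _).loads_self _).xor
          (loads_and ((X.readable_v₂ (!i)).pad _).loads_self _)))
    exact ⟨μ, hμ, fun l => (h l).2⟩
  choose μ hμ hb using h
  refine ⟨_, (Negligible.sum Finset.univ fun c _ => (hμ c).const_mul zero_le_two).const_mul
    zero_le_four, fun l => ?_⟩
  rw [← sum_expect_triple hD, ← sum_expect_triple hD, ← mul_sub, ← Finset.sum_sub_distrib, abs_mul,
    abs_of_pos four_pos]
  refine mul_le_mul_of_nonneg_left ((Finset.abs_sum_le_sum_abs _ _).trans ?_) zero_le_four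
  exact Finset.sum_le_sum fun c _ => hb c l

end Experiment

end Device

end

noncomputable section

namespace Device

variable {F : ENTCF} (D : Device F)

/-! ### The preimage test -/

open Classical in
/-- The pairs of correct answers in the preimage round. -/
def corr (F : ENTCF) (θ : Bool × Bool) (l : ℕ) (k : Bits (F.κ l) × Bits (F.κ l))
    (y : F.Y l × F.Y l) : Finset (Ans F l) :=
  Finset.univ.filter fun a => a.1 ∈ F.correct θ.1 l k.1 y.1 ∧ a.2 ∈ F.correct θ.2 l k.2 y.2

theorem mem_corr {θ : Bool × Bool} {l : ℕ} {k : Bits (F.κ l) × Bits (F.κ l)} {y : F.Y l × F.Y l}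
    {a : Ans F l} (i : Bool) : a ∈ corr F θ l k y ↔
      sel i a ∈ F.correct (sel i θ) l (sel i k) (sel i y) ∧
      sel (!i) a ∈ F.correct (sel (!i) θ) l (sel (!i) k) (sel (!i) y) := by
  rw [corr, Finset.mem_filter, and_iff_right (Finset.mem_univ _)]
  cases i
  · rfl
  · exact and_comm

/-- The probability of an answer in the preimage round. -/
def preWgt (l : ℕ) (k : Bits (F.κ l) × Bits (F.κ l)) (y : F.Y l × F.Y l) (a : Ans F l) : ℝ :=
  (D.Pi l a y * D.ψ l k.1 k.2 y).trace.re

theorem preWgt_nonneg (l : ℕ) (k : Bits (F.κ l) × Bits (F.κ l)) (y : F.Y l × F.Y l)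
    (a : Ans F l) : 0 ≤ D.preWgt l k y a := by
  rw [preWgt, ← (D.Pi_block l y).trace_conj a]
  exact D.wgt_nonneg l k (y, (zeros _, zeros _)) _

theorem sum_preWgt (l : ℕ) (k : Bits (F.κ l) × Bits (F.κ l)) :
    ∑ y, ∑ a, D.preWgt l k y a = 1 := by
  have h : ∀ y, ∑ a, D.preWgt l k y a = (D.ψ l k.1 k.2 y).trace.re := by
    intro y
    simp only [preWgt]
    rw [← Complex.re_sum, ← Matrix.trace_sum, ← Finset.sum_mul, (D.Pi_block l y).2.2,
      Matrix.one_mul]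
  simp only [h]
  rw [← Complex.re_sum, D.sum_trace_block, Complex.one_re]

/-- The probability of an incorrect answer in the preimage round. -/
def incorrect (θ : Bool × Bool) (l : ℕ) : ℝ :=
  ∑ k, F.pairProb θ l k * ∑ y, ∑ a with a ∉ corr F θ l k y, D.preWgt l k y a

theorem γP_le (l : ℕ) (θ : Bool) (j : Fin 4) : 1 - D.γP l ≤
    (![D.pre₁ l false θ, D.pre₂ l θ false, D.pre₂ l θ true, D.pre₁ l true θ] : Fin 4 → ℝ) j := by
  rw [γP, sub_sub_cancel]
  exact (ciInf_le (Set.finite_range _).bddBelow θ).trans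
    (ciInf_le (Set.finite_range _).bddBelow j)

theorem one_sub_sum_preWgt (θ : Bool × Bool) (l : ℕ)
    (c : Bits (F.κ l) × Bits (F.κ l) → F.Y l × F.Y l → Ans F l → Prop)
    [∀ k y a, Decidable (c k y a)] :
    ∑ k, F.pairProb θ l k * ∑ y, ∑ a, (if c k y a then 0 else D.preWgt l k y a) =
      1 - ∑ k, F.pairProb θ l k * ∑ y, ∑ a, if c k y a then D.preWgt l k y a else 0 := by
  rw [← F.sum_pairProb θ l, ← Finset.sum_sub_distrib]
  refine Finset.sum_congr rfl fun k _ => ?_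
  rw [← mul_one_sub, ← D.sum_preWgt l k, ← Finset.sum_sub_distrib]
  congr 1
  refine Finset.sum_congr rfl fun y _ => ?_
  rw [← Finset.sum_sub_distrib]
  refine Finset.sum_congr rfl fun a _ => ?_
  split_ifs <;> simp

theorem pre₁_eq (l : ℕ) (θ₁ θ₂ : Bool) : D.pre₁ l θ₁ θ₂ = ∑ k, F.pairProb (θ₁, θ₂) l k *
    ∑ y, ∑ a : Ans F l, if a.1 ∈ F.correct θ₁ l k.1 y.1 then D.preWgt l k y a else 0 := by
  rw [pre₁, F.avg_eq]
  refine Finset.sum_congr rfl fun k _ => congrArg _ (Finset.sum_congr rfl fun y _ => ?_)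
  rw [Fintype.sum_prod_type_right, Finset.sum_comm]
  simp only [Finset.sum_ite_mem, Finset.univ_inter]
  rfl

theorem pre₂_eq (l : ℕ) (θ₁ θ₂ : Bool) : D.pre₂ l θ₁ θ₂ = ∑ k, F.pairProb (θ₁, θ₂) l k *
    ∑ y, ∑ a : Ans F l, if a.2 ∈ F.correct θ₂ l k.2 y.2 then D.preWgt l k y a else 0 := by
  rw [pre₂, F.avg_eq]
  refine Finset.sum_congr rfl fun k _ => congrArg _ (Finset.sum_congr rfl fun y _ => ?_)
  rw [Fintype.sum_prod_type, Finset.sum_comm]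
  simp only [Finset.sum_ite_mem, Finset.univ_inter]
  rfl

/-- A union bound: a pair of answers fails only if one of its two components does, and each
component fails with probability at most γ_P for all types of keys. -/
theorem incorrect_le (θ : Bool × Bool) (l : ℕ) : D.incorrect θ l ≤ 2 * D.γP l := by
  have h1 : 1 - D.γP l ≤ D.pre₁ l θ.1 θ.2 := by
    cases h : θ.1
    · exact D.γP_le l θ.2 0
    · exact D.γP_le l θ.2 3
  have h2 : 1 - D.γP l ≤ D.pre₂ l θ.1 θ.2 := by
    cases h : θ.2
    · exact D.γP_le l θ.1 1
    · exact D.γP_le l θ.1 2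
  have h3 := D.one_sub_sum_preWgt θ l fun k y a => a.1 ∈ F.correct θ.1 l k.1 y.1
  have h4 := D.one_sub_sum_preWgt θ l fun k y a => a.2 ∈ F.correct θ.2 l k.2 y.2
  rw [← D.pre₁_eq l θ.1 θ.2] at h3
  rw [← D.pre₂_eq l θ.1 θ.2] at h4
  have h5 : D.incorrect θ l ≤ (1 - D.pre₁ l θ.1 θ.2) + (1 - D.pre₂ l θ.1 θ.2) := by
    rw [← h3, ← h4, ← Finset.sum_add_distrib, incorrect]
    refine Finset.sum_le_sum fun k _ => ?_
    rw [← mul_add, ← Finset.sum_add_distrib]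
    refine mul_le_mul_of_nonneg_left (Finset.sum_le_sum fun y _ => ?_) (F.pairProb_nonneg _ _ _)
    rw [← Finset.sum_add_distrib, Finset.sum_filter]
    refine Finset.sum_le_sum fun a _ => ?_
    simp only [mem_corr false]
    have := D.preWgt_nonneg l k y a
    by_cases ha : a.1 ∈ F.correct θ.1 l k.1 y.1
    · by_cases hb : a.2 ∈ F.correct θ.2 l k.2 y.2 <;> simp [sel, ha, hb]
    · simp only [sel, ha, Bool.false_eq_true, if_false, false_and, not_false_eq_true, if_true]
      split_ifs <;> linarith
  linarith

/-! ### The test case -/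

theorem eigenproj_obs (l : ℕ) (q : Bool × Bool) (i b : Bool) :
    eigenproj (Matrix.blockDiagonal (D.obs l q i)) b = Matrix.blockDiagonal (D.marg l q i b) := by
  have : D.marg l q i b = (1 / 2 : ℂ) • (1 + sgn b • D.obs l q i) :=
    funext fun o => D.marg_eq l q i b o
  rw [eigenproj, this, Matrix.blockDiagonal_smul, Matrix.blockDiagonal_add,
    Matrix.blockDiagonal_one, Matrix.blockDiagonal_smul]

theorem trace_sum_blockDiagonal {H O : Type} [Fintype H] [DecidableEq H] [Fintype O] [DecidableEq O]
    (E : Bool × Bool → O → Matrix H H ℂ) (c : Bool × Bool → O → Prop) [∀ v o, Decidable (c v o)]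
    (s : O → Matrix H H ℂ) :
    (∑ v, Matrix.blockDiagonal (E v) * Matrix.blockDiagonal fun o => if c v o then s o else 0).trace.re =
      ∑ o, ∑ v, if c v o then (E v o * s o).trace.re else 0 := by
  simp only [← Matrix.blockDiagonal_mul, Matrix.trace_sum, Matrix.trace_blockDiagonal,
    Complex.re_sum]
  rw [Finset.sum_comm]
  refine Finset.sum_congr rfl fun o _ => Finset.sum_congr rfl fun v _ => ?_
  split_ifs <;> simp

/-- The success probability for the observable `X` at the place `i`. -/
def testX (i : Bool) (l : ℕ) (k : Bits (F.κ l) × Bits (F.κ l)) (o : Obs F l) : ℝ :=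
  (F.uHat l (sel i k) (sel i o.1) (sel i o.2)).elim 0 fun u =>
    (F.bHat l (sel (!i) k) (sel (!i) o.1)).elim 0 fun b =>
      (D.marg l (true, true) i (xor u b) o * D.σBlock l k.1 k.2 o).trace.re

/-- The success probability for the observable `Z` at the place `i`. -/
def testZ (i : Bool) (l : ℕ) (k : Bits (F.κ l) × Bits (F.κ l)) (o : Obs F l) : ℝ :=
  (F.bHat l (sel i k) (sel i o.1)).elim 0 fun b =>
    (F.uHat l (sel (!i) k) (sel (!i) o.1) (sel (!i) o.2)).elim 0 fun _ =>
      (D.marg l (false, false) i b o * D.σBlock l k.1 k.2 o).trace.re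

theorem γT_le (l : ℕ) (j : Fin 8) : 1 - D.γT l ≤
    (![D.test01 l (D.Z₁ l) Prod.fst, D.test01 l (D.Z₁tilde l) Prod.fst,
      D.test10 l (D.X₁ l) Prod.fst, D.test10 l (D.X₁tilde l) Prod.fst,
      D.test10 l (D.Z₂ l) Prod.snd, D.test10 l (D.Z₂tilde l) Prod.snd,
      D.test01 l (D.X₂ l) Prod.snd, D.test01 l (D.X₂tilde l) Prod.snd] : Fin 8 → ℝ) j := by
  rw [γT, sub_sub_cancel]
  exact ciInf_le (Set.finite_range _).bddBelow j

theorem Z₁_eq (l : ℕ) : D.Z₁ l = Matrix.blockDiagonal (D.obs l (false, false) false) :=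
  D.sum_sgn_PFull l (false, false) false
theorem Z₂_eq (l : ℕ) : D.Z₂ l = Matrix.blockDiagonal (D.obs l (false, false) true) :=
  D.sum_sgn_PFull l (false, false) true
theorem X₁_eq (l : ℕ) : D.X₁ l = Matrix.blockDiagonal (D.obs l (true, true) false) :=
  D.sum_sgn_PFull l (true, true) false
theorem X₂_eq (l : ℕ) : D.X₂ l = Matrix.blockDiagonal (D.obs l (true, true) true) :=
  D.sum_sgn_PFull l (true, true) true

/-- The decoded values determine the only `v` that contributes, if they are defined at all. -/
theorem sum_ite_uHat_bHat (u b : Option Bool) (g : Bool → Bool → ℝ) :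
    (∑ v : Bool × Bool, if u = some (xor v.1 v.2) ∧ b = some v.2 then g v.1 v.2 else 0) =
      u.elim 0 fun u => b.elim 0 fun b => g (xor u b) b := by
  rw [Fintype.sum_prod_type]
  rcases u with _ | (_ | _) <;> rcases b with _ | (_ | _) <;> simp

theorem sum_ite_bHat_uHat (u b : Option Bool) (g : Bool → Bool → ℝ) :
    (∑ v : Bool × Bool, if b = some v.1 ∧ u = some (xor v.2 v.1) then g v.1 v.2 else 0) =
      u.elim 0 fun u => b.elim 0 fun b => g b (xor u b) := by
  rw [Fintype.sum_prod_type]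
  rcases u with _ | (_ | _) <;> rcases b with _ | (_ | _) <;> simp

theorem elim_comm (u b : Option Bool) (g : Bool → ℝ) :
    (u.elim 0 fun _ => b.elim 0 fun b => g b) = b.elim 0 fun b => u.elim 0 fun _ => g b := by
  cases u <;> cases b <;> rfl

/-- Among the eight tests, the ones with number 2 and 6 concern the observables X₁ and X₂ for the
questions (1, 1). -/
theorem le_testX (i : Bool) (l : ℕ) :
    1 - D.γT l ≤ ∑ k, F.pairProb (ordered i true false) l k * ∑ o, D.testX i l k o := by
  cases i
  · refine (D.γT_le l 2).trans (le_of_eq ?_)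
    change D.test10 l (D.X₁ l) Prod.fst = _
    rw [test10, F.avg_eq, X₁_eq]
    refine Finset.sum_congr rfl fun k _ => congrArg _ ?_
    simp only [eigenproj_obs, σ10]
    rw [trace_sum_blockDiagonal]
    exact Finset.sum_congr rfl fun o _ => sum_ite_uHat_bHat _ _ fun v _ =>
      (D.marg l (true, true) false v o * D.σBlock l k.1 k.2 o).trace.re
  · refine (D.γT_le l 6).trans (le_of_eq ?_)
    change D.test01 l (D.X₂ l) Prod.snd = _
    rw [test01, F.avg_eq, X₂_eq]
    refine Finset.sum_congr rfl fun k _ => congrArg _ ?_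
    simp only [eigenproj_obs, σ01]
    rw [trace_sum_blockDiagonal]
    exact Finset.sum_congr rfl fun o _ => sum_ite_bHat_uHat _ _ fun _ v =>
      (D.marg l (true, true) true v o * D.σBlock l k.1 k.2 o).trace.re

/-- The tests with number 0 and 4 concern Z₁ and Z₂. They also require û to be defined at the other
place; its value is irrelevant here. -/
theorem le_testZ (i : Bool) (l : ℕ) :
    1 - D.γT l ≤ ∑ k, F.pairProb (ordered i false true) l k * ∑ o, D.testZ i l k o := by
  cases i
  · refine (D.γT_le l 0).trans (le_of_eq ?_)
    change D.test01 l (D.Z₁ l) Prod.fst = _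
    rw [test01, F.avg_eq, Z₁_eq]
    refine Finset.sum_congr rfl fun k _ => congrArg _ ?_
    simp only [eigenproj_obs, σ01]
    rw [trace_sum_blockDiagonal]
    exact Finset.sum_congr rfl fun o _ => (sum_ite_bHat_uHat _ _ fun v _ =>
      (D.marg l (false, false) false v o * D.σBlock l k.1 k.2 o).trace.re).trans
      (elim_comm _ _ fun b => (D.marg l (false, false) false b o * D.σBlock l k.1 k.2 o).trace.re)
  · refine (D.γT_le l 4).trans (le_of_eq ?_)
    change D.test10 l (D.Z₂ l) Prod.snd = _
    rw [test10, F.avg_eq, Z₂_eq]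
    refine Finset.sum_congr rfl fun k _ => congrArg _ ?_
    simp only [eigenproj_obs, σ10]
    rw [trace_sum_blockDiagonal]
    exact Finset.sum_congr rfl fun o _ => (sum_ite_uHat_bHat _ _ fun _ v =>
      (D.marg l (false, false) true v o * D.σBlock l k.1 k.2 o).trace.re).trans
      (elim_comm _ _ fun b => (D.marg l (false, false) true b o * D.σBlock l k.1 k.2 o).trace.re)

end Device

end

noncomputable section

namespace Device

variable {F : ENTCF} (D : Device F)

/-! ### Vectors -/

section Col

variable {T : Type} {l : ℕ}

/-- The purified states after the operators `L`, for a family of pairs of keys with weights. -/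
def col (w : T → ℝ) (k : T → Bits (F.κ l) × Bits (F.κ l))
    (L : T → Obs F l → Matrix (Bits (D.nD l)) (Bits (D.nD l)) ℂ) :
    EuclideanSpace ℂ ((T × Obs F l) × Bits (D.nD l) × Bits (D.nD l)) :=
  vecOf fun j => ((√(w j.1) : ℝ) : ℂ) • (L j.1 j.2 * D.root l (k j.1) j.2.1)

variable {w : T → ℝ} (k : T → Bits (F.κ l) × Bits (F.κ l))

theorem col_sub (L L' : T → Obs F l → Matrix (Bits (D.nD l)) (Bits (D.nD l)) ℂ) :
    D.col w k L - D.col w k L' = D.col w k (L - L') := by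
  rw [col, col, ← vecOf_sub, col]
  congr 1
  funext j
  simp only [Pi.sub_apply, Matrix.sub_mul, smul_sub]

theorem col_add (L L' : T → Obs F l → Matrix (Bits (D.nD l)) (Bits (D.nD l)) ℂ) :
    D.col w k L + D.col w k L' = D.col w k (L + L') := by
  rw [col, col, ← vecOf_add, col]
  congr 1
  funext j
  simp only [Pi.add_apply, Matrix.add_mul, smul_add]

theorem smul_col (c : ℂ) (L : T → Obs F l → Matrix (Bits (D.nD l)) (Bits (D.nD l)) ℂ) :
    c • D.col w k L = D.col w k (c • L) := by
  rw [col, ← vecOf_smul, col]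
  congr 1
  funext j
  simp only [Pi.smul_apply, Matrix.smul_mul]
  rw [smul_comm]

variable [Fintype T]

theorem mulOp_col (A L : T → Obs F l → Matrix (Bits (D.nD l)) (Bits (D.nD l)) ℂ) :
    mulOp (fun j => A j.1 j.2) (D.col w k L) = D.col w k fun t o => A t o * L t o := by
  rw [col, mulOp_vecOf, col]
  congr 1
  funext j
  rw [Matrix.mul_smul, Matrix.mul_assoc]

theorem re_inner_col (hw : ∀ t, 0 ≤ w t)
    (L L' : T → Obs F l → Matrix (Bits (D.nD l)) (Bits (D.nD l)) ℂ) :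
    (inner ℂ (D.col w k L) (D.col w k L')).re = ∑ t, w t * ∑ o : Obs F l,
      (L' t o * D.ψ l (k t).1 (k t).2 o.1 * (L t o)ᴴ).trace.re := by
  rw [col, col, inner_vecOf, Complex.re_sum, Fintype.sum_prod_type]
  refine Finset.sum_congr rfl fun t _ => ?_
  rw [Finset.mul_sum]
  refine Finset.sum_congr rfl fun o _ => ?_
  rw [Matrix.conjTranspose_smul, Matrix.smul_mul, Matrix.mul_smul, smul_smul, Matrix.trace_smul,
    smul_eq_mul, Complex.star_def, Complex.conj_ofReal, ← Complex.ofReal_mul,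
    Real.mul_self_sqrt (hw t), Complex.re_ofReal_mul, Matrix.conjTranspose_mul, ← D.root_mul]
  simp only [Matrix.mul_assoc]

theorem norm_sq_col (hw : ∀ t, 0 ≤ w t)
    (L : T → Obs F l → Matrix (Bits (D.nD l)) (Bits (D.nD l)) ℂ) :
    ‖D.col w k L‖ ^ 2 = ∑ t, w t * ∑ o, D.wgt l (k t) o (L t o) := by
  rw [← inner_self_eq_norm_sq (𝕜 := ℂ)]
  exact D.re_inner_col k hw L L

end Col

/-! ### Preimages -/

/-- Measure a preimage, with an outcome in `s`, and the string `d`. -/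
def after (l : ℕ) (s : F.Y l × F.Y l → Finset (Ans F l)) (o : Obs F l) :
    Matrix (Bits (D.nD l)) (Bits (D.nD l)) ℂ := D.M l o.2 o.1 * ∑ a ∈ s o.1, D.Pi l a o.1

theorem after_univ (l : ℕ) (o : Obs F l) : D.after l (fun _ => Finset.univ) o = D.M l o.2 o.1 := by
  rw [after, (D.Pi_block l o.1).2.2, Matrix.mul_one]

theorem after_singleton (l : ℕ) (a : Ans F l) (o : Obs F l) :
    D.after l (fun _ => {a}) o = D.M l o.2 o.1 * D.Pi l a o.1 := by
  rw [after, Finset.sum_singleton]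

/-- The strings `d` are measured after the preimage and summed over all outcomes, so their
measurement drops out, and what remains is a sum over orthogonal projectors. -/
theorem sum_wgt_after (l : ℕ) (k : Bits (F.κ l) × Bits (F.κ l))
    (s : F.Y l × F.Y l → Finset (Ans F l)) :
    ∑ o, D.wgt l k o (D.after l s o) = ∑ y, ∑ a ∈ s y, D.preWgt l k y a := by
  rw [Fintype.sum_prod_type]
  refine Finset.sum_congr rfl fun y _ => ?_
  have h1 : ∑ d, D.wgt l k (y, d) (D.after l s (y, d)) =
      D.wgt l k (y, (zeros _, zeros _)) (∑ a ∈ s y, D.Pi l a y) :=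
    D.sum_wgt_mul_univ l k (y, (zeros _, zeros _)) (D.M_block l y) (∑ a ∈ s y, D.Pi l a y)
  rw [h1, wgt, (D.Pi_block l y).trace_conj_sum, Finset.sum_mul, Matrix.trace_sum, Complex.re_sum]
  rfl

theorem sum_wgt_after_univ (l : ℕ) (k : Bits (F.κ l) × Bits (F.κ l)) :
    ∑ o, D.wgt l k o (D.M l o.2 o.1) = 1 := by
  have h := D.sum_wgt_after l k fun _ => Finset.univ
  simp only [after_univ] at h
  rw [h, D.sum_preWgt]

theorem sum_sum_wgt_after (l : ℕ) (k : Bits (F.κ l) × Bits (F.κ l)) :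
    ∑ a, ∑ o : Obs F l, D.wgt l k o (D.M l o.2 o.1 * D.Pi l a o.1) = 1 := by
  have h : ∀ a, ∑ o : Obs F l, D.wgt l k o (D.M l o.2 o.1 * D.Pi l a o.1) =
      ∑ y, D.preWgt l k y a := fun a => by
    have := D.sum_wgt_after l k fun _ => {a}
    simpa only [after_singleton, Finset.sum_singleton] using this
  simp only [h]
  rw [Finset.sum_comm, D.sum_preWgt]

/-- An outcome in a set with at most one element. -/
theorem apply_after_of_subsingleton {l : ℕ} {s : F.Y l × F.Y l → Finset (Ans F l)} {o : Obs F l}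
    (hs : (s o.1 : Set (Ans F l)).Subsingleton)
    {φ : Matrix (Bits (D.nD l)) (Bits (D.nD l)) ℂ → ℝ} (hφ : φ 0 = 0) :
    φ (D.after l s o) = ∑ a ∈ s o.1, φ (D.M l o.2 o.1 * D.Pi l a o.1) := by
  rcases hs.eq_empty_or_singleton with h | ⟨a, h⟩
  · rw [Finset.coe_eq_empty] at h
    rw [after, h, Finset.sum_empty, Finset.sum_empty, Matrix.mul_zero, hφ]
  · rw [Finset.coe_eq_singleton] at h
    rw [after, h, Finset.sum_singleton, Finset.sum_singleton]

theorem wgt_marg_add (l : ℕ) (k : Bits (F.κ l) × Bits (F.κ l)) (o : Obs F l) (q : Bool × Bool)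
    (i b : Bool) (L : Matrix (Bits (D.nD l)) (Bits (D.nD l)) ℂ) :
    D.wgt l k o (D.marg l q i b o * L) + D.wgt l k o (D.marg l q i (!b) o * L) =
      D.wgt l k o L := by
  rw [← D.sum_wgt_mul_univ l k o (D.marg_proj l q i o) L, Fintype.sum_bool]
  cases b
  · exact add_comm _ _
  · rfl

theorem wgt_marg_le (l : ℕ) (k : Bits (F.κ l) × Bits (F.κ l)) (o : Obs F l) (q : Bool × Bool)
    (i b : Bool) (L : Matrix (Bits (D.nD l)) (Bits (D.nD l)) ℂ) :
    D.wgt l k o (D.marg l q i b o * L) ≤ D.wgt l k o L := by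
  rw [← D.wgt_marg_add l k o q i b L]
  exact le_add_of_nonneg_right (D.wgt_nonneg _ _ _ _)

theorem wgt_marg_M (l : ℕ) (k : Bits (F.κ l) × Bits (F.κ l)) (o : Obs F l) (q : Bool × Bool)
    (i b : Bool) : D.wgt l k o (D.marg l q i b o * D.M l o.2 o.1) =
      (D.marg l q i b o * D.σBlock l k.1 k.2 o).trace.re := by
  rw [← (D.marg_proj l q i o).trace_conj b, wgt, σBlock]
  simp only [Matrix.conjTranspose_mul, (D.M_block l o.1).isHermitian, Matrix.mul_assoc]

namespace Experiment

variable {D}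

theorem sum_trapdoor (i θ : Bool) (l : ℕ) (f : Bits (F.κ l) × Bits (F.κ l) → ℝ) :
    ∑ j : (Bits (F.κ l) × Bits (F.τ l)) × Bits (F.κ l),
      F.genProb false l j.1.1 j.1.2 * F.keyProb θ l j.2 * f (ordered i j.1.1 j.2) =
    ∑ k, F.pairProb (ordered i false θ) l k * f k := by
  rw [Fintype.sum_prod_type, Fintype.sum_prod_type, ← sum_ordered i]
  refine Finset.sum_congr rfl fun k _ => ?_
  rw [Finset.sum_comm]
  refine Finset.sum_congr rfl fun k' _ => ?_
  dsimp only
  rw [F.pairProb_ordered, ← Finset.sum_mul, ← Finset.sum_mul]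
  rfl

/-- The answers `Z` are correct with high probability in the test case. -/
theorem le_imageProb (i : Bool) (l : ℕ) : 1 - D.γT l ≤ imageProb D i true l := by
  refine (D.le_testZ i l).trans ?_
  rw [← sum_trapdoor i true l fun k => ∑ o, D.testZ i l k o, imageProb]
  refine Finset.sum_le_sum fun j _ => ?_
  -- The inversion is known to be correct only for pairs of a key and a trapdoor that occur; other
  -- pairs have weight zero.
  by_cases hj : F.genProb false l j.1.1 j.1.2 = 0
  · rw [hj]; simp
  refine mul_le_mul_of_nonneg_left (Finset.sum_le_sum fun o _ => ?_)
    (mul_nonneg (F.genProb_nonneg _ _ _ _) (F.keyProb_nonneg _ _ _))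
  rw [testZ, sel_ordered]
  cases hb : F.bHat l j.1.1 (sel i o.1) with
  | none => exact D.wgt_nonneg _ _ _ _
  | some b =>
    rw [Option.elim_some, ENTCF.invG_eq_of_bHat hj hb]
    cases F.uHat l (sel (!i) (ordered i j.1.1 j.2)) (sel (!i) o.1) (sel (!i) o.2) with
    | none => exact D.wgt_nonneg _ _ _ _
    | some u => rw [Option.elim_some, wgt_marg_M]

/-- Passes from norms to probabilities. If `a > c` then `b` is at least `a - c`, which is then
squared; if `a ≤ c` then the left side is not positive. -/
theorem sq_sub_le {a b c : ℝ} (ha : 0 ≤ a) (ha1 : a ≤ 1) (hc : 0 ≤ c) (h : a ≤ b + c) :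
    a ^ 2 - 2 * c ≤ b ^ 2 := by
  by_cases hac : a ≤ c
  · nlinarith [sq_nonneg b]
  · nlinarith

/-- For injective keys, the measurement of the preimage hardly disturbs the state. -/
theorem imageProb_le_preimageProb (i : Bool) (l : ℕ) :
    imageProb D i false l - 2 * √(2 * D.γP l) ≤ preimageProb D i false l := by
  let T := (Bits (F.κ l) × Bits (F.τ l)) × Bits (F.κ l)
  let w : T → ℝ := fun j => F.genProb false l j.1.1 j.1.2 * F.keyProb false l j.2
  have hw : ∀ j, 0 ≤ w j := fun j => mul_nonneg (F.genProb_nonneg _ _ _ _) (F.keyProb_nonneg _ _ _)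
  let k : T → Bits (F.κ l) × Bits (F.κ l) := fun j => ordered i j.1.1 j.2
  let θ : Bool × Bool := ordered i false false
  let Q : T → Obs F l → Matrix (Bits (D.nD l)) (Bits (D.nD l)) ℂ := fun j o =>
    D.marg l (false, false) i (F.invG l (j.1.2, sel i o.1)).1 o
  let ξ := D.col w k fun _ => D.after l fun _ => Finset.univ
  let η := D.col w k fun j => D.after l (corr F θ l (k j))
  have hQ : ∀ L, ‖mulOp (fun j => Q j.1 j.2) (D.col w k L)‖ ≤ ‖D.col w k L‖ := by
    intro L
    refine (sq_le_sq₀ (norm_nonneg _) (norm_nonneg _)).1 ?_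
    rw [mulOp_col, norm_sq_col _ _ hw, norm_sq_col _ _ hw]
    exact Finset.sum_le_sum fun j _ => mul_le_mul_of_nonneg_left
      (Finset.sum_le_sum fun o _ => D.wgt_marg_le _ _ _ _ _ _ _) (hw j)
  have hξ : ‖mulOp (fun j => Q j.1 j.2) ξ‖ ^ 2 = imageProb D i false l := by
    rw [mulOp_col, norm_sq_col _ _ hw]
    simp only [after_univ]
    rfl
  have hξ1 : ‖ξ‖ ≤ 1 := by
    refine (sq_le_one_iff₀ (norm_nonneg _)).1 (le_of_eq ?_)
    rw [norm_sq_col _ _ hw]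
    simp only [after_univ, D.sum_wgt_after_univ]
    have := sum_trapdoor (F := F) i false l fun _ => 1
    rw [this]
    simp only [mul_one, F.sum_pairProb]
  -- For two injective keys at most one pair of answers is correct, and its bit at `i` is the
  -- decoded bit. So on this branch the projector for the decoded bit is the one for the measured
  -- preimage; the incorrect answers are dropped, as their weights are nonnegative.
  have hη : ‖mulOp (fun j => Q j.1 j.2) η‖ ^ 2 ≤ preimageProb D i false l := by
    rw [mulOp_col, norm_sq_col _ _ hw, preimageProb,
      ← sum_trapdoor i false l fun k => ∑ a : Ans F l, ∑ o, D.wgt l k o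
        (D.marg l (false, false) i (sel i a).1 o * (D.M l o.2 o.1 * D.Pi l a o.1))]
    refine Finset.sum_le_sum fun j _ => ?_
    by_cases hj : F.genProb false l j.1.1 j.1.2 = 0
    · simp [w, hj]
    refine mul_le_mul_of_nonneg_left ?_ (hw j)
    rw [Finset.sum_comm]
    refine Finset.sum_le_sum fun o _ => ?_
    have hs : (corr F θ l (k j) o.1 : Set (Ans F l)).Subsingleton := by
      intro a ha a' ha'
      rw [Finset.mem_coe, mem_corr i] at ha ha'
      simp only [θ, k, sel_ordered, sel_not_ordered] at ha ha'
      rw [← ordered_sel i a, ← ordered_sel i a',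
        ENTCF.correct_unique ha.1 ha'.1 (by simp), ENTCF.correct_unique ha.2 ha'.2 (by simp)]
    rw [D.apply_after_of_subsingleton hs (φ := fun L => D.wgt l (k j) o (Q j o * L)) (by simp)]
    have h1 : ∀ a ∈ corr F θ l (k j) o.1,
        D.wgt l (k j) o (Q j o * (D.M l o.2 o.1 * D.Pi l a o.1)) =
        D.wgt l (k j) o (D.marg l (false, false) i (sel i a).1 o *
          (D.M l o.2 o.1 * D.Pi l a o.1)) := by
      intro a ha
      rw [mem_corr i] at ha
      simp only [θ, k, sel_ordered] at ha
      simp only [Q, ENTCF.invG_eq_of_bHat hj ((ENTCF.mem_correct.1 ha.1).1 rfl)]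
    rw [Finset.sum_congr rfl h1]
    exact Finset.sum_le_sum_of_subset_of_nonneg (Finset.subset_univ _) fun a _ _ =>
      D.wgt_nonneg _ _ _ _
  -- The difference is the branch with an incorrect answer in the preimage round.
  have hd : ‖ξ - η‖ ^ 2 ≤ 2 * D.γP l := by
    refine le_of_eq_of_le ?_ (D.incorrect_le θ l)
    have h1 : ξ - η = D.col w k fun j => D.after l fun y => (corr F θ l (k j) y)ᶜ := by
      rw [col_sub]
      congr 1
      funext j o
      simp only [Pi.sub_apply, after]
      rw [← Matrix.mul_sub, ← Finset.sum_compl_add_sum (corr F θ l (k j) o.1), add_sub_cancel_right]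
    rw [h1, norm_sq_col _ _ hw, incorrect, ← sum_trapdoor i false l fun k => ∑ y,
      ∑ a with a ∉ corr F θ l k y, D.preWgt l k y a]
    refine Finset.sum_congr rfl fun j _ => congrArg _ ?_
    rw [sum_wgt_after]
    refine Finset.sum_congr rfl fun y _ => Finset.sum_congr ?_ fun _ _ => rfl
    ext a; simp [k]
  have hadd : ‖mulOp (fun j => Q j.1 j.2) ξ‖ ≤ ‖mulOp (fun j => Q j.1 j.2) η‖ + ‖ξ - η‖ := by
    have e : mulOp (fun j => Q j.1 j.2) ξ = mulOp (fun j => Q j.1 j.2) η +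
        mulOp (fun j => Q j.1 j.2) (ξ - η) := by rw [← map_add]; congr 1; abel
    -- A projector does not increase the norm of the difference, so the disturbance of the norm is
    -- at most that difference.
    rw [e]
    refine (norm_add_le _ _).trans (add_le_add_right ?_ _)
    rw [show ξ - η = _ from D.col_sub k _ _]
    exact hQ _
  have h := sq_sub_le (norm_nonneg _) ((hQ _).trans hξ1) (norm_nonneg _) hadd
  rw [hξ] at h
  have := Real.le_sqrt_of_sq_le hd
  linarith

/-- The measured preimage determines the answer `Z`, also for claw-free keys. -/
theorem preimageProb_ge (hD : D.Efficient) (hP : D.Perfect) (i : Bool) :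
    ∃ μ, Negligible μ ∧ ∀ l, 1 - preimageProb D i true l ≤ D.γT l + μ l := by
  -- The types of the keys at `i` and at the other place pass from injective and claw-free, where
  -- the test case applies, to both injective, where a preimage can be measured without disturbance,
  -- and finally to claw-free and injective.
  obtain ⟨μ, hμ, h⟩ := imageProb_invariance hD i
  obtain ⟨ν, hν, h'⟩ := preimageProb_invariance hD i
  refine ⟨_, ((hP.const_mul zero_le_two).sqrt.const_mul zero_le_two).add (hμ.add hν), fun l => ?_⟩
  have h1 := abs_le.1 (h l)
  have h2 := abs_le.1 (h' l)
  have h3 := le_imageProb (D := D) i l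
  have h4 := imageProb_le_preimageProb (D := D) i l
  linarith

end Experiment

end Device

end

/-! ### The sign in the test case and its correlation with the X answer. -/

noncomputable section

namespace Device

variable {F : ENTCF} {D : Device F}

namespace Experiment

/-- The sign `(-1)^(û ⊕ b̂)`, or `0` if it is undefined. -/
def testSign (F : ENTCF) (i : Bool) (l : ℕ) (k : Bits (F.κ l) × Bits (F.κ l)) (o : Obs F l) : ℝ :=
  (F.uHat l (sel i k) (sel i o.1) (sel i o.2)).elim 0 fun u =>
    (F.bHat l (sel (!i) k) (sel (!i) o.1)).elim 0 fun b => sgnR (xor u b)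

theorem abs_sgnR_le (b : Bool) : |sgnR b| ≤ 1 := by cases b <;> simp [sgnR]

theorem abs_testSign_le (i : Bool) (l : ℕ) (k : Bits (F.κ l) × Bits (F.κ l)) (o : Obs F l) :
    |testSign F i l k o| ≤ 1 := by
  rw [testSign]
  cases F.uHat l (sel i k) (sel i o.1) (sel i o.2) <;>
    cases F.bHat l (sel (!i) k) (sel (!i) o.1) <;>
    simp only [Option.elim_none, Option.elim_some, abs_zero, zero_le_one, abs_sgnR_le]

/-- In the test case, the answer `X` agrees with the sign. -/
theorem le_sum_testSign (i : Bool) (l : ℕ) : 1 - 2 * D.γT l ≤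
    ∑ k, F.pairProb (ordered i true false) l k * ∑ o : Obs F l, testSign F i l k o *
      (D.obs l (true, true) i o * (D.M l o.2 o.1 * D.ψ l k.1 k.2 o.1 *
        (D.M l o.2 o.1)ᴴ)).trace.re := by
  -- The projector of the correct answer is half of 1 plus the sign times X, so equality holds where
  -- both decoded values are defined. Elsewhere the right side is 0 and the left side is at most 0.
  have h : ∀ k o, 2 * D.testX i l k o - D.wgt l k o (D.M l o.2 o.1) ≤ testSign F i l k o *
      (D.obs l (true, true) i o * (D.M l o.2 o.1 * D.ψ l k.1 k.2 o.1 *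
        (D.M l o.2 o.1)ᴴ)).trace.re := by
    intro k o
    have h0 := D.wgt_nonneg l k o (D.M l o.2 o.1)
    rw [testX, testSign]
    cases F.uHat l (sel i k) (sel i o.1) (sel i o.2) with
    | none => simpa using h0
    | some u =>
      cases F.bHat l (sel (!i) k) (sel (!i) o.1) with
      | none => simpa using h0
      | some b =>
        simp only [Option.elim_some]
        refine le_of_eq ?_
        rw [marg_eq, σBlock, wgt, (D.M_block l o.1).isHermitian, Matrix.smul_mul,
          Matrix.trace_smul, smul_eq_mul, Matrix.add_mul, Matrix.one_mul, Matrix.trace_add,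
          Matrix.smul_mul, Matrix.trace_smul, smul_eq_mul]
        have e1 : (1 / 2 : ℂ) = ((1 / 2 : ℝ) : ℂ) := by norm_num
        have e2 : sgn (xor u b) = ((sgnR (xor u b) : ℝ) : ℂ) := by
          cases xor u b <;> simp [sgn, sgnR]
        rw [e1, e2, Complex.re_ofReal_mul, Complex.add_re, Complex.re_ofReal_mul]
        ring
  have h1 := D.le_testX i l
  have h2 : ∑ k, F.pairProb (ordered i true false) l k * ∑ o, D.wgt l k o (D.M l o.2 o.1) = 1 := by
    simp only [D.sum_wgt_after_univ, mul_one, F.sum_pairProb]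
  have h3 : 2 * (∑ k, F.pairProb (ordered i true false) l k * ∑ o, D.testX i l k o) -
      ∑ k, F.pairProb (ordered i true false) l k * ∑ o, D.wgt l k o (D.M l o.2 o.1) ≤
      ∑ k, F.pairProb (ordered i true false) l k * ∑ o : Obs F l, testSign F i l k o *
      (D.obs l (true, true) i o * (D.M l o.2 o.1 * D.ψ l k.1 k.2 o.1 *
        (D.M l o.2 o.1)ᴴ)).trace.re := by
    rw [Finset.mul_sum, ← Finset.sum_sub_distrib]
    refine Finset.sum_le_sum fun k _ => ?_
    rw [mul_left_comm, ← mul_sub, Finset.mul_sum, ← Finset.sum_sub_distrib]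
    exact mul_le_mul_of_nonneg_left (Finset.sum_le_sum fun o _ => h k o) (F.pairProb_nonneg _ _ _)
  linarith

/-- After the measurement of a correct preimage, the answer `X` is uncorrelated with the sign. -/
theorem sum_testSign_corr_le (i : Bool) (l : ℕ) :
    ∑ k, F.pairProb (ordered i true false) l k * ∑ o : Obs F l,
      ∑ a ∈ corr F (ordered i true false) l k o.1, testSign F i l k o *
        (D.obs l (true, true) i o * (D.M l o.2 o.1 * D.Pi l a o.1 * D.ψ l k.1 k.2 o.1 *
          (D.M l o.2 o.1 * D.Pi l a o.1)ᴴ)).trace.re ≤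
      |hardcoreAdv D i l| + D.incorrect (ordered i true false) l := by
  classical
  let f : Bits (F.κ l) → Bits (F.κ l) → Bits (F.τ l) → Ans F l → Obs F l → ℝ := fun x k t a o =>
    ∑ v, F.hardcoreSign l x (sel i a, (sel i o.2, xor (sel i v) (F.invG l (t, sel (!i) o.1)).1)) *
      D.wgt l (ordered i x k) o (D.P l (true, true) v o * (D.M l o.2 o.1 * D.Pi l a o.1))
  let g : Bits (F.κ l) × Bits (F.κ l) → Ans F l → Obs F l → ℝ := fun k a o =>
    if a ∈ corr F (ordered i true false) l k o.1 then testSign F i l k o *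
        (D.obs l (true, true) i o * (D.M l o.2 o.1 * D.Pi l a o.1 * D.ψ l k.1 k.2 o.1 *
          (D.M l o.2 o.1 * D.Pi l a o.1)ᴴ)).trace.re else 0
  let e : Bits (F.κ l) × Bits (F.κ l) → Ans F l → Obs F l → ℝ := fun k a o =>
    if a ∈ corr F (ordered i true false) l k o.1 then 0 else
      D.wgt l k o (D.M l o.2 o.1 * D.Pi l a o.1)
  -- For correct answers, `f` equals `g`, because the hardcore sign is then given by û and the
  -- decoded bit of the other key is b̂. For incorrect answers `g` is 0, and `f` is at least minus
  -- the weight, which `e` compensates.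
  have hpt : ∀ x k t, F.keyProb true l x ≠ 0 → F.genProb false l k t ≠ 0 → ∀ a o,
      g (ordered i x k) a o ≤ f x k t a o + e (ordered i x k) a o := by
    intro x k t hx ht a o
    by_cases ha : a ∈ corr F (ordered i true false) l (ordered i x k) o.1
    · simp only [g, e, if_pos ha, add_zero, f]
      refine le_of_eq ?_
      rw [← sum_sgnR_wgt, Finset.mul_sum]
      refine Finset.sum_congr rfl fun v _ => ?_
      rw [← mul_assoc]
      congr 1
      rw [mem_corr i] at ha
      simp only [sel_ordered, sel_not_ordered] at ha
      have hb := (ENTCF.mem_correct.1 ha.2).1 rfl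
      rw [ENTCF.hardcoreSign_eq hx ha.1, ENTCF.invG_eq_of_bHat ht hb, testSign, sel_ordered,
        sel_not_ordered, hb]
      cases F.uHat l x (sel i o.1) (sel i o.2) with
      | none => simp
      | some u =>
        simp only [Option.elim_some]
        cases u <;> cases (sel (!i) a).1 <;> cases sel i v <;> simp [sgnR]
    · simp only [g, e, if_neg ha, f]
      rw [← D.sum_wgt_mul_univ l _ o (D.P_block l (true, true) o) (D.M l o.2 o.1 * D.Pi l a o.1),
        ← Finset.sum_add_distrib]
      refine Finset.sum_nonneg fun v _ => ?_
      have h1 := D.wgt_nonneg l (ordered i x k) o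
        (D.P l (true, true) v o * (D.M l o.2 o.1 * D.Pi l a o.1))
      have h2 := (abs_le.1 (ENTCF.abs_hardcoreSign_le (F := F) (k := x)
        (sel i a, (sel i o.2, xor (sel i v) (F.invG l (t, sel (!i) o.1)).1)))).1
      nlinarith
  have hf : ∑ x, ∑ k, ∑ t, F.keyProb true l x * F.genProb false l k t * ∑ a, ∑ o, f x k t a o =
      hardcoreAdv D i l := rfl
  -- Quantities that do not refer to the trapdoor are averages over the keys alone.
  have hgen : ∀ φ : Bits (F.κ l) × Bits (F.κ l) → ℝ,
      ∑ x, ∑ k, ∑ t, F.keyProb true l x * F.genProb false l k t * φ (ordered i x k) =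
      ∑ k, F.pairProb (ordered i true false) l k * φ k := by
    intro φ
    rw [← sum_ordered i]
    refine Finset.sum_congr rfl fun x _ => Finset.sum_congr rfl fun k _ => ?_
    rw [sum_genProb_mul, F.pairProb_ordered]
  -- Summing over the strings `d` turns the weights of the incorrect branches into preimage
  -- probabilities.
  have he : ∑ k, F.pairProb (ordered i true false) l k * ∑ a, ∑ o, e k a o =
      D.incorrect (ordered i true false) l := by
    refine Finset.sum_congr rfl fun k _ => congrArg _ ?_
    have h1 : ∀ y a, ∑ d, D.wgt l k (y, d) (D.M l d y * D.Pi l a y) = D.preWgt l k y a := by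
      intro y a
      have h2 : ∑ d, D.wgt l k (y, d) (D.M l d y * D.Pi l a y) =
          D.wgt l k (y, (zeros _, zeros _)) (D.Pi l a y) :=
        D.sum_wgt_mul_univ l k (y, (zeros _, zeros _)) (D.M_block l y) (D.Pi l a y)
      rw [h2, wgt, (D.Pi_block l y).trace_conj]; rfl
    rw [Finset.sum_comm, Fintype.sum_prod_type]
    refine Finset.sum_congr rfl fun y _ => ?_
    rw [Finset.sum_comm, Finset.sum_filter]
    refine Finset.sum_congr rfl fun a _ => ?_
    by_cases ha : a ∈ corr F (ordered i true false) l k y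
    · simp [e, ha]
    · simp only [e, if_neg ha, ha, not_false_eq_true, if_true]
      exact h1 y a
  have hg : ∑ k, F.pairProb (ordered i true false) l k * ∑ a, ∑ o, g k a o ≤
      hardcoreAdv D i l + D.incorrect (ordered i true false) l := by
    rw [← hf, ← he, ← hgen, ← hgen, ← Finset.sum_add_distrib]
    refine Finset.sum_le_sum fun x _ => ?_
    rw [← Finset.sum_add_distrib]
    refine Finset.sum_le_sum fun k _ => ?_
    rw [← Finset.sum_add_distrib]
    refine Finset.sum_le_sum fun t _ => ?_
    by_cases hx : F.keyProb true l x = 0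
    · simp [hx]
    by_cases ht : F.genProb false l k t = 0
    · simp [ht]
    rw [← mul_add, ← Finset.sum_add_distrib]
    refine mul_le_mul_of_nonneg_left (Finset.sum_le_sum fun a _ => ?_)
      (mul_nonneg (F.keyProb_nonneg _ _ _) (F.genProb_nonneg _ _ _ _))
    rw [← Finset.sum_add_distrib]
    exact Finset.sum_le_sum fun o _ => hpt x k t hx ht a o
  refine le_trans (le_of_eq ?_) (hg.trans (add_le_add_left (le_abs_self _) _))
  refine Finset.sum_congr rfl fun k _ => congrArg _ ?_
  rw [Finset.sum_comm]
  refine Finset.sum_congr rfl fun o _ => ?_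
  simp only [g]
  rw [Finset.sum_ite_mem, Finset.univ_inter]

end Experiment
end Device
end

/-! ### Anticommutation for a claw-free key at `i` and an injective key elsewhere. -/

noncomputable section

theorem anticommute_mulOp {ι H : Type} [Fintype ι] [Fintype H] [DecidableEq H]
    {Z X : ι → Matrix H H ℂ} {s : ι → ℝ} (hZ : ∀ j, (Z j)ᴴ = Z j) (hX : ∀ j, (X j)ᴴ = X j)
    (hZ2 : ∀ j, Z j * Z j = 1) (hX2 : ∀ j, X j * X j = 1) (hs : ∀ j, |s j| ≤ 1)
    {ξ η₀ η₁ : EuclideanSpace ℂ (ι × H × H)} {ε₁ ε₂ ε₃ γ : ℝ} (hξ : ‖ξ‖ ≤ 1)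
    (h₀ : ‖(1 / 2 : ℂ) • (η₀ - mulOp Z η₀)‖ ^ 2 ≤ ε₁)
    (h₁ : ‖(1 / 2 : ℂ) • (η₁ + mulOp Z η₁)‖ ^ 2 ≤ ε₁) (h₂ : ‖ξ - η₀ - η₁‖ ^ 2 ≤ ε₂)
    (h₃ : (inner ℂ η₀ (mulOp (fun j => (s j : ℂ) • 1) (mulOp X η₀)) +
      inner ℂ η₁ (mulOp (fun j => (s j : ℂ) • 1) (mulOp X η₁))).re ≤ ε₃)
    (h₄ : 1 - 2 * γ ≤ (inner ℂ ξ (mulOp (fun j => (s j : ℂ) • 1) (mulOp X ξ))).re) :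
    ‖mulOp Z (mulOp X ξ) + mulOp X (mulOp Z ξ)‖ ^ 2 ≤
      16 * γ + 8 * (ε₃ + 2 * ((√ε₂ + 2 * √ε₁) * (2 + (√ε₂ + 2 * √ε₁)))) :=
  anticommute_of_uncorrelated (mulOp_isSymmetric hZ) (mulOp_isSymmetric hX)
    (mulOp_isSymmetric fun j => by
      rw [Matrix.conjTranspose_smul, Matrix.conjTranspose_one, Complex.star_def,
        Complex.conj_ofReal])
    (mulOp_involution hZ2) (mulOp_involution hX2) (norm_mulOp_real_le hs)
    (fun x => by
      rw [mulOp_mulOp, mulOp_mulOp]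
      simp only [Matrix.smul_mul, Matrix.mul_smul, Matrix.one_mul, Matrix.mul_one])
    hξ h₀ h₁ h₂ h₃ h₄

namespace Device

variable {F : ENTCF} {D : Device F}

namespace Experiment

/-- The anticommutator on the post-measurement state, as a vector. -/
theorem anticommProb_eq (i : Bool) (θ : Bool × Bool) (l : ℕ) : anticommProb D i θ l =
    ‖mulOp (fun j => D.obs l (false, false) i j.2) (mulOp (fun j => D.obs l (true, true) i j.2)
        (D.col (F.pairProb θ l) id fun _ => D.after l fun _ => Finset.univ)) +
      mulOp (fun j => D.obs l (true, true) i j.2) (mulOp (fun j => D.obs l (false, false) i j.2)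
        (D.col (F.pairProb θ l) id fun _ => D.after l fun _ => Finset.univ))‖ ^ 2 := by
  rw [D.mulOp_col id (fun _ => D.obs l (true, true) i),
    D.mulOp_col id (fun _ => D.obs l (false, false) i),
    D.mulOp_col id (fun _ => D.obs l (false, false) i),
    D.mulOp_col id (fun _ => D.obs l (true, true) i), col_add,
    norm_sq_col _ _ (F.pairProb_nonneg θ l), anticommProb]
  refine Finset.sum_congr rfl fun k _ => congrArg _ ?_
  rw [stateNormSq_anticomm]
  refine Finset.sum_congr rfl fun o _ => ?_
  rw [Pi.add_apply, Pi.add_apply, after_univ, ← Matrix.mul_assoc, ← Matrix.mul_assoc,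
    ← Matrix.add_mul, wgt, stateNormSq, Matrix.mul_assoc, Matrix.trace_mul_comm, anticomm]
  simp only [Matrix.conjTranspose_mul, Matrix.mul_assoc, id]

/-- The anticommutator is small for one pair of types of keys. -/
theorem anticommProb_le (i : Bool) (l : ℕ) {ε₁ : ℝ} (hε : 1 - preimageProb D i true l ≤ ε₁) :
    anticommProb D i (ordered i true false) l ≤ 16 * D.γT l +
      8 * (|hardcoreAdv D i l| + 2 * D.γP l +
        2 * ((√(2 * D.γP l) + 2 * √ε₁) * (2 + (√(2 * D.γP l) + 2 * √ε₁)))) := by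
  classical
  let θ : Bool × Bool := ordered i true false
  let T := Bits (F.κ l) × Bits (F.κ l)
  let w : T → ℝ := F.pairProb θ l
  have hw : ∀ j, 0 ≤ w j := F.pairProb_nonneg θ l
  let c : Bool → T → F.Y l × F.Y l → Finset (Ans F l) := fun b k y =>
    (corr F θ l k y).filter fun a => (sel i a).1 = b
  -- With its bit prescribed, the correct preimage for the claw-free key is unique, and the
  -- injective key has at most one correct answer anyway.
  have hc : ∀ b k y, (c b k y : Set (Ans F l)).Subsingleton := by
    intro b k y a ha a' ha'
    rw [Finset.mem_coe, Finset.mem_filter, mem_corr i] at ha ha'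
    simp only [θ, sel_ordered, sel_not_ordered] at ha ha'
    rw [← ordered_sel i a, ← ordered_sel i a',
      ENTCF.correct_unique ha.1.1 ha'.1.1 (fun _ => ha.2.trans ha'.2.symm),
      ENTCF.correct_unique ha.1.2 ha'.1.2 (by simp)]
  let ξ := D.col w id fun _ => D.after l fun _ => Finset.univ
  let η : Bool → _ := fun b => D.col w id fun k => D.after l (c b k)
  let Z : T → Obs F l → Matrix (Bits (D.nD l)) (Bits (D.nD l)) ℂ := fun _ =>
    D.obs l (false, false) i
  let X : T → Obs F l → Matrix (Bits (D.nD l)) (Bits (D.nD l)) ℂ := fun _ =>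
    D.obs l (true, true) i
  let S : T → Obs F l → Matrix (Bits (D.nD l)) (Bits (D.nD l)) ℂ := fun k o =>
    (testSign F i l k o : ℂ) • 1
  have hξ : ‖ξ‖ ≤ 1 := by
    refine (sq_le_one_iff₀ (norm_nonneg _)).1 (le_of_eq ?_)
    rw [norm_sq_col _ _ hw]
    simp only [after_univ, id, D.sum_wgt_after_univ, mul_one]
    exact F.sum_pairProb θ l
  -- The Z answer can differ from `b` on the branch with bit `b` only if it differs from the bit of
  -- the measured preimage, and all such events together have probability 1 minus `preimageProb`.
  have hη : ∀ b, ‖D.col w id fun k o => D.marg l (false, false) i (!b) o *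
      D.after l (c b k) o‖ ^ 2 ≤ ε₁ := by
    intro b
    refine le_trans ?_ hε
    have h1 : 1 - preimageProb D i true l = ∑ k, w k * ∑ a : Ans F l, ∑ o,
        D.wgt l k o (D.marg l (false, false) i (!(sel i a).1) o *
          (D.M l o.2 o.1 * D.Pi l a o.1)) := by
      rw [preimageProb, ← F.sum_pairProb θ l, ← Finset.sum_sub_distrib]
      refine Finset.sum_congr rfl fun k _ => ?_
      rw [← mul_one_sub, ← D.sum_sum_wgt_after l k, ← Finset.sum_sub_distrib]
      refine congrArg _ (Finset.sum_congr rfl fun a _ => ?_)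
      rw [← Finset.sum_sub_distrib]
      refine Finset.sum_congr rfl fun o _ => ?_
      rw [← D.wgt_marg_add l k o (false, false) i (sel i a).1, add_sub_cancel_left]
    rw [h1, norm_sq_col _ _ hw]
    refine Finset.sum_le_sum fun k _ => mul_le_mul_of_nonneg_left ?_ (hw k)
    rw [Finset.sum_comm]
    refine Finset.sum_le_sum fun o _ => ?_
    rw [D.apply_after_of_subsingleton (hc b k o.1)
      (φ := fun L => D.wgt l (id k) o (D.marg l (false, false) i (!b) o * L)) (by simp)]
    have h2 : ∀ a ∈ c b k o.1,
        D.wgt l k o (D.marg l (false, false) i (!b) o * (D.M l o.2 o.1 * D.Pi l a o.1)) =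
        D.wgt l k o (D.marg l (false, false) i (!(sel i a).1) o *
          (D.M l o.2 o.1 * D.Pi l a o.1)) := by
      intro a ha
      rw [(Finset.mem_filter.1 ha).2]
    rw [id, Finset.sum_congr rfl h2]
    exact Finset.sum_le_sum_of_subset_of_nonneg (Finset.subset_univ _) fun a _ _ =>
      D.wgt_nonneg _ _ _ _
  have hZη : ∀ b L, D.col w id (fun k o => D.marg l (false, false) i b o * L k o) =
      (1 / 2 : ℂ) • (D.col w id L + sgn b • mulOp (fun j => Z j.1 j.2) (D.col w id L)) := by
    intro b L
    rw [mulOp_col, smul_col, col_add, smul_col]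
    congr 1
    funext k o
    simp only [marg_eq, Pi.smul_apply, Pi.add_apply, Matrix.smul_mul, Matrix.add_mul,
      Matrix.one_mul, Z]
  -- The branches for the two bits make up all correct answers, so the rest is the branch of
  -- incorrect ones.
  have h₂ : ‖ξ - η false - η true‖ ^ 2 ≤ 2 * D.γP l := by
    refine le_of_eq_of_le ?_ (D.incorrect_le θ l)
    have h1 : ξ - η false - η true = D.col w id fun k => D.after l fun y =>
        (corr F θ l k y)ᶜ := by
      rw [col_sub, col_sub]
      congr 1
      funext k o
      have e1 : ∑ a ∈ corr F θ l k o.1, D.Pi l a o.1 =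
          ∑ a ∈ c false k o.1, D.Pi l a o.1 + ∑ a ∈ c true k o.1, D.Pi l a o.1 := by
        rw [← Finset.sum_fiberwise _ (fun a => (sel i a).1), Fintype.sum_bool, add_comm]
      simp only [Pi.sub_apply, after]
      rw [← Matrix.mul_sub, ← Matrix.mul_sub, sub_sub, ← e1,
        ← Finset.sum_compl_add_sum (corr F θ l k o.1), add_sub_cancel_right]
    rw [h1, norm_sq_col _ _ hw, incorrect]
    refine Finset.sum_congr rfl fun k _ => congrArg _ ?_
    rw [sum_wgt_after]
    refine Finset.sum_congr rfl fun y _ => Finset.sum_congr ?_ fun _ _ => rfl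
    ext a; simp
  have hSX : ∀ L, (inner ℂ (D.col w id L) (mulOp (fun j => S j.1 j.2)
      (mulOp (fun j => X j.1 j.2) (D.col w id L)))).re = ∑ k, w k * ∑ o : Obs F l,
        testSign F i l k o * (D.obs l (true, true) i o *
          (L k o * D.ψ l k.1 k.2 o.1 * (L k o)ᴴ)).trace.re := by
    intro L
    rw [mulOp_col, mulOp_col, re_inner_col _ _ hw]
    refine Finset.sum_congr rfl fun k _ => congrArg _ (Finset.sum_congr rfl fun o _ => ?_)
    simp only [S, X, Matrix.smul_mul, Matrix.one_mul, Matrix.trace_smul, smul_eq_mul,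
      Complex.re_ofReal_mul, Matrix.mul_assoc, id]
  -- Each branch has at most one correct answer for every image. So the two quadratic forms add up
  -- to the sum over correct answers, for which the hardcore bit gives the bound.
  have h₃ : (inner ℂ (η false) (mulOp (fun j => S j.1 j.2) (mulOp (fun j => X j.1 j.2) (η false))) +
      inner ℂ (η true) (mulOp (fun j => S j.1 j.2) (mulOp (fun j => X j.1 j.2) (η true)))).re ≤
      |hardcoreAdv D i l| + 2 * D.γP l := by
    refine le_trans (le_of_eq ?_) ((sum_testSign_corr_le (D := D) i l).trans
      (add_le_add_right (D.incorrect_le θ l) _))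
    rw [Complex.add_re, hSX, hSX, ← Finset.sum_add_distrib]
    refine Finset.sum_congr rfl fun k _ => ?_
    rw [← mul_add, ← Finset.sum_add_distrib]
    refine congrArg _ (Finset.sum_congr rfl fun o _ => ?_)
    have e1 : ∀ b, testSign F i l k o * (D.obs l (true, true) i o *
        (D.after l (c b k) o * D.ψ l k.1 k.2 o.1 * (D.after l (c b k) o)ᴴ)).trace.re =
        ∑ a ∈ c b k o.1, testSign F i l k o * (D.obs l (true, true) i o *
        (D.M l o.2 o.1 * D.Pi l a o.1 * D.ψ l k.1 k.2 o.1 *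
          (D.M l o.2 o.1 * D.Pi l a o.1)ᴴ)).trace.re := fun b =>
      D.apply_after_of_subsingleton (hc b k o.1) (φ := fun L => testSign F i l k o *
        (D.obs l (true, true) i o * (L * D.ψ l k.1 k.2 o.1 * Lᴴ)).trace.re) (by simp)
    rw [e1, e1, ← Finset.sum_fiberwise (corr F _ l k o.1) (fun a => (sel i a).1),
      Fintype.sum_bool, add_comm]
  have h₄ : 1 - 2 * D.γT l ≤ (inner ℂ ξ (mulOp (fun j => S j.1 j.2)
      (mulOp (fun j => X j.1 j.2) ξ))).re := by
    rw [hSX]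
    simp only [after_univ]
    exact le_sum_testSign i l
  have h₀ : ‖(1 / 2 : ℂ) • (η false - mulOp (fun j => Z j.1 j.2) (η false))‖ ^ 2 ≤ ε₁ := by
    have := hη false
    rw [Bool.not_false, hZη true, sgn, if_pos rfl, neg_one_smul, ← sub_eq_add_neg] at this
    exact this
  have h₁ : ‖(1 / 2 : ℂ) • (η true + mulOp (fun j => Z j.1 j.2) (η true))‖ ^ 2 ≤ ε₁ := by
    have := hη true
    rw [Bool.not_true, hZη false, sgn, if_neg Bool.false_ne_true, one_smul] at this
    exact this
  have hZ : ∀ j : T × Obs F l, (Z j.1 j.2)ᴴ = Z j.1 j.2 := fun j => D.obs_isHermitian l _ i j.2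
  have hX : ∀ j : T × Obs F l, (X j.1 j.2)ᴴ = X j.1 j.2 := fun j => D.obs_isHermitian l _ i j.2
  have hZ2 : ∀ j : T × Obs F l, Z j.1 j.2 * Z j.1 j.2 = 1 := fun j => D.obs_mul_self l _ i j.2
  have hX2 : ∀ j : T × Obs F l, X j.1 j.2 * X j.1 j.2 = 1 := fun j => D.obs_mul_self l _ i j.2
  have hs : ∀ j : T × Obs F l, |testSign F i l j.1 j.2| ≤ 1 := fun j =>
    abs_testSign_le i l j.1 j.2
  exact (anticommProb_eq i θ l).trans_le (anticommute_mulOp hZ hX hZ2 hX2 hs hξ h₀ h₁ h₂ h₃ h₄)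

end Experiment

end Device

end

/-! ### Collecting the errors, and the passage to all types of keys. -/

noncomputable section

namespace Device

variable {F : ENTCF} {D : Device F}

namespace Experiment

/-- Binary observables preserve norms, so both products have norm at most 1 on ξ. This trivial bound
serves where γ_T exceeds 1. -/
theorem anticommProb_le_four (i : Bool) (θ : Bool × Bool) (l : ℕ) :
    anticommProb D i θ l ≤ 4 := by
  let A : Bool × Bool → _ := fun q => mulOp (ι := (Bits (F.κ l) × Bits (F.κ l)) × Obs F l)
    fun j => D.obs l q i j.2
  have nA : ∀ q x, ‖A q x‖ = ‖x‖ := fun q => norm_eq_of_symmetric_involution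
    (mulOp_isSymmetric fun j => D.obs_isHermitian l q i j.2)
    (mulOp_involution fun j => D.obs_mul_self l q i j.2)
  let ξ := D.col (F.pairProb θ l) id fun _ => D.after l fun _ => Finset.univ
  have hξ : ‖ξ‖ ≤ 1 := by
    refine (sq_le_one_iff₀ (norm_nonneg _)).1 (le_of_eq ?_)
    rw [norm_sq_col _ _ (F.pairProb_nonneg θ l)]
    simp only [after_univ, id, D.sum_wgt_after_univ, mul_one]
    exact F.sum_pairProb θ l
  have h : ‖A (false, false) (A (true, true) ξ) + A (true, true) (A (false, false) ξ)‖ ≤ 2 := by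
    refine (norm_add_le _ _).trans ?_
    rw [nA, nA, nA, nA]
    linarith
  rw [anticommProb_eq]
  refine (pow_le_pow_left₀ (norm_nonneg _) h 2).trans ?_
  norm_num

theorem imageProb_le_one (i θ : Bool) (l : ℕ) : imageProb D i θ l ≤ 1 := by
  have h := sum_trapdoor (F := F) i θ l fun _ => 1
  simp only [mul_one, F.sum_pairProb] at h
  rw [← h, imageProb]
  refine Finset.sum_le_sum fun j _ => mul_le_of_le_one_right
    (mul_nonneg (F.genProb_nonneg _ _ _ _) (F.keyProb_nonneg _ _ _)) ?_
  rw [← D.sum_wgt_after_univ l (ordered i j.1.1 j.2)]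
  exact Finset.sum_le_sum fun o _ => D.wgt_marg_le _ _ _ _ _ _ _

/-- A success probability is at most 1; one of the eight is compared with `imageProb`. -/
theorem γT_nonneg (D : Device F) (l : ℕ) : 0 ≤ D.γT l := by
  have h1 := le_imageProb (D := D) false l
  have h2 := imageProb_le_one (D := D) false true l
  linarith

/-- Use √(γ + ν) ≤ √γ + √ν, γ ≤ √γ, and 2a² + 2b² as a bound for the square of the sum δ = √(2p) +
2√(γ + ν). The terms with γ are then 16γ + 64√γ + 128γ, at most 208√γ. -/
theorem anticommute_bound {γ ν p h : ℝ} (hγ : 0 ≤ γ) (hγ1 : γ ≤ 1) (hν : 0 ≤ ν) (hp : 0 ≤ p) :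
    16 * γ + 8 * (h + 2 * p +
      2 * ((√(2 * p) + 2 * √(γ + ν)) * (2 + (√(2 * p) + 2 * √(γ + ν))))) ≤
      208 * √γ + (8 * h + 80 * p + 32 * √(2 * p) + 64 * √ν + 128 * ν) := by
  have h1 := Real.sqrt_nonneg (2 * p)
  have h2 := Real.sqrt_nonneg γ
  have h3 := Real.sqrt_nonneg ν
  have s1 := Real.sq_sqrt (mul_nonneg zero_le_two hp)
  have s2 := Real.sq_sqrt hγ
  have s3 := Real.sq_sqrt hν
  have s4 := Real.sq_sqrt (add_nonneg hγ hν)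
  have h4 : √(γ + ν) ≤ √γ + √ν := by
    rw [Real.sqrt_le_left (add_nonneg h2 h3)]
    nlinarith [mul_nonneg h2 h3]
  have h5 : γ ≤ √γ := Real.le_sqrt_of_sq_le (by nlinarith)
  nlinarith [sq_nonneg (√(2 * p) - 2 * √(γ + ν))]

/-- The observables at the place `i` anticommute for one pair of types of keys. -/
theorem exists_anticommProb_le (hD : D.Efficient) (hP : D.Perfect) (i : Bool) :
    ∃ μ, Negligible μ ∧ ∀ l,
      anticommProb D i (ordered i true false) l ≤ 208 * √(D.γT l) + μ l := by
  obtain ⟨ν, hν, h₁⟩ := preimageProb_ge hD hP i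
  obtain ⟨a, ha, h₂⟩ := abs_hardcoreAdv_le hD i
  refine ⟨fun l => 8 * a l + 80 * D.γP l + 32 * √(2 * D.γP l) + 64 * √(ν l) + 128 * ν l,
    ((((ha.const_mul (by norm_num)).add (hP.const_mul (by norm_num))).add
      ((hP.const_mul zero_le_two).sqrt.const_mul (by norm_num))).add
      (hν.sqrt.const_mul (by norm_num))).add (hν.const_mul (by norm_num)), fun l => ?_⟩
  have hγ := γT_nonneg D l
  have hp := hP.1 l
  -- Negligible functions are nonnegative, so the additional terms can be dropped when the trivial
  -- bound is used.
  have hn := hν.1 l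
  have ha0 := ha.1 l
  -- The estimate γ ≤ √γ needs γ ≤ 1; otherwise √γ is at least 1 and the bound by 4 suffices.
  by_cases hγ1 : D.γT l ≤ 1
  · have h3 := anticommute_bound (h := |hardcoreAdv D i l|) hγ hγ1 hn hp
    have h4 := anticommProb_le i l (h₁ l)
    have h5 := h₂ l
    linarith
  · have h3 := anticommProb_le_four (D := D) i (ordered i true false) l
    have h4 : 1 ≤ √(D.γT l) := Real.one_le_sqrt.2 (not_le.1 hγ1).le
    have h5 := Real.sqrt_nonneg (2 * D.γP l)
    have h6 := Real.sqrt_nonneg (ν l)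
    linarith

/-- The observables at the place `i` anticommute for all types of keys. -/
theorem exists_anticommProb_ordered_le (hD : D.Efficient) (hP : D.Perfect) (i a b : Bool) :
    ∃ μ, Negligible μ ∧ ∀ l,
      anticommProb D i (ordered i a b) l ≤ 208 * √(D.γT l) + μ l := by
  obtain ⟨μ, hμ, h⟩ := exists_anticommProb_le hD hP i
  -- Starting from claw-free at `i` and injective elsewhere, changing one key at a time reaches the
  -- other three pairs of types: first the other key, or the key at `i`, or after the latter also
  -- the other key.
  obtain ⟨μ₁, hμ₁, h₁⟩ := anticommProb_invariance hD i (!i) true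
  obtain ⟨μ₂, hμ₂, h₂⟩ := anticommProb_invariance hD i i false
  obtain ⟨μ₃, hμ₃, h₃⟩ := anticommProb_invariance hD i (!i) false
  refine ⟨_, hμ.add (hμ₁.add (hμ₂.add hμ₃)), fun l => ?_⟩
  have h0 := h l
  have h1 := abs_le.1 (h₁ l)
  have h2 := abs_le.1 (h₂ l)
  have h3 := abs_le.1 (h₃ l)
  have p1 := hμ₁.1 l
  have p2 := hμ₂.1 l
  have p3 := hμ₃.1 l
  rw [ordered_not, ordered_not] at h1 h3
  cases a <;> cases b <;> linarith

end Experiment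

open Experiment in
theorem approxZero_anticomm (hD : D.Efficient) (hP : D.Perfect) (i θ₁ θ₂ : Bool) :
    D.ApproxZero 208 (fun l => D.γT l ^ (1 / 2 : ℝ)) θ₁ θ₂ fun l =>
      anticomm (Matrix.blockDiagonal (D.obs l (false, false) i))
        (Matrix.blockDiagonal (D.obs l (true, true) i)) := by
  obtain ⟨μ, hμ, h⟩ := exists_anticommProb_ordered_le hD hP i (sel i (θ₁, θ₂)) (sel (!i) (θ₁, θ₂))
  refine ⟨μ, hμ, fun l => ?_⟩
  have := h l
  rw [ordered_sel, anticommProb, Real.sqrt_eq_rpow] at this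
  rw [F.avg_eq]
  exact this

end Device

end

theorem proposition4p1 :
    ∃ C : ℝ, 0 < C ∧ ∀ (F : ENTCF) (D : Device F), D.Efficient → D.Perfect →
      ∀ θ₁ θ₂ : Bool,
        D.ApproxZero C (fun l => D.γT l ^ (1 / 2 : ℝ)) θ₁ θ₂
          (fun l => anticomm (D.Z₁ l) (D.X₁ l)) ∧
        D.ApproxZero C (fun l => D.γT l ^ (1 / 2 : ℝ)) θ₁ θ₂
          (fun l => anticomm (D.Z₂ l) (D.X₂ l)) := by
  -- The constant is the one of `anticommute_bound`.
  refine ⟨208, by norm_num, fun F D hD hP θ₁ θ₂ => ⟨?_, ?_⟩⟩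
  · simp only [D.Z₁_eq, D.X₁_eq]
    exact Device.approxZero_anticomm hD hP false θ₁ θ₂
  · simp only [D.Z₂_eq, D.X₂_eq]
    exact Device.approxZero_anticomm hD hP true θ₁ θ₂
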